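/- Let $n\ge 2$, let $h(x)=x/2$ on $\mathbb R^n$, and let $p:\mathbb R^n\setminus\{O\}\to\mathbb S^{n-1}\times\mathbb S^1$, $p(x)=(x/|x|,\,e^{2\pi i\log_2|x|})$, be the covering whose fibres are the orbits of $h$. Let $\hat\gamma\subset\mathbb S^{n-1}\times\mathbb S^1$ be a smooth knot (a smoothly embedded circle) whose projection to the factor $\mathbb S^1$ has degree $\pm1$ (for $n\ge 3$: whose homotopy class generates $\pi_1(\mathbb S^{n-1}\times\mathbb S^1)\cong\mathbb Z$), and put $\gamma=p^{-1}(\hat\gamma)$. Let $C=\{x\in\mathbb R^n: x_2^2+\dots+x_n^2\le 4\}$, let $g(x_1,\dots,x_n)=(x_1+1,x_2,\dots,x_n)$, and, with $r=x_1^2+\dots+x_n^2$, let $\phi^t$ be the flow on $C$ of the $C^1$ vector field $$\dot x_1=\begin{cases}1-\tfrac19(r-4)^2,& r\le 4\\ 1,& r>4\end{cases}\qquad \dot x_i=\begin{cases}-x_i,& r\le 2\\ \tfrac{x_i}{2}\bigl(\sin(\tfrac{\pi}{2}(r-3))-1\bigr),& 2<r\le 4\\ 0,& r>4\end{cases}\quad(i=2,\dots,n).$$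 This flow is defined for all times and leaves $C$ invariant; put $\phi=\phi^1$. (1) The knot $\hat\gamma$ has a closed smooth tubular neighbourhood, that is, a set $N(\hat\gamma)$ for which some diffeomorphism of $\mathbb R^{n-1}\times\mathbb S^1$ onto an open subset of $\mathbb S^{n-1}\times\mathbb S^1$ takes $\mathbb D^{n-1}\times\mathbb S^1$ onto $N(\hat\gamma)$ and $\{0\}\times\mathbb S^1$ onto $\hat\gamma$. For every such $N(\hat\gamma)$ there is a smooth diffeomorphism $\zeta:N(\gamma)=p^{-1}(N(\hat\gamma))\to C$ with $\zeta h=g\zeta$ on $N(\gamma)$ and $\zeta(\gamma)=\mathbb R\times\{(0,\dots,0)\}$. (2) Take any such $N(\hat\gamma)$ and any smooth diffeomorphism $\zeta:N(\gamma)\to C$ with $\zeta h=g\zeta$. Let $\bar\varphi:\mathbb R^n\to\mathbb R^n$ equal $\zeta^{-1}\phi\zeta$ on $N(\gamma)$ and $h$ elsewhere, let $\vartheta_S:\mathbb S^n\setminus\{N\}\to\mathbb R^n$ be the stereographic projection from the North Pole $N$ (so that the South Pole $S$ goes to $O$), and let $\varphi_{\gamma,n}=\vartheta_S^{-1}\bar\varphi\,\vartheta_S$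 on $\mathbb S^n\setminus\{N\}$, $\varphi_{\gamma,n}(N)=N$. Then $\varphi_{\gamma,n}$ is a $C^1$-diffeomorphism of $\mathbb S^n$ and is Morse–Smale: its non-wandering set is finite and consists of hyperbolic periodic points, whose stable and unstable manifolds intersect transversally. Its non-wandering set consists of exactly four points, all of them hyperbolic fixed points: the two sinks $\omega=\vartheta_S^{-1}\zeta^{-1}(-1,0,\dots,0)$ and $S$, the saddle $\sigma=\vartheta_S^{-1}\zeta^{-1}(1,0,\dots,0)$, whose differential has exactly one eigenvalue outside the unit circle, and the source $N$. The unstable separatrices of $\sigma$ (the connected components of $W^u_\sigma\setminus\{\sigma\}$) are exactly the two images under $\vartheta_S^{-1}\zeta^{-1}$ of $(-1,1)\times\{0\}$ and $(1,\infty)\times\{0\}$, and the first of them lies in the basin of $\omega$. If $\zeta(\gamma)=\mathbb R\times\{(0,\dots,0)\}$, both lie in $\vartheta_S^{-1}(\gamma)$. (3) Let $n=3$, let $V_3=\{\tfrac14\le|x|^2\le1\}\subset\mathbb R^3$ and $F_3=\{|x|^2=1\}$, and let $V_2,F_2$ be their intersections with the plane $x_3=0$. Let $\alpha,\beta,\gamma_0\in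 F_2$ be three distinct points, $d\subset F_2$ the arc with ends $\beta,\gamma_0$ that does not contain $\alpha$, and $a,b,c\subset V_3$ pairwise disjoint smooth closed arcs with ends $\alpha,\beta$; $h(\beta),h(\gamma_0)$; $\gamma_0,h(\alpha)$, respectively, such that: $a,c\subset V_2$, and $a$, $c$ without their ends do not meet $F_2\cup h(F_2)$; $b\cup h(d)$ is the boundary of a 2-disc $\Delta\subset V_3$ whose interior does not meet $F_3\cup h(F_3)$ and meets each of $a$ and $c$ in exactly one point; every connected component of $a\cup b\cup c\cup h(a\cup b\cup c)$ is a smooth arc. Let $\ell=\bigcup_{k\in\mathbb Z}h^k(a\cup b\cup c)$ (the Fox–Artin arc). Then $p(\ell)$ is a smooth knot in $\mathbb S^2\times\mathbb S^1$ as above and $p^{-1}(p(\ell))=\ell$, so that (1) and (2) apply with $\gamma=\ell$; the diffeomorphism $\varphi_{\ell,3}$ of $\mathbb S^3$ so obtained is the standard Pixton diffeomorphism. -/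

import Mathlib

open Set Filter Topology
open scoped Manifold ContDiff

noncomputable section

namespace Pixton

/-- The Euclidean space `ℝⁿ`. -/
abbrev Euc (n : ℕ) : Type := EuclideanSpace ℝ (Fin n)

/-- The unit sphere `Sⁿ` of `ℝⁿ⁺¹`. -/
abbrev Sph (n : ℕ) : Type := Metric.sphere (0 : Euc (n + 1)) 1

/-! ### Hyperbolic fixed points, invariant manifolds, Morse–Smale diffeomorphisms of `Sⁿ` -/

/-- The complex eigenvalues of a real endomorphism, with algebraic multiplicity. -/
def eigenvalues {n : ℕ} (A : Euc n →L[ℝ] Euc n) : Multiset ℂ :=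
  ((A : Euc n →ₗ[ℝ] Euc n).charpoly.map (algebraMap ℝ ℂ)).roots

/-- The differential of `g` at a point `p`, which is meant to be fixed by `g`: then source and
target are the same tangent space, seen in the same preferred chart. -/
def differentialAt {n : ℕ} (g : Sph n → Sph n) (p : Sph n) : Euc n →L[ℝ] Euc n :=
  mfderiv (𝓡 n) (𝓡 n) g p

/-- `p` is a fixed point of `g` and the differential has no eigenvalue of modulus one. -/
def IsHyperbolicFixedPoint {n : ℕ} (g : Sph n → Sph n) (p : Sph n) : Prop :=
  g p = p ∧ ∀ μ ∈ eigenvalues (differentialAt g p), ‖μ‖ ≠ 1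

/-- A hyperbolic fixed point all of whose eigenvalues lie inside the unit circle. -/
def IsSink {n : ℕ} (g : Sph n → Sph n) (p : Sph n) : Prop :=
  IsHyperbolicFixedPoint g p ∧ ∀ μ ∈ eigenvalues (differentialAt g p), ‖μ‖ < 1

/-- A hyperbolic fixed point all of whose eigenvalues lie outside the unit circle. -/
def IsSource {n : ℕ} (g : Sph n → Sph n) (p : Sph n) : Prop :=
  IsHyperbolicFixedPoint g p ∧ ∀ μ ∈ eigenvalues (differentialAt g p), 1 < ‖μ‖

open Classical in
/-- A hyperbolic fixed point with eigenvalues on both sides of the unit circle, exactly `k` of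
them (with multiplicity) outside; `k` is the dimension of its unstable manifold. -/
def IsSaddle {n : ℕ} (g : Sph n → Sph n) (p : Sph n) (k : ℕ) : Prop :=
  IsHyperbolicFixedPoint g p ∧
    (∃ μ ∈ eigenvalues (differentialAt g p), ‖μ‖ < 1) ∧
    (∃ μ ∈ eigenvalues (differentialAt g p), 1 < ‖μ‖) ∧
    (eigenvalues (differentialAt g p)).countP (fun μ => 1 < ‖μ‖) = k

/-- The non-wandering set. -/
def nonWanderingSet {X : Type*} [TopologicalSpace X] (g : X → X) : Set X :=
  {x | ∀ U : Set X, IsOpen U → x ∈ U → ∃ k : ℕ, 0 < k ∧ (g^[k] '' U ∩ U).Nonempty}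

/-- The stable manifold `Wˢ_p` of `g`. -/
def stableSet {X : Type*} [MetricSpace X] (g : X → X) (p : X) : Set X :=
  {x | Tendsto (fun k : ℕ => dist (g^[k] x) (g^[k] p)) atTop (𝓝 0)}

/-- The tangent vectors at `x` of an (injectively immersed) submanifold `W` of `Sⁿ`: the
velocities at `x` of the `C¹` curves that run inside `W`. -/
def tangentVectors {n : ℕ} (W : Set (Sph n)) (x : Sph n) : Set (Euc n) :=
  {v | ∃ c : ℝ → Sph n, ContMDiff 𝓘(ℝ, ℝ) (𝓡 n) 1 c ∧ (∀ t, c t ∈ W) ∧ c 0 = x ∧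
    (mfderiv 𝓘(ℝ, ℝ) (𝓡 n) c 0 : ℝ →L[ℝ] Euc n) 1 = v}

/-- `V` and `W` intersect transversally: at each common point the tangent spaces span. -/
def Transversal {n : ℕ} (V W : Set (Sph n)) : Prop :=
  ∀ x ∈ V ∩ W, Submodule.span ℝ (tangentVectors V x ∪ tangentVectors W x) = ⊤

/-- A Morse–Smale diffeomorphism: the non-wandering set is finite and consists of hyperbolic
periodic points, whose stable and unstable manifolds intersect transversally. -/
structure IsMorseSmale {n : ℕ} (f : Sph n ≃ₘ^1⟮𝓡 n, 𝓡 n⟯ Sph n) : Prop where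
  finite : (nonWanderingSet f).Finite
  hyperbolic : ∀ p ∈ nonWanderingSet f, ∃ k : ℕ, 0 < k ∧ IsHyperbolicFixedPoint (f^[k]) p
  transversal : ∀ p ∈ nonWanderingSet f, ∀ q ∈ nonWanderingSet f,
    Transversal (stableSet f p) (stableSet f.symm q)

/-- The unstable separatrices of `p`: the connected components of `Wᵘ_p \ {p}`. -/
def unstableSeparatrices {n : ℕ} (f : Sph n ≃ₘ^1⟮𝓡 n, 𝓡 n⟯ Sph n) (p : Sph n) :
    Set (Set (Sph n)) :=
  {L | ∃ x ∈ stableSet f.symm p \ {p}, L = connectedComponentIn (stableSet f.symm p \ {p}) x}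

/-! ### The homothety, the covering and knots in `Sᵐ × S¹` (with `m = n - 1`) -/

/-- The homothety `h(x) = x / 2`. -/
def homothety {n : ℕ} (x : Euc n) : Euc n := (2 : ℝ)⁻¹ • x

/-- The covering `p : ℝᵐ⁺¹ \ {O} → Sᵐ × S¹`, `x ↦ (x / |x|, exp (2πi log₂ |x|))`. Its fibres are
the orbits of `h`, so it realizes `Sᵐ × S¹` as the annulus `1/2 ≤ |x| ≤ 1` whose boundary spheres
are glued by `h`. -/
def covering {m : ℕ} (x : {x : Euc (m + 1) // x ≠ 0}) : Sph m × Circle :=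
  (⟨‖(x : Euc (m + 1))‖⁻¹ • (x : Euc (m + 1)), by
      have hx : ‖(x : Euc (m + 1))‖ ≠ 0 := norm_ne_zero_iff.mpr x.2
      simp [norm_smul, hx]⟩,
    Circle.exp (2 * Real.pi * Real.logb 2 ‖(x : Euc (m + 1))‖))

/-- The full preimage `p⁻¹(A)`, as a subset of `ℝᵐ⁺¹`. -/
def coveringPreimage {m : ℕ} (A : Set (Sph m × Circle)) : Set (Euc (m + 1)) :=
  {x | ∃ hx : x ≠ 0, covering ⟨x, hx⟩ ∈ A}

/-- The image `p(B)` of a subset `B` of `ℝᵐ⁺¹` (the origin is ignored). -/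
def coveringImage {m : ℕ} (B : Set (Euc (m + 1))) : Set (Sph m × Circle) :=
  {y | ∃ x : {x : Euc (m + 1) // x ≠ 0}, (x : Euc (m + 1)) ∈ B ∧ covering x = y}

/-- `K` is a smooth knot in `Sᵐ × S¹` (the image of a smooth embedding of the circle) that winds
exactly once, in one direction or the other, around the factor `S¹`. -/
def IsEssentialKnot {m : ℕ} (K : Set (Sph m × Circle)) : Prop :=
  ∃ κ : C(Circle, Sph m × Circle),
    ContMDiff (𝓡 1) ((𝓡 m).prod (𝓡 1)) ∞ κ ∧
    Function.Injective κ ∧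
    (∀ z, Function.Injective (mfderiv (𝓡 1) ((𝓡 m).prod (𝓡 1)) κ z)) ∧
    range κ = K ∧
    ((ContinuousMap.snd.comp κ).Homotopic (ContinuousMap.id Circle) ∨
      (ContinuousMap.snd.comp κ).Homotopic ⟨fun z => z⁻¹, continuous_inv⟩)

/-- `T` is a (closed) smooth tubular neighbourhood of the knot `K` in `Sᵐ × S¹`: a diffeomorphism
of `ℝᵐ × S¹` onto an open set takes the closed unit disc bundle onto `T` and the zero section
onto `K`. -/
def IsTubularNeighborhood {m : ℕ} (K T : Set (Sph m × Circle)) : Prop :=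
  ∃ e : Euc m × Circle → Sph m × Circle,
    IsLocalDiffeomorph (𝓘(ℝ, Euc m).prod (𝓡 1)) ((𝓡 m).prod (𝓡 1)) ∞ e ∧
    Function.Injective e ∧
    e '' (Metric.closedBall 0 1 ×ˢ univ) = T ∧
    e '' ({0} ×ˢ univ) = K

/-! ### The model flow on the cylinder `C` -/

/-- The cylinder `C = {x₂² + ⋯ + xₙ² ≤ 4}` in `ℝⁿ`, `n = m + 1`. -/
def cylinder (m : ℕ) : Set (Euc (m + 1)) := {x | ∑ i : Fin m, x i.succ ^ 2 ≤ 4}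

/-- The point `(t, 0, …, 0)` of the axis of the cylinder. -/
def axisPoint (m : ℕ) (t : ℝ) : Euc (m + 1) := EuclideanSpace.single 0 t

/-- The vector field that defines the flow `φᵗ`. -/
def modelField {m : ℕ} (x : Euc (m + 1)) : Euc (m + 1) :=
  WithLp.toLp 2 (Fin.cons
    (if ‖x‖ ^ 2 ≤ 4 then 1 - 1 / 9 * (‖x‖ ^ 2 - 4) ^ 2 else 1)
    (fun i : Fin m =>
      if ‖x‖ ^ 2 ≤ 2 then -x i.succ
      else if ‖x‖ ^ 2 ≤ 4 then
        x i.succ / 2 * (Real.sin (Real.pi / 2 * (‖x‖ ^ 2 - 3)) - 1)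
      else 0))

/-- `c` is a solution of `ẋ = modelField x`, defined for all times, that starts at `x`. -/
def IsModelTrajectory {m : ℕ} (x : Euc (m + 1)) (c : ℝ → Euc (m + 1)) : Prop :=
  c 0 = x ∧ ∀ t, HasDerivAt c (modelField (c t)) t

open Classical in
/-- The flow `φᵗ`: `modelFlow t x` is the value at time `t` of the trajectory of `x`. -/
def modelFlow {m : ℕ} (t : ℝ) (x : Euc (m + 1)) : Euc (m + 1) :=
  if h : ∃ c, IsModelTrajectory x c then h.choose t else x

/-- `ζ` is a smooth diffeomorphism of the `h`-invariant set `A` onto the cylinder `C` that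
conjugates `h` to the unit translation `g(x₁, x₂, …, xₙ) = (x₁ + 1, x₂, …, xₙ)`. -/
structure IsConjugator {m : ℕ} (A : Set (Euc (m + 1)))
    (ζ : PartialEquiv (Euc (m + 1)) (Euc (m + 1))) : Prop where
  source_eq : ζ.source = A
  target_eq : ζ.target = cylinder m
  smooth : ContDiffOn ℝ ∞ ζ A
  smooth_symm : ContDiffOn ℝ ∞ ζ.symm (cylinder m)
  invariant : ∀ x, x ∈ A ↔ homothety x ∈ A
  conj : ∀ x ∈ A, ζ (homothety x) = ζ x + axisPoint m 1

/-! ### The sphere and the generalized Pixton map -/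

/-- The North Pole of `Sⁿ`. -/
def northPole (n : ℕ) : Sph n := ⟨EuclideanSpace.single (Fin.last n) 1, by simp⟩

/-- The South Pole of `Sⁿ`. -/
def southPole (n : ℕ) : Sph n := ⟨EuclideanSpace.single (Fin.last n) (-1), by simp⟩

/-- The stereographic projection `ϑ_S : Sⁿ \ {N} → ℝⁿ`, which takes `S` to the origin. -/
def stereo {n : ℕ} (x : Sph n) : Euc n :=
  WithLp.toLp 2 (fun i => (x : Euc (n + 1)) i.castSucc / (1 - (x : Euc (n + 1)) (Fin.last n)))

/-- The inverse `ϑ_S⁻¹ : ℝⁿ → Sⁿ \ {N}` of the stereographic projection. -/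
def stereoInv {n : ℕ} (y : Euc n) : Sph n :=
  ⟨WithLp.toLp 2 (Fin.snoc (α := fun _ => ℝ) (fun i => 2 * y i / (‖y‖ ^ 2 + 1))
      ((‖y‖ ^ 2 - 1) / (‖y‖ ^ 2 + 1))), by
    have h : (‖y‖ ^ 2 + 1 : ℝ) ≠ 0 := by positivity
    have hy : ∑ i, y i ^ 2 = ‖y‖ ^ 2 := by simp [EuclideanSpace.norm_sq_eq]
    rw [mem_sphere_zero_iff_norm, EuclideanSpace.norm_eq, Real.sqrt_eq_one, Fin.sum_univ_castSucc]
    simp only [Fin.snoc_castSucc, Fin.snoc_last, Real.norm_eq_abs, sq_abs, div_pow, mul_pow]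
    rw [← Finset.sum_div, ← Finset.mul_sum, hy]
    field_simp
    ring⟩

open Classical in
/-- The map `φ̄` of `ℝⁿ`: it is `h` outside the domain `N(γ)` of `ζ`, and `ζ⁻¹ φ¹ ζ` on it. -/
def planarMap {m : ℕ} (ζ : PartialEquiv (Euc (m + 1)) (Euc (m + 1))) (x : Euc (m + 1)) :
    Euc (m + 1) :=
  if x ∈ ζ.source then ζ.symm (modelFlow 1 (ζ x)) else homothety x

open Classical in
/-- The generalized Pixton map `φ_{γ,n}` of `Sⁿ`, `n = m + 1`, built with `ζ : N(γ) → C`. -/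
def pixtonMap {m : ℕ} (ζ : PartialEquiv (Euc (m + 1)) (Euc (m + 1))) (x : Sph (m + 1)) :
    Sph (m + 1) :=
  if x = northPole (m + 1) then northPole (m + 1) else stereoInv (planarMap ζ (stereo x))

/-- The point of `Sⁿ` that corresponds to the point `(t, 0, …, 0)` of the cylinder. -/
def axisInSphere {m : ℕ} (ζ : PartialEquiv (Euc (m + 1)) (Euc (m + 1))) (t : ℝ) : Sph (m + 1) :=
  stereoInv (ζ.symm (axisPoint m t))

/-- The dynamics of the map `φ_{γ,n}` built with `ζ`, where `γ` is the lifted arc in `ℝⁿ`: it is a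
Morse–Smale diffeomorphism with exactly four non-wandering points, two sinks, a saddle with
one-dimensional unstable manifold and a source; the two unstable separatrices of the saddle
correspond to the intervals `(-1, 1)` and `(1, ∞)` of the axis, the first one lies in the basin
of the sink `ω`, and both lie in `γ` if `ζ` takes `γ` to the axis. -/
def HasPixtonDynamics {m : ℕ} (γ : Set (Euc (m + 1)))
    (ζ : PartialEquiv (Euc (m + 1)) (Euc (m + 1))) : Prop :=
  ∃ f : Sph (m + 1) ≃ₘ^1⟮𝓡 (m + 1), 𝓡 (m + 1)⟯ Sph (m + 1),
    (∀ x, f x = pixtonMap ζ x) ∧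
    IsMorseSmale f ∧
    nonWanderingSet f =
      {axisInSphere ζ (-1), southPole (m + 1), axisInSphere ζ 1, northPole (m + 1)} ∧
    (nonWanderingSet f).ncard = 4 ∧
    IsSink f (axisInSphere ζ (-1)) ∧
    IsSink f (southPole (m + 1)) ∧
    IsSaddle f (axisInSphere ζ 1) 1 ∧
    IsSource f (northPole (m + 1)) ∧
    unstableSeparatrices f (axisInSphere ζ 1) =
      {axisInSphere ζ '' Ioo (-1) 1, axisInSphere ζ '' Ioi 1} ∧
    axisInSphere ζ '' Ioo (-1) 1 ⊆ stableSet f (axisInSphere ζ (-1)) ∧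
    (ζ '' γ = range (axisPoint m) →
      ∀ L ∈ unstableSeparatrices f (axisInSphere ζ 1), L ⊆ stereoInv '' γ)

/-- The construction applied to the knot `K`: tubular neighbourhoods `T` of `K` exist; for each of
them there is a conjugating diffeomorphism `ζ : p⁻¹(T) → C` that takes `γ = p⁻¹(K)` to the axis;
and every choice of `T` and of a conjugating `ζ` yields the dynamics described above. -/
def ConstructionWorks {m : ℕ} (K : Set (Sph m × Circle)) : Prop :=
  (∃ T, IsTubularNeighborhood K T) ∧
  ∀ T, IsTubularNeighborhood K T →
    (∃ ζ, IsConjugator (coveringPreimage T) ζ ∧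
      ζ '' coveringPreimage K = range (axisPoint m)) ∧
    ∀ ζ, IsConjugator (coveringPreimage T) ζ → HasPixtonDynamics (coveringPreimage K) ζ

/-! ### The Fox–Artin arc in `ℝ³` -/

/-- `A` is a smooth closed arc with boundary points `u`, `v`. -/
def IsSmoothArc {n : ℕ} (A : Set (Euc n)) (u v : Euc n) : Prop :=
  ∃ σ : ℝ → Euc n, ContDiff ℝ ∞ σ ∧ InjOn σ (Icc 0 1) ∧ (∀ t ∈ Icc (0 : ℝ) 1, deriv σ t ≠ 0) ∧
    σ '' Icc 0 1 = A ∧ σ 0 = u ∧ σ 1 = v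

/-- The annulus `V₃ = {1/4 ≤ |x|² ≤ 1}` in `ℝ³`. -/
def V3 : Set (Euc 3) := {x | 1 / 4 ≤ ‖x‖ ^ 2 ∧ ‖x‖ ^ 2 ≤ 1}

/-- The outer boundary sphere of `V₃`. -/
def F3 : Set (Euc 3) := {x | ‖x‖ ^ 2 = 1}

/-- The annulus `V₂`, in the plane `x₃ = 0` of `ℝ³`. -/
def V2 : Set (Euc 3) := {x | x ∈ V3 ∧ x 2 = 0}

/-- The outer boundary circle of `V₂`. -/
def F2 : Set (Euc 3) := {x | x ∈ F3 ∧ x 2 = 0}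

/-- `l` is a Fox–Artin arc: the union of the images, under all powers of `h`, of three disjoint
smooth arcs `a`, `b`, `c` in `V₃`. The disc `Δ` is the image of the closed unit disc of the plane
under `δ`. -/
def IsFoxArtinArc (l : Set (Euc 3)) : Prop :=
  ∃ (α β γ : Euc 3) (a b c d : Set (Euc 3)) (δ : Euc 2 → Euc 3),
    α ∈ F2 ∧ β ∈ F2 ∧ γ ∈ F2 ∧ α ≠ β ∧ β ≠ γ ∧ α ≠ γ ∧
    IsSmoothArc d β γ ∧ d ⊆ F2 ∧ α ∉ d ∧
    IsSmoothArc a α β ∧ IsSmoothArc b (homothety β) (homothety γ) ∧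
    IsSmoothArc c γ (homothety α) ∧
    a ⊆ V3 ∧ b ⊆ V3 ∧ c ⊆ V3 ∧ Disjoint a b ∧ Disjoint b c ∧ Disjoint a c ∧
    a ⊆ V2 ∧ c ⊆ V2 ∧
    Disjoint ((a \ {α, β}) ∪ (c \ {γ, homothety α})) (F2 ∪ homothety '' F2) ∧
    ContinuousOn δ (Metric.closedBall 0 1) ∧ InjOn δ (Metric.closedBall 0 1) ∧
    δ '' Metric.closedBall 0 1 ⊆ V3 ∧
    δ '' Metric.sphere 0 1 = b ∪ homothety '' d ∧
    Disjoint (δ '' Metric.ball 0 1) (F3 ∪ homothety '' F3) ∧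
    (∃! x, x ∈ δ '' Metric.ball 0 1 ∩ a) ∧ (∃! x, x ∈ δ '' Metric.ball 0 1 ∩ c) ∧
    (∀ x ∈ (a ∪ b ∪ c) ∪ homothety '' (a ∪ b ∪ c), ∃ u v,
      IsSmoothArc (connectedComponentIn ((a ∪ b ∪ c) ∪ homothety '' (a ∪ b ∪ c)) x) u v) ∧
    l = ⋃ k : ℤ, (fun x => ((2 : ℝ)⁻¹ ^ k) • x) '' (a ∪ b ∪ c)

end Pixton

end

/-! The dynamics come from the model flow. Outside the ball of radius 2 the model field is the
constant unit field along the axis, so it is bounded and Lipschitz with uniformly continuous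
derivative. Its flow therefore exists for all times, and it is C¹ because the derivative in the
initial point solves the variational equation (`hasFDerivAt_flow`, `contDiff_flow`). On the boundary
of the cylinder the time-one map agrees with the unit translation up to first order, and far out
along the cylinder it equals that translation. Since `ζ` carries the homothety to the translation,
`ζ⁻¹ φ ζ` and the homothety fit together into a C¹ map of `ℝⁿ` (`contDiff_gluedMap`) that is a pure
homothety near the origin and near infinity. Backward time with ratio 2 gives the inverse. In the
chart at the North Pole the ratio 1/2 becomes 2, whence the source.

Wandering points: outside the tube the norm is halved at each step. Inside, write `u` for the
squared distance to the axis. Off the axis `-x₁ + (log u) / 2` strictly decreases along the flow. At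
points of the axis `-G(x₁) + u` does the job, where `G'` is the speed on the axis. Only the
equilibria `±1` survive (`exists_wandering`). There the differential of the time-one map is
diagonal, with `exp (±4/3)` along the axis and `exp (-1)` across it.

Transversality: the basins of the sinks and the unstable manifold of the source are open, so only
the saddle itself matters. Its unstable manifold is the part `x₁ > -1` of the axis. Instead of a
stable manifold theorem, a shooting argument (`exists_orbit_in_wedge`) finds an orbit trapped in `1
- u/2 ≤ x₁ ≤ 1`. The distance to the axis decays exactly like `exp (-t)` along it, so the orbit and
its mirror image form a graph over the signed distance, tangent at the saddle to a prescribed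
direction orthogonal to the axis (`exists_stable_curve`). These directions and the axis span.

Topology: the embedding of the solid torus that defines a tubular neighbourhood lifts to a map `E`
between the covering spaces (`exists_torus_lift`). Winding number `±1` says that one turn multiplies
`E` by `2^{±1}`; hence `E` is injective and fills the whole preimage, and `ζ` is its inverse up to a
diagonal linear map (`exists_isConjugator`). Tubular neighbourhoods exist because the lifted knot
has a smooth moving frame that is multiplied by the same factor as the knot; the resulting map is a
local diffeomorphism along the compact core and injective on it, hence an embedding nearby
(`exists_isTubularNeighborhood`).

Fox–Artin arc: the component of `b` in the union of the three arcs and their images is one smooth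
arc that runs through `c`, `h(a)`, `b`, `h(c)` in this order. Parametrized by the
homothety-invariant length `|dx| / |x|`, its last piece becomes a translate of the first, so it
extends to a smooth equivariant curve with image `ℓ` (`IsFoxArtinArc.exists_equivariant_curve`).
Such a curve covers a knot of degree `-1`. -/

noncomputable section

namespace Pixton

/-! ### General theory: flows and their C¹ dependence on the initial point. -/

section

/-! ### Flows of bounded Lipschitz vector fields -/

section ODE

open scoped NNReal

variable {E : Type*} [NormedAddCommGroup E] [NormedSpace ℝ E] {v : E → E} {K : ℝ≥0}

/-- `c` is an integral curve of the autonomous field `v`, defined for all times, with `c 0 = x`. -/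
def IsTrajectory (v : E → E) (x : E) (c : ℝ → E) : Prop :=
  c 0 = x ∧ ∀ t, HasDerivAt c (v (c t)) t

theorem IsTrajectory.continuous {x : E} {c : ℝ → E} (h : IsTrajectory v x c) : Continuous c :=
  continuous_iff_continuousAt.2 fun t => (h.2 t).continuousAt

theorem IsTrajectory.unique (hK : LipschitzWith K v) {x : E} {c d : ℝ → E}
    (hc : IsTrajectory v x c) (hd : IsTrajectory v x d) : c = d :=
  ODE_solution_unique_univ (v := fun _ => v) (s := fun _ => univ) (K := K) (t₀ := 0)
    (fun _ => hK.lipschitzOnWith) (fun t => ⟨hc.2 t, trivial⟩) (fun t => ⟨hd.2 t, trivial⟩)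
    (hc.1.trans hd.1.symm)

theorem IsTrajectory.comp_add {x : E} {c : ℝ → E} (h : IsTrajectory v x c) (s : ℝ) :
    IsTrajectory v (c s) (fun t => c (t + s)) :=
  ⟨by simp, fun t => (h.2 (t + s)).comp_add_const t s⟩

theorem IsTrajectory.comp_neg {x : E} {c : ℝ → E} (h : IsTrajectory v x c) :
    IsTrajectory (fun y => -v y) x (fun t => c (-t)) :=
  ⟨by simp [h.1], fun t => by
    have := (h.2 (-t)).scomp t (hasDerivAt_neg t)
    simpa [Function.comp_def] using this⟩

/-- A global bound `L` on the speed lets Picard–Lindelöf run on the ball of radius `L * (n + 1)` and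
yields a solution on an interval of half-length `n + 1`, whatever `n`. By uniqueness these solutions
agree, and they are patched along `⌈|t|⌉`. -/
theorem exists_isTrajectory [CompleteSpace E] (hK : LipschitzWith K v) {L : ℝ≥0}
    (hL : ∀ x, ‖v x‖ ≤ L) (x : E) : ∃ c, IsTrajectory v x c := by
  have hloc : ∀ n : ℕ, ∃ α : ℝ → E, α 0 = x ∧
      ∀ t ∈ Ioo (-((n : ℝ) + 1)) (n + 1), HasDerivAt α (v (α t)) t := by
    intro n
    have hn : (0 : ℝ) ≤ n := n.cast_nonneg
    have hpl : IsPicardLindelof (fun _ => v)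
        (⟨0, by constructor <;> linarith⟩ : Icc (-((n : ℝ) + 1)) (n + 1)) x
        (L * (n + 1)) 0 L K := by
      apply IsPicardLindelof.of_time_independent (fun y _ => hL y) hK.lipschitzOnWith
      simp
    obtain ⟨α, h0, hα⟩ := hpl.exists_eq_forall_mem_Icc_hasDerivWithinAt₀
    exact ⟨α, h0, fun t ht => (hα t (Ioo_subset_Icc_self ht)).hasDerivAt (Icc_mem_nhds ht.1 ht.2)⟩
  choose α h0 hα using hloc
  have hagree : ∀ n m : ℕ, n ≤ m → EqOn (α n) (α m) (Ioo (-((n : ℝ) + 1)) (n + 1)) := by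
    intro n m hnm
    have hn : (0 : ℝ) ≤ n := n.cast_nonneg
    have hnm' : (n : ℝ) ≤ m := by exact_mod_cast hnm
    refine ODE_solution_unique_of_mem_Ioo (v := fun _ => v) (s := fun _ => univ) (K := K) (t₀ := 0)
      (fun _ _ => hK.lipschitzOnWith) (by constructor <;> linarith)
      (fun t ht => ⟨hα n t ht, trivial⟩)
      (fun t ht => ⟨hα m t ⟨by linarith [ht.1], by linarith [ht.2]⟩, trivial⟩) ?_
    rw [h0, h0]
  refine ⟨fun t => α ⌈|t|⌉₊ t, by simp [h0], fun t => ?_⟩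
  set N := ⌈|t|⌉₊ with hN
  have hNt : |t| ≤ N := Nat.le_ceil _
  have habs := abs_le.1 hNt
  -- The index `⌈|s|⌉₊` jumps at integers, but near `t` it never exceeds `N + 1`, so one solution
  -- describes the patched curve there.
  have heq : (fun s => α ⌈|s|⌉₊ s) =ᶠ[𝓝 t] α (N + 1) := by
    have : Ioo (-((N : ℝ) + 1)) (N + 1) ∈ 𝓝 t :=
      Ioo_mem_nhds (by linarith [habs.1]) (by linarith [habs.2])
    filter_upwards [this] with s hs
    refine hagree _ _ ?_ ?_
    · refine Nat.ceil_le.2 (abs_le.2 ⟨?_, ?_⟩) <;> push_cast <;> linarith [hs.1, hs.2]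
    · have hs' : |s| ≤ (⌈|s|⌉₊ : ℝ) := Nat.le_ceil _
      have := abs_le.1 hs'
      constructor <;> linarith [this.1, this.2]
  have hd : HasDerivAt (α (N + 1)) (v (α (N + 1) t)) t := by
    apply hα; push_cast; constructor <;> linarith [habs.1, habs.2]
  have := hd.congr_of_eventuallyEq heq
  rwa [← heq.eq_of_nhds] at this

theorem dist_trajectory_le (hK : LipschitzWith K v) {x y : E} {c d : ℝ → E}
    (hc : IsTrajectory v x c) (hd : IsTrajectory v y d) {t : ℝ} (ht : 0 ≤ t) :
    dist (c t) (d t) ≤ dist x y * Real.exp (K * t) := by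
  have := dist_le_of_trajectories_ODE (v := fun _ => v) (K := K) (f := c) (g := d) (a := 0) (b := t)
    (δ := dist x y) (fun _ => hK) hc.continuous.continuousOn
    (fun s _ => (hc.2 s).hasDerivWithinAt) hd.continuous.continuousOn
    (fun s _ => (hd.2 s).hasDerivWithinAt) (by rw [hc.1, hd.1]) t ⟨ht, le_rfl⟩
  simpa using this

theorem gronwallBound_zero_mul (K a b x : ℝ) :
    gronwallBound 0 K (a * b) x = a * gronwallBound 0 K b x := by
  unfold gronwallBound; split_ifs <;> ring

/-- The mean value inequality for `v - v'(p)`. Uniform continuity of the derivative makes `δ`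
independent of `p`, which is needed because the base point will move along a trajectory. -/
theorem exists_remainder_le (hv : Differentiable ℝ v) (hu : UniformContinuous (fderiv ℝ v))
    {ε : ℝ} (hε : 0 < ε) :
    ∃ δ > 0, ∀ p y, dist y p < δ → ‖v y - v p - fderiv ℝ v p (y - p)‖ ≤ ε * ‖y - p‖ := by
  obtain ⟨δ, hδ, h⟩ := Metric.uniformContinuous_iff.1 hu ε hε
  refine ⟨δ, hδ, fun p y hy => ?_⟩
  refine (convex_ball p δ).norm_image_sub_le_of_norm_fderiv_le' (𝕜 := ℝ) (fun z _ => hv z)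
    (fun z hz => ?_) (Metric.mem_ball_self hδ) hy
  rw [← dist_eq_norm]
  exact (h hz).le

/-- The derivative of the flow with respect to the initial point solves the variational
equation. -/
theorem hasFDerivAt_flow (hK : LipschitzWith K v) (hv : Differentiable ℝ v)
    (hu : UniformContinuous (fderiv ℝ v)) {Φ : E → ℝ → E} (hΦ : ∀ x, IsTrajectory v x (Φ x))
    {T : ℝ} (hT : 0 ≤ T) (x : E) {Y : ℝ → E →L[ℝ] E} (hY0 : Y 0 = 1)
    (hYc : ContinuousOn Y (Icc 0 T))
    (hY : ∀ t ∈ Ico 0 T, HasDerivWithinAt Y ((fderiv ℝ v (Φ x t)).comp (Y t)) (Ici t) t) :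
    HasFDerivAt (fun z => Φ z T) (Y T) x := by
  rw [hasFDerivAt_iff_isLittleO_nhds_zero, Asymptotics.isLittleO_iff]
  intro c hc
  set C := Real.exp (K * T) with hC
  have hCpos : 0 < C := Real.exp_pos _
  set B := gronwallBound 0 K 1 T with hB
  have hBnn : 0 ≤ B := by
    have := gronwallBound_mono (δ := 0) (ε := 1) (K := K) le_rfl zero_le_one K.2 hT
    simpa [gronwallBound_x0] using this
  -- Chosen so that `ε * (C * B) ≤ c`; the summand 1 covers the case `B = 0`, that is `T = 0`.
  set ε := c / (C * B + 1) with hε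
  have hεpos : 0 < ε := by positivity
  obtain ⟨δ, hδ, hrem⟩ := exists_remainder_le hv hu hεpos
  have hball : Metric.ball (0 : E) (δ / C) ∈ 𝓝 (0 : E) := Metric.ball_mem_nhds _ (by positivity)
  filter_upwards [hball] with ξ hξ
  have hξ' : ‖ξ‖ * C < δ := by
    rw [mem_ball_zero_iff, lt_div_iff₀ hCpos] at hξ; exact hξ
  have hdist : ∀ t ∈ Icc 0 T, ‖Φ (x + ξ) t - Φ x t‖ ≤ ‖ξ‖ * C := by
    intro t ht
    have := dist_trajectory_le hK (hΦ (x + ξ)) (hΦ x) ht.1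
    rw [dist_eq_norm, dist_eq_norm, add_sub_cancel_left] at this
    refine this.trans (mul_le_mul_of_nonneg_left ?_ (norm_nonneg _))
    exact Real.exp_le_exp.2 (mul_le_mul_of_nonneg_left ht.2 K.2)
  -- The error of the linear approximation starts at zero and satisfies `|f'| ≤ K |f| + ε C |ξ|`:
  -- the Taylor remainder of `v` along the trajectory is the inhomogeneity.
  have key := norm_le_gronwallBound_of_norm_deriv_right_le
    (f := fun t => Φ (x + ξ) t - Φ x t - Y t ξ)
    (f' := fun t => v (Φ (x + ξ) t) - v (Φ x t) - (fderiv ℝ v (Φ x t)) (Y t ξ))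
    (δ := 0) (K := K) (ε := ε * (‖ξ‖ * C)) (a := 0) (b := T) ?_ ?_ ?_ ?_ T ⟨hT, le_rfl⟩
  · rw [sub_zero, show ε * (‖ξ‖ * C) = (ε * (‖ξ‖ * C)) * 1 by ring, gronwallBound_zero_mul, ← hB]
      at key
    refine key.trans ?_
    have : ε * (C * B) ≤ c := by
      rw [hε, div_mul_eq_mul_div, div_le_iff₀ (by positivity)]
      nlinarith [mul_nonneg hCpos.le hBnn]
    calc ε * (‖ξ‖ * C) * B = (ε * (C * B)) * ‖ξ‖ := by ring
      _ ≤ c * ‖ξ‖ := mul_le_mul_of_nonneg_right this (norm_nonneg _)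
  · exact ((hΦ _).continuous.continuousOn.sub (hΦ _).continuous.continuousOn).sub
      (hYc.clm_apply continuousOn_const)
  · intro t ht
    have h1 := ((hΦ (x + ξ)).2 t).hasDerivWithinAt (s := Ici t)
    have h2 := ((hΦ x).2 t).hasDerivWithinAt (s := Ici t)
    have h3 := (hY t ht).clm_apply (hasDerivWithinAt_const t (Ici t) ξ)
    refine (h1.sub h2).sub ?_
    simpa using h3
  · simp [(hΦ _).1, hY0]
  · intro t ht
    have hd := hdist t ⟨ht.1, ht.2.le⟩
    have hr := hrem (Φ x t) (Φ (x + ξ) t) (by rw [dist_eq_norm]; linarith)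
    have hop : ‖fderiv ℝ v (Φ x t)‖ ≤ K := norm_fderiv_le_of_lipschitz ℝ hK
    have heq : v (Φ (x + ξ) t) - v (Φ x t) - (fderiv ℝ v (Φ x t)) (Y t ξ) =
        (fderiv ℝ v (Φ x t)) (Φ (x + ξ) t - Φ x t - Y t ξ) +
        (v (Φ (x + ξ) t) - v (Φ x t) - fderiv ℝ v (Φ x t) (Φ (x + ξ) t - Φ x t)) := by
      simp only [map_sub]; abel
    rw [heq]
    refine (norm_add_le _ _).trans (add_le_add ?_ ?_)
    · exact (ContinuousLinearMap.le_opNorm _ _).trans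
        (mul_le_mul_of_nonneg_right hop (norm_nonneg _))
    · exact hr.trans (mul_le_mul_of_nonneg_left hd hεpos.le)

/-- Solutions of a linear equation on a short time interval. -/
theorem exists_linear_solution [CompleteSpace E] {A : ℝ → E →L[ℝ] E} (hA : Continuous A)
    (hAK : ∀ t, ‖A t‖ ≤ K) {T : ℝ} (hT : 0 ≤ T) (hTK : 2 * K * T ≤ 1) :
    ∃ Y : ℝ → E →L[ℝ] E, Y 0 = 1 ∧ ContinuousOn Y (Icc 0 T) ∧
      ∀ t ∈ Ico 0 T, HasDerivWithinAt Y ((A t).comp (Y t)) (Ici t) t := by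
  -- In the unit ball around the identity `‖Y‖ ≤ 2`, so the speed is at most `2 K`, and `2 K T ≤ 1`
  -- keeps the solution in that ball.
  have hpl : IsPicardLindelof (fun t (Y : E →L[ℝ] E) => (A t).comp Y)
      (⟨0, ⟨le_rfl, hT⟩⟩ : Icc (0 : ℝ) T) 1 1 0 (2 * K) K := by
    refine ⟨fun t _ => ?_, fun Y _ => ?_, fun t _ Y hY => ?_, ?_⟩
    · refine LipschitzOnWith.of_dist_le_mul fun Y _ Z _ => ?_
      rw [dist_eq_norm, dist_eq_norm, ← ContinuousLinearMap.comp_sub]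
      exact (ContinuousLinearMap.opNorm_comp_le _ _).trans
        (mul_le_mul_of_nonneg_right (hAK t) (norm_nonneg _))
    · exact (hA.clm_comp continuous_const).continuousOn
    · have h1 : ‖(1 : E →L[ℝ] E)‖ ≤ 1 := ContinuousLinearMap.norm_id_le
      have h2 : ‖Y - 1‖ ≤ 1 := by simpa [dist_eq_norm] using hY
      have h3 : ‖Y‖ ≤ 2 := by
        calc ‖Y‖ = ‖(Y - 1) + 1‖ := by simp
          _ ≤ ‖Y - 1‖ + ‖(1 : E →L[ℝ] E)‖ := norm_add_le _ _
          _ ≤ 2 := by linarith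
      calc ‖(A t).comp Y‖ ≤ ‖A t‖ * ‖Y‖ := ContinuousLinearMap.opNorm_comp_le _ _
        _ ≤ K * 2 := mul_le_mul (hAK t) h3 (norm_nonneg _) K.2
        _ = _ := by push_cast; ring
    · simp [hT]; linarith
  obtain ⟨Y, hY0, hY⟩ := hpl.exists_eq_forall_mem_Icc_hasDerivWithinAt₀
  refine ⟨Y, hY0, fun t ht => (hY t ht).continuousWithinAt, fun t ht => ?_⟩
  exact (hY t ⟨ht.1, ht.2.le⟩).mono_of_mem_nhdsWithin (Icc_mem_nhdsGE_of_mem ht)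

theorem norm_linear_solution_le {A Y : ℝ → E →L[ℝ] E} (hAK : ∀ t, ‖A t‖ ≤ K) {T : ℝ}
    (hY0 : Y 0 = 1) (hYc : ContinuousOn Y (Icc 0 T))
    (hY : ∀ t ∈ Ico 0 T, HasDerivWithinAt Y ((A t).comp (Y t)) (Ici t) t) :
    ∀ t ∈ Icc 0 T, ‖Y t‖ ≤ Real.exp (K * T) := by
  intro t ht
  have := norm_le_gronwallBound_of_norm_deriv_right_le (δ := 1) (K := K) (ε := 0) hYc hY
    (by rw [hY0]; exact ContinuousLinearMap.norm_id_le) (fun s _ => by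
      rw [add_zero]
      exact (ContinuousLinearMap.opNorm_comp_le _ _).trans
        (mul_le_mul_of_nonneg_right (hAK s) (norm_nonneg _))) t ht
  rw [gronwallBound_ε0, sub_zero, one_mul] at this
  exact this.trans (Real.exp_le_exp.2 (mul_le_mul_of_nonneg_left ht.2 K.2))

/-- The derivative in the initial point is the solution of the variational equation. It depends
continuously on the point by Grönwall applied to the difference of two such solutions, with the
variation of `fderiv ℝ v` along the two trajectories as inhomogeneity. -/
theorem contDiff_flow_short [CompleteSpace E] (hK : LipschitzWith K v) (hv : Differentiable ℝ v)
    (hu : UniformContinuous (fderiv ℝ v)) {Φ : E → ℝ → E} (hΦ : ∀ x, IsTrajectory v x (Φ x))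
    {T : ℝ} (hT : 0 ≤ T) (hTK : 2 * K * T ≤ 1) : ContDiff ℝ 1 (fun z => Φ z T) := by
  have hop : ∀ y, ‖fderiv ℝ v y‖ ≤ K := fun y => norm_fderiv_le_of_lipschitz ℝ hK
  choose Y hY0 hYc hY using fun x => exists_linear_solution (A := fun t => fderiv ℝ v (Φ x t))
    (hu.continuous.comp (hΦ x).continuous) (fun t => hop _) hT hTK
  have hder : ∀ x, HasFDerivAt (fun z => Φ z T) (Y x T) x := fun x =>
    hasFDerivAt_flow hK hv hu hΦ hT x (hY0 x) (hYc x) (hY x)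
  refine contDiff_one_iff_hasFDerivAt.2 ⟨fun x => Y x T, ?_, hder⟩
  set C := Real.exp (K * T) with hC
  have hCpos : 0 < C := Real.exp_pos _
  set B := gronwallBound 0 K 1 T with hB
  have hBnn : 0 ≤ B := by
    have := gronwallBound_mono (δ := 0) (ε := 1) (K := K) le_rfl zero_le_one K.2 hT
    simpa [gronwallBound_x0] using this
  refine Metric.continuous_iff.2 fun x ε hε => ?_
  set η := ε / (2 * (C * B + 1)) with hη
  have hηpos : 0 < η := by positivity
  obtain ⟨δ, hδ, huc⟩ := Metric.uniformContinuous_iff.1 hu η hηpos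
  refine ⟨δ / C, by positivity, fun z hz => ?_⟩
  have hz' : dist z x * C < δ := (lt_div_iff₀ hCpos).1 hz
  have key := norm_le_gronwallBound_of_norm_deriv_right_le
    (f := fun t => Y z t - Y x t)
    (f' := fun t => (fderiv ℝ v (Φ z t)).comp (Y z t) - (fderiv ℝ v (Φ x t)).comp (Y x t))
    (δ := 0) (K := K) (ε := η * C) (a := 0) (b := T) ((hYc z).sub (hYc x))
    (fun t ht => (hY z t ht).sub (hY x t ht)) (by simp [hY0]) ?_ T ⟨hT, le_rfl⟩
  · rw [sub_zero, show η * C = (η * C) * 1 by ring, gronwallBound_zero_mul, ← hB] at key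
    rw [dist_eq_norm]
    refine key.trans_lt ?_
    have h2 : η * (2 * (C * B + 1)) = ε := div_mul_cancel₀ _ (by positivity)
    nlinarith [mul_nonneg hCpos.le hBnn]
  · intro t ht
    have hd : dist (Φ z t) (Φ x t) < δ := by
      refine (dist_trajectory_le hK (hΦ z) (hΦ x) ht.1).trans_lt (lt_of_le_of_lt ?_ hz')
      refine mul_le_mul_of_nonneg_left ?_ dist_nonneg
      exact Real.exp_le_exp.2 (mul_le_mul_of_nonneg_left ht.2.le K.2)
    have hA := huc hd
    rw [dist_eq_norm] at hA
    have heq : (fderiv ℝ v (Φ z t)).comp (Y z t) - (fderiv ℝ v (Φ x t)).comp (Y x t) =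
        (fderiv ℝ v (Φ z t)).comp (Y z t - Y x t) +
          (fderiv ℝ v (Φ z t) - fderiv ℝ v (Φ x t)).comp (Y x t) := by
      simp only [ContinuousLinearMap.comp_sub, ContinuousLinearMap.sub_comp]; abel
    rw [heq]
    refine (norm_add_le _ _).trans (add_le_add ?_ ?_)
    · exact (ContinuousLinearMap.opNorm_comp_le _ _).trans
        (mul_le_mul_of_nonneg_right (hop _) (norm_nonneg _))
    · exact (ContinuousLinearMap.opNorm_comp_le _ _).trans
        (mul_le_mul hA.le (norm_linear_solution_le (fun t => hop _) (hY0 x) (hYc x) (hY x) t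
          ⟨ht.1, ht.2.le⟩) (norm_nonneg _) hηpos.le)

theorem trajectory_add (hK : LipschitzWith K v) {Φ : E → ℝ → E}
    (hΦ : ∀ x, IsTrajectory v x (Φ x)) (x : E) (s t : ℝ) : Φ x (t + s) = Φ (Φ x s) t :=
  congrFun (((hΦ x).comp_add s).unique hK (hΦ (Φ x s))) t

/-- The group property writes the time-`T` map as an iterate of a map of time `T / N` short enough
for `contDiff_flow_short`. -/
theorem contDiff_flow_of_nonneg [CompleteSpace E] (hK : LipschitzWith K v)
    (hv : Differentiable ℝ v) (hu : UniformContinuous (fderiv ℝ v)) {Φ : E → ℝ → E}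
    (hΦ : ∀ x, IsTrajectory v x (Φ x)) {T : ℝ} (hT : 0 ≤ T) : ContDiff ℝ 1 (fun z => Φ z T) := by
  obtain ⟨N, hN⟩ := exists_nat_gt (2 * K * T)
  have hNpos : (0 : ℝ) < N := lt_of_le_of_lt (by positivity) hN
  have hshort : ContDiff ℝ 1 (fun z => Φ z (T / N)) := by
    refine contDiff_flow_short hK hv hu hΦ (by positivity) ?_
    rw [← mul_div_assoc, div_le_one hNpos]; exact hN.le
  have hk : ∀ k : ℕ, ContDiff ℝ 1 (fun z => Φ z (k * (T / N))) := by
    intro k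
    induction k with
    | zero => simp only [Nat.cast_zero, zero_mul, (hΦ _).1]; exact contDiff_id
    | succ k ih =>
      have : (fun z => Φ z ((k + 1 : ℕ) * (T / N))) =
          (fun z => Φ z (k * (T / N))) ∘ (fun z => Φ z (T / N)) := by
        funext z
        simp only [Function.comp_apply]
        rw [← trajectory_add hK hΦ]; push_cast; ring_nf
      rw [this]
      exact ih.comp hshort
  have := hk N
  rwa [mul_div_cancel₀ _ hNpos.ne'] at this

/-- The flow of a Lipschitz `C¹` vector field with uniformly continuous derivative is `C¹`. -/
theorem contDiff_flow [CompleteSpace E] (hK : LipschitzWith K v)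
    (hv : Differentiable ℝ v) (hu : UniformContinuous (fderiv ℝ v)) {Φ : E → ℝ → E}
    (hΦ : ∀ x, IsTrajectory v x (Φ x)) (T : ℝ) : ContDiff ℝ 1 (fun z => Φ z T) := by
  rcases le_total 0 T with hT | hT
  · exact contDiff_flow_of_nonneg hK hv hu hΦ hT
  · have hK' : LipschitzWith K (fun y => -v y) := LipschitzWith.neg hK
    have hu' : UniformContinuous (fderiv ℝ (fun y => -v y)) := by
      have : fderiv ℝ (fun y => -v y) = fun y => -fderiv ℝ v y := by
        funext y; exact fderiv_fun_neg
      rw [this]; exact hu.neg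
    have := contDiff_flow_of_nonneg hK' hv.neg hu' (Φ := fun x t => Φ x (-t))
      (fun x => (hΦ x).comp_neg) (T := -T) (by linarith)
    simpa using this

end ODE

end

/-! ### The dynamics of the model flow on the cylinder. -/

section

/-! ### The model field -/

theorem hasDerivAt_ite_le {f g f' g' : ℝ → ℝ} {a : ℝ} (hf : ∀ x, HasDerivAt f (f' x) x)
    (hg : ∀ x, HasDerivAt g (g' x) x) (hfg : f a = g a) (hfg' : f' a = g' a) (x : ℝ) :
    HasDerivAt (fun x => if x ≤ a then f x else g x) (if x ≤ a then f' x else g' x) x := by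
  rcases lt_trichotomy x a with h | rfl | h
  · rw [if_pos h.le]
    refine (hf x).congr_of_eventuallyEq ?_
    filter_upwards [Iio_mem_nhds h] with y hy
    exact if_pos (le_of_lt hy)
  · rw [if_pos le_rfl, ← hasDerivWithinAt_univ, ← Iic_union_Ici (a := x)]
    refine HasDerivWithinAt.union ?_ ?_
    · exact (hf x).hasDerivWithinAt.congr (fun y hy => if_pos hy) (if_pos le_rfl)
    · rw [hfg']
      refine (hg x).hasDerivWithinAt.congr (fun y hy => ?_) ((if_pos le_rfl).trans hfg)
      rcases eq_or_lt_of_le (mem_Ici.1 hy) with rfl | hy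
      · exact (if_pos le_rfl).trans hfg
      · exact if_neg (not_le.2 hy)
  · rw [if_neg (not_le.2 h)]
    refine (hg x).congr_of_eventuallyEq ?_
    filter_upwards [Ioi_mem_nhds h] with y hy
    exact if_neg (not_le.2 hy)

/-- The axial speed of the model field, as a function of `|x|²`. -/
def axialSpeed (r : ℝ) : ℝ := if r ≤ 4 then 1 - 1 / 9 * (r - 4) ^ 2 else 1

/-- The radial contraction rate of the model field, as a function of `|x|²`. -/
def radialRate (r : ℝ) : ℝ :=
  if r ≤ 2 then 1 else if r ≤ 4 then (1 - Real.sin (Real.pi / 2 * (r - 3))) / 2 else 0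

theorem hasDerivAt_axialSpeed (r : ℝ) :
    HasDerivAt axialSpeed (if r ≤ 4 then -(2 / 9) * (r - 4) else 0) r := by
  refine hasDerivAt_ite_le (f := fun r : ℝ => 1 - 1 / 9 * (r - 4) ^ 2) (g := fun _ => 1)
    (f' := fun r => -(2 / 9) * (r - 4)) (g' := fun _ => 0) (fun x => ?_)
    (fun x => hasDerivAt_const _ _) (by norm_num) (by norm_num) r
  have := ((((hasDerivAt_id x).sub_const 4).pow 2).const_mul (1 / 9 : ℝ)).const_sub 1
  refine this.congr_deriv ?_
  simp; ring

theorem contDiff_axialSpeed : ContDiff ℝ 1 axialSpeed := by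
  refine contDiff_one_iff_deriv.2 ⟨fun r => (hasDerivAt_axialSpeed r).differentiableAt, ?_⟩
  rw [show deriv axialSpeed = _ from funext fun r => (hasDerivAt_axialSpeed r).deriv]
  exact Continuous.if_le (by fun_prop) (by fun_prop) continuous_id continuous_const
    (by rintro x rfl; norm_num)

theorem sin_half_pi : Real.sin (Real.pi / 2 * (4 - 3)) = 1 := by norm_num

theorem cos_half_pi : Real.cos (Real.pi / 2 * (4 - 3)) = 0 := by norm_num

theorem sin_neg_half_pi : Real.sin (Real.pi / 2 * (2 - 3)) = -1 := by
  rw [show Real.pi / 2 * (2 - 3) = -(Real.pi / 2) by ring]; simp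

theorem cos_neg_half_pi : Real.cos (Real.pi / 2 * (2 - 3)) = 0 := by
  rw [show Real.pi / 2 * (2 - 3) = -(Real.pi / 2) by ring]; simp

theorem hasDerivAt_radialRate (r : ℝ) :
    HasDerivAt radialRate (if r ≤ 2 then 0 else
      if r ≤ 4 then -(Real.pi / 4 * Real.cos (Real.pi / 2 * (r - 3))) else 0) r := by
  refine hasDerivAt_ite_le (f := fun _ => 1)
    (g := fun r : ℝ => if r ≤ 4 then (1 - Real.sin (Real.pi / 2 * (r - 3))) / 2 else 0)
    (f' := fun _ => 0)
    (g' := fun r => if r ≤ 4 then -(Real.pi / 4 * Real.cos (Real.pi / 2 * (r - 3))) else 0)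
    (fun x => hasDerivAt_const _ _) (fun x => ?_) ?_ ?_ r
  · refine hasDerivAt_ite_le (f := fun r : ℝ => (1 - Real.sin (Real.pi / 2 * (r - 3))) / 2)
      (g := fun _ => 0) (f' := fun r => -(Real.pi / 4 * Real.cos (Real.pi / 2 * (r - 3))))
      (g' := fun _ => 0) (fun x => ?_) (fun x => hasDerivAt_const _ _) ?_ ?_ x
    · have := ((((hasDerivAt_id x).sub_const 3).const_mul (Real.pi / 2)).sin.const_sub 1).div_const 2
      refine this.congr_deriv ?_
      simp; ring
    · simp only [sin_half_pi]; norm_num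
    · simp only [cos_half_pi]; norm_num
  · simp only [sin_neg_half_pi]; norm_num
  · simp only [cos_neg_half_pi]; norm_num

theorem contDiff_radialRate : ContDiff ℝ 1 radialRate := by
  refine contDiff_one_iff_deriv.2 ⟨fun r => (hasDerivAt_radialRate r).differentiableAt, ?_⟩
  rw [show deriv radialRate = _ from funext fun r => (hasDerivAt_radialRate r).deriv]
  refine Continuous.if_le (by fun_prop) ?_ continuous_id continuous_const ?_
  · refine Continuous.if_le (by fun_prop) (by fun_prop) continuous_id continuous_const ?_
    rintro x rfl; simp [cos_half_pi]
  · rintro x rfl; simp [cos_neg_half_pi]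

theorem radialRate_nonneg (r : ℝ) : 0 ≤ radialRate r := by
  unfold radialRate; split_ifs
  · norm_num
  · linarith [Real.sin_le_one (Real.pi / 2 * (r - 3))]
  · norm_num

theorem radialRate_le_one (r : ℝ) : radialRate r ≤ 1 := by
  unfold radialRate; split_ifs
  · norm_num
  · linarith [Real.neg_one_le_sin (Real.pi / 2 * (r - 3))]
  · norm_num

theorem radialRate_of_le {r : ℝ} (h : r ≤ 2) : radialRate r = 1 := if_pos h

theorem radialRate_of_ge {r : ℝ} (h : 4 ≤ r) : radialRate r = 0 := by
  unfold radialRate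
  rcases eq_or_lt_of_le h with rfl | h
  · rw [if_neg (by norm_num), if_pos le_rfl, sin_half_pi]; norm_num
  · rw [if_neg (by linarith), if_neg (by linarith)]

theorem axialSpeed_of_ge {r : ℝ} (h : 4 ≤ r) : axialSpeed r = 1 := by
  unfold axialSpeed
  rcases eq_or_lt_of_le h with rfl | h
  · norm_num
  · rw [if_neg (by linarith)]

theorem axialSpeed_of_le {r : ℝ} (h : r ≤ 4) : axialSpeed r = 1 - 1 / 9 * (r - 4) ^ 2 := if_pos h

theorem axialSpeed_pos {r : ℝ} (h : 1 < r) : 0 < axialSpeed r := by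
  unfold axialSpeed; split_ifs with h4
  · nlinarith
  · norm_num

theorem axialSpeed_one : axialSpeed 1 = 0 := by unfold axialSpeed; norm_num

theorem axialSpeed_neg {r : ℝ} (h : r < 1) : axialSpeed r < 0 := by
  rw [axialSpeed_of_le (by linarith)]; nlinarith

theorem axialSpeed_eq_zero_iff {r : ℝ} : axialSpeed r = 0 ↔ r = 1 := by
  refine ⟨fun h => ?_, fun h => h ▸ axialSpeed_one⟩
  rcases lt_trichotomy r 1 with h1 | h1 | h1
  · exact absurd h (axialSpeed_neg h1).ne
  · exact h1
  · exact absurd h (axialSpeed_pos h1).ne'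

variable {m : ℕ}

/-- The squared distance to the axis of the cylinder. -/
def axisDistSq (x : Euc (m + 1)) : ℝ := ∑ i : Fin m, x i.succ ^ 2

theorem axisDistSq_nonneg (x : Euc (m + 1)) : 0 ≤ axisDistSq x :=
  Finset.sum_nonneg fun _ _ => sq_nonneg _

theorem norm_sq_eq (x : Euc (m + 1)) : ‖x‖ ^ 2 = x 0 ^ 2 + axisDistSq x := by
  rw [EuclideanSpace.norm_sq_eq, Fin.sum_univ_succ]; simp [axisDistSq]

theorem mem_cylinder {x : Euc (m + 1)} : x ∈ cylinder m ↔ axisDistSq x ≤ 4 := Iff.rfl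

@[simp] theorem axisPoint_zero (t : ℝ) : axisPoint m t 0 = t := by simp [axisPoint]

@[simp] theorem axisPoint_succ (t : ℝ) (i : Fin m) : axisPoint m t i.succ = 0 := by
  simp [axisPoint]

theorem axisPoint_eq_smul (t : ℝ) : axisPoint m t = t • axisPoint m 1 := by
  ext i; refine Fin.cases ?_ (fun i => ?_) i <;> simp

theorem axisPoint_add (s t : ℝ) : axisPoint m (s + t) = axisPoint m s + axisPoint m t := by
  ext i; refine Fin.cases ?_ (fun i => ?_) i <;> simp

theorem continuous_axisPoint : Continuous (axisPoint m) := by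
  rw [show axisPoint m = fun t => t • axisPoint m 1 from funext axisPoint_eq_smul]; fun_prop

@[simp] theorem axisDistSq_axisPoint (t : ℝ) : axisDistSq (axisPoint m t) = 0 := by
  simp [axisDistSq]

@[simp] theorem axisDistSq_add_axisPoint (x : Euc (m + 1)) (t : ℝ) :
    axisDistSq (x + axisPoint m t) = axisDistSq x := by
  simp [axisDistSq]

theorem eq_axisPoint_of_axisDistSq_eq_zero {x : Euc (m + 1)} (h : axisDistSq x = 0) :
    x = axisPoint m (x 0) := by
  have := (Finset.sum_eq_zero_iff_of_nonneg (fun i _ => sq_nonneg (x (Fin.succ i)))).1 h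
  ext i; refine Fin.cases ?_ (fun i => ?_) i
  · simp
  · simpa using this i (Finset.mem_univ _)

theorem continuous_axisDistSq : Continuous (axisDistSq (m := m)) := by
  unfold axisDistSq; fun_prop

theorem axisPoint_mem_cylinder (t : ℝ) : axisPoint m t ∈ cylinder m := by
  simp [mem_cylinder]

theorem modelField_zero (x : Euc (m + 1)) : modelField x 0 = axialSpeed (‖x‖ ^ 2) := rfl

theorem modelField_succ (x : Euc (m + 1)) (i : Fin m) :
    modelField x i.succ = -(radialRate (‖x‖ ^ 2) * x i.succ) := by
  have : modelField x i.succ = (if ‖x‖ ^ 2 ≤ 2 then -x i.succ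
      else if ‖x‖ ^ 2 ≤ 4 then
        x i.succ / 2 * (Real.sin (Real.pi / 2 * (‖x‖ ^ 2 - 3)) - 1)
      else 0) := rfl
  rw [this]; unfold radialRate; split_ifs <;> ring

/-- Coordinate-free form of the field, from which smoothness, symmetry and derivatives are read off.
-/
theorem modelField_eq (x : Euc (m + 1)) :
    modelField x = axialSpeed (‖x‖ ^ 2) • axisPoint m 1 -
      radialRate (‖x‖ ^ 2) • (x - x 0 • axisPoint m 1) := by
  ext i; refine Fin.cases ?_ (fun i => ?_) i
  · simp [modelField_zero]
  · simp [modelField_succ]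

theorem modelField_of_ge {x : Euc (m + 1)} (h : 4 ≤ ‖x‖ ^ 2) : modelField x = axisPoint m 1 := by
  rw [modelField_eq, axialSpeed_of_ge h, radialRate_of_ge h]; simp

theorem contDiff_modelField : ContDiff ℝ 1 (modelField (m := m)) := by
  rw [show modelField (m := m) = _ from funext modelField_eq]
  have hn : ContDiff ℝ 1 (fun x : Euc (m + 1) => ‖x‖ ^ 2) := contDiff_id.norm_sq ℝ
  have h0 : ContDiff ℝ 1 (fun x : Euc (m + 1) => x 0) := by fun_prop
  exact ((contDiff_axialSpeed.comp hn).smul contDiff_const).sub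
    ((contDiff_radialRate.comp hn).smul (contDiff_id.sub (h0.smul contDiff_const)))

/-- The source of all global estimates: a C¹ field that differs from a constant one by a compactly
supported field is Lipschitz, bounded and has uniformly continuous derivative. -/
theorem hasCompactSupport_modelField_sub :
    HasCompactSupport (fun x : Euc (m + 1) => modelField x - axisPoint m 1) := by
  refine HasCompactSupport.intro (isCompact_closedBall (0 : Euc (m + 1)) 2) fun x hx => ?_
  rw [Metric.mem_closedBall, dist_zero_right, not_le] at hx
  rw [modelField_of_ge (by nlinarith), sub_self]

theorem exists_lipschitzWith_modelField : ∃ K, LipschitzWith K (modelField (m := m)) := by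
  obtain ⟨K, hK⟩ := ContDiff.lipschitzWith_of_hasCompactSupport
    (hasCompactSupport_modelField_sub (m := m)) (contDiff_modelField.sub contDiff_const) one_ne_zero
  refine ⟨K, LipschitzWith.of_dist_le_mul fun x y => ?_⟩
  simpa using hK.dist_le_mul x y

theorem exists_norm_modelField_le : ∃ L : NNReal, ∀ x, ‖modelField (m := m) x‖ ≤ L := by
  obtain ⟨C, hC⟩ := Continuous.bounded_above_of_compact_support
    ((contDiff_modelField (m := m)).continuous.sub continuous_const)
    (hasCompactSupport_modelField_sub (m := m))
  refine ⟨Real.toNNReal (C + ‖axisPoint m 1‖), fun x => ?_⟩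
  refine le_trans ?_ (Real.le_coe_toNNReal _)
  have := norm_add_le (modelField x - axisPoint m 1) (axisPoint m 1)
  rw [sub_add_cancel] at this
  exact this.trans (by gcongr; exact hC x)

theorem uniformContinuous_fderiv_modelField :
    UniformContinuous (fderiv ℝ (modelField (m := m))) := by
  have h := (hasCompactSupport_modelField_sub (m := m)).fderiv (𝕜 := ℝ)
  have hfd : fderiv ℝ (fun x : Euc (m + 1) => modelField x - axisPoint m 1) =
      fderiv ℝ modelField := by
    funext x; exact fderiv_sub_const _
  rw [hfd] at h
  exact h.uniformContinuous_of_continuous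
    ((contDiff_modelField (m := m)).continuous_fderiv one_ne_zero)

/-! ### The model flow -/

theorem isTrajectory_modelFlow (x : Euc (m + 1)) :
    IsTrajectory modelField x (fun t => modelFlow t x) := by
  obtain ⟨K, hK⟩ := exists_lipschitzWith_modelField (m := m)
  obtain ⟨L, hL⟩ := exists_norm_modelField_le (m := m)
  have h : ∃ c, IsModelTrajectory x c := exists_isTrajectory hK hL x
  have : (fun t => modelFlow t x) = h.choose := by funext t; simp only [modelFlow, dif_pos h]
  rw [this]; exact h.choose_spec

theorem modelFlow_eq {x : Euc (m + 1)} {c : ℝ → Euc (m + 1)} (h : IsTrajectory modelField x c)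
    (t : ℝ) : modelFlow t x = c t := by
  obtain ⟨K, hK⟩ := exists_lipschitzWith_modelField (m := m)
  exact congrFun ((isTrajectory_modelFlow x).unique hK h) t

@[simp] theorem modelFlow_zero (x : Euc (m + 1)) : modelFlow 0 x = x := (isTrajectory_modelFlow x).1

theorem modelFlow_add (s t : ℝ) (x : Euc (m + 1)) :
    modelFlow (s + t) x = modelFlow s (modelFlow t x) := by
  obtain ⟨K, hK⟩ := exists_lipschitzWith_modelField (m := m)
  exact trajectory_add hK isTrajectory_modelFlow x t s

@[simp] theorem modelFlow_neg_modelFlow (t : ℝ) (x : Euc (m + 1)) :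
    modelFlow (-t) (modelFlow t x) = x := by rw [← modelFlow_add]; simp

@[simp] theorem modelFlow_modelFlow_neg (t : ℝ) (x : Euc (m + 1)) :
    modelFlow t (modelFlow (-t) x) = x := by rw [← modelFlow_add]; simp

theorem contDiff_modelFlow (t : ℝ) : ContDiff ℝ 1 (modelFlow (m := m) t) := by
  obtain ⟨K, hK⟩ := exists_lipschitzWith_modelField (m := m)
  exact contDiff_flow hK (contDiff_modelField.differentiable one_ne_zero)
    uniformContinuous_fderiv_modelField isTrajectory_modelFlow t

theorem continuous_modelFlow (t : ℝ) : Continuous (modelFlow (m := m) t) :=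
  (contDiff_modelFlow t).continuous

theorem continuous_modelFlow_time (x : Euc (m + 1)) : Continuous (fun t => modelFlow t x) :=
  (isTrajectory_modelFlow x).continuous

theorem hasDerivAt_modelFlow_zero (x : Euc (m + 1)) (t : ℝ) :
    HasDerivAt (fun t => modelFlow t x 0) (axialSpeed (‖modelFlow t x‖ ^ 2)) t := by
  have := ((EuclideanSpace.proj (𝕜 := ℝ) (0 : Fin (m + 1))).hasFDerivAt).comp_hasDerivAt t
    ((isTrajectory_modelFlow x).2 t)
  exact this

theorem hasDerivAt_modelFlow_succ (x : Euc (m + 1)) (i : Fin m) (t : ℝ) :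
    HasDerivAt (fun t => modelFlow t x i.succ)
      (-(radialRate (‖modelFlow t x‖ ^ 2) * modelFlow t x i.succ)) t := by
  have := ((EuclideanSpace.proj (𝕜 := ℝ) i.succ).hasFDerivAt).comp_hasDerivAt t
    ((isTrajectory_modelFlow x).2 t)
  rw [← modelField_succ]
  exact this

theorem hasDerivAt_axisDistSq_modelFlow (x : Euc (m + 1)) (t : ℝ) :
    HasDerivAt (fun t => axisDistSq (modelFlow t x))
      (-2 * radialRate (‖modelFlow t x‖ ^ 2) * axisDistSq (modelFlow t x)) t := by
  unfold axisDistSq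
  have := HasDerivAt.fun_sum (u := Finset.univ) (fun (i : Fin m) _ =>
    (hasDerivAt_modelFlow_succ x i t).fun_pow 2)
  refine this.congr_deriv ?_
  rw [Finset.mul_sum]
  refine Finset.sum_congr rfl fun i _ => ?_
  simp; ring

theorem antitone_axisDistSq_modelFlow (x : Euc (m + 1)) :
    Antitone (fun t => axisDistSq (modelFlow t x)) := by
  refine antitone_of_deriv_nonpos
    (fun t => (hasDerivAt_axisDistSq_modelFlow x t).differentiableAt) fun t => ?_
  rw [(hasDerivAt_axisDistSq_modelFlow x t).deriv]
  nlinarith [mul_nonneg (radialRate_nonneg (‖modelFlow t x‖ ^ 2))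
    (axisDistSq_nonneg (modelFlow t x))]

/-- The contraction rate never exceeds 1, so the distance to the axis decays at most like `exp
(-t)`. This is what keeps the axis invariant in backward time. -/
theorem monotone_exp_mul_axisDistSq_modelFlow (x : Euc (m + 1)) :
    Monotone (fun t => Real.exp (2 * t) * axisDistSq (modelFlow t x)) := by
  have hd : ∀ t, HasDerivAt (fun t => Real.exp (2 * t) * axisDistSq (modelFlow t x))
      (Real.exp (2 * t) * 2 * axisDistSq (modelFlow t x) + Real.exp (2 * t) *
      (-2 * radialRate (‖modelFlow t x‖ ^ 2) * axisDistSq (modelFlow t x))) t := fun t => by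
    have h1 : HasDerivAt (fun t : ℝ => Real.exp (2 * t)) (Real.exp (2 * t) * 2) t := by
      have := ((hasDerivAt_id t).const_mul (2 : ℝ)).exp
      simpa using this
    exact h1.mul (hasDerivAt_axisDistSq_modelFlow x t)
  refine monotone_of_deriv_nonneg (fun t => (hd t).differentiableAt) fun t => ?_
  rw [(hd t).deriv]
  have h1 := radialRate_le_one (‖modelFlow t x‖ ^ 2)
  have h2 := axisDistSq_nonneg (modelFlow t x)
  have h3 := Real.exp_pos (2 * t)
  have : 0 ≤ Real.exp (2 * t) * (2 * ((1 - radialRate (‖modelFlow t x‖ ^ 2)) *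
    axisDistSq (modelFlow t x))) := by
    have := mul_nonneg (sub_nonneg.2 h1) h2
    positivity
  linarith

theorem axisDistSq_modelFlow_eq_zero {x : Euc (m + 1)} (h : axisDistSq x = 0) (t : ℝ) :
    axisDistSq (modelFlow t x) = 0 := by
  refine le_antisymm ?_ (axisDistSq_nonneg _)
  rcases le_total 0 t with ht | ht
  · have := antitone_axisDistSq_modelFlow x ht
    simpa [h] using this
  · have := monotone_exp_mul_axisDistSq_modelFlow x ht
    simp only [mul_zero, Real.exp_zero, modelFlow_zero, h] at this
    exact nonpos_of_mul_nonpos_right this (Real.exp_pos _)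

theorem axisDistSq_modelFlow_pos {x : Euc (m + 1)} (h : 0 < axisDistSq x) (t : ℝ) :
    0 < axisDistSq (modelFlow t x) := by
  refine lt_of_le_of_ne (axisDistSq_nonneg _) fun h0 => ?_
  have := axisDistSq_modelFlow_eq_zero h0.symm (-t)
  rw [modelFlow_neg_modelFlow] at this
  exact h.ne' this

/-- As long as the straight line stays off the ball of radius 2 it solves the equation; uniqueness
does the rest. -/
theorem modelFlow_eq_add_of_forall_ge {x : Euc (m + 1)} {a b : ℝ} (h0 : (0 : ℝ) ∈ Ioo a b)
    (h : ∀ t ∈ Ioo a b, 4 ≤ ‖x + axisPoint m t‖ ^ 2) {t : ℝ} (ht : t ∈ Ioo a b) :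
    modelFlow t x = x + axisPoint m t := by
  obtain ⟨K, hK⟩ := exists_lipschitzWith_modelField (m := m)
  refine ODE_solution_unique_of_mem_Ioo (v := fun _ => modelField) (s := fun _ => univ) (K := K)
    (t₀ := 0) (fun _ _ => hK.lipschitzOnWith) h0
    (fun t _ => ⟨(isTrajectory_modelFlow x).2 t, trivial⟩) (g := fun t => x + axisPoint m t)
    (fun t ht => ⟨?_, trivial⟩) (by simp [axisPoint]) ht
  rw [modelField_of_ge (h t ht)]
  have := ((hasDerivAt_id t).smul_const (axisPoint m 1)).const_add x
  simp only [id, one_smul, ← axisPoint_eq_smul] at this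
  exact this

theorem modelFlow_of_axisDistSq_ge {x : Euc (m + 1)} (h : 4 ≤ axisDistSq x) (t : ℝ) :
    modelFlow t x = x + axisPoint m t := by
  refine modelFlow_eq_add_of_forall_ge (a := -|t| - 1) (b := |t| + 1)
    ⟨by linarith [abs_nonneg t], by linarith [abs_nonneg t]⟩ (fun s _ => ?_)
    ⟨by linarith [neg_abs_le t], by linarith [le_abs_self t]⟩
  rw [norm_sq_eq, axisDistSq_add_axisPoint]
  nlinarith [sq_nonneg ((x + axisPoint m s) 0)]

/-- During a time of length at most one the line keeps `|x₁| ≥ 2`. This makes the glued map a pure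
homothety near the origin and near infinity. -/
theorem modelFlow_of_abs_gt {x : Euc (m + 1)} (h : 3 < |x 0|) {t : ℝ} (ht : |t| ≤ 1) :
    modelFlow t x = x + axisPoint m t := by
  have ht' := abs_le.1 ht
  have key : ∀ s, 2 ≤ |x 0 + s| → 4 ≤ ‖x + axisPoint m s‖ ^ 2 := fun s hs => by
    rw [norm_sq_eq, axisDistSq_add_axisPoint]
    have h2 : (x + axisPoint m s) 0 = x 0 + s := by simp
    rw [h2, ← sq_abs]
    nlinarith [axisDistSq_nonneg x]
  rcases lt_abs.1 h with h | h
  · refine modelFlow_eq_add_of_forall_ge (a := 2 - x 0) (b := 2) ⟨by linarith, by norm_num⟩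
      (fun s hs => key s (le_abs.2 (Or.inl ?_))) ⟨by linarith, by linarith⟩
    linarith [hs.1]
  · refine modelFlow_eq_add_of_forall_ge (a := -2) (b := -2 - x 0) ⟨by norm_num, by linarith⟩
      (fun s hs => key s (le_abs.2 (Or.inr ?_))) ⟨by linarith, by linarith⟩
    linarith [hs.2]

/-- A point that had left the cylinder would flow back by a translation along the axis, which
preserves the distance to the axis; so it would have been outside from the start. The argument
serves both directions of time. -/
theorem modelFlow_mem_cylinder {x : Euc (m + 1)} (hx : x ∈ cylinder m) (t : ℝ) :
    modelFlow t x ∈ cylinder m := by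
  rw [mem_cylinder] at *
  by_contra h
  rw [not_le] at h
  have := modelFlow_of_axisDistSq_ge h.le (-t)
  rw [modelFlow_neg_modelFlow] at this
  rw [this, axisDistSq_add_axisPoint] at hx
  linarith

theorem hasFDerivAt_modelFlow {T : ℝ} (hT : 0 ≤ T) (x : Euc (m + 1))
    {Y : ℝ → Euc (m + 1) →L[ℝ] Euc (m + 1)} (hY0 : Y 0 = 1)
    (hY : ∀ t, HasDerivAt Y ((fderiv ℝ modelField (modelFlow t x)).comp (Y t)) t) :
    HasFDerivAt (modelFlow T) (Y T) x := by
  obtain ⟨K, hK⟩ := exists_lipschitzWith_modelField (m := m)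
  exact hasFDerivAt_flow hK (contDiff_modelField.differentiable one_ne_zero)
    uniformContinuous_fderiv_modelField isTrajectory_modelFlow hT x hY0
    (fun t _ => (hY t).continuousAt.continuousWithinAt) (fun t _ => (hY t).hasDerivWithinAt)

theorem hasFDerivAt_axialSpeed_norm_sq (x : Euc (m + 1)) :
    HasFDerivAt (fun x : Euc (m + 1) => axialSpeed (‖x‖ ^ 2))
      ((if ‖x‖ ^ 2 ≤ 4 then -(2 / 9) * (‖x‖ ^ 2 - 4) else 0) • (2 • innerSL ℝ x)) x :=
  (hasDerivAt_axialSpeed _).comp_hasFDerivAt x (hasStrictFDerivAt_norm_sq x).hasFDerivAt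

/-- Both profile functions join their constant continuation at `r = 4` with vanishing derivative, so
the statement includes the sphere `|x|² = 4` itself. -/
theorem fderiv_modelField_of_ge {x : Euc (m + 1)} (h : 4 ≤ ‖x‖ ^ 2) :
    fderiv ℝ modelField x = 0 := by
  have hA : HasFDerivAt (fun x : Euc (m + 1) => axialSpeed (‖x‖ ^ 2))
      (0 : Euc (m + 1) →L[ℝ] ℝ) x := by
    refine (hasFDerivAt_axialSpeed_norm_sq x).congr_fderiv ?_
    split_ifs with h4
    · rw [le_antisymm h4 h]; simp
    · simp
  have hR : HasFDerivAt (fun x : Euc (m + 1) => radialRate (‖x‖ ^ 2))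
      (0 : Euc (m + 1) →L[ℝ] ℝ) x := by
    refine ((hasDerivAt_radialRate _).comp_hasFDerivAt x
      (hasStrictFDerivAt_norm_sq x).hasFDerivAt).congr_fderiv ?_
    rw [if_neg (by linarith)]
    split_ifs with h4
    · rw [le_antisymm h4 h, cos_half_pi]; simp
    · simp
  have hX : HasFDerivAt (fun x : Euc (m + 1) => x - x 0 • axisPoint m 1)
      (fderiv ℝ (fun x : Euc (m + 1) => x - x 0 • axisPoint m 1) x) x :=
    DifferentiableAt.hasFDerivAt (by fun_prop)
  have hA' := hA.smul_const (axisPoint m 1)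
  have hR' := HasFDerivAt.fun_smul hR hX
  have := hA'.fun_sub hR'
  rw [radialRate_of_ge h] at this
  rw [show modelField (m := m) = _ from funext modelField_eq]
  refine this.fderiv.trans ?_
  ext y i; simp

/-- The variational equation has zero coefficient along such an orbit; for negative times the
derivative is obtained by inverting the flow. On the boundary of the cylinder this is the
first-order matching that makes the glued map C¹. -/
theorem hasFDerivAt_modelFlow_of_axisDistSq_ge {x : Euc (m + 1)} (h : 4 ≤ axisDistSq x) (t : ℝ) :
    HasFDerivAt (modelFlow t) (1 : Euc (m + 1) →L[ℝ] Euc (m + 1)) x := by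
  have key : ∀ (t : ℝ), 0 ≤ t → ∀ x : Euc (m + 1), 4 ≤ axisDistSq x →
      HasFDerivAt (modelFlow t) (1 : Euc (m + 1) →L[ℝ] Euc (m + 1)) x := by
    intro t ht x h
    refine hasFDerivAt_modelFlow (Y := fun _ => 1) ht x rfl fun s => ?_
    rw [fderiv_modelField_of_ge, ContinuousLinearMap.zero_comp]
    · exact hasDerivAt_const _ _
    · rw [modelFlow_of_axisDistSq_ge h, norm_sq_eq, axisDistSq_add_axisPoint]
      nlinarith [sq_nonneg ((x + axisPoint m s) 0)]
  rcases le_total 0 t with ht | ht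
  · exact key t ht x h
  · have h1 := key (-t) (by linarith) (modelFlow t x)
      (by rw [modelFlow_of_axisDistSq_ge h, axisDistSq_add_axisPoint]; exact h)
    have h2 := ((contDiff_modelFlow (m := m) t).differentiable one_ne_zero x).hasFDerivAt
    have h3 := h1.comp x h2
    have h4 : modelFlow (-t) ∘ modelFlow t = (id : Euc (m + 1) → Euc (m + 1)) := by
      funext y; simp
    rw [h4] at h3
    have h5 := h3.unique (hasFDerivAt_id x)
    have h6 : fderiv ℝ (modelFlow t) x = 1 := by
      rw [← ContinuousLinearMap.one_def] at h5
      simpa [ContinuousLinearMap.one_def] using h5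
    rwa [h6] at h2

end

section

variable {m : ℕ}

/-! ### Eigenvalues of the differentials at the fixed points -/

theorem eigenvalues_eq_of_semiconj {n : ℕ} {A A' : Euc n →L[ℝ] Euc n} (B : Euc n ≃L[ℝ] Euc n)
    (h : ∀ x, B (A x) = A' (B x)) : eigenvalues A = eigenvalues A' := by
  have : (A' : Euc n →ₗ[ℝ] Euc n) = B.toLinearEquiv.conj (A : Euc n →ₗ[ℝ] Euc n) := by
    ext1 x
    simp [LinearEquiv.conj_apply, h]
  unfold eigenvalues
  rw [this, LinearEquiv.charpoly_conj]

/-- The linear map that multiplies the axis by `a` and the orthogonal directions by `b`. -/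
def axialMap (m : ℕ) (a b : ℝ) : Euc (m + 1) →L[ℝ] Euc (m + 1) :=
  a • (EuclideanSpace.proj (𝕜 := ℝ) (0 : Fin (m + 1))).smulRight (axisPoint m 1) +
    b • (ContinuousLinearMap.id ℝ _ -
      (EuclideanSpace.proj (𝕜 := ℝ) (0 : Fin (m + 1))).smulRight (axisPoint m 1))

theorem axialMap_apply (a b : ℝ) (x : Euc (m + 1)) :
    axialMap m a b x = (a * x 0) • axisPoint m 1 + b • (x - x 0 • axisPoint m 1) := by
  simp [axialMap, smul_smul]

@[simp] theorem axialMap_apply_zero (a b : ℝ) (x : Euc (m + 1)) :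
    axialMap m a b x 0 = a * x 0 := by
  simp [axialMap_apply]

@[simp] theorem axialMap_apply_succ (a b : ℝ) (x : Euc (m + 1)) (i : Fin m) :
    axialMap m a b x i.succ = b * x i.succ := by
  simp [axialMap_apply]

theorem axialMap_self (a : ℝ) : axialMap m a a = a • ContinuousLinearMap.id ℝ _ := by
  ext x i; refine Fin.cases ?_ (fun i => ?_) i <;> simp

theorem eigenvalues_axialMap (a b : ℝ) :
    eigenvalues (axialMap m a b) = (a : ℂ) ::ₘ Multiset.replicate m (b : ℂ) := by
  have hmat : LinearMap.toMatrix (EuclideanSpace.basisFun (Fin (m + 1)) ℝ).toBasis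
      (EuclideanSpace.basisFun (Fin (m + 1)) ℝ).toBasis
      (axialMap m a b : Euc (m + 1) →ₗ[ℝ] Euc (m + 1)) =
      Matrix.diagonal (Fin.cons a (fun _ => b) : Fin (m + 1) → ℝ) := by
    ext i j
    rw [LinearMap.toMatrix_apply]
    simp only [OrthonormalBasis.coe_toBasis, EuclideanSpace.basisFun_apply,
      ContinuousLinearMap.coe_coe, OrthonormalBasis.coe_toBasis_repr_apply,
      EuclideanSpace.basisFun_repr]
    rw [Matrix.diagonal_apply]
    refine Fin.cases ?_ (fun i => ?_) i
    · rw [axialMap_apply_zero]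
      by_cases h : (0 : Fin (m + 1)) = j
      · subst h; simp
      · rw [if_neg h]; simp [h]
    · rw [axialMap_apply_succ]
      by_cases h : i.succ = j
      · subst h; simp
      · rw [if_neg h]; simp [h]
  unfold eigenvalues
  rw [← LinearMap.charpoly_toMatrix _ (EuclideanSpace.basisFun (Fin (m + 1)) ℝ).toBasis, hmat,
    Matrix.charpoly_diagonal, Polynomial.map_prod]
  simp only [Polynomial.map_sub, Polynomial.map_X, Polynomial.map_C]
  have := Polynomial.roots_multiset_prod_X_sub_C
    ((Finset.univ : Finset (Fin (m + 1))).val.map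
      (fun i => (algebraMap ℝ ℂ ((Fin.cons a (fun _ => b) : Fin (m + 1) → ℝ) i))))
  rw [Multiset.map_map] at this
  rw [Finset.prod_eq_multiset_prod]
  refine Eq.trans this ?_
  rw [Fin.univ_succ, Finset.cons_val, Multiset.map_cons, Finset.map_val, Multiset.map_map]
  simp only [Fin.cons_zero, Function.comp_def, Function.Embedding.coeFn_mk, Fin.cons_succ,
    Multiset.map_const']
  simp

theorem modelField_axisPoint {s : ℝ} (hs : s ^ 2 = 1) : modelField (axisPoint m s) = 0 := by
  have hn : ‖axisPoint m s‖ ^ 2 = 1 := by rw [norm_sq_eq]; simp [hs]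
  rw [modelField_eq, hn, axialSpeed_one, radialRate_of_le (by norm_num), axisPoint_zero,
    ← axisPoint_eq_smul s]
  simp

theorem modelFlow_axisPoint {s : ℝ} (hs : s ^ 2 = 1) (t : ℝ) :
    modelFlow t (axisPoint m s) = axisPoint m s :=
  modelFlow_eq (c := fun _ => axisPoint m s)
    ⟨rfl, fun t => by rw [modelField_axisPoint hs]; exact hasDerivAt_const _ _⟩ t

/-- Near the equilibria `|x|² < 2`, so the contraction rate is constantly 1. The axial speed has
derivative `2/3` at `r = 1`, and `r` has differential `2 s dx₁`; hence `4/3 * s`. -/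
theorem hasFDerivAt_modelField_axisPoint {s : ℝ} (hs : s ^ 2 = 1) :
    HasFDerivAt modelField (axialMap m (4 / 3 * s) (-1)) (axisPoint m s) := by
  have hn : ‖axisPoint m s‖ ^ 2 = 1 := by rw [norm_sq_eq]; simp [hs]
  have hev : modelField =ᶠ[𝓝 (axisPoint m s)] fun x : Euc (m + 1) =>
      axialSpeed (‖x‖ ^ 2) • axisPoint m 1 - (x - x 0 • axisPoint m 1) := by
    have : ∀ᶠ x : Euc (m + 1) in 𝓝 (axisPoint m s), ‖x‖ ^ 2 < 2 :=
      ((continuous_id.norm.pow 2).tendsto _).eventually_lt_const (by simp [hn])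
    filter_upwards [this] with x hx
    rw [modelField_eq, radialRate_of_le hx.le, one_smul]
  refine HasFDerivAt.congr_of_eventuallyEq ?_ hev
  have h1 := (hasFDerivAt_axialSpeed_norm_sq (axisPoint m s)).smul_const (axisPoint m 1)
  have h2 : HasFDerivAt (fun x : Euc (m + 1) => x - x 0 • axisPoint m 1)
      (ContinuousLinearMap.id ℝ _ -
      (EuclideanSpace.proj (𝕜 := ℝ) (0 : Fin (m + 1))).smulRight (axisPoint m 1))
      (axisPoint m s) :=
    (ContinuousLinearMap.id ℝ _ -
      (EuclideanSpace.proj (𝕜 := ℝ) (0 : Fin (m + 1))).smulRight (axisPoint m 1)).hasFDerivAt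
  refine (h1.fun_sub h2).congr_fderiv ?_
  ext x i
  have hin : inner ℝ (axisPoint m s) x = s * x 0 := by
    simp [axisPoint, EuclideanSpace.inner_single_left]
  refine Fin.cases ?_ (fun i => ?_) i
  · simp [hn, hin, axialMap_apply]; norm_num; ring
  · simp [axialMap_apply]

/-- The differential of the time-one map at the two equilibria. -/
theorem hasFDerivAt_modelFlow_axisPoint {s : ℝ} (hs : s ^ 2 = 1) :
    HasFDerivAt (modelFlow 1) (axialMap m (Real.exp (4 / 3 * s)) (Real.exp (-1)))
      (axisPoint m s) := by
  -- At an equilibrium the variational equation has constant diagonal coefficients, so its solution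
  -- is an explicit exponential.
  have h := hasFDerivAt_modelFlow (T := 1) zero_le_one (axisPoint m s)
    (Y := fun t => axialMap m (Real.exp (4 / 3 * s * t)) (Real.exp (-1 * t))) ?_ ?_
  · simpa using h
  · rw [mul_zero, mul_zero, Real.exp_zero, axialMap_self, one_smul]; rfl
  · intro t
    rw [modelFlow_axisPoint hs, (hasFDerivAt_modelField_axisPoint hs).fderiv]
    have he : ∀ c : ℝ, HasDerivAt (fun t : ℝ => Real.exp (c * t)) (c * Real.exp (c * t)) t := by
      intro c
      have := ((hasDerivAt_id t).const_mul c).exp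
      simpa [mul_comm] using this
    have := ((he (4 / 3 * s)).smul_const
      ((EuclideanSpace.proj (𝕜 := ℝ) (0 : Fin (m + 1))).smulRight (axisPoint m 1))).fun_add
      ((he (-1)).smul_const (ContinuousLinearMap.id ℝ _ -
      (EuclideanSpace.proj (𝕜 := ℝ) (0 : Fin (m + 1))).smulRight (axisPoint m 1)))
    refine this.congr_deriv ?_
    ext x i
    refine Fin.cases ?_ (fun i => ?_) i
    · simp; ring
    · simp

/-! ### Wandering points of the model flow -/

/-- Take a level `c` strictly between `L (g x)` and `L x`, and let `U` consist of the points above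
`c` whose image is below `c`. Since `L` does not increase, an orbit from `U` stays below `c` after
one step. -/
theorem exists_wandering_of_lyapunov {X : Type*} [TopologicalSpace X] {g : X → X} {V : Set X}
    {L : X → ℝ} {x : X} (hV : IsOpen V) (hgV : MapsTo g V V) (hx : x ∈ V) (hL : ContinuousOn L V)
    (hg : Continuous g) (hle : ∀ y ∈ V, L (g y) ≤ L y) (hlt : L (g x) < L x) :
    ∃ U, IsOpen U ∧ x ∈ U ∧ ∀ y ∈ U, ∀ k : ℕ, 0 < k → g^[k] y ∉ U := by
  obtain ⟨c, hc1, hc2⟩ := exists_between hlt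
  refine ⟨(V ∩ L ⁻¹' Ioi c) ∩ (V ∩ (L ∘ g) ⁻¹' Iio c), ?_, ⟨⟨hx, hc2⟩, ⟨hx, hc1⟩⟩, ?_⟩
  · exact (hL.isOpen_inter_preimage hV isOpen_Ioi).inter
      ((hL.comp hg.continuousOn hgV).isOpen_inter_preimage hV isOpen_Iio)
  · rintro y ⟨⟨hyV, -⟩, ⟨-, hy⟩⟩ k hk ⟨⟨-, h1⟩, -⟩
    obtain ⟨k, rfl⟩ := Nat.exists_eq_succ_of_ne_zero hk.ne'
    have hiter : ∀ j : ℕ, g^[j + 1] y ∈ V ∧ L (g^[j + 1] y) < c := by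
      intro j
      induction j with
      | zero => exact ⟨hgV hyV, hy⟩
      | succ j ih =>
        rw [Function.iterate_succ_apply']
        exact ⟨hgV ih.1, (hle _ ih.1).trans_lt ih.2⟩
    exact absurd (mem_Ioi.1 h1) (not_lt.2 (hiter k).2.le)

/-- This sum is minus the derivative of `-x₁ + (log u) / 2` along the flow. Where the axial speed
may be negative the rate is 1, and the speed is at least `1 - 16/9`. -/
theorem axialSpeed_add_radialRate_pos {r : ℝ} (h : 0 ≤ r) :
    0 < axialSpeed r + radialRate r := by
  rcases le_or_gt r 2 with h2 | h2
  · rw [radialRate_of_le h2, axialSpeed_of_le (by linarith)]; nlinarith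
  · linarith [axialSpeed_pos (show 1 < r by linarith), radialRate_nonneg r]

/-- The Lyapunov function is `-x₁ + (log u) / 2`, strictly decreasing everywhere off the axis. -/
theorem exists_wandering_of_axisDistSq_pos {y : Euc (m + 1)} (hy : 0 < axisDistSq y) :
    ∃ U, IsOpen U ∧ y ∈ U ∧ ∀ z ∈ U, ∀ k : ℕ, 0 < k → (modelFlow 1)^[k] z ∉ U := by
  have hanti : ∀ z : Euc (m + 1), 0 < axisDistSq z →
      StrictAnti (fun t => -modelFlow t z 0 + 1 / 2 * Real.log (axisDistSq (modelFlow t z))) := by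
    intro z hz
    refine strictAnti_of_deriv_neg fun t => ?_
    have hp := axisDistSq_modelFlow_pos hz t
    have := ((hasDerivAt_modelFlow_zero z t).fun_neg).fun_add
      (((hasDerivAt_axisDistSq_modelFlow z t).log hp.ne').const_mul (1 / 2))
    rw [this.deriv, mul_div_assoc, div_self hp.ne']
    linarith [axialSpeed_add_radialRate_pos (sq_nonneg ‖modelFlow t z‖)]
  have hlt : ∀ z : Euc (m + 1), 0 < axisDistSq z → -modelFlow 1 z 0 +
      1 / 2 * Real.log (axisDistSq (modelFlow 1 z)) < -z 0 + 1 / 2 * Real.log (axisDistSq z) := by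
    intro z hz
    simpa using hanti z hz zero_lt_one
  refine exists_wandering_of_lyapunov (V := {z | 0 < axisDistSq z})
    (L := fun z => -z 0 + 1 / 2 * Real.log (axisDistSq z))
    (isOpen_lt continuous_const continuous_axisDistSq)
    (fun z hz => axisDistSq_modelFlow_pos hz 1) hy ?_ (continuous_modelFlow 1)
    (fun z hz => (hlt z hz).le) (hlt y hy)
  refine ContinuousOn.add (by fun_prop) (continuousOn_const.mul ?_)
  exact continuous_axisDistSq.continuousOn.log fun z hz => ne_of_gt hz

/-- Here `a = x₁²`, and the expression is minus the derivative of `-G(x₁) + u` along the flow. For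
`a ≥ 1` both speeds are nonnegative. For `a < 1` the rate is 1, and replacing `a + u` by `a` in the
second speed costs at most `2 u`, which the second term pays. -/
theorem axialSpeed_mul_bound {a u : ℝ} (hu : 0 ≤ u) (hu1 : u ≤ 1) (ha : 0 ≤ a) :
    0 ≤ axialSpeed a * axialSpeed (a + u) + 2 * radialRate (a + u) * u := by
  rcases le_or_gt 1 a with h1 | h1
  · have hs : ∀ r, 1 ≤ r → 0 ≤ axialSpeed r := fun r hr => by
      rcases eq_or_lt_of_le hr with rfl | hr
      · exact axialSpeed_one.ge
      · exact (axialSpeed_pos hr).le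
    have := mul_nonneg (hs a h1) (hs (a + u) (by linarith))
    have := mul_nonneg (radialRate_nonneg (a + u)) hu
    linarith
  · rw [radialRate_of_le (by linarith), axialSpeed_of_le (by linarith),
      axialSpeed_of_le (by linarith)]
    have key : (1 - 1 / 9 * (a - 4) ^ 2) * (1 - 1 / 9 * (a + u - 4) ^ 2) =
        (1 - 1 / 9 * (a - 4) ^ 2) ^ 2 +
        u * ((1 - 1 / 9 * (a - 4) ^ 2) * (1 / 9 * (8 - 2 * a - u))) := by ring
    rw [key]
    have h2 : -(7 / 9) ≤ 1 - 1 / 9 * (a - 4) ^ 2 := by nlinarith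
    have h3 : 0 ≤ 1 / 9 * (8 - 2 * a - u) := by linarith
    have h4 : 1 / 9 * (8 - 2 * a - u) ≤ 1 := by linarith
    have h5 : -2 ≤ (1 - 1 / 9 * (a - 4) ^ 2) * (1 / 9 * (8 - 2 * a - u)) := by nlinarith
    nlinarith [sq_nonneg (1 - 1 / 9 * (a - 4) ^ 2)]

theorem modelFlow_axisPoint_eq (t s : ℝ) :
    modelFlow t (axisPoint m s) = axisPoint m (modelFlow t (axisPoint m s) 0) :=
  eq_axisPoint_of_axisDistSq_eq_zero (axisDistSq_modelFlow_eq_zero (by simp) t)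

theorem modelFlow_axisPoint_sq_ne {s : ℝ} (hs : s ^ 2 ≠ 1) (t : ℝ) :
    modelFlow t (axisPoint m s) 0 ^ 2 ≠ 1 := fun h => by
  have h1 := modelFlow_axisPoint (m := m) h (-t)
  rw [← modelFlow_axisPoint_eq, modelFlow_neg_modelFlow] at h1
  have h2 := congrArg (fun x : Euc (m + 1) => x 0) h1
  simp only [axisPoint_zero] at h2
  rw [← h2] at h
  exact hs h

/-- On the axis the logarithm is not available. With `G' (x₁)` the axial speed at distance zero,
`-G(x₁) + u` is nonincreasing for `u < 1`, and along the axis its derivative is minus the square of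
the speed, hence negative away from the equilibria. -/
theorem exists_wandering_of_axisPoint {s : ℝ} (hs : s ^ 2 ≠ 1) :
    ∃ U, IsOpen U ∧ axisPoint m s ∈ U ∧
      ∀ z ∈ U, ∀ k : ℕ, 0 < k → (modelFlow 1)^[k] z ∉ U := by
  set G : ℝ → ℝ := fun a => ∫ τ in (0 : ℝ)..a, axialSpeed (τ ^ 2) with hG
  have hGd : ∀ a, HasDerivAt G (axialSpeed (a ^ 2)) a := fun a => by
    have hc : Continuous (fun τ : ℝ => axialSpeed (τ ^ 2)) :=
      contDiff_axialSpeed.continuous.comp (continuous_pow 2)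
    exact intervalIntegral.integral_hasDerivAt_right (hc.intervalIntegrable _ _)
      (hc.stronglyMeasurableAtFilter _ _) hc.continuousAt
  have hd : ∀ (z : Euc (m + 1)) (t : ℝ), HasDerivAt
      (fun t => -G (modelFlow t z 0) + axisDistSq (modelFlow t z))
      (-(axialSpeed ((modelFlow t z 0) ^ 2) * axialSpeed (‖modelFlow t z‖ ^ 2)) +
        -2 * radialRate (‖modelFlow t z‖ ^ 2) * axisDistSq (modelFlow t z)) t := fun z t =>
    (((hGd _).comp t (hasDerivAt_modelFlow_zero z t)).fun_neg).fun_add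
      (hasDerivAt_axisDistSq_modelFlow z t)
  have hinv : ∀ z : Euc (m + 1), axisDistSq z < 1 → ∀ t, 0 ≤ t →
      axisDistSq (modelFlow t z) < 1 := fun z hz t ht => by
    have := antitone_axisDistSq_modelFlow z ht
    simp only [modelFlow_zero] at this
    exact this.trans_lt hz
  refine exists_wandering_of_lyapunov (V := {z | axisDistSq z < 1})
    (L := fun z => -G (z 0) + axisDistSq z)
    (isOpen_lt continuous_axisDistSq continuous_const)
    (fun z hz => hinv z hz 1 zero_le_one) (by simp) ?_ (continuous_modelFlow 1)
    (fun z hz => ?_) ?_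
  · have hGc : Continuous G := continuous_iff_continuousAt.2 fun a => (hGd a).continuousAt
    have := continuous_axisDistSq (m := m)
    exact (((hGc.comp (by fun_prop)).neg).add this).continuousOn
  · have hanti : AntitoneOn (fun t => -G (modelFlow t z 0) + axisDistSq (modelFlow t z))
        (Ici 0) := by
      refine antitoneOn_of_deriv_nonpos (convex_Ici 0)
        (fun t _ => (hd z t).continuousAt.continuousWithinAt)
        (fun t _ => (hd z t).differentiableAt.differentiableWithinAt) fun t ht => ?_
      rw [interior_Ici] at ht
      rw [(hd z t).deriv, norm_sq_eq]
      linarith [axialSpeed_mul_bound (axisDistSq_nonneg (modelFlow t z))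
        (hinv z hz t (le_of_lt ht)).le (sq_nonneg (modelFlow t z 0))]
    simpa using hanti (mem_Ici.2 le_rfl) (mem_Ici.2 zero_le_one) zero_le_one
  · have hanti : StrictAnti (fun t => -G (modelFlow t (axisPoint m s) 0) +
        axisDistSq (modelFlow t (axisPoint m s))) := by
      refine strictAnti_of_deriv_neg fun t => ?_
      rw [(hd _ t).deriv, norm_sq_eq, axisDistSq_modelFlow_eq_zero (by simp)]
      have hne : axialSpeed (modelFlow t (axisPoint m s) 0 ^ 2) ≠ 0 := fun h =>
        modelFlow_axisPoint_sq_ne hs t (axialSpeed_eq_zero_iff.1 h)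
      simp only [add_zero, mul_zero]
      linarith [mul_self_pos.2 hne]
    simpa using hanti zero_lt_one

theorem exists_wandering {y : Euc (m + 1)} (h1 : y ≠ axisPoint m 1) (h2 : y ≠ axisPoint m (-1)) :
    ∃ U, IsOpen U ∧ y ∈ U ∧ ∀ z ∈ U, ∀ k : ℕ, 0 < k → (modelFlow 1)^[k] z ∉ U := by
  rcases (axisDistSq_nonneg y).eq_or_lt with h | h
  · have hy := eq_axisPoint_of_axisDistSq_eq_zero h.symm
    rw [hy]
    refine exists_wandering_of_axisPoint fun hs => ?_
    rcases mul_self_eq_one_iff.1 ((sq _).symm.trans hs) with h | h <;> rw [h] at hy <;> contradiction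
  · exact exists_wandering_of_axisDistSq_pos h

theorem modelFlow_nat (k : ℕ) (x : Euc (m + 1)) : (modelFlow 1)^[k] x = modelFlow k x := by
  induction k with
  | zero => simp
  | succ k ih => rw [Function.iterate_succ_apply', ih, ← modelFlow_add]; push_cast; ring_nf

/-! ### The flow on the axis -/

/-- A fixed point of the time-one map cannot be wandering. -/
theorem sq_eq_one_of_modelFlow_axisPoint {s : ℝ}
    (h : modelFlow 1 (axisPoint m s) = axisPoint m s) : s ^ 2 = 1 := by
  by_contra hs
  obtain ⟨U, -, hU, hw⟩ := exists_wandering_of_axisPoint (m := m) hs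
  exact hw _ hU 1 one_pos (by simpa [h] using hU)

/-- The orbit never meets the equilibria, which are the only possible boundary points of `I`; so the
set of times spent in `I` is clopen. -/
theorem modelFlow_axisPoint_mem {s : ℝ} {I : Set ℝ} (hI : I = Iio (-1) ∨ I = Ioo (-1) 1 ∨ I = Ioi 1)
    (hs : s ∈ I) (t : ℝ) : modelFlow t (axisPoint m s) 0 ∈ I := by
  have hs1 : s ^ 2 ≠ 1 := by
    intro h
    rcases mul_self_eq_one_iff.1 ((sq _).symm.trans h) with rfl | rfl <;>
      rcases hI with rfl | rfl | rfl <;> simp at hs <;> linarith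
  have hne : ∀ t, modelFlow t (axisPoint m s) 0 ≠ 1 ∧ modelFlow t (axisPoint m s) 0 ≠ -1 :=
    fun t => ⟨fun h => modelFlow_axisPoint_sq_ne hs1 t (by rw [h]; norm_num),
      fun h => modelFlow_axisPoint_sq_ne hs1 t (by rw [h]; norm_num)⟩
  have hcont : Continuous (fun t => modelFlow t (axisPoint m s) 0) :=
    continuous_iff_continuousAt.2 fun t => (hasDerivAt_modelFlow_zero _ t).continuousAt
  have hopen : IsOpen I := by
    rcases hI with rfl | rfl | rfl
    exacts [isOpen_Iio, isOpen_Ioo, isOpen_Ioi]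
  have hcl : ∀ x, x ∈ closure I → x ≠ 1 → x ≠ -1 → x ∈ I := by
    intro x hx h1 h2
    rcases hI with rfl | rfl | rfl
    · rw [closure_Iio] at hx; exact lt_of_le_of_ne hx h2
    · rw [closure_Ioo (by norm_num)] at hx
      exact ⟨lt_of_le_of_ne hx.1 (Ne.symm h2), lt_of_le_of_ne hx.2 h1⟩
    · rw [closure_Ioi] at hx; exact lt_of_le_of_ne hx (Ne.symm h1)
  have hclopen : IsClopen ((fun t => modelFlow t (axisPoint m s) 0) ⁻¹' I) := by
    refine ⟨?_, hopen.preimage hcont⟩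
    have : (fun t => modelFlow t (axisPoint m s) 0) ⁻¹' I =
        (fun t => modelFlow t (axisPoint m s) 0) ⁻¹' closure I := by
      ext t; exact ⟨fun h => subset_closure h, fun h => hcl _ h (hne t).1 (hne t).2⟩
    rw [this]
    exact isClosed_closure.preimage hcont
  have := hclopen.eq_univ ⟨0, by simpa using hs⟩
  exact this.ge (mem_univ t)

theorem antitone_modelFlow_axisPoint {s : ℝ} (hs : s ∈ Ioo (-1 : ℝ) 1) :
    Antitone (fun t => modelFlow t (axisPoint m s) 0) := by
  refine antitone_of_deriv_nonpos
    (fun t => (hasDerivAt_modelFlow_zero _ t).differentiableAt) fun t => ?_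
  have h := modelFlow_axisPoint_mem (m := m) (Or.inr (Or.inl rfl)) hs t
  rw [(hasDerivAt_modelFlow_zero _ t).deriv, norm_sq_eq, axisDistSq_modelFlow_eq_zero (by simp)]
  exact (axialSpeed_neg (by nlinarith [h.1, h.2])).le

theorem monotone_modelFlow_axisPoint {s : ℝ} (hs : 1 < s) :
    Monotone (fun t => modelFlow t (axisPoint m s) 0) := by
  refine monotone_of_deriv_nonneg
    (fun t => (hasDerivAt_modelFlow_zero _ t).differentiableAt) fun t => ?_
  have h : 1 < modelFlow t (axisPoint m s) 0 :=
    modelFlow_axisPoint_mem (m := m) (Or.inr (Or.inr rfl)) hs t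
  rw [(hasDerivAt_modelFlow_zero _ t).deriv, norm_sq_eq, axisDistSq_modelFlow_eq_zero (by simp)]
  exact (axialSpeed_pos (by nlinarith)).le

/-- A limit of iterates is fixed by the map that is iterated; `e = -1` iterates the inverse, whose
fixed points are the same. -/
theorem sq_eq_one_of_tendsto {s l e : ℝ} (he : e = 1 ∨ e = -1)
    (h : Tendsto (fun k : ℕ => modelFlow (e * k) (axisPoint m s) 0) atTop (𝓝 l)) : l ^ 2 = 1 := by
  apply sq_eq_one_of_modelFlow_axisPoint (m := m)
  have h1 : Tendsto (fun k : ℕ => modelFlow (e * k) (axisPoint m s)) atTop (𝓝 (axisPoint m l)) := by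
    have := (continuous_axisPoint (m := m)).continuousAt.tendsto.comp h
    refine this.congr fun k => ?_
    simp [← modelFlow_axisPoint_eq]
  have h2 : Tendsto (fun k : ℕ => modelFlow e (modelFlow (e * k) (axisPoint m s))) atTop
      (𝓝 (modelFlow e (axisPoint m l))) :=
    ((continuous_modelFlow (m := m) e).tendsto _).comp h1
  have h3 : Tendsto (fun k : ℕ => modelFlow e (modelFlow (e * k) (axisPoint m s))) atTop
      (𝓝 (axisPoint m l)) := by
    refine (h1.comp (tendsto_add_atTop_nat 1)).congr fun k => ?_
    simp only [Function.comp_apply]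
    rw [← modelFlow_add]; push_cast; ring_nf
  have h4 := tendsto_nhds_unique h2 h3
  rcases he with rfl | rfl
  · exact h4
  · nth_rewrite 1 [← h4]
    simp

/-- The axial coordinate decreases and is bounded, so it converges to an equilibrium; the limit 1 is
excluded because the orbit starts below it. -/
theorem tendsto_modelFlow_axisPoint {s : ℝ} (hs : s ∈ Ioo (-1 : ℝ) 1) :
    Tendsto (fun k : ℕ => modelFlow k (axisPoint m s) 0) atTop (𝓝 (-1)) := by
  have hmem := fun t => modelFlow_axisPoint_mem (m := m) (Or.inr (Or.inl rfl)) hs t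
  have hanti : Antitone (fun k : ℕ => modelFlow k (axisPoint m s) 0) := fun i j hij =>
    antitone_modelFlow_axisPoint hs (Nat.cast_le.2 hij)
  have hbdd : BddBelow (range (fun k : ℕ => modelFlow k (axisPoint m s) 0)) :=
    ⟨-1, by rintro _ ⟨k, rfl⟩; exact (hmem k).1.le⟩
  have hlim := tendsto_atTop_ciInf hanti hbdd
  have hsq := sq_eq_one_of_tendsto (m := m) (s := s) (e := 1) (Or.inl rfl) (by simpa using hlim)
  rcases mul_self_eq_one_iff.1 ((sq _).symm.trans hsq) with h | h
  · have : (⨅ k : ℕ, modelFlow k (axisPoint m s) 0) ≤ modelFlow (0 : ℕ) (axisPoint m s) 0 :=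
      ciInf_le hbdd 0
    rw [h] at this
    simp at this
    linarith [hs.2]
  · rwa [h] at hlim

theorem tendsto_modelFlow_neg_axisPoint {s : ℝ} (hs : -1 < s) :
    Tendsto (fun k : ℕ => modelFlow (-k) (axisPoint m s) 0) atTop (𝓝 1) := by
  rcases lt_trichotomy s 1 with h1 | rfl | h1
  · have hmem := fun t => modelFlow_axisPoint_mem (m := m) (Or.inr (Or.inl rfl)) ⟨hs, h1⟩ t
    have hmono : Monotone (fun k : ℕ => modelFlow (-k) (axisPoint m s) 0) := fun i j hij =>
      antitone_modelFlow_axisPoint ⟨hs, h1⟩ (neg_le_neg (Nat.cast_le.2 hij))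
    have hbdd : BddAbove (range (fun k : ℕ => modelFlow (-k) (axisPoint m s) 0)) :=
      ⟨1, by rintro _ ⟨k, rfl⟩; exact (hmem _).2.le⟩
    have hlim := tendsto_atTop_ciSup hmono hbdd
    have hsq := sq_eq_one_of_tendsto (m := m) (s := s) (e := -1) (Or.inr rfl) (by simpa using hlim)
    rcases mul_self_eq_one_iff.1 ((sq _).symm.trans hsq) with h | h
    · rwa [h] at hlim
    · have := le_ciSup hbdd 0
      rw [h] at this
      simp at this
      linarith
  · simp [modelFlow_axisPoint]
  · have hmem := fun t => modelFlow_axisPoint_mem (m := m) (Or.inr (Or.inr rfl)) h1 t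
    have hanti : Antitone (fun k : ℕ => modelFlow (-k) (axisPoint m s) 0) := fun i j hij =>
      monotone_modelFlow_axisPoint h1 (neg_le_neg (Nat.cast_le.2 hij))
    have hbdd : BddBelow (range (fun k : ℕ => modelFlow (-k) (axisPoint m s) 0)) :=
      ⟨1, by rintro _ ⟨k, rfl⟩; exact (hmem _).le⟩
    have hlim := tendsto_atTop_ciInf hanti hbdd
    have hsq := sq_eq_one_of_tendsto (m := m) (s := s) (e := -1) (Or.inr rfl) (by simpa using hlim)
    rcases mul_self_eq_one_iff.1 ((sq _).symm.trans hsq) with h | h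
    · rwa [h] at hlim
    · have : (1 : ℝ) ≤ ⨅ k : ℕ, modelFlow (-k) (axisPoint m s) 0 := le_ciInf fun k => (hmem _).le
      rw [h] at this
      norm_num at this

theorem modelFlow_axisPoint_le {s : ℝ} (hs : s ≤ -1) (t : ℝ) :
    modelFlow t (axisPoint m s) 0 ≤ -1 := by
  rcases eq_or_lt_of_le hs with rfl | h
  · rw [modelFlow_axisPoint (by norm_num)]; simp
  · exact (modelFlow_axisPoint_mem (m := m) (Or.inl rfl) h t).le

end

section

variable {m : ℕ}

/-! ### Curves in the stable manifold of the saddle -/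

theorem modelFlow_reflect (R : Euc (m + 1) ≃ₗᵢ[ℝ] Euc (m + 1)) (hR0 : ∀ x, R x 0 = x 0)
    (hRe : R (axisPoint m 1) = axisPoint m 1) (t : ℝ) (x : Euc (m + 1)) :
    modelFlow t (R x) = R (modelFlow t x) := by
  refine modelFlow_eq (c := fun t => R (modelFlow t x)) ⟨by simp, fun t => ?_⟩ t
  have h := (R.toContinuousLinearEquiv.hasFDerivAt).comp_hasDerivAt t
    ((isTrajectory_modelFlow x).2 t)
  refine h.congr_deriv ?_
  simp [modelField_eq, hR0, hRe]

/-- A function whose derivative is negative at each of its zeros cannot cross zero upwards. -/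
theorem le_of_barrier {f f' : ℝ → ℝ} {a : ℝ} (hf : ∀ t, HasDerivAt f (f' t) t) (ha : f a ≤ 0)
    (h : ∀ t, a ≤ t → f t = 0 → f' t < 0) {t : ℝ} (ht : a ≤ t) : f t ≤ 0 :=
  image_le_of_deriv_right_lt_deriv_boundary (f := f) (f' := f') (a := a) (b := t)
    (B := fun _ => 0) (B' := fun _ => 0)
    (fun x _ => (hf x).continuousAt.continuousWithinAt) (fun x _ => (hf x).hasDerivWithinAt) ha
    (fun _ => hasDerivAt_const _ _) (fun x hx => h x hx.1) ⟨ht, le_rfl⟩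

/-- There is an orbit that starts at distance one from the axis and stays in the wedge
`1 - u / 2 ≤ x₁ ≤ 1`, where `u` is the squared distance to the axis. -/
theorem exists_orbit_in_wedge {w : Euc (m + 1)} (hw : axisDistSq w = 1) (hw0 : w 0 = 0) :
    ∃ a : ℝ, ∀ t, 0 ≤ t →
      1 - axisDistSq (modelFlow t (w + axisPoint m a)) / 2 ≤ modelFlow t (w + axisPoint m a) 0 ∧
      modelFlow t (w + axisPoint m a) 0 ≤ 1 := by
  set x : ℝ → Euc (m + 1) := fun a => w + axisPoint m a with hx
  have hu0 : ∀ a, axisDistSq (x a) = 1 := fun a => by rw [hx, axisDistSq_add_axisPoint, hw]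
  have hupos : ∀ a t, 0 < axisDistSq (modelFlow t (x a)) := fun a t =>
    axisDistSq_modelFlow_pos (by rw [hu0]; norm_num) t
  have hule : ∀ a t, 0 ≤ t → axisDistSq (modelFlow t (x a)) ≤ 1 := fun a t ht => by
    have := antitone_axisDistSq_modelFlow (x a) ht
    simpa [hu0] using this
  -- The face `x₁ = 1` cannot be recrossed downwards: there `|x|² = 1 + u > 1`, so the axial speed
  -- is positive.
  have htop : ∀ a t₁, 0 ≤ t₁ → 1 < modelFlow t₁ (x a) 0 → ∀ t, t₁ ≤ t →
      1 ≤ modelFlow t (x a) 0 := by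
    intro a t₁ ht₁ h1 t ht
    have := le_of_barrier (f := fun t => 1 - modelFlow t (x a) 0) (a := t₁)
      (fun t => (hasDerivAt_modelFlow_zero (x a) t).const_sub 1) (by linarith) (fun s hs h0 => by
        have h2 : modelFlow s (x a) 0 = 1 := by linarith
        have := axialSpeed_pos (r := ‖modelFlow s (x a)‖ ^ 2)
          (by rw [norm_sq_eq, h2]; linarith [hupos a s])
        linarith) ht
    linarith
  -- Nor can the lower face be recrossed upwards: there `|x|² = 1 + u² / 4`, and `x₁ - 1 + u / 2`
  -- has derivative `u (u / 6 - 1) - u⁴ / 144`, negative for `0 < u ≤ 1`.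
  have hbot : ∀ a t₁, 0 ≤ t₁ → modelFlow t₁ (x a) 0 < 1 - axisDistSq (modelFlow t₁ (x a)) / 2 →
      ∀ t, t₁ ≤ t → modelFlow t (x a) 0 ≤ 1 - axisDistSq (modelFlow t (x a)) / 2 := by
    intro a t₁ ht₁ h1 t ht
    have := le_of_barrier
      (f := fun t => modelFlow t (x a) 0 - 1 + axisDistSq (modelFlow t (x a)) / 2) (a := t₁)
      (fun t => ((hasDerivAt_modelFlow_zero (x a) t).sub_const 1).fun_add
        ((hasDerivAt_axisDistSq_modelFlow (x a) t).div_const 2)) (by linarith) (fun s hs h0 => by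
        have hp := hupos a s
        have hl := hule a s (ht₁.trans hs)
        have h2 : modelFlow s (x a) 0 = 1 - axisDistSq (modelFlow s (x a)) / 2 := by linarith
        rw [norm_sq_eq, h2]
        set u := axisDistSq (modelFlow s (x a)) with hu
        have hr : (1 - u / 2) ^ 2 + u = 1 + u ^ 2 / 4 := by ring
        rw [hr, radialRate_of_le (by nlinarith), axialSpeed_of_le (by nlinarith)]
        have : 1 - 1 / 9 * (1 + u ^ 2 / 4 - 4) ^ 2 + -2 * 1 * u / 2 =
          u * (u / 6 - 1) - u ^ 4 / 144 := by ring
        rw [this]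
        nlinarith [pow_pos hp 4]) ht
    linarith
  by_contra hcon
  push Not at hcon
  -- Shooting: the parameters whose orbit leaves through the top and those whose orbit leaves
  -- through the bottom form disjoint nonempty open sets. They cannot cover the line.
  set T : Set ℝ := ⋃ t ∈ Ici (0 : ℝ), {a | 1 < modelFlow t (x a) 0} with hT
  set B : Set ℝ := ⋃ t ∈ Ici (0 : ℝ),
    {a | modelFlow t (x a) 0 < 1 - axisDistSq (modelFlow t (x a)) / 2} with hB
  have hxc : Continuous x := continuous_const.add continuous_axisPoint
  have hfc : ∀ t, Continuous fun a => modelFlow t (x a) := fun t =>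
    (continuous_modelFlow t).comp hxc
  have hTo : IsOpen T := isOpen_biUnion fun t _ => isOpen_lt continuous_const
    ((by fun_prop : Continuous fun y : Euc (m + 1) => y 0).comp (hfc t))
  have hBo : IsOpen B := isOpen_biUnion fun t _ => isOpen_lt
    ((by fun_prop : Continuous fun y : Euc (m + 1) => y 0).comp (hfc t))
    (continuous_const.sub ((continuous_axisDistSq.comp (hfc t)).div_const 2))
  have hdisj : Disjoint T B := by
    rw [Set.disjoint_left]
    intro a ha hb
    simp only [hT, hB, mem_iUnion, mem_ofPred_eq, mem_Ici, exists_prop] at ha hb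
    obtain ⟨t₁, h1, h1'⟩ := ha
    obtain ⟨t₂, h2, h2'⟩ := hb
    have h3 := htop a t₁ h1 h1' _ (le_max_left t₁ t₂)
    have h4 := hbot a t₂ h2 h2' _ (le_max_right t₁ t₂)
    linarith [hupos a (max t₁ t₂)]
  have hcov : (univ : Set ℝ) ⊆ T ∪ B := by
    intro a _
    obtain ⟨t, ht, h⟩ := hcon a
    by_cases hb : 1 - axisDistSq (modelFlow t (x a)) / 2 ≤ modelFlow t (x a) 0
    · left; simp only [hT, mem_iUnion, mem_ofPred_eq, mem_Ici, exists_prop]; exact ⟨t, ht, h hb⟩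
    · right; simp only [hB, mem_iUnion, mem_ofPred_eq, mem_Ici, exists_prop]
      exact ⟨t, ht, not_le.1 hb⟩
  have h2T : (2 : ℝ) ∈ T := by
    simp only [hT, mem_iUnion, mem_ofPred_eq, mem_Ici, exists_prop]
    exact ⟨0, le_rfl, by simp [hx, hw0]⟩
  have h0B : (0 : ℝ) ∈ B := by
    simp only [hB, mem_iUnion, mem_ofPred_eq, mem_Ici, exists_prop]
    refine ⟨0, le_rfl, ?_⟩
    rw [modelFlow_zero, hu0]
    simp [hx, hw0]; norm_num
  rcases isPreconnected_univ.subset_or_subset hTo hBo hdisj hcov with h | h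
  · exact Set.disjoint_left.1 hdisj (h (mem_univ 0)) h0B
  · exact Set.disjoint_left.1 hdisj h2T (h (mem_univ 2))

theorem modelFlow_succ_of_radialRate {x : Euc (m + 1)} (i : Fin m)
    (h : ∀ t, 0 ≤ t → radialRate (‖modelFlow t x‖ ^ 2) = 1) {t : ℝ} (ht : 0 ≤ t) :
    modelFlow t x i.succ = Real.exp (-t) * x i.succ := by
  have hd : ∀ s, HasDerivAt (fun s => Real.exp s * modelFlow s x i.succ)
      (Real.exp s * modelFlow s x i.succ + Real.exp s *
        -(radialRate (‖modelFlow s x‖ ^ 2) * modelFlow s x i.succ)) s := fun s =>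
    (Real.hasDerivAt_exp s).mul (hasDerivAt_modelFlow_succ x i s)
  have := constant_of_has_deriv_right_zero (f := fun s => Real.exp s * modelFlow s x i.succ)
    (a := 0) (b := t) (fun s _ => (hd s).continuousAt.continuousWithinAt) (fun s hs => by
      refine (hd s).hasDerivWithinAt.congr_deriv ?_
      rw [h s hs.1]; ring) t ⟨ht, le_rfl⟩
  simp only [Real.exp_zero, modelFlow_zero, one_mul] at this
  rw [← this, ← mul_assoc, ← Real.exp_add]
  simp

/-- Through the saddle of the model flow there is, in each direction orthogonal to the axis, a `C¹`
curve inside the stable manifold. -/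
theorem exists_stable_curve (i : Fin m) :
    ∃ c : ℝ → Euc (m + 1), ContDiff ℝ 1 c ∧ c 0 = axisPoint m 1 ∧
      HasDerivAt c ((2 : ℝ)⁻¹ • EuclideanSpace.single i.succ (1 : ℝ)) 0 ∧
      ∀ t, axisDistSq (c t) < 4 ∧
        Tendsto (fun k : ℕ => modelFlow k (c t)) atTop (𝓝 (axisPoint m 1)) := by
  set w : Euc (m + 1) := EuclideanSpace.single i.succ (1 : ℝ) with hw
  have hw0 : w 0 = 0 := by simp [hw, (Fin.succ_ne_zero i).symm]
  have hwi : w i.succ = 1 := by simp [hw]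
  have hwj : ∀ j : Fin m, j ≠ i → w j.succ = 0 := fun j hj => by simp [hw, hj]
  have hwu : axisDistSq w = 1 := by
    unfold axisDistSq
    rw [Finset.sum_eq_single i (fun j _ hj => by simp [hwj j hj]) (by simp), hwi, one_pow]
  obtain ⟨a, ha⟩ := exists_orbit_in_wedge hwu hw0
  set x : Euc (m + 1) := w + axisPoint m a with hx
  have hxu : axisDistSq x = 1 := by rw [hx, axisDistSq_add_axisPoint, hwu]
  have hule : ∀ t, 0 ≤ t → axisDistSq (modelFlow t x) ≤ 1 := fun t ht => by
    have := antitone_axisDistSq_modelFlow x ht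
    simpa [hxu] using this
  have hrad : ∀ t, 0 ≤ t → radialRate (‖modelFlow t x‖ ^ 2) = 1 := fun t ht => by
    apply radialRate_of_le
    rw [norm_sq_eq]
    nlinarith [ha t ht, hule t ht, axisDistSq_nonneg (modelFlow t x)]
  have hflow : ∀ t, 0 ≤ t → modelFlow t x = axisPoint m (modelFlow t x 0) + Real.exp (-t) • w := by
    intro t ht
    ext j
    refine Fin.cases ?_ (fun j => ?_) j
    · simp [hw0]
    · rw [modelFlow_succ_of_radialRate j hrad ht, hx]; simp
  have hu : ∀ t, 0 ≤ t → axisDistSq (modelFlow t x) = Real.exp (-t) ^ 2 := by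
    intro t ht
    rw [hflow t ht, add_comm, axisDistSq_add_axisPoint]
    have : axisDistSq (Real.exp (-t) • w) = Real.exp (-t) ^ 2 * axisDistSq w := by
      simp [axisDistSq, mul_pow, Finset.mul_sum]
    rw [this, hwu, mul_one]
  set f : ℝ → ℝ := fun t => modelFlow t x 0 with hf
  -- The stable curve as a graph: `F s` is the height of the trapped orbit at the moment when its
  -- distance to the axis is `|s|`. As `Real.log s = Real.log |s|`, one formula covers both signs of
  -- `s`; the conventions `Real.log 0 = 0` and `0⁻¹ = 0` give `F' 0 = 0`.
  set F : ℝ → ℝ := fun s => if s = 0 then 1 else f (-Real.log s) with hF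
  set F' : ℝ → ℝ := fun s => -(axialSpeed (‖modelFlow (-Real.log s) x‖ ^ 2)) * s⁻¹ with hF'
  have hlog : ∀ s : ℝ, s ∈ Ioo (-1 : ℝ) 1 → 0 ≤ -Real.log s := fun s hs => by
    rw [← Real.log_abs, neg_nonneg]
    exact Real.log_nonpos (abs_nonneg s) (abs_le.2 ⟨hs.1.le, hs.2.le⟩)
  have hexp : ∀ s : ℝ, s ≠ 0 → Real.exp (-(-Real.log s)) = |s| := fun s hs => by
    rw [neg_neg, ← Real.log_abs, Real.exp_log (abs_pos.2 hs)]
  -- The wedge has quadratic width in `s`, so the curve is tangent to the radial direction at the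
  -- saddle.
  have hFb : ∀ s ∈ Ioo (-1 : ℝ) 1, |F s - 1| ≤ s ^ 2 / 2 := by
    intro s hs
    by_cases h0 : s = 0
    · simp [hF, h0]
    · have h1 := ha _ (hlog s hs)
      rw [hu _ (hlog s hs), hexp s h0, sq_abs] at h1
      simp only [hF, if_neg h0]
      rw [abs_le]; constructor <;> linarith [h1.1, h1.2]
  -- In the wedge `|x|²` differs from 1 by at most `s²`, so the axial speed is at most `2 s²`;
  -- dividing by `|s|` gives a bound that tends to zero, which makes `F'` continuous at 0.
  have hF'b : ∀ s ∈ Ioo (-1 : ℝ) 1, |F' s| ≤ 2 * |s| := by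
    intro s hs
    by_cases h0 : s = 0
    · simp [hF', h0]
    · have h1 := ha _ (hlog s hs)
      have h2 := hu _ (hlog s hs)
      rw [hexp s h0, sq_abs] at h2
      rw [h2] at h1
      have hs2 : s ^ 2 ≤ 1 := by nlinarith [hs.1, hs.2]
      have hs0 : 0 ≤ s ^ 2 := sq_nonneg s
      have hr1 : |‖modelFlow (-Real.log s) x‖ ^ 2 - 1| ≤ s ^ 2 := by
        rw [norm_sq_eq, h2, abs_le]; constructor <;> nlinarith [h1.1, h1.2]
      have hr2 := abs_le.1 hr1
      have hA : |axialSpeed (‖modelFlow (-Real.log s) x‖ ^ 2)| ≤ 2 * s ^ 2 := by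
        rw [axialSpeed_of_le (by linarith)]
        rw [abs_le]; constructor <;> nlinarith
      simp only [hF', abs_mul, abs_neg, abs_inv]
      rw [← div_eq_mul_inv, div_le_iff₀ (abs_pos.2 h0)]
      calc _ ≤ 2 * s ^ 2 := hA
        _ = 2 * |s| * |s| := by rw [mul_assoc, abs_mul_abs_self]; ring
  have hFd : ∀ s ∈ Ioo (-1 : ℝ) 1, HasDerivAt F (F' s) s := by
    intro s hs
    by_cases h0 : s = 0
    · subst h0
      have hF'0 : F' 0 = 0 := by simp [hF']
      rw [hF'0, hasDerivAt_iff_isLittleO_nhds_zero, Asymptotics.isLittleO_iff]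
      intro c hc
      have h1 : Ioo (-1 : ℝ) 1 ∈ 𝓝 (0 : ℝ) := Ioo_mem_nhds (by norm_num) (by norm_num)
      have h2 : Ioo (-c) c ∈ 𝓝 (0 : ℝ) := Ioo_mem_nhds (by linarith) hc
      filter_upwards [h1, h2] with s hs hsc
      have hb := hFb s hs
      have hF0 : F 0 = 1 := if_pos rfl
      simp only [zero_add, smul_zero, sub_zero, hF0, Real.norm_eq_abs]
      have : |s| ≤ c := abs_le.2 ⟨hsc.1.le, hsc.2.le⟩
      have h3 : s ^ 2 = |s| * |s| := by rw [abs_mul_abs_self, sq]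
      nlinarith [abs_nonneg s]
    · have h1 : HasDerivAt (fun s => f (-Real.log s)) (F' s) s := by
        have := (hasDerivAt_modelFlow_zero x (-Real.log s)).comp s (Real.hasDerivAt_log h0).neg
        refine this.congr_deriv ?_
        simp only [hF']; ring
      refine h1.congr_of_eventuallyEq ?_
      filter_upwards [isOpen_ne.mem_nhds h0] with y hy
      exact if_neg hy
  have hF'c : ContinuousOn F' (Ioo (-1) 1) := by
    intro s hs
    by_cases h0 : s = 0
    · subst h0
      refine ContinuousAt.continuousWithinAt ?_
      have hF'0 : F' 0 = 0 := by simp [hF']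
      rw [ContinuousAt, hF'0]
      refine squeeze_zero_norm' (a := fun s => 2 * |s|) ?_ ?_
      · filter_upwards [Ioo_mem_nhds (show (-1 : ℝ) < 0 by norm_num) (show (0 : ℝ) < 1 by norm_num)]
          with s hs using hF'b s hs
      · have : Continuous fun s : ℝ => 2 * |s| := by fun_prop
        simpa using this.tendsto 0
    · refine ContinuousAt.continuousWithinAt ?_
      have h1 : ContinuousAt (fun s => -Real.log s) s := (Real.continuousAt_log h0).neg
      have h2 : ContinuousAt (fun s => modelFlow (-Real.log s) x) s :=
        ContinuousAt.comp (f := fun s => -Real.log s) (g := fun t => modelFlow t x)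
          (continuous_modelFlow_time x).continuousAt h1
      have h3 : ContinuousAt (fun s => axialSpeed (‖modelFlow (-Real.log s) x‖ ^ 2)) s :=
        ContinuousAt.comp (g := axialSpeed) contDiff_axialSpeed.continuous.continuousAt (h2.norm.pow 2)
      exact h3.neg.mul (continuousAt_inv₀ h0)
  -- Tangent vectors are defined by curves on the whole line; `sin t / 2` stays in the domain of the
  -- graph. Its speed at 0 explains the factor `2⁻¹` in the statement.
  set q : ℝ → ℝ := fun t => Real.sin t / 2 with hq
  have hqm : ∀ t, q t ∈ Ioo (-1 : ℝ) 1 := fun t => by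
    constructor <;> simp only [hq] <;> linarith [Real.sin_le_one t, Real.neg_one_le_sin t]
  have hqd : ∀ t, HasDerivAt q (Real.cos t / 2) t := fun t => (Real.hasDerivAt_sin t).div_const 2
  have hq0 : q 0 = 0 := by simp [hq]
  have hcd : ∀ t, HasDerivAt (fun t => axisPoint m (F (q t)) + q t • w)
      ((F' (q t) * (Real.cos t / 2)) • axisPoint m 1 + (Real.cos t / 2) • w) t := by
    intro t
    have h1 := ((hFd _ (hqm t)).comp t (hqd t)).smul_const (axisPoint m 1)
    have h2 := (hqd t).smul_const w
    have h3 := h1.fun_add h2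
    simp only [Function.comp_apply, ← axisPoint_eq_smul] at h3
    simpa only [← axisPoint_eq_smul] using h3
  refine ⟨fun t => axisPoint m (F (q t)) + q t • w, ?_, ?_, ?_, fun t => ⟨?_, ?_⟩⟩
  · refine contDiff_one_iff_deriv.2 ⟨fun t => (hcd t).differentiableAt, ?_⟩
    rw [show deriv (fun t => axisPoint m (F (q t)) + q t • w) = _ from
      funext fun t => (hcd t).deriv]
    have hqc : Continuous q := by simp only [hq]; fun_prop
    have h1 : Continuous fun t => F' (q t) :=
      hF'c.comp_continuous hqc hqm
    have h2 : Continuous fun t => Real.cos t / 2 := by fun_prop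
    exact ((h1.mul h2).smul continuous_const).add (h2.smul continuous_const)
  · simp [hq0, hF]
  · refine (hcd 0).congr_deriv ?_
    rw [hq0, show F' 0 = 0 by simp [hF']]
    simp
  · simp only
    rw [add_comm (axisPoint m _), axisDistSq_add_axisPoint]
    have : axisDistSq (q t • w) = q t ^ 2 * axisDistSq w := by
      simp [axisDistSq, mul_pow, Finset.mul_sum]
    rw [this, hwu]
    nlinarith [(hqm t).1, (hqm t).2]
  · -- the orbit of `c t` is `c` itself, up to a reflection
    have hlim : Tendsto (fun t : ℝ => modelFlow t x) atTop (𝓝 (axisPoint m 1)) := by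
      have he : Tendsto (fun t : ℝ => Real.exp (-t)) atTop (𝓝 0) := Real.tendsto_exp_neg_atTop_nhds_zero
      have h0 : Tendsto f atTop (𝓝 1) := by
        have hl : Tendsto (fun t : ℝ => 1 - Real.exp (-t) ^ 2 / 2) atTop (𝓝 1) := by
          simpa using ((he.pow 2).div_const 2).const_sub 1
        refine tendsto_of_tendsto_of_tendsto_of_le_of_le' hl tendsto_const_nhds ?_ ?_
        · filter_upwards [eventually_ge_atTop 0] with t ht
          rw [← hu t ht]; exact (ha t ht).1
        · filter_upwards [eventually_ge_atTop 0] with t ht using (ha t ht).2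
      have h1 : Tendsto (fun t => axisPoint m (f t) + Real.exp (-t) • w) atTop
          (𝓝 (axisPoint m 1 + (0 : ℝ) • w)) :=
        ((continuous_axisPoint.tendsto _).comp h0).add (he.smul_const w)
      rw [zero_smul, add_zero] at h1
      refine h1.congr' ?_
      filter_upwards [eventually_ge_atTop 0] with t ht using (hflow t ht).symm
    have hlimk : ∀ s : ℝ, Tendsto (fun k : ℕ => modelFlow (k + s) x) atTop (𝓝 (axisPoint m 1)) :=
      fun s => hlim.comp (tendsto_atTop_add_const_right _ _ tendsto_natCast_atTop_atTop)
    simp only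
    rcases lt_trichotomy (q t) 0 with h | h | h
    -- Negative parameters lie on the mirror image of the orbit; the reflection commutes with the
    -- flow.
    · set R : Euc (m + 1) ≃ₗᵢ[ℝ] Euc (m + 1) := (ℝ ∙ w)ᗮ.reflection with hRd
      have hwn : ‖w‖ ^ 2 = 1 := by rw [norm_sq_eq, hwu, hw0]; norm_num
      have hR : ∀ y, R y = y - (2 * y i.succ) • w := fun y => by
        rw [hRd, Submodule.reflection_orthogonal_apply, Submodule.reflection_singleton_apply]
        simp only [RCLike.ofReal_real_eq_id, id, hwn, div_one]
        rw [hw, EuclideanSpace.inner_single_left]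
        simp [two_mul, add_smul, two_smul]
      have hRw : R w = -w := by rw [hR, hwi, mul_one, two_smul]; abel
      have hRa : ∀ s, R (axisPoint m s) = axisPoint m s := fun s => by rw [hR]; simp
      have hR0 : ∀ y, R y 0 = y 0 := fun y => by rw [hR]; simp [hw0]
      have heq : axisPoint m (F (q t)) + q t • w = R (modelFlow (-Real.log (q t)) x) := by
        rw [hflow _ (hlog _ (hqm t)), hexp _ h.ne, map_add, hRa, map_smul, hRw, abs_of_neg h]
        simp [hF, h.ne, hf]
      rw [heq]
      have := (R.continuous.tendsto _).comp (hlimk (-Real.log (q t)))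
      rw [hRa] at this
      refine this.congr fun k => ?_
      rw [Function.comp_apply, modelFlow_reflect R hR0 (hRa 1), modelFlow_add]
    · rw [h]
      simp [hF, modelFlow_axisPoint]
    · have heq : axisPoint m (F (q t)) + q t • w = modelFlow (-Real.log (q t)) x := by
        rw [hflow _ (hlog _ (hqm t)), hexp _ h.ne', abs_of_pos h]
        simp [hF, h.ne', hf]
      rw [heq]
      refine (hlimk (-Real.log (q t))).congr fun k => ?_
      rw [modelFlow_add]

end

/-! ### Gluing the model flow to the homothety in Euclidean space. -/

section

variable {m : ℕ}

/-! ### The glued map of `ℝⁿ` and its inverse -/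

/-- The coordinates orthogonal to the axis of the cylinder. -/
def axisTail (m : ℕ) : Euc (m + 1) →L[ℝ] Euc m :=
  LinearMap.toContinuousLinearMap
    { toFun := fun x => WithLp.toLp 2 fun i : Fin m => x i.succ
      map_add' := fun x y => by ext i; simp
      map_smul' := fun c x => by ext i; simp }

@[simp] theorem axisTail_apply (x : Euc (m + 1)) (i : Fin m) : axisTail m x i = x i.succ := rfl

theorem norm_axisTail_sq (x : Euc (m + 1)) : ‖axisTail m x‖ ^ 2 = axisDistSq x := by
  rw [EuclideanSpace.norm_sq_eq]; simp [axisDistSq]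

theorem cylinder_eq_preimage : cylinder m = axisTail m ⁻¹' Metric.closedBall 0 2 := by
  ext x
  rw [mem_cylinder, mem_preimage, mem_closedBall_zero_iff, ← norm_axisTail_sq]
  constructor <;> intro h <;> nlinarith [norm_nonneg (axisTail m x)]

theorem cylinder_mem_nhds {x : Euc (m + 1)} (hx : axisDistSq x < 4) : cylinder m ∈ 𝓝 x :=
  mem_of_superset ((isOpen_lt continuous_axisDistSq continuous_const).mem_nhds hx)
    fun _ hy => mem_cylinder.2 (le_of_lt hy)

theorem convex_cylinder : Convex ℝ (cylinder m) := by
  rw [cylinder_eq_preimage]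
  exact (convex_closedBall _ _).linear_preimage (axisTail m).toLinearMap

theorem uniqueDiffOn_cylinder : UniqueDiffOn ℝ (cylinder m) :=
  uniqueDiffOn_convex convex_cylinder
    ⟨axisPoint m 0, mem_interior_iff_mem_nhds.2 (cylinder_mem_nhds (by simp))⟩

/-- A conjugator defined on a set that is closed in the punctured space. -/
structure IsPixtonConjugator (A : Set (Euc (m + 1)))
    (ζ : PartialEquiv (Euc (m + 1)) (Euc (m + 1))) : Prop extends IsConjugator A ζ where
  zero_notMem : (0 : Euc (m + 1)) ∉ A
  isClosed : IsClosed (insert 0 A)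

open Classical in
/-- The map that is `ζ⁻¹ φˢ ζ` on the domain of `ζ` and the homothety of ratio `lam` elsewhere. -/
def gluedMap (ζ : PartialEquiv (Euc (m + 1)) (Euc (m + 1))) (s lam : ℝ) (x : Euc (m + 1)) :
    Euc (m + 1) :=
  if x ∈ ζ.source then ζ.symm (modelFlow s (ζ x)) else lam • x

/-- The two pairs (time, ratio) for which the glued map is continuous. -/
def IsGluePair (s lam : ℝ) : Prop := (s = 1 ∧ lam = 2⁻¹) ∨ (s = -1 ∧ lam = 2)

theorem IsGluePair.inv {s lam : ℝ} (h : IsGluePair s lam) : IsGluePair (-s) lam⁻¹ := by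
  rcases h with ⟨rfl, rfl⟩ | ⟨rfl, rfl⟩
  · exact Or.inr ⟨rfl, by norm_num⟩
  · exact Or.inl ⟨by norm_num, rfl⟩

theorem IsGluePair.pos {s lam : ℝ} (h : IsGluePair s lam) : 0 < lam := by
  rcases h with ⟨rfl, rfl⟩ | ⟨rfl, rfl⟩ <;> norm_num

theorem IsGluePair.abs_le {s lam : ℝ} (h : IsGluePair s lam) : |s| ≤ 1 := by
  rcases h with ⟨rfl, rfl⟩ | ⟨rfl, rfl⟩ <;> norm_num

theorem isGluePair_one : IsGluePair 1 2⁻¹ := Or.inl ⟨rfl, rfl⟩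

theorem isGluePair_neg_one : IsGluePair (-1) 2 := Or.inr ⟨rfl, rfl⟩

section

variable {A : Set (Euc (m + 1))} {ζ : PartialEquiv (Euc (m + 1)) (Euc (m + 1))} {s lam : ℝ}

theorem IsConjugator.two_smul_mem (h : IsConjugator A ζ) {x : Euc (m + 1)} (hx : x ∈ A) :
    (2 : ℝ) • x ∈ A := by
  rw [h.invariant]; simpa [homothety, smul_smul] using hx

theorem IsConjugator.glue (h : IsConjugator A ζ) (hs : IsGluePair s lam) {x : Euc (m + 1)}
    (hx : x ∈ A) : lam • x ∈ A ∧ ζ (lam • x) = ζ x + axisPoint m s := by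
  rcases hs with ⟨rfl, rfl⟩ | ⟨rfl, rfl⟩
  · exact ⟨(h.invariant x).1 hx, h.conj x hx⟩
  · have h2 := h.two_smul_mem hx
    refine ⟨h2, ?_⟩
    have := h.conj _ h2
    simp only [homothety, smul_smul] at this
    norm_num at this
    rw [this, add_assoc, ← axisPoint_add]
    simp [axisPoint]

theorem IsConjugator.glue_mem_iff (h : IsConjugator A ζ) (hs : IsGluePair s lam)
    {x : Euc (m + 1)} : lam • x ∈ A ↔ x ∈ A := by
  refine ⟨fun hx => ?_, fun hx => (h.glue hs hx).1⟩
  have := (h.glue hs.inv hx).1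
  rwa [smul_smul, inv_mul_cancel₀ hs.pos.ne', one_smul] at this

theorem IsConjugator.mapsTo (h : IsConjugator A ζ) : MapsTo ζ A (cylinder m) := fun x hx => by
  rw [← h.target_eq]; exact ζ.map_source (by rwa [h.source_eq])

theorem IsConjugator.symm_mem (h : IsConjugator A ζ) {y : Euc (m + 1)} (hy : y ∈ cylinder m) :
    ζ.symm y ∈ A := by
  rw [← h.source_eq]; exact ζ.map_target (by rwa [h.target_eq])

theorem IsConjugator.left_inv (h : IsConjugator A ζ) {x : Euc (m + 1)} (hx : x ∈ A) :
    ζ.symm (ζ x) = x := ζ.left_inv (by rwa [h.source_eq])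

theorem IsConjugator.right_inv (h : IsConjugator A ζ) {y : Euc (m + 1)} (hy : y ∈ cylinder m) :
    ζ (ζ.symm y) = y := ζ.right_inv (by rwa [h.target_eq])

theorem IsConjugator.hasFDerivWithinAt_symm (h : IsConjugator A ζ) {y : Euc (m + 1)}
    (hy : y ∈ cylinder m) :
    HasFDerivWithinAt ζ.symm (fderivWithin ℝ ζ.symm (cylinder m) y) (cylinder m) y :=
  ((h.smooth_symm.differentiableOn (by simp)) y hy).hasFDerivWithinAt

theorem IsConjugator.hasFDerivWithinAt (h : IsConjugator A ζ) {x : Euc (m + 1)} (hx : x ∈ A) :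
    HasFDerivWithinAt ζ (fderivWithin ℝ ζ A x) A x :=
  ((h.smooth.differentiableOn (by simp)) x hx).hasFDerivWithinAt

theorem IsConjugator.fderivWithin_comp_fderivWithin_symm (h : IsConjugator A ζ)
    {y : Euc (m + 1)} (hy : y ∈ cylinder m) :
    (fderivWithin ℝ ζ A (ζ.symm y)).comp (fderivWithin ℝ ζ.symm (cylinder m) y) =
      ContinuousLinearMap.id ℝ _ := by
  have h1 := (h.hasFDerivWithinAt (h.symm_mem hy)).comp y (h.hasFDerivWithinAt_symm hy)
    (fun z hz => h.symm_mem hz)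
  have h2 : HasFDerivWithinAt (ζ ∘ ζ.symm) (ContinuousLinearMap.id ℝ (Euc (m + 1)))
      (cylinder m) y :=
    (hasFDerivWithinAt_id y _).congr (fun z hz => h.right_inv hz) (h.right_inv hy)
  exact (uniqueDiffOn_cylinder y hy).eq h1 h2

/-- The derivative of `ζ⁻¹` on the cylinder is invertible. -/
theorem IsConjugator.exists_equiv_symm (h : IsConjugator A ζ) {y : Euc (m + 1)}
    (hy : y ∈ cylinder m) : ∃ e : Euc (m + 1) ≃L[ℝ] Euc (m + 1),
      (e : Euc (m + 1) →L[ℝ] Euc (m + 1)) = fderivWithin ℝ ζ.symm (cylinder m) y := by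
  have hcomp := h.fderivWithin_comp_fderivWithin_symm hy
  have hinj : Function.Injective (fderivWithin ℝ ζ.symm (cylinder m) y) := by
    refine Function.LeftInverse.injective (g := fderivWithin ℝ ζ A (ζ.symm y)) fun v => ?_
    exact congrArg (fun L : Euc (m + 1) →L[ℝ] Euc (m + 1) => L v) hcomp
  let L : Euc (m + 1) →ₗ[ℝ] Euc (m + 1) := fderivWithin ℝ ζ.symm (cylinder m) y
  have hbij : Function.Bijective L :=
    ⟨hinj, LinearMap.surjective_of_injective (f := L) hinj⟩
  refine ⟨(LinearEquiv.ofBijective _ hbij).toContinuousLinearEquiv, ?_⟩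
  ext1 v; rfl

/-- Unique differentiability passes from the convex cylinder to its image under a map with
invertible derivative. Without it the derivatives of `ζ` within `A`, used at the boundary, would not
be determined. -/
theorem IsConjugator.uniqueDiffOn (h : IsConjugator A ζ) : UniqueDiffOn ℝ A := by
  intro x hx
  obtain ⟨e, he⟩ := h.exists_equiv_symm (h.mapsTo hx)
  have h1 := (h.hasFDerivWithinAt_symm (h.mapsTo hx)).uniqueDiffWithinAt
    (uniqueDiffOn_cylinder _ (h.mapsTo hx)) (by rw [← he]; exact e.surjective.denseRange)
  rw [h.left_inv hx] at h1
  refine h1.mono ?_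
  rintro _ ⟨y, hy, rfl⟩
  exact h.symm_mem hy

theorem IsConjugator.hasStrictFDerivAt_symm (h : IsConjugator A ζ) {y : Euc (m + 1)}
    (hy : axisDistSq y < 4) : ∃ e : Euc (m + 1) ≃L[ℝ] Euc (m + 1),
      HasStrictFDerivAt ζ.symm (e : Euc (m + 1) →L[ℝ] Euc (m + 1)) y := by
  obtain ⟨e, he⟩ := h.exists_equiv_symm (mem_cylinder.2 hy.le)
  have hc : ContDiffAt ℝ ∞ ζ.symm y := h.smooth_symm.contDiffAt (cylinder_mem_nhds hy)
  refine ⟨e, ?_⟩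
  rw [he, fderivWithin_of_mem_nhds (cylinder_mem_nhds hy)]
  exact hc.hasStrictFDerivAt (by simp)

/-- By the inverse function theorem `ζ⁻¹` is open at interior points of the cylinder, so boundary
points of `A` can only come from the boundary of the cylinder. -/
theorem IsConjugator.mem_nhds (h : IsConjugator A ζ) {x : Euc (m + 1)} (hx : x ∈ A)
    (hlt : axisDistSq (ζ x) < 4) : A ∈ 𝓝 x := by
  obtain ⟨e, he⟩ := h.hasStrictFDerivAt_symm hlt
  have := he.map_nhds_eq_of_equiv
  rw [h.left_inv hx] at this
  rw [← this]
  exact mem_map.2 (mem_of_superset (cylinder_mem_nhds hlt) fun z hz => h.symm_mem hz)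

theorem IsConjugator.continuousOn (h : IsConjugator A ζ) : ContinuousOn ζ A := h.smooth.continuousOn

theorem gluedMap_of_mem (h : IsConjugator A ζ) {x : Euc (m + 1)} (hx : x ∈ A) :
    gluedMap ζ s lam x = ζ.symm (modelFlow s (ζ x)) := by
  unfold gluedMap; rw [if_pos (by rwa [h.source_eq])]

theorem gluedMap_of_notMem (h : IsConjugator A ζ) {x : Euc (m + 1)} (hx : x ∉ A) :
    gluedMap ζ s lam x = lam • x := by
  unfold gluedMap; rw [if_neg (by rwa [h.source_eq])]

/-- Wherever the flow acts as the translation, the conjugacy turns it back into the homothety; so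
the two branches of the glued map agree there. -/
theorem gluedMap_of_translate (h : IsConjugator A ζ) (hs : IsGluePair s lam) {x : Euc (m + 1)}
    (hx : x ∈ A) (ht : modelFlow s (ζ x) = ζ x + axisPoint m s) : gluedMap ζ s lam x = lam • x := by
  have := h.glue hs hx
  rw [gluedMap_of_mem h hx, ht, ← this.2, h.left_inv this.1]

open Classical in
/-- The derivative of the glued map. -/
def gluedDeriv (A : Set (Euc (m + 1))) (ζ : PartialEquiv (Euc (m + 1)) (Euc (m + 1)))
    (s lam : ℝ) (x : Euc (m + 1)) : Euc (m + 1) →L[ℝ] Euc (m + 1) :=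
  if x ∈ A then (fderivWithin ℝ ζ.symm (cylinder m) (modelFlow s (ζ x))).comp
    ((fderiv ℝ (modelFlow s) (ζ x)).comp (fderivWithin ℝ ζ A x))
  else lam • ContinuousLinearMap.id ℝ _

theorem hasFDerivWithinAt_gluedMap (h : IsConjugator A ζ) {x : Euc (m + 1)} (hx : x ∈ A) :
    HasFDerivWithinAt (gluedMap ζ s lam) (gluedDeriv A ζ s lam x) A x := by
  rw [gluedDeriv, if_pos hx]
  have h1 := ((contDiff_modelFlow (m := m) s).differentiable one_ne_zero (ζ x)).hasFDerivAt
  have h2 := h1.comp_hasFDerivWithinAt x (h.hasFDerivWithinAt hx)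
  have h3 := (h.hasFDerivWithinAt_symm (modelFlow_mem_cylinder (h.mapsTo hx) s)).comp x h2
    (fun y hy => modelFlow_mem_cylinder (h.mapsTo hy) s)
  exact h3.congr (fun y hy => gluedMap_of_mem h hy) (gluedMap_of_mem h hx)

/-- On the boundary the flow has the value and the derivative of the translation. The map `ζ⁻¹ (ζ +
s)` equals the homothety on all of `A`, and derivatives within `A` are unique. -/
theorem gluedDeriv_of_boundary (h : IsConjugator A ζ) (hs : IsGluePair s lam) {x : Euc (m + 1)}
    (hx : x ∈ A) (hge : 4 ≤ axisDistSq (ζ x)) :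
    gluedDeriv A ζ s lam x = lam • ContinuousLinearMap.id ℝ _ := by
  rw [gluedDeriv, if_pos hx, (hasFDerivAt_modelFlow_of_axisDistSq_ge hge s).fderiv,
    modelFlow_of_axisDistSq_ge hge]
  have hmem : ∀ y ∈ A, ζ y + axisPoint m s ∈ cylinder m := fun y hy => by
    rw [← (h.glue hs hy).2]; exact h.mapsTo (h.glue hs hy).1
  have h2 := (h.hasFDerivWithinAt hx).add_const (axisPoint m s)
  have h3 := (h.hasFDerivWithinAt_symm (hmem x hx)).comp x h2 hmem
  have h4 : HasFDerivWithinAt (ζ.symm ∘ fun y => ζ y + axisPoint m s)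
      (lam • ContinuousLinearMap.id ℝ (Euc (m + 1))) A x := by
    refine ((hasFDerivWithinAt_id x A).fun_const_smul lam).congr (fun y hy => ?_) ?_
    · rw [Function.comp_apply, ← (h.glue hs hy).2, h.left_inv (h.glue hs hy).1]; rfl
    · rw [Function.comp_apply, ← (h.glue hs hx).2, h.left_inv (h.glue hs hx).1]; rfl
  exact (h.uniqueDiffOn x hx).eq h3 h4

theorem IsPixtonConjugator.compl_mem_nhds (h : IsPixtonConjugator A ζ) {x : Euc (m + 1)}
    (hx0 : x ≠ 0) (hx : x ∉ A) : Aᶜ ∈ 𝓝 x := by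
  have : (insert 0 A)ᶜ ∈ 𝓝 x := h.isClosed.isOpen_compl.mem_nhds (by simp [hx0, hx])
  exact mem_of_superset this (compl_subset_compl.2 (subset_insert _ _))

/-- Three cases: interior points of `A`; boundary points, where the derivatives within `A` and
within its complement coincide; and points outside `A`, which have a neighbourhood outside `A`
because `A` is closed off the origin. -/
theorem hasFDerivAt_gluedMap (h : IsPixtonConjugator A ζ) (hs : IsGluePair s lam)
    {x : Euc (m + 1)} (hx0 : x ≠ 0) :
    HasFDerivAt (gluedMap ζ s lam) (gluedDeriv A ζ s lam x) x := by
  have hlin : ∀ y, HasFDerivAt (fun y : Euc (m + 1) => lam • y)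
      (lam • ContinuousLinearMap.id ℝ (Euc (m + 1))) y := fun y =>
    (hasFDerivAt_id y).fun_const_smul lam
  by_cases hx : x ∈ A
  · have h1 := hasFDerivWithinAt_gluedMap (s := s) (lam := lam) h.toIsConjugator hx
    rcases lt_or_ge (axisDistSq (ζ x)) 4 with hlt | hge
    · exact h1.hasFDerivAt (h.mem_nhds hx hlt)
    · rw [← hasFDerivWithinAt_univ, ← union_compl_self A]
      refine h1.union ?_
      rw [gluedDeriv_of_boundary h.toIsConjugator hs hx hge]
      exact (hlin x).hasFDerivWithinAt.congr
        (fun y hy => gluedMap_of_notMem h.toIsConjugator hy)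
        (gluedMap_of_translate h.toIsConjugator hs hx (modelFlow_of_axisDistSq_ge hge s))
  · rw [gluedDeriv, if_neg hx]
    refine (hlin x).congr_of_eventuallyEq ?_
    filter_upwards [h.compl_mem_nhds hx0 hx] with y hy
    exact gluedMap_of_notMem h.toIsConjugator hy

theorem continuousOn_gluedDeriv (h : IsPixtonConjugator A ζ) (hs : IsGluePair s lam) :
    ContinuousOn (gluedDeriv A ζ s lam) {0}ᶜ := by
  have hA : ContinuousOn (gluedDeriv A ζ s lam) A := by
    have h1 : ContinuousOn (fderivWithin ℝ ζ A) A :=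
      h.smooth.continuousOn_fderivWithin h.uniqueDiffOn (by simp)
    have h2 : ContinuousOn (fderivWithin ℝ ζ.symm (cylinder m)) (cylinder m) :=
      h.smooth_symm.continuousOn_fderivWithin uniqueDiffOn_cylinder (by simp)
    have h3 : Continuous (fderiv ℝ (modelFlow (m := m) s)) :=
      (contDiff_modelFlow s).continuous_fderiv one_ne_zero
    have h4 : ContinuousOn (fun x => modelFlow s (ζ x)) A :=
      (continuous_modelFlow s).comp_continuousOn h.continuousOn
    have h5 := (h2.comp h4 fun x hx => modelFlow_mem_cylinder (h.mapsTo hx) s).clm_comp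
      ((h3.comp_continuousOn h.continuousOn).clm_comp h1)
    exact h5.congr fun x hx => by rw [gluedDeriv, if_pos hx]; rfl
  intro x hx0
  refine ContinuousAt.continuousWithinAt ?_
  by_cases hx : x ∈ A
  · rcases lt_or_ge (axisDistSq (ζ x)) 4 with hlt | hge
    · exact hA.continuousAt (h.mem_nhds hx hlt)
    · rw [← continuousWithinAt_univ, ← union_compl_self A]
      refine (hA x hx).union ?_
      refine (continuousWithinAt_const (b := lam • ContinuousLinearMap.id ℝ (Euc (m + 1)))).congr
        (fun y hy => ?_) (gluedDeriv_of_boundary h.toIsConjugator hs hx hge)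
      exact if_neg hy
  · refine (continuousAt_const (y := lam • ContinuousLinearMap.id ℝ (Euc (m + 1)))).congr ?_
    filter_upwards [h.compl_mem_nhds hx0 hx] with y hy
    exact (if_neg hy).symm

/-! ### Behaviour near the origin and near infinity -/

theorem IsConjugator.zpow_smul (h : IsConjugator A ζ) {x : Euc (m + 1)} (hx : x ∈ A) (k : ℤ) :
    (2 : ℝ) ^ k • x ∈ A ∧ ζ ((2 : ℝ) ^ k • x) = ζ x + axisPoint m (-k) := by
  induction k with
  | zero => simpa [axisPoint] using hx
  | succ k ih =>
    have := h.glue isGluePair_neg_one ih.1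
    rw [smul_smul, ← zpow_one_add₀ two_ne_zero, add_comm 1 (k : ℤ)] at this
    refine ⟨this.1, ?_⟩
    rw [this.2, ih.2, add_assoc, ← axisPoint_add]
    push_cast; ring_nf
  | pred k ih =>
    have := h.glue isGluePair_one ih.1
    rw [smul_smul, ← zpow_neg_one, ← zpow_add₀ two_ne_zero, add_comm (-1) (-(k : ℤ)),
      ← sub_eq_add_neg] at this
    refine ⟨this.1, ?_⟩
    rw [this.2, ih.2, add_assoc, ← axisPoint_add]
    push_cast; ring_nf

/-- The axial coordinate of `ζ` equals `-log₂ |x|` up to a bounded error: it is bounded on the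
compact part of `A` in one fundamental annulus, and equivariance spreads the bound. -/
theorem IsPixtonConjugator.exists_bound (h : IsPixtonConjugator A ζ) :
    ∃ B : ℝ, ∀ x ∈ A, ∀ n : ℤ, (2 : ℝ) ^ n ≤ ‖x‖ → ‖x‖ < 2 ^ (n + 1) →
      |ζ x 0 + (n + 1)| ≤ B := by
  have hcomp : IsCompact (A ∩ {x | 1 / 2 ≤ ‖x‖ ∧ ‖x‖ ≤ 1}) := by
    have h1 : A ∩ {x | 1 / 2 ≤ ‖x‖ ∧ ‖x‖ ≤ 1} =
        (insert 0 A ∩ {x | 1 / 2 ≤ ‖x‖}) ∩ Metric.closedBall 0 1 := by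
      ext x
      constructor
      · rintro ⟨hx, h1, h2⟩
        exact ⟨⟨Or.inr hx, h1⟩, by simpa using h2⟩
      · rintro ⟨⟨rfl | hx, h1⟩, h2⟩
        · simp at h1; norm_num at h1
        · exact ⟨hx, h1, by simpa using h2⟩
    rw [h1]
    exact (isCompact_closedBall _ _).inter_left
      (h.isClosed.inter (isClosed_le continuous_const continuous_norm))
  obtain ⟨B, hB⟩ := hcomp.exists_bound_of_continuousOn (f := fun x => ζ x 0)
    ((by fun_prop : Continuous fun y : Euc (m + 1) => y 0).comp_continuousOn
      (h.continuousOn.mono inter_subset_left))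
  refine ⟨B, fun x hx n h1 h2 => ?_⟩
  have hz := h.zpow_smul hx (-(n + 1))
  have hpos : (0 : ℝ) < 2 ^ (n + 1) := by positivity
  have hn : ‖(2 : ℝ) ^ (-(n + 1)) • x‖ = ‖x‖ / 2 ^ (n + 1) := by
    rw [norm_smul, zpow_neg, norm_inv, Real.norm_of_nonneg hpos.le, div_eq_inv_mul]
  have := hB ((2 : ℝ) ^ (-(n + 1)) • x) ⟨hz.1, ?_, ?_⟩
  · rw [hz.2] at this
    simpa using this
  · rw [hn, div_le_div_iff₀ two_pos hpos, zpow_add_one₀ two_ne_zero]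
    linarith
  · rw [hn, div_le_one hpos]; exact h2.le

theorem IsPixtonConjugator.exists_small (h : IsPixtonConjugator A ζ) (M : ℝ) :
    ∃ δ > 0, ∀ x ∈ A, ‖x‖ < δ → M < ζ x 0 := by
  obtain ⟨B, hB⟩ := h.exists_bound
  obtain ⟨N, hN⟩ := exists_nat_gt (M + B)
  refine ⟨(2 : ℝ) ^ (-(N : ℤ)), by positivity, fun x hx hlt => ?_⟩
  have hx0 : 0 < ‖x‖ := norm_pos_iff.2 fun h0 => h.zero_notMem (h0 ▸ hx)
  obtain ⟨n, hn⟩ := exists_mem_Ico_zpow hx0 (one_lt_two)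
  have hnN : n < -(N : ℤ) := (zpow_lt_zpow_iff_right₀ one_lt_two).1 (hn.1.trans_lt hlt)
  have := (abs_le.1 (hB x hx n hn.1 hn.2)).1
  have h2 : ((n + 1 : ℤ) : ℝ) ≤ ((-(N : ℤ) : ℤ) : ℝ) := by exact_mod_cast hnN
  push_cast at h2
  linarith

theorem IsPixtonConjugator.exists_large (h : IsPixtonConjugator A ζ) (M : ℝ) :
    ∃ R > 0, ∀ x ∈ A, R < ‖x‖ → ζ x 0 < M := by
  obtain ⟨B, hB⟩ := h.exists_bound
  obtain ⟨N, hN⟩ := exists_nat_gt (B - M)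
  refine ⟨(2 : ℝ) ^ (N : ℤ), by positivity, fun x hx hlt => ?_⟩
  have hx0 : 0 < ‖x‖ := norm_pos_iff.2 fun h0 => h.zero_notMem (h0 ▸ hx)
  obtain ⟨n, hn⟩ := exists_mem_Ico_zpow hx0 (one_lt_two)
  have hnN : (N : ℤ) < n + 1 := (zpow_lt_zpow_iff_right₀ one_lt_two).1 (hlt.trans hn.2)
  have := (abs_le.1 (hB x hx n hn.1 hn.2)).2
  have h2 : ((N : ℤ) : ℝ) < ((n + 1 : ℤ) : ℝ) := by exact_mod_cast hnN
  push_cast at h2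
  linarith

/-- Points of `A` close to the origin have axial coordinate above 3, where the flow is a translation
during the needed time. This smooths the map at the origin, where the tube accumulates. -/
theorem IsPixtonConjugator.exists_gluedMap_small (h : IsPixtonConjugator A ζ)
    (hs : IsGluePair s lam) : ∃ δ > 0, ∀ x, ‖x‖ < δ → gluedMap ζ s lam x = lam • x := by
  obtain ⟨δ, hδ, hd⟩ := h.exists_small 3
  refine ⟨δ, hδ, fun x hx => ?_⟩
  by_cases hxA : x ∈ A
  · exact gluedMap_of_translate h.toIsConjugator hs hxA
      (modelFlow_of_abs_gt (lt_abs.2 (Or.inl (hd x hxA hx))) hs.abs_le)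
  · exact gluedMap_of_notMem h.toIsConjugator hxA

theorem IsPixtonConjugator.exists_gluedMap_large (h : IsPixtonConjugator A ζ)
    (hs : IsGluePair s lam) : ∃ R > 0, ∀ x, R < ‖x‖ → gluedMap ζ s lam x = lam • x := by
  obtain ⟨R, hR, hd⟩ := h.exists_large (-3)
  refine ⟨R, hR, fun x hx => ?_⟩
  by_cases hxA : x ∈ A
  · exact gluedMap_of_translate h.toIsConjugator hs hxA
      (modelFlow_of_abs_gt (lt_abs.2 (Or.inr (by linarith [hd x hxA hx]))) hs.abs_le)
  · exact gluedMap_of_notMem h.toIsConjugator hxA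

theorem hasFDerivAt_gluedMap_zero (h : IsPixtonConjugator A ζ) (hs : IsGluePair s lam) :
    HasFDerivAt (gluedMap ζ s lam) (lam • ContinuousLinearMap.id ℝ (Euc (m + 1))) 0 := by
  obtain ⟨δ, hδ, hd⟩ := h.exists_gluedMap_small hs
  refine ((hasFDerivAt_id (0 : Euc (m + 1))).fun_const_smul lam).congr_of_eventuallyEq ?_
  filter_upwards [Metric.ball_mem_nhds _ hδ] with y hy
  exact hd y (by simpa using hy)

theorem contDiff_gluedMap (h : IsPixtonConjugator A ζ) (hs : IsGluePair s lam) :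
    ContDiff ℝ 1 (gluedMap ζ s lam) := by
  rw [contDiff_iff_contDiffAt]
  intro x
  by_cases hx0 : x = 0
  · subst hx0
    obtain ⟨δ, hδ, hd⟩ := h.exists_gluedMap_small hs
    refine ContDiffAt.congr_of_eventuallyEq (f := fun y => lam • y) (by fun_prop) ?_
    filter_upwards [Metric.ball_mem_nhds _ hδ] with y hy
    exact hd y (by simpa using hy)
  · have ho : IsOpen ({0}ᶜ : Set (Euc (m + 1))) := isOpen_compl_singleton
    have : ContDiffOn ℝ 1 (gluedMap ζ s lam) {0}ᶜ := by
      rw [show (1 : WithTop ℕ∞) = 0 + 1 by simp,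
        contDiffOn_succ_iff_hasFDerivWithinAt_of_uniqueDiffOn ho.uniqueDiffOn]
      refine ⟨by simp, gluedDeriv A ζ s lam, ?_, fun y hy =>
        (hasFDerivAt_gluedMap h hs hy).hasFDerivWithinAt⟩
      exact contDiffOn_zero.2 (continuousOn_gluedDeriv h hs)
    exact this.contDiffAt (ho.mem_nhds hx0)

theorem gluedMap_mem_iff (h : IsConjugator A ζ) (hs : IsGluePair s lam) (x : Euc (m + 1)) :
    gluedMap ζ s lam x ∈ A ↔ x ∈ A := by
  by_cases hx : x ∈ A
  · rw [gluedMap_of_mem h hx]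
    exact iff_of_true (h.symm_mem (modelFlow_mem_cylinder (h.mapsTo hx) s)) hx
  · rw [gluedMap_of_notMem h hx, h.glue_mem_iff hs]

theorem apply_gluedMap (h : IsConjugator A ζ) {x : Euc (m + 1)} (hx : x ∈ A) :
    ζ (gluedMap ζ s lam x) = modelFlow s (ζ x) := by
  rw [gluedMap_of_mem h hx, h.right_inv (modelFlow_mem_cylinder (h.mapsTo hx) s)]

theorem gluedMap_inv (h : IsConjugator A ζ) (hs : IsGluePair s lam) (x : Euc (m + 1)) :
    gluedMap ζ (-s) lam⁻¹ (gluedMap ζ s lam x) = x := by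
  by_cases hx : x ∈ A
  · rw [gluedMap_of_mem h ((gluedMap_mem_iff h hs x).2 hx), apply_gluedMap h hx,
      modelFlow_neg_modelFlow, h.left_inv hx]
  · rw [gluedMap_of_notMem h (fun hc => hx ((gluedMap_mem_iff h hs x).1 hc)),
      gluedMap_of_notMem h hx, smul_smul, inv_mul_cancel₀ hs.pos.ne', one_smul]

end

end

/-! ### Transport to the sphere. -/

section

variable {n m : ℕ}

/-! ### Stereographic projections -/

theorem sphere_last_sq (x : Sph n) :
    (x : Euc (n + 1)) (Fin.last n) ^ 2 + ∑ i : Fin n, (x : Euc (n + 1)) i.castSucc ^ 2 = 1 := by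
  have h : ‖(x : Euc (n + 1))‖ ^ 2 = 1 := by rw [norm_eq_of_mem_sphere x]; norm_num
  rw [EuclideanSpace.norm_sq_eq, Fin.sum_univ_castSucc] at h
  simp only [Real.norm_eq_abs, sq_abs] at h
  linarith

theorem eq_northPole_iff (x : Sph n) : x = northPole n ↔ (x : Euc (n + 1)) (Fin.last n) = 1 := by
  constructor
  · rintro rfl; simp [northPole]
  · intro h
    have hs := sphere_last_sq x
    rw [h] at hs
    have hz : ∑ i : Fin n, (x : Euc (n + 1)) i.castSucc ^ 2 = 0 := by linarith
    rw [Finset.sum_eq_zero_iff_of_nonneg (fun i _ => sq_nonneg _)] at hz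
    ext i
    refine Fin.lastCases ?_ (fun i => ?_) i
    · simp [northPole, h]
    · have := hz i (Finset.mem_univ _)
      rw [sq_eq_zero_iff] at this
      simp [northPole, this, Fin.castSucc_ne_last]

theorem last_lt_one {x : Sph n} (hx : x ≠ northPole n) :
    (x : Euc (n + 1)) (Fin.last n) < 1 := by
  have h1 : (x : Euc (n + 1)) (Fin.last n) ≠ 1 := fun h => hx ((eq_northPole_iff x).2 h)
  have hs := sphere_last_sq x
  have : 0 ≤ ∑ i : Fin n, (x : Euc (n + 1)) i.castSucc ^ 2 :=
    Finset.sum_nonneg fun i _ => sq_nonneg _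
  exact lt_of_le_of_ne (by nlinarith) h1

@[simp] theorem stereoInv_castSucc (y : Euc n) (i : Fin n) :
    (stereoInv y : Euc (n + 1)) i.castSucc = 2 * y i / (‖y‖ ^ 2 + 1) := by
  simp [stereoInv]

@[simp] theorem stereoInv_last (y : Euc n) :
    (stereoInv y : Euc (n + 1)) (Fin.last n) = (‖y‖ ^ 2 - 1) / (‖y‖ ^ 2 + 1) := by
  simp [stereoInv]

theorem stereo_apply (x : Sph n) (i : Fin n) : stereo x i =
    (x : Euc (n + 1)) i.castSucc / (1 - (x : Euc (n + 1)) (Fin.last n)) := rfl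

theorem stereo_stereoInv (y : Euc n) : stereo (stereoInv y) = y := by
  ext i
  have h : (‖y‖ ^ 2 + 1 : ℝ) ≠ 0 := by positivity
  rw [stereo_apply, stereoInv_castSucc, stereoInv_last]
  field_simp
  ring

theorem stereoInv_ne_northPole (y : Euc n) : stereoInv y ≠ northPole n := by
  rw [Ne, eq_northPole_iff, stereoInv_last]
  have h : (‖y‖ ^ 2 + 1 : ℝ) ≠ 0 := by positivity
  rw [div_eq_one_iff_eq h]
  intro h; linarith

theorem norm_stereo_sq {x : Sph n} (hx : x ≠ northPole n) : ‖stereo x‖ ^ 2 =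
    (1 + (x : Euc (n + 1)) (Fin.last n)) / (1 - (x : Euc (n + 1)) (Fin.last n)) := by
  have h1 := last_lt_one hx
  have hs := sphere_last_sq x
  rw [EuclideanSpace.norm_sq_eq]
  simp only [stereo_apply, Real.norm_eq_abs, sq_abs, div_pow]
  rw [← Finset.sum_div, div_eq_div_iff (by positivity) (by linarith)]
  have : ∑ i : Fin n, (x : Euc (n + 1)) i.castSucc ^ 2 =
    1 - (x : Euc (n + 1)) (Fin.last n) ^ 2 := by linarith
  rw [this]; ring

theorem stereoInv_stereo {x : Sph n} (hx : x ≠ northPole n) : stereoInv (stereo x) = x := by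
  have h1 := last_lt_one hx
  have h2 : 1 - (x : Euc (n + 1)) (Fin.last n) ≠ 0 := by linarith
  ext i
  refine Fin.lastCases ?_ (fun i => ?_) i
  · rw [stereoInv_last, norm_stereo_sq hx]; field_simp; ring
  · rw [stereoInv_castSucc, norm_stereo_sq hx, stereo_apply]; field_simp; ring

theorem stereoInv_injective : Function.Injective (stereoInv (n := n)) :=
  Function.LeftInverse.injective stereo_stereoInv

theorem stereoInv_zero : stereoInv (0 : Euc n) = southPole n := by
  ext i
  refine Fin.lastCases ?_ (fun i => ?_) i
  · rw [stereoInv_last]; simp [southPole]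
  · rw [stereoInv_castSucc]; simp [southPole, Fin.castSucc_ne_last]

theorem contMDiff_coe_sph {k : WithTop ℕ∞} :
    ContMDiff (𝓡 n) 𝓘(ℝ, Euc (n + 1)) k (fun x : Sph n => (x : Euc (n + 1))) :=
  have := Fact.mk (@finrank_euclideanSpace_fin ℝ _ (n + 1))
  contMDiff_coe_sphere

theorem contMDiff_of_coe_sph {k : WithTop ℕ∞} {F H M : Type*} [NormedAddCommGroup F]
    [NormedSpace ℝ F] [TopologicalSpace H] {I : ModelWithCorners ℝ F H} [TopologicalSpace M]
    [ChartedSpace H M] [IsManifold I k M] {f : M → Sph n}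
    (hf : ContMDiff I 𝓘(ℝ, Euc (n + 1)) k (fun x => (f x : Euc (n + 1)))) :
    ContMDiff I (𝓡 n) k f :=
  have := Fact.mk (@finrank_euclideanSpace_fin ℝ _ (n + 1))
  ContMDiff.codRestrict_sphere hf fun x => (f x).2

theorem contMDiff_stereoInv {k : WithTop ℕ∞} :
    ContMDiff 𝓘(ℝ, Euc n) (𝓡 n) k (stereoInv (n := n)) := by
  refine contMDiff_of_coe_sph ?_
  rw [contMDiff_iff_contDiff, contDiff_euclidean]
  intro i
  have hn : ContDiff ℝ k (fun y : Euc n => ‖y‖ ^ 2) := contDiff_id.norm_sq ℝ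
  have hne : ∀ y : Euc n, ‖y‖ ^ 2 + 1 ≠ 0 := fun y => by positivity
  refine Fin.lastCases ?_ (fun i => ?_) i
  · simp only [stereoInv_last]
    exact (hn.sub contDiff_const).div (hn.add contDiff_const) hne
  · simp only [stereoInv_castSucc]
    exact (contDiff_const.mul (by fun_prop)).div (hn.add contDiff_const) hne

theorem continuous_stereoInv : Continuous (stereoInv (n := n)) :=
  (contMDiff_stereoInv (k := 0)).continuous

theorem contMDiffAt_stereo {k : WithTop ℕ∞} {x : Sph n} (hx : x ≠ northPole n) :
    ContMDiffAt (𝓡 n) 𝓘(ℝ, Euc n) k (stereo (n := n)) x := by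
  have h1 : ContMDiffAt (𝓡 n) 𝓘(ℝ, Euc (n + 1)) k
      (fun x : Sph n => (x : Euc (n + 1))) x := contMDiff_coe_sph.contMDiffAt
  have h2 : ContDiffAt ℝ k (fun y : Euc (n + 1) =>
      (WithLp.toLp 2 (fun i : Fin n => y i.castSucc / (1 - y (Fin.last n))) : Euc n))
      (x : Euc (n + 1)) := by
    rw [contDiffAt_euclidean]
    intro i
    refine ContDiffAt.div (by fun_prop) (by fun_prop) ?_
    have := last_lt_one hx
    linarith
  exact h2.contMDiffAt.comp x h1

theorem continuousAt_stereo {x : Sph n} (hx : x ≠ northPole n) :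
    ContinuousAt (stereo (n := n)) x := (contMDiffAt_stereo (k := 0) hx).continuousAt

/-- The reflection of the sphere in the equator. -/
def sphereFlip (x : Sph n) : Sph n :=
  ⟨WithLp.toLp 2 (Fin.snoc (α := fun _ => ℝ) (fun i : Fin n => (x : Euc (n + 1)) i.castSucc)
    (-(x : Euc (n + 1)) (Fin.last n))), by
    have hs := sphere_last_sq x
    rw [mem_sphere_zero_iff_norm, EuclideanSpace.norm_eq, Real.sqrt_eq_one, Fin.sum_univ_castSucc]
    simp only [Fin.snoc_castSucc, Fin.snoc_last, Real.norm_eq_abs, sq_abs, neg_sq]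
    linarith⟩

@[simp] theorem sphereFlip_castSucc (x : Sph n) (i : Fin n) :
    (sphereFlip x : Euc (n + 1)) i.castSucc = (x : Euc (n + 1)) i.castSucc := by
  simp [sphereFlip]

@[simp] theorem sphereFlip_last (x : Sph n) :
    (sphereFlip x : Euc (n + 1)) (Fin.last n) = -(x : Euc (n + 1)) (Fin.last n) := by
  simp [sphereFlip]

@[simp] theorem sphereFlip_sphereFlip (x : Sph n) : sphereFlip (sphereFlip x) = x := by
  ext i
  refine Fin.lastCases ?_ (fun i => ?_) i <;> simp

theorem sphereFlip_northPole : sphereFlip (northPole n) = southPole n := by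
  ext i
  refine Fin.lastCases ?_ (fun i => ?_) i
  · simp [northPole, southPole]
  · simp [northPole, southPole, Fin.castSucc_ne_last]

theorem sphereFlip_southPole : sphereFlip (southPole n) = northPole n := by
  rw [← sphereFlip_northPole, sphereFlip_sphereFlip]

theorem contMDiff_sphereFlip {k : WithTop ℕ∞} : ContMDiff (𝓡 n) (𝓡 n) k (sphereFlip (n := n)) := by
  have : IsManifold (𝓡 n) k (Sph n) := IsManifold.of_le le_top
  refine contMDiff_of_coe_sph ?_
  have h2 : ContDiff ℝ k (fun y : Euc (n + 1) => (WithLp.toLp 2 (Fin.snoc (α := fun _ => ℝ)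
      (fun i : Fin n => y i.castSucc) (-y (Fin.last n))) : Euc (n + 1))) := by
    rw [contDiff_euclidean]
    intro i
    refine Fin.lastCases ?_ (fun i => ?_) i
    · simp only [Fin.snoc_last]; fun_prop
    · simp only [Fin.snoc_castSucc]; fun_prop
  exact h2.contMDiff.comp contMDiff_coe_sph

theorem southPole_ne_northPole : southPole n ≠ northPole n := by
  rw [Ne, eq_northPole_iff]; simp [southPole]; norm_num

/-- In stereographic coordinates the flip is the inversion in the unit sphere; it provides a chart
at the North Pole. -/
theorem sphereFlip_stereoInv {y : Euc n} (hy : y ≠ 0) :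
    sphereFlip (stereoInv y) = stereoInv ((‖y‖ ^ 2)⁻¹ • y) := by
  have hn : ‖y‖ ≠ 0 := norm_ne_zero_iff.2 hy
  have h2 : ‖(‖y‖ ^ 2)⁻¹ • y‖ ^ 2 = (‖y‖ ^ 2)⁻¹ := by
    rw [norm_smul, mul_pow, Real.norm_of_nonneg (by positivity)]; field_simp
  have h3 : 1 + ‖y‖ ^ 2 ≠ 0 := by positivity
  have h4 : ‖y‖ ^ 2 + 1 ≠ 0 := by positivity
  ext i
  refine Fin.lastCases ?_ (fun i => ?_) i
  · rw [sphereFlip_last, stereoInv_last, stereoInv_last, h2]; field_simp; ring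
  · rw [sphereFlip_castSucc, stereoInv_castSucc, stereoInv_castSucc, h2]
    simp only [PiLp.smul_apply, smul_eq_mul]
    field_simp; ring

/-- A local inverse pair of `C¹` maps around the point `p` of the sphere. -/
structure IsChartPair (ψ : Sph n → Euc n) (θ : Euc n → Sph n) (p : Sph n) : Prop where
  contMDiffAt : ContMDiffAt (𝓡 n) 𝓘(ℝ, Euc n) 1 ψ p
  contMDiffAt_symm : ContMDiffAt 𝓘(ℝ, Euc n) (𝓡 n) 1 θ (ψ p)
  left_inv : ∀ᶠ x in 𝓝 p, θ (ψ x) = x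
  right_inv : ∀ᶠ y in 𝓝 (ψ p), ψ (θ y) = y

theorem isChartPair_stereo {p : Sph n} (hp : p ≠ northPole n) : IsChartPair stereo stereoInv p where
  contMDiffAt := contMDiffAt_stereo hp
  contMDiffAt_symm := contMDiff_stereoInv.contMDiffAt
  left_inv := by filter_upwards [isOpen_ne.mem_nhds hp] with x hx using stereoInv_stereo hx
  right_inv := Eventually.of_forall stereo_stereoInv

theorem isChartPair_flip {p : Sph n} (hp : p ≠ southPole n) :
    IsChartPair (stereo ∘ sphereFlip) (sphereFlip ∘ stereoInv) p := by
  have hne : ∀ x : Sph n, x ≠ southPole n → sphereFlip x ≠ northPole n := fun x hx h => by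
    apply hx
    rw [← sphereFlip_sphereFlip x, h, sphereFlip_northPole]
  refine ⟨(contMDiffAt_stereo (hne p hp)).comp p contMDiff_sphereFlip.contMDiffAt,
    (contMDiff_sphereFlip.comp contMDiff_stereoInv).contMDiffAt, ?_, ?_⟩
  · filter_upwards [isOpen_ne.mem_nhds hp] with x hx
    simp [stereoInv_stereo (hne x hx)]
  · exact Eventually.of_forall fun y => by simp [stereo_stereoInv]

theorem exists_isChartPair (p : Sph n) : ∃ ψ θ, IsChartPair ψ θ p := by
  by_cases hp : p = northPole n
  · exact ⟨_, _, isChartPair_flip (by rw [hp]; exact southPole_ne_northPole.symm)⟩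
  · exact ⟨_, _, isChartPair_stereo hp⟩

section ChartPair

variable {ψ : Sph n → Euc n} {θ : Euc n → Sph n} {p : Sph n}

theorem IsChartPair.apply_symm (h : IsChartPair ψ θ p) : θ (ψ p) = p := h.left_inv.self_of_nhds

theorem IsChartPair.continuousAt (h : IsChartPair ψ θ p) : ContinuousAt ψ p :=
  h.contMDiffAt.continuousAt

theorem IsChartPair.continuousAt_symm (h : IsChartPair ψ θ p) : ContinuousAt θ (ψ p) :=
  h.contMDiffAt_symm.continuousAt

/-- The differential of the inverse chart. -/
theorem IsChartPair.mfderiv_comp (h : IsChartPair ψ θ p) :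
    ∃ e : Euc n ≃L[ℝ] Euc n,
      (∀ v, e v = (mfderiv (𝓡 n) 𝓘(ℝ, Euc n) ψ p : Euc n →L[ℝ] Euc n) v) ∧
      (∀ v, e.symm v = (mfderiv 𝓘(ℝ, Euc n) (𝓡 n) θ (ψ p) : Euc n →L[ℝ] Euc n) v) := by
  have hψ : HasMFDerivAt (𝓡 n) 𝓘(ℝ, Euc n) ψ (θ (ψ p)) (mfderiv (𝓡 n) 𝓘(ℝ, Euc n) ψ p) := by
    rw [h.apply_symm]; exact (h.contMDiffAt.mdifferentiableAt one_ne_zero).hasMFDerivAt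
  have hθ := (h.contMDiffAt_symm.mdifferentiableAt one_ne_zero).hasMFDerivAt
  have hc := hψ.comp (ψ p) hθ
  have hid : HasMFDerivAt 𝓘(ℝ, Euc n) 𝓘(ℝ, Euc n) (ψ ∘ θ) (ψ p)
      (ContinuousLinearMap.id ℝ (Euc n)) := by
    refine HasMFDerivAt.congr_of_eventuallyEq (hasMFDerivAt_id (ψ p)) ?_
    filter_upwards [h.right_inv] with y hy using hy
  have heq := hasMFDerivAt_unique hc hid
  set P : Euc n →L[ℝ] Euc n := mfderiv (𝓡 n) 𝓘(ℝ, Euc n) ψ p with hP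
  set Q : Euc n →L[ℝ] Euc n := mfderiv 𝓘(ℝ, Euc n) (𝓡 n) θ (ψ p) with hQ
  have hPQ : ∀ v, P (Q v) = v := fun v =>
    congrArg (fun L : Euc n →L[ℝ] Euc n => L v) heq
  have hQP : ∀ v, Q (P v) = v := by
    intro v
    have hinj : Function.Injective (P : Euc n →ₗ[ℝ] Euc n) :=
      LinearMap.injective_iff_surjective.2 fun w => ⟨Q w, hPQ w⟩
    exact hinj (hPQ (P v))
  exact ⟨ContinuousLinearEquiv.equivOfInverse P Q hQP hPQ, fun v => rfl, fun v => rfl⟩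

/-- The differential of the chart at the fixed point conjugates the differential of `f` with `F'`.
-/
theorem IsChartPair.eigenvalues_differentialAt (h : IsChartPair ψ θ p) {f : Sph n → Sph n}
    {F : Euc n → Euc n} {F' : Euc n →L[ℝ] Euc n} (hf : MDifferentiableAt (𝓡 n) (𝓡 n) f p)
    (hp : f p = p) (hF : HasFDerivAt F F' (ψ p)) (hconj : ∀ᶠ x in 𝓝 p, ψ (f x) = F (ψ x)) :
    eigenvalues (differentialAt f p) = eigenvalues F' := by
  obtain ⟨e, he, -⟩ := h.mfderiv_comp
  refine eigenvalues_eq_of_semiconj e fun v => ?_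
  have hψ := (h.contMDiffAt.mdifferentiableAt one_ne_zero).hasMFDerivAt
  have hψ' : HasMFDerivAt (𝓡 n) 𝓘(ℝ, Euc n) ψ (f p) (mfderiv (𝓡 n) 𝓘(ℝ, Euc n) ψ p) := by
    rw [hp]; exact hψ
  have h1 := hψ'.comp p hf.hasMFDerivAt
  have h2 := (hF.hasMFDerivAt).comp p hψ
  have h3 : HasMFDerivAt (𝓡 n) 𝓘(ℝ, Euc n) (ψ ∘ f) p
      (F'.comp (mfderiv (𝓡 n) 𝓘(ℝ, Euc n) ψ p)) := h2.congr_of_eventuallyEq hconj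
  have heq := hasMFDerivAt_unique h1 h3
  rw [he, he]
  exact congrArg (fun L : Euc n →L[ℝ] Euc n => L v) heq

/-- Velocities of curves that run inside `W`, read in a chart. -/
theorem IsChartPair.mem_tangentVectors (h : IsChartPair ψ θ p) {W : Set (Sph n)}
    {c : ℝ → Euc n} (hc : ContDiff ℝ 1 c) (h0 : c 0 = ψ p) {v : Euc n} (hv : HasDerivAt c v 0)
    (hθ : ∀ t, ContMDiffAt 𝓘(ℝ, Euc n) (𝓡 n) 1 θ (c t)) (hW : ∀ t, θ (c t) ∈ W) :
    (mfderiv 𝓘(ℝ, Euc n) (𝓡 n) θ (ψ p) : Euc n →L[ℝ] Euc n) v ∈ tangentVectors W p := by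
  refine ⟨θ ∘ c, fun t => (hθ t).comp t hc.contMDiff.contMDiffAt, hW, ?_, ?_⟩
  · rw [Function.comp_apply, h0, h.apply_symm]
  · have h1 := (h.contMDiffAt_symm.mdifferentiableAt one_ne_zero).hasMFDerivAt
    rw [← h0] at h1
    have h2 := h1.comp (0 : ℝ) (hv.hasFDerivAt.hasMFDerivAt)
    rw [h2.mfderiv, ← h0]
    change (mfderiv 𝓘(ℝ, Euc n) (𝓡 n) θ (c 0) : Euc n →L[ℝ] Euc n)
      ((ContinuousLinearMap.toSpanSingleton ℝ v) 1) = _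
    simp

/-- The curve `δ sin (t / δ)` has unit speed at 0 and amplitude `δ`, so a curve with arbitrary
initial velocity can be kept near the point for all times. -/
theorem tangentVectors_eq_univ {W : Set (Sph n)} {p : Sph n} (hW : W ∈ 𝓝 p) :
    tangentVectors W p = univ := by
  obtain ⟨ψ, θ, h⟩ := exists_isChartPair p
  obtain ⟨e, -, he⟩ := h.mfderiv_comp
  refine eq_univ_of_forall fun v => ?_
  have hev : ∀ᶠ y in 𝓝 (ψ p), ContMDiffAt 𝓘(ℝ, Euc n) (𝓡 n) 1 θ y ∧ θ y ∈ W := by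
    refine ((contMDiffAt_iff_contMDiffAt_nhds (by simp)).1 h.contMDiffAt_symm).and ?_
    exact h.continuousAt_symm.eventually_mem (by rwa [h.apply_symm])
  obtain ⟨ε, hε, hball⟩ := Metric.eventually_nhds_iff.1 hev
  set δ := ε / (‖e v‖ + 1) with hδ
  have hδpos : 0 < δ := by positivity
  have hδε : δ * ‖e v‖ < ε := by
    have h1 : 0 < ‖e v‖ + 1 := by positivity
    rw [hδ, div_mul_eq_mul_div, div_lt_iff₀ h1]; nlinarith
  set c : ℝ → Euc n := fun t => ψ p + (δ * Real.sin (t / δ)) • e v with hc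
  have hcd : ContDiff ℝ 1 c := by
    have : ContDiff ℝ 1 (fun t : ℝ => δ * Real.sin (t / δ)) :=
      contDiff_const.mul (Real.contDiff_sin.comp (contDiff_id.div_const δ))
    exact contDiff_const.add (this.smul contDiff_const)
  have hder : HasDerivAt c (e v) 0 := by
    have h1 : HasDerivAt (fun t : ℝ => δ * Real.sin (t / δ)) 1 0 := by
      have := (((hasDerivAt_id (0 : ℝ)).div_const δ).sin).const_mul δ
      refine this.congr_deriv ?_
      simp; field_simp
    have := (h1.smul_const (e v)).const_add (ψ p)
    rwa [one_smul] at this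
  have hmem : ∀ t, dist (c t) (ψ p) < ε := fun t => by
    rw [hc, dist_eq_norm, add_sub_cancel_left, norm_smul, norm_mul, Real.norm_of_nonneg hδpos.le,
      Real.norm_eq_abs]
    calc δ * |Real.sin (t / δ)| * ‖e v‖ ≤ δ * 1 * ‖e v‖ := by
          gcongr; exact Real.abs_sin_le_one _
      _ < ε := by rwa [mul_one]
  have := h.mem_tangentVectors (W := W) hcd (by simp [hc]) hder (fun t => (hball (hmem t)).1)
    (fun t => (hball (hmem t)).2)
  rwa [← he, ContinuousLinearEquiv.symm_apply_apply] at this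

end ChartPair

end

section

variable {n m : ℕ}

/-! ### Attracting fixed points -/

theorem mem_stableSet_iff {X : Type*} [MetricSpace X] {g : X → X} {p : X} (hp : g p = p) {x : X} :
    x ∈ stableSet g p ↔ Tendsto (fun k : ℕ => g^[k] x) atTop (𝓝 p) := by
  have : ∀ k : ℕ, g^[k] p = p := fun k => Function.iterate_fixed hp k
  simp only [stableSet, mem_ofPred_eq, this]
  exact tendsto_iff_dist_tendsto_zero.symm

theorem stableSet_fixed_eq {X : Type*} [MetricSpace X] {g : X → X} {p q : X} (hp : g p = p)
    (hq : g q = q) (h : p ∈ stableSet g q) : p = q := by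
  rw [mem_stableSet_iff hq] at h
  simp only [Function.iterate_fixed hp] at h
  exact tendsto_nhds_unique tendsto_const_nhds h

/-- Every orbit in the basin enters the interior of the given neighbourhood after some `k` steps;
pull that interior back by `g^[k]`. -/
theorem isOpen_stableSet_of_mem_nhds {X : Type*} [MetricSpace X] {g : X → X} {p : X}
    (hg : Continuous g) (hp : g p = p) (h : stableSet g p ∈ 𝓝 p) : IsOpen (stableSet g p) := by
  rw [isOpen_iff_mem_nhds]
  intro x hx
  obtain ⟨k, hk⟩ := (((mem_stableSet_iff hp).1 hx).eventually
    (eventually_eventually_nhds.2 h)).exists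
  have := (hg.iterate k).continuousAt.preimage_mem_nhds hk
  filter_upwards [this] with y hy
  have hy' := (mem_stableSet_iff hp).1 hy
  rw [mem_stableSet_iff hp]
  refine (tendsto_add_atTop_iff_nat k).1 (hy'.congr fun j => ?_)
  rw [Function.iterate_add_apply]

theorem exists_contraction {E : Type*} [NormedAddCommGroup E] [NormedSpace ℝ E] {F : E → E}
    {F' : E →L[ℝ] E} {q : E} (hF : HasFDerivAt F F' q) (hq : F q = q) {c : ℝ} (hc : c < 1)
    (hF' : ∀ v, ‖F' v‖ ≤ c * ‖v‖) :
    ∃ c' < 1, 0 ≤ c' ∧ ∀ᶠ y in 𝓝 q, ‖F y - q‖ ≤ c' * ‖y - q‖ := by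
  -- Halfway between `c` and 1 absorbs the remainder; the maximum with 0 is taken since `c` is not
  -- assumed nonnegative.
  refine ⟨max ((1 + c) / 2) 0, max_lt (by linarith) one_pos, le_max_right _ _, ?_⟩
  have h1 := hF.isLittleO.bound (show 0 < (1 - c) / 2 by linarith)
  filter_upwards [h1] with y hy
  rw [hq] at hy
  calc ‖F y - q‖ = ‖(F y - q - F' (y - q)) + F' (y - q)‖ := by simp
    _ ≤ ‖F y - q - F' (y - q)‖ + ‖F' (y - q)‖ := norm_add_le _ _
    _ ≤ (1 - c) / 2 * ‖y - q‖ + c * ‖y - q‖ := add_le_add hy (hF' _)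
    _ = (1 + c) / 2 * ‖y - q‖ := by ring
    _ ≤ max ((1 + c) / 2) 0 * ‖y - q‖ := by gcongr; exact le_max_left _ _

section Sink

variable {ψ : Sph n → Euc n} {θ : Euc n → Sph n} {p : Sph n} {g : Sph n → Sph n}
  {F : Euc n → Euc n} {F' : Euc n →L[ℝ] Euc n} {c : ℝ}

/-- A forward invariant neighbourhood on which the map contracts in the chart. Because the chart
maps are total functions that are inverse only locally, the condition `θ (ψ x) = x` is built into
the trap and has to be propagated along the orbit. -/
theorem IsChartPair.exists_trap (h : IsChartPair ψ θ p) (hg : Continuous g) (hp : g p = p)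
    (hF : HasFDerivAt F F' (ψ p)) (hc : c < 1) (hF' : ∀ v, ‖F' v‖ ≤ c * ‖v‖)
    (hconj : ∀ᶠ x in 𝓝 p, ψ (g x) = F (ψ x)) :
    ∃ c' < 1, 0 ≤ c' ∧ ∃ S ∈ 𝓝 p, MapsTo g S S ∧
      (∀ x ∈ S, ‖ψ (g x) - ψ p‖ ≤ c' * ‖ψ x - ψ p‖) ∧ (∀ x ∈ S, θ (ψ x) = x) := by
  have hq : F (ψ p) = ψ p := by rw [← hconj.self_of_nhds, hp]
  obtain ⟨c', hc', hc0, hcon⟩ := exists_contraction hF hq hc hF'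
  have hU : ∀ᶠ x in 𝓝 p, ‖ψ (g x) - ψ p‖ ≤ c' * ‖ψ x - ψ p‖ ∧ θ (ψ x) = x := by
    filter_upwards [hconj, h.left_inv, h.continuousAt.eventually hcon] with x h1 h2 h3
    exact ⟨by rw [h1]; exact h3, h2⟩
  have hU2 : ∀ᶠ x in 𝓝 p, (‖ψ (g x) - ψ p‖ ≤ c' * ‖ψ x - ψ p‖ ∧ θ (ψ x) = x) ∧
      θ (ψ (g x)) = g x ∧ (‖ψ (g (g x)) - ψ p‖ ≤ c' * ‖ψ (g x) - ψ p‖) := by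
    have : Tendsto g (𝓝 p) (𝓝 p) := by simpa [ContinuousAt, hp] using hg.continuousAt (x := p)
    filter_upwards [hU, this.eventually hU] with x h1 h2 using ⟨h1, h2.2, h2.1⟩
  have hθ : ∀ᶠ y in 𝓝 (ψ p), (‖ψ (g (θ y)) - ψ p‖ ≤ c' * ‖ψ (θ y) - ψ p‖ ∧
      θ (ψ (θ y)) = θ y) ∧ θ (ψ (g (θ y))) = g (θ y) ∧
      (‖ψ (g (g (θ y))) - ψ p‖ ≤ c' * ‖ψ (g (θ y)) - ψ p‖) := by
    have : Tendsto θ (𝓝 (ψ p)) (𝓝 p) := by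
      simpa [ContinuousAt, h.apply_symm] using h.continuousAt_symm
    exact this.eventually hU2
  obtain ⟨ε, hε, hball⟩ := Metric.eventually_nhds_iff.1 hθ
  refine ⟨c', hc', hc0, {x | θ (ψ x) = x ∧ ‖ψ x - ψ p‖ < ε}, ?_, ?_, ?_, fun x hx => hx.1⟩
  · have : ∀ᶠ x in 𝓝 p, ‖ψ x - ψ p‖ < ε := by
      have := h.continuousAt.eventually (Metric.ball_mem_nhds (ψ p) hε)
      filter_upwards [this] with x hx
      simpa [dist_eq_norm] using hx
    filter_upwards [h.left_inv, this] with x h1 h2 using ⟨h1, h2⟩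
  · rintro x ⟨h1, h2⟩
    have := hball (y := ψ x) (by rwa [dist_eq_norm])
    rw [h1] at this
    refine ⟨this.2.1, this.1.1.trans_lt ?_⟩
    nlinarith [norm_nonneg (ψ x - ψ p)]
  · rintro x ⟨h1, h2⟩
    have := hball (y := ψ x) (by rwa [dist_eq_norm])
    rw [h1] at this
    exact this.1.1

theorem IsChartPair.isOpen_stableSet (h : IsChartPair ψ θ p) (hg : Continuous g) (hp : g p = p)
    (hF : HasFDerivAt F F' (ψ p)) (hc : c < 1) (hF' : ∀ v, ‖F' v‖ ≤ c * ‖v‖)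
    (hconj : ∀ᶠ x in 𝓝 p, ψ (g x) = F (ψ x)) : IsOpen (stableSet g p) := by
  obtain ⟨c', hc', hc0, S, hS, hmaps, hcon, hleft⟩ := h.exists_trap hg hp hF hc hF' hconj
  refine isOpen_stableSet_of_mem_nhds hg hp (mem_of_superset hS fun x hx => ?_)
  rw [mem_stableSet_iff hp]
  have hmem : ∀ k : ℕ, g^[k] x ∈ S := fun k => hmaps.iterate k hx
  have hbound : ∀ k : ℕ, ‖ψ (g^[k] x) - ψ p‖ ≤ c' ^ k * ‖ψ x - ψ p‖ := by
    intro k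
    induction k with
    | zero => simp
    | succ k ih =>
      rw [Function.iterate_succ_apply', pow_succ', mul_assoc]
      exact (hcon _ (hmem k)).trans (mul_le_mul_of_nonneg_left ih hc0)
  have hlim : Tendsto (fun k : ℕ => ψ (g^[k] x)) atTop (𝓝 (ψ p)) := by
    rw [tendsto_iff_norm_sub_tendsto_zero]
    refine squeeze_zero (fun _ => norm_nonneg _) hbound ?_
    simpa using (tendsto_pow_atTop_nhds_zero_of_lt_one hc0 hc').mul_const ‖ψ x - ψ p‖
  have := h.continuousAt_symm.tendsto.comp hlim
  rw [h.apply_symm] at this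
  exact this.congr fun k => hleft _ (hmem k)

/-- A sink has trivial unstable manifold. Once a backward orbit stays in the trap, its distance to
`p` at step `N` is at most `c' ^ j` times the distance at step `N + j`, and both factors tend to 0.
-/
theorem IsChartPair.stableSet_inverse (h : IsChartPair ψ θ p) (hg : Continuous g) (hp : g p = p)
    (hF : HasFDerivAt F F' (ψ p)) (hc : c < 1) (hF' : ∀ v, ‖F' v‖ ≤ c * ‖v‖)
    (hconj : ∀ᶠ x in 𝓝 p, ψ (g x) = F (ψ x)) {k : Sph n → Sph n} (hk : ∀ x, g (k x) = x)
    (hkp : k p = p) : stableSet k p ⊆ {p} := by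
  obtain ⟨c', hc', hc0, S, hS, -, hcon, hleft⟩ := h.exists_trap hg hp hF hc hF' hconj
  intro x hx
  rw [mem_stableSet_iff hkp] at hx
  obtain ⟨N, hN⟩ := eventually_atTop.1 (hx.eventually hS)
  have hstep : ∀ j : ℕ, ‖ψ (k^[N] x) - ψ p‖ ≤ c' ^ j * ‖ψ (k^[N + j] x) - ψ p‖ := by
    intro j
    induction j with
    | zero => simp
    | succ j ih =>
      have h1 := hcon _ (hN (N + j + 1) (by omega))
      have e : g (k^[N + j + 1] x) = k^[N + j] x := by rw [Function.iterate_succ_apply', hk]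
      rw [e] at h1
      refine ih.trans ?_
      rw [pow_succ, mul_assoc]
      refine mul_le_mul_of_nonneg_left ?_ (pow_nonneg hc0 j)
      exact h1
  have hlim : Tendsto (fun j : ℕ => c' ^ j * ‖ψ (k^[N + j] x) - ψ p‖) atTop (𝓝 (0 * 0)) := by
    refine (tendsto_pow_atTop_nhds_zero_of_lt_one hc0 hc').mul ?_
    have h1 : Tendsto (fun j : ℕ => k^[N + j] x) atTop (𝓝 p) := by
      refine ((tendsto_add_atTop_iff_nat N).2 hx).congr fun j => ?_
      rw [add_comm]
    exact tendsto_iff_norm_sub_tendsto_zero.1 (h.continuousAt.tendsto.comp h1)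
  rw [mul_zero] at hlim
  have h0 : ‖ψ (k^[N] x) - ψ p‖ ≤ 0 := ge_of_tendsto' hlim hstep
  have h1 : ψ (k^[N] x) = ψ p := sub_eq_zero.1 (norm_le_zero_iff.1 h0)
  have h2 : k^[N] x = p := by
    rw [← hleft _ (hN N le_rfl), h1, h.apply_symm]
  have h3 : ∀ j : ℕ, ∀ y, g^[j] (k^[j] y) = y := fun j =>
    Function.LeftInverse.iterate (g := g) (f := k) hk j
  rw [mem_singleton_iff, ← h3 N x, h2, Function.iterate_fixed hp]

end Sink

/-! ### The diffeomorphism of the sphere -/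

open Classical in
/-- The map of the sphere induced by the glued map. -/
def sphereMap (ζ : PartialEquiv (Euc (m + 1)) (Euc (m + 1))) (s lam : ℝ) (x : Sph (m + 1)) :
    Sph (m + 1) :=
  if x = northPole (m + 1) then northPole (m + 1) else stereoInv (gluedMap ζ s lam (stereo x))

section

variable {A : Set (Euc (m + 1))} {ζ : PartialEquiv (Euc (m + 1)) (Euc (m + 1))} {s lam : ℝ}

theorem sphereMap_northPole : sphereMap ζ s lam (northPole (m + 1)) = northPole (m + 1) :=
  if_pos rfl

theorem sphereMap_of_ne {x : Sph (m + 1)} (hx : x ≠ northPole (m + 1)) :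
    sphereMap ζ s lam x = stereoInv (gluedMap ζ s lam (stereo x)) := if_neg hx

theorem sphereMap_stereoInv (y : Euc (m + 1)) :
    sphereMap ζ s lam (stereoInv y) = stereoInv (gluedMap ζ s lam y) := by
  rw [sphereMap_of_ne (stereoInv_ne_northPole y), stereo_stereoInv]

theorem sphereMap_inv (h : IsConjugator A ζ) (hs : IsGluePair s lam) (x : Sph (m + 1)) :
    sphereMap ζ (-s) lam⁻¹ (sphereMap ζ s lam x) = x := by
  by_cases hx : x = northPole (m + 1)
  · rw [hx, sphereMap_northPole, sphereMap_northPole]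
  · rw [sphereMap_of_ne hx, sphereMap_stereoInv, gluedMap_inv h hs, stereoInv_stereo hx]

/-- Conjugation by the inversion inverts the ratio of a homothety. -/
theorem flip_smul_flip (hlam : 0 < lam) {y : Euc n} (hy : y ≠ 0) :
    sphereFlip (stereoInv (lam⁻¹ • stereo (sphereFlip (stereoInv y)))) = stereoInv (lam • y) := by
  have hn : ‖y‖ ≠ 0 := norm_ne_zero_iff.2 hy
  rw [sphereFlip_stereoInv hy, stereo_stereoInv, sphereFlip_stereoInv]
  · congr 1
    rw [norm_smul, norm_smul, smul_smul, smul_smul, Real.norm_of_nonneg (by positivity),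
      Real.norm_of_nonneg (by positivity)]
    congr 1
    field_simp
  · simp [hlam.ne', hy]

theorem sphereMap_eventuallyEq_northPole (h : IsPixtonConjugator A ζ) (hs : IsGluePair s lam) :
    ∀ᶠ x in 𝓝 (northPole (m + 1)), sphereMap ζ s lam x =
      sphereFlip (stereoInv (lam⁻¹ • stereo (sphereFlip x))) := by
  obtain ⟨R, hR, hlarge⟩ := h.exists_gluedMap_large hs
  have hev : ∀ᶠ x : Sph (m + 1) in 𝓝 (northPole (m + 1)),
      R ^ 2 * (1 - (x : Euc (m + 2)) (Fin.last (m + 1))) <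
        1 + (x : Euc (m + 2)) (Fin.last (m + 1)) := by
    have hc : Continuous fun x : Sph (m + 1) => (x : Euc (m + 2)) (Fin.last (m + 1)) :=
      (by fun_prop : Continuous fun y : Euc (m + 2) => y (Fin.last (m + 1))).comp
        continuous_subtype_val
    refine ContinuousAt.eventually_lt (f := fun x : Sph (m + 1) =>
      R ^ 2 * (1 - (x : Euc (m + 2)) (Fin.last (m + 1))))
      (g := fun x : Sph (m + 1) => 1 + (x : Euc (m + 2)) (Fin.last (m + 1)))
      (by fun_prop) (by fun_prop) ?_
    rw [(eq_northPole_iff (northPole (m + 1))).1 rfl]; norm_num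
  filter_upwards [hev] with x hx
  by_cases hxN : x = northPole (m + 1)
  · rw [hxN, sphereMap_northPole, sphereFlip_northPole, ← stereoInv_zero, stereo_stereoInv,
      smul_zero, stereoInv_zero, sphereFlip_southPole]
  · have hn : R < ‖stereo x‖ := by
      have h1 := last_lt_one hxN
      have h2 : R ^ 2 < ‖stereo x‖ ^ 2 := by
        rw [norm_stereo_sq hxN, lt_div_iff₀ (by linarith)]; exact hx
      exact lt_of_pow_lt_pow_left₀ 2 (norm_nonneg _) h2
    have hy0 : stereo x ≠ 0 := norm_pos_iff.1 (hR.trans hn)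
    rw [sphereMap_of_ne hxN, hlarge _ hn]
    conv_rhs => rw [← stereoInv_stereo hxN]
    rw [flip_smul_flip hs.pos hy0]

theorem contMDiff_sphereMap (h : IsPixtonConjugator A ζ) (hs : IsGluePair s lam) :
    ContMDiff (𝓡 (m + 1)) (𝓡 (m + 1)) 1 (sphereMap ζ s lam) := by
  intro x
  by_cases hx : x = northPole (m + 1)
  · subst hx
    refine ContMDiffAt.congr_of_eventuallyEq (f := fun x : Sph (m + 1) =>
      sphereFlip (stereoInv (lam⁻¹ • stereo (sphereFlip x)))) ?_
      (sphereMap_eventuallyEq_northPole h hs)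
    have hc := isChartPair_flip (southPole_ne_northPole (n := m + 1)).symm
    have hl : ContMDiff 𝓘(ℝ, Euc (m + 1)) 𝓘(ℝ, Euc (m + 1)) 1
        (fun y : Euc (m + 1) => lam⁻¹ • y) :=
      (by fun_prop : ContDiff ℝ 1 (fun y : Euc (m + 1) => lam⁻¹ • y)).contMDiff
    exact ((contMDiff_sphereFlip.comp contMDiff_stereoInv).comp hl).contMDiffAt.comp _
      hc.contMDiffAt
  · refine ContMDiffAt.congr_of_eventuallyEq (f := fun x : Sph (m + 1) =>
      stereoInv (gluedMap ζ s lam (stereo x))) ?_ ?_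
    · exact (contMDiff_stereoInv.comp (contDiff_gluedMap h hs).contMDiff).contMDiffAt.comp _
        (contMDiffAt_stereo hx)
    · filter_upwards [isOpen_ne.mem_nhds hx] with y hy using sphereMap_of_ne hy

/-- The diffeomorphism of the sphere built with `ζ`. -/
def pixtonDiffeo (h : IsPixtonConjugator A ζ) :
    Sph (m + 1) ≃ₘ^1⟮𝓡 (m + 1), 𝓡 (m + 1)⟯ Sph (m + 1) where
  toFun := sphereMap ζ 1 2⁻¹
  invFun := sphereMap ζ (-1) 2
  left_inv x := by simpa using sphereMap_inv h.toIsConjugator isGluePair_one x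
  right_inv x := by simpa using sphereMap_inv h.toIsConjugator isGluePair_neg_one x
  contMDiff_toFun := contMDiff_sphereMap h isGluePair_one
  contMDiff_invFun := contMDiff_sphereMap h isGluePair_neg_one

theorem coe_pixtonDiffeo (h : IsPixtonConjugator A ζ) :
    ⇑(pixtonDiffeo h) = sphereMap ζ 1 2⁻¹ := rfl

theorem coe_pixtonDiffeo_symm (h : IsPixtonConjugator A ζ) :
    ⇑(pixtonDiffeo h).symm = sphereMap ζ (-1) 2 := rfl

/-! ### Charts given by `ζ` -/

/-- The point of the sphere that corresponds to the point `y` of the cylinder. -/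
def cylinderInSphere (ζ : PartialEquiv (Euc (m + 1)) (Euc (m + 1))) (y : Euc (m + 1)) :
    Sph (m + 1) := stereoInv (ζ.symm y)

theorem axisInSphere_eq (t : ℝ) : axisInSphere ζ t = cylinderInSphere ζ (axisPoint m t) := rfl

theorem stereo_cylinderInSphere (y : Euc (m + 1)) : stereo (cylinderInSphere ζ y) = ζ.symm y :=
  stereo_stereoInv _

theorem cylinderInSphere_apply (h : IsConjugator A ζ) {y : Euc (m + 1)} (hy : y ∈ cylinder m) :
    ζ (stereo (cylinderInSphere ζ y)) = y := by
  rw [stereo_cylinderInSphere, h.right_inv hy]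

theorem eventually_mem (h : IsConjugator A ζ) {y : Euc (m + 1)} (hy : axisDistSq y < 4) :
    ∀ᶠ x in 𝓝 (cylinderInSphere ζ y), x ≠ northPole (m + 1) ∧ stereo x ∈ A := by
  have hyC : y ∈ cylinder m := mem_cylinder.2 hy.le
  refine Filter.Eventually.and (isOpen_ne.mem_nhds (stereoInv_ne_northPole _)) ?_
  have hA : A ∈ 𝓝 (ζ.symm y) := h.mem_nhds (h.symm_mem hyC) (by rwa [h.right_inv hyC])
  rw [← stereo_cylinderInSphere] at hA
  exact (continuousAt_stereo (stereoInv_ne_northPole _)).eventually hA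

theorem contMDiffAt_cylinderInSphere (h : IsConjugator A ζ) {y : Euc (m + 1)}
    (hy : axisDistSq y < 4) :
    ContMDiffAt 𝓘(ℝ, Euc (m + 1)) (𝓡 (m + 1)) 1 (cylinderInSphere ζ) y := by
  have h1 : ContDiffAt ℝ 1 ζ.symm y :=
    (h.smooth_symm.contDiffAt (cylinder_mem_nhds hy)).of_le (by simp)
  exact contMDiff_stereoInv.contMDiffAt.comp y h1.contMDiffAt

/-- The coordinates `ζ ∘ stereo` are a chart at interior points of the tube; in them the sphere map
is the model flow. -/
theorem isChartPair_cylinder (h : IsConjugator A ζ) {y : Euc (m + 1)} (hy : axisDistSq y < 4) :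
    IsChartPair (ζ ∘ stereo) (cylinderInSphere ζ) (cylinderInSphere ζ y) := by
  have hyC : y ∈ cylinder m := mem_cylinder.2 hy.le
  have hA : A ∈ 𝓝 (ζ.symm y) := h.mem_nhds (h.symm_mem hyC) (by rwa [h.right_inv hyC])
  have hval : (ζ ∘ stereo) (cylinderInSphere ζ y) = y := cylinderInSphere_apply h hyC
  refine ⟨?_, ?_, ?_, ?_⟩
  · have h1 : ContDiffAt ℝ 1 ζ (stereo (cylinderInSphere ζ y)) := by
      rw [stereo_cylinderInSphere]
      exact (h.smooth.contDiffAt hA).of_le (by simp)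
    exact h1.contMDiffAt.comp _ (contMDiffAt_stereo (stereoInv_ne_northPole _))
  · rw [hval]; exact contMDiffAt_cylinderInSphere h hy
  · filter_upwards [eventually_mem h hy] with x hx
    rw [cylinderInSphere, Function.comp_apply, h.left_inv hx.2, stereoInv_stereo hx.1]
  · rw [hval]
    filter_upwards [cylinder_mem_nhds hy] with z hz using cylinderInSphere_apply h hz

theorem conj_cylinder (h : IsConjugator A ζ) {y : Euc (m + 1)} (hy : axisDistSq y < 4) :
    ∀ᶠ x in 𝓝 (cylinderInSphere ζ y),
      (ζ ∘ stereo) (sphereMap ζ s lam x) = modelFlow s ((ζ ∘ stereo) x) := by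
  filter_upwards [eventually_mem h hy] with x hx
  rw [sphereMap_of_ne hx.1, Function.comp_apply, stereo_stereoInv, apply_gluedMap h hx.2,
    Function.comp_apply]

theorem sphereMap_cylinderInSphere (h : IsConjugator A ζ) {y : Euc (m + 1)}
    (hy : y ∈ cylinder m) :
    sphereMap ζ s lam (cylinderInSphere ζ y) = cylinderInSphere ζ (modelFlow s y) := by
  rw [cylinderInSphere, sphereMap_stereoInv, gluedMap_of_mem h (h.symm_mem hy), h.right_inv hy]
  rfl

theorem iterate_sphereMap_cylinderInSphere (h : IsConjugator A ζ) {y : Euc (m + 1)}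
    (hy : y ∈ cylinder m) (k : ℕ) : (sphereMap ζ s lam)^[k] (cylinderInSphere ζ y) =
      cylinderInSphere ζ (modelFlow (s * k) y) := by
  induction k with
  | zero => simp
  | succ k ih =>
    rw [Function.iterate_succ_apply', ih, sphereMap_cylinderInSphere h
      (modelFlow_mem_cylinder hy _), ← modelFlow_add]
    push_cast; ring_nf

theorem iterate_sphereMap_of_notMem (h : IsConjugator A ζ) (hs : IsGluePair s lam)
    {y : Euc (m + 1)} (hy : y ∉ A) (k : ℕ) :
    (sphereMap ζ s lam)^[k] (stereoInv y) = stereoInv (lam ^ k • y) ∧ lam ^ k • y ∉ A := by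
  induction k with
  | zero => simpa using hy
  | succ k ih =>
    rw [Function.iterate_succ_apply', ih.1, sphereMap_stereoInv, gluedMap_of_notMem h ih.2,
      smul_smul, ← pow_succ']
    refine ⟨rfl, ?_⟩
    rw [pow_succ', ← smul_smul, h.glue_mem_iff hs]
    exact ih.2

theorem eq_cylinderInSphere (h : IsConjugator A ζ) {x : Sph (m + 1)}
    (hx : x ≠ northPole (m + 1)) (hA : stereo x ∈ A) : x = cylinderInSphere ζ (ζ (stereo x)) := by
  rw [cylinderInSphere, h.left_inv hA, stereoInv_stereo hx]

theorem continuousOn_cylinderInSphere (h : IsConjugator A ζ) :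
    ContinuousOn (cylinderInSphere ζ) (cylinder m) :=
  continuous_stereoInv.comp_continuousOn h.smooth_symm.continuousOn

theorem injOn_cylinderInSphere (h : IsConjugator A ζ) :
    InjOn (cylinderInSphere ζ) (cylinder m) := fun y hy z hz hyz => by
  rw [← cylinderInSphere_apply h hy, hyz, cylinderInSphere_apply h hz]

theorem continuous_axisInSphere (h : IsConjugator A ζ) : Continuous (axisInSphere ζ) :=
  (continuousOn_cylinderInSphere h).comp_continuous continuous_axisPoint axisPoint_mem_cylinder

theorem injective_axisInSphere (h : IsConjugator A ζ) : Function.Injective (axisInSphere ζ) :=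
  fun s t hst => by
    have := injOn_cylinderInSphere h (axisPoint_mem_cylinder s) (axisPoint_mem_cylinder t) hst
    simpa using congrArg (fun x : Euc (m + 1) => x 0) this

theorem sphereMap_axisInSphere_fixed (h : IsConjugator A ζ) {t : ℝ} (ht : t ^ 2 = 1) :
    sphereMap ζ s lam (axisInSphere ζ t) = axisInSphere ζ t := by
  rw [axisInSphere_eq, sphereMap_cylinderInSphere h (axisPoint_mem_cylinder t),
    modelFlow_axisPoint ht]

theorem sphereMap_southPole (h : IsPixtonConjugator A ζ) :
    sphereMap ζ s lam (southPole (m + 1)) = southPole (m + 1) := by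
  rw [← stereoInv_zero, sphereMap_stereoInv, gluedMap_of_notMem h.toIsConjugator h.zero_notMem,
    smul_zero]

theorem axisInSphere_ne_southPole (h : IsPixtonConjugator A ζ) (t : ℝ) :
    axisInSphere ζ t ≠ southPole (m + 1) := fun ht => by
  rw [← stereoInv_zero] at ht
  have := stereoInv_injective ht
  exact h.zero_notMem (this ▸ h.symm_mem (axisPoint_mem_cylinder t))

theorem axisInSphere_ne_northPole (t : ℝ) : axisInSphere ζ t ≠ northPole (m + 1) :=
  stereoInv_ne_northPole _

/-! ### The non-wandering set -/

theorem wandering_of_nhds {X : Type*} [TopologicalSpace X] {g : X → X} {x : X} {U : Set X}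
    (hU : U ∈ 𝓝 x) (h : ∀ y ∈ U, ∀ k : ℕ, 0 < k → g^[k] y ∉ U) : x ∉ nonWanderingSet g := by
  intro hx
  obtain ⟨V, hVU, hV, hxV⟩ := mem_nhds_iff.1 hU
  obtain ⟨k, hk, z, ⟨y, hy, rfl⟩, hz⟩ := hx V hV hxV
  exact h y (hVU hy) k hk (hVU hz)

theorem mem_nonWanderingSet_of_fixed {X : Type*} [TopologicalSpace X] {g : X → X} {x : X}
    (h : g x = x) : x ∈ nonWanderingSet g :=
  fun _ _ hx => ⟨1, one_pos, x, ⟨x, hx, by simpa using h⟩, hx⟩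

/-- Two mechanisms combine, since a neighbourhood of a boundary point of the tube contains points of
both kinds: inside `A` the model flow has wandering neighbourhoods, outside `A` the norm is halved
at each step. Both regions are invariant. -/
theorem notMem_nonWanderingSet (h : IsPixtonConjugator A ζ) {y : Euc (m + 1)} (hy0 : y ≠ 0)
    (hy1 : y ≠ ζ.symm (axisPoint m 1)) (hy2 : y ≠ ζ.symm (axisPoint m (-1))) :
    stereoInv y ∉ nonWanderingSet (sphereMap ζ 1 2⁻¹) := by
  have hn : 0 < ‖y‖ := norm_pos_iff.2 hy0
  -- The ratio of the two radii is `5/3 < 2`, so halving the norm leaves the ring for good.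
  have hring : ∀ᶠ z in 𝓝 y, ‖y‖ * (3 / 4) < ‖z‖ ∧ ‖z‖ < ‖y‖ * (5 / 4) :=
    (continuous_norm.continuousAt.eventually_const_lt (by linarith)).and
      (continuous_norm.continuousAt.eventually_lt_const (by linarith))
  have hexp : ∃ W ∈ 𝓝 y, (∀ z ∈ W, ‖y‖ * (3 / 4) < ‖z‖ ∧ ‖z‖ < ‖y‖ * (5 / 4)) ∧
      ∀ z ∈ W, z ∈ A → ∀ k : ℕ, 0 < k → ζ.symm (modelFlow k (ζ z)) ∉ W := by
    by_cases hyA : y ∈ A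
    · have h1 : ζ y ≠ axisPoint m 1 := fun hc => hy1 (by rw [← hc, h.left_inv hyA])
      have h2 : ζ y ≠ axisPoint m (-1) := fun hc => hy2 (by rw [← hc, h.left_inv hyA])
      obtain ⟨U, hU, hyU, hw⟩ := exists_wandering h1 h2
      have hζ : ∀ᶠ z in 𝓝 y, z ∈ A → ζ z ∈ U :=
        eventually_nhdsWithin_iff.1 ((h.continuousOn y hyA).eventually (hU.mem_nhds hyU))
      refine ⟨_, hring.and hζ, fun z hz => hz.1, fun z hz hzA k hk hc => ?_⟩
      have hC := modelFlow_mem_cylinder (h.mapsTo hzA) (k : ℝ)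
      have := hc.2 (h.symm_mem hC)
      rw [h.right_inv hC, ← modelFlow_nat] at this
      exact hw _ (hz.2 hzA) k hk this
    · exact ⟨_, hring.and (h.compl_mem_nhds hy0 hyA), fun z hz => hz.1,
        fun z hz hzA => absurd hzA hz.2⟩
  obtain ⟨W, hW, hWr, hWA⟩ := hexp
  have hne := stereoInv_ne_northPole y
  refine wandering_of_nhds (U := {x | x ≠ northPole (m + 1) ∧ stereo x ∈ W}) ?_ ?_
  · refine Filter.Eventually.and (isOpen_ne.mem_nhds hne) ?_
    refine (continuousAt_stereo hne).eventually ?_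
    rw [stereo_stereoInv]; exact hW
  · rintro x ⟨hxN, hxW⟩ k hk ⟨hkN, hkW⟩
    by_cases hxA : stereo x ∈ A
    · rw [eq_cylinderInSphere h.toIsConjugator hxN hxA,
        iterate_sphereMap_cylinderInSphere h.toIsConjugator (h.mapsTo hxA),
        stereo_cylinderInSphere, one_mul] at hkW
      exact hWA _ hxW hxA k hk hkW
    · rw [← stereoInv_stereo hxN, (iterate_sphereMap_of_notMem h.toIsConjugator isGluePair_one
        hxA k).1, stereo_stereoInv] at hkW
      have h1 := (hWr _ hkW).1
      have h2 := (hWr _ hxW).2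
      rw [norm_smul, norm_pow, norm_inv, Real.norm_ofNat] at h1
      have h3 : (2⁻¹ : ℝ) ^ k ≤ 2⁻¹ := by
        calc (2⁻¹ : ℝ) ^ k ≤ 2⁻¹ ^ 1 := pow_le_pow_of_le_one (by norm_num) (by norm_num) hk
          _ = 2⁻¹ := pow_one _
      nlinarith [norm_nonneg (stereo x)]

theorem nonWanderingSet_pixtonDiffeo (h : IsPixtonConjugator A ζ) :
    nonWanderingSet (pixtonDiffeo h) =
      {axisInSphere ζ (-1), southPole (m + 1), axisInSphere ζ 1, northPole (m + 1)} := by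
  rw [coe_pixtonDiffeo]
  ext x
  constructor
  · intro hx
    by_cases hxN : x = northPole (m + 1)
    · simp [hxN]
    · have hx' := stereoInv_stereo hxN
      by_contra hc
      simp only [mem_insert_iff, mem_singleton_iff, not_or] at hc
      refine notMem_nonWanderingSet h (y := stereo x) ?_ ?_ ?_ (hx'.symm ▸ hx)
      · rintro h0; rw [h0, stereoInv_zero] at hx'; exact hc.2.1 hx'.symm
      · rintro h0; rw [h0] at hx'; exact hc.2.2.1 hx'.symm
      · rintro h0; rw [h0] at hx'; exact hc.1 hx'.symm
  · rintro (rfl | rfl | rfl | rfl)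
    · exact mem_nonWanderingSet_of_fixed (sphereMap_axisInSphere_fixed h.toIsConjugator (by norm_num))
    · exact mem_nonWanderingSet_of_fixed (sphereMap_southPole h)
    · exact mem_nonWanderingSet_of_fixed (sphereMap_axisInSphere_fixed h.toIsConjugator (by norm_num))
    · exact mem_nonWanderingSet_of_fixed sphereMap_northPole

end

end

/-! ### The dynamics of the Pixton diffeomorphism: fixed points, invariant manifolds,
transversality. -/

section

variable {n m : ℕ}

/-! ### The four fixed points -/

theorem norm_axialMap_le {a b c : ℝ} (ha : |a| ≤ c) (hb : |b| ≤ c) (v : Euc (m + 1)) :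
    ‖axialMap m a b v‖ ≤ c * ‖v‖ := by
  have hc : 0 ≤ c := (abs_nonneg a).trans ha
  have hu : axisDistSq (axialMap m a b v) = b ^ 2 * axisDistSq v := by
    simp [axisDistSq, mul_pow, Finset.mul_sum]
  have ha2 : a ^ 2 ≤ c ^ 2 := sq_le_sq' (by linarith [neg_abs_le a]) (by linarith [le_abs_self a])
  have hb2 : b ^ 2 ≤ c ^ 2 := sq_le_sq' (by linarith [neg_abs_le b]) (by linarith [le_abs_self b])
  refine le_of_sq_le_sq ?_ (by positivity)
  rw [mul_pow, norm_sq_eq, norm_sq_eq v, hu, axialMap_apply_zero]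
  nlinarith [sq_nonneg (v 0), axisDistSq_nonneg v]

section

variable {A : Set (Euc (m + 1))} {ζ : PartialEquiv (Euc (m + 1)) (Euc (m + 1))} {s lam : ℝ}

theorem continuous_sphereMap (h : IsPixtonConjugator A ζ) (hs : IsGluePair s lam) :
    Continuous (sphereMap ζ s lam) := (contMDiff_sphereMap h hs).continuous

theorem conj_southPole (ζ : PartialEquiv (Euc (m + 1)) (Euc (m + 1))) (s lam : ℝ) :
    ∀ᶠ x in 𝓝 (southPole (m + 1)), stereo (sphereMap ζ s lam x) = gluedMap ζ s lam (stereo x) := by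
  filter_upwards [isOpen_ne.mem_nhds southPole_ne_northPole] with x hx
  rw [sphereMap_of_ne hx, stereo_stereoInv]

theorem conj_northPole (h : IsPixtonConjugator A ζ) (hs : IsGluePair s lam) :
    ∀ᶠ x in 𝓝 (northPole (m + 1)), (stereo ∘ sphereFlip) (sphereMap ζ s lam x) =
      lam⁻¹ • (stereo ∘ sphereFlip) x := by
  filter_upwards [sphereMap_eventuallyEq_northPole h hs] with x hx
  rw [hx, Function.comp_apply, sphereFlip_sphereFlip, stereo_stereoInv, Function.comp_apply]

theorem stereo_southPole : stereo (southPole n) = 0 := by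
  rw [← stereoInv_zero, stereo_stereoInv]

theorem hasFDerivAt_gluedMap_southPole (h : IsPixtonConjugator A ζ) (hs : IsGluePair s lam) :
    HasFDerivAt (gluedMap ζ s lam) (axialMap m lam lam) (stereo (southPole (m + 1))) := by
  rw [stereo_southPole, axialMap_self]
  exact hasFDerivAt_gluedMap_zero h hs

theorem hasFDerivAt_smul_axialMap (x : Euc (m + 1)) :
    HasFDerivAt (fun y : Euc (m + 1) => lam • y) (axialMap m lam lam) x := by
  rw [axialMap_self]
  exact (hasFDerivAt_id x).fun_const_smul lam

theorem eigenvalues_southPole (h : IsPixtonConjugator A ζ) (hs : IsGluePair s lam) :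
    eigenvalues (differentialAt (sphereMap ζ s lam) (southPole (m + 1))) =
      (lam : ℂ) ::ₘ Multiset.replicate m (lam : ℂ) := by
  rw [← eigenvalues_axialMap]
  exact (isChartPair_stereo southPole_ne_northPole).eigenvalues_differentialAt
    ((contMDiff_sphereMap h hs).mdifferentiableAt one_ne_zero) (sphereMap_southPole h)
    (hasFDerivAt_gluedMap_southPole h hs) (conj_southPole ζ s lam)

theorem eigenvalues_northPole (h : IsPixtonConjugator A ζ) (hs : IsGluePair s lam) :
    eigenvalues (differentialAt (sphereMap ζ s lam) (northPole (m + 1))) =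
      ((lam⁻¹ : ℝ) : ℂ) ::ₘ Multiset.replicate m ((lam⁻¹ : ℝ) : ℂ) := by
  rw [← eigenvalues_axialMap]
  exact (isChartPair_flip southPole_ne_northPole.symm).eigenvalues_differentialAt
    ((contMDiff_sphereMap h hs).mdifferentiableAt one_ne_zero) sphereMap_northPole
    (hasFDerivAt_smul_axialMap _) (conj_northPole h hs)

theorem isChartPair_axis (h : IsConjugator A ζ) (t : ℝ) :
    IsChartPair (ζ ∘ stereo) (cylinderInSphere ζ) (axisInSphere ζ t) :=
  isChartPair_cylinder h (y := axisPoint m t) (by simp)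

theorem apply_axisInSphere (h : IsConjugator A ζ) (t : ℝ) :
    (ζ ∘ stereo) (axisInSphere ζ t) = axisPoint m t :=
  cylinderInSphere_apply h (axisPoint_mem_cylinder t)

theorem conj_axis (h : IsConjugator A ζ) (t : ℝ) :
    ∀ᶠ x in 𝓝 (axisInSphere ζ t),
      (ζ ∘ stereo) (sphereMap ζ s lam x) = modelFlow s ((ζ ∘ stereo) x) :=
  conj_cylinder h (y := axisPoint m t) (by simp)

theorem hasFDerivAt_modelFlow_axisInSphere (h : IsConjugator A ζ) {t : ℝ} (ht : t ^ 2 = 1) :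
    HasFDerivAt (modelFlow 1) (axialMap m (Real.exp (4 / 3 * t)) (Real.exp (-1)))
      ((ζ ∘ stereo) (axisInSphere ζ t)) := by
  rw [apply_axisInSphere h]
  exact hasFDerivAt_modelFlow_axisPoint ht

theorem eigenvalues_axisInSphere (h : IsPixtonConjugator A ζ) {t : ℝ} (ht : t ^ 2 = 1) :
    eigenvalues (differentialAt (sphereMap ζ 1 2⁻¹) (axisInSphere ζ t)) =
      ((Real.exp (4 / 3 * t) : ℝ) : ℂ) ::ₘ Multiset.replicate m ((Real.exp (-1) : ℝ) : ℂ) := by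
  rw [← eigenvalues_axialMap]
  exact (isChartPair_axis h.toIsConjugator t).eigenvalues_differentialAt
    ((contMDiff_sphereMap h isGluePair_one).mdifferentiableAt one_ne_zero)
    (sphereMap_axisInSphere_fixed h.toIsConjugator ht)
    (hasFDerivAt_modelFlow_axisInSphere h.toIsConjugator ht) (conj_axis h.toIsConjugator t)

theorem isSink_of_eigenvalues {g : Sph n → Sph n} {p : Sph n} {a b : ℝ} (hp : g p = p)
    (he : eigenvalues (differentialAt g p) = (a : ℂ) ::ₘ Multiset.replicate m (b : ℂ))
    (ha : |a| < 1) (hb : |b| < 1) : IsSink g p := by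
  have : ∀ μ ∈ eigenvalues (differentialAt g p), ‖μ‖ < 1 := fun μ hμ => by
    rw [he, Multiset.mem_cons] at hμ
    rcases hμ with rfl | hμ
    · simpa using ha
    · rw [Multiset.eq_of_mem_replicate hμ]; simpa using hb
  exact ⟨⟨hp, fun μ hμ => (this μ hμ).ne⟩, this⟩

theorem isSource_of_eigenvalues {g : Sph n → Sph n} {p : Sph n} {a b : ℝ} (hp : g p = p)
    (he : eigenvalues (differentialAt g p) = (a : ℂ) ::ₘ Multiset.replicate m (b : ℂ))
    (ha : 1 < |a|) (hb : 1 < |b|) : IsSource g p := by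
  have : ∀ μ ∈ eigenvalues (differentialAt g p), 1 < ‖μ‖ := fun μ hμ => by
    rw [he, Multiset.mem_cons] at hμ
    rcases hμ with rfl | hμ
    · simpa using ha
    · rw [Multiset.eq_of_mem_replicate hμ]; simpa using hb
  exact ⟨⟨hp, fun μ hμ => (this μ hμ).ne'⟩, this⟩

theorem isSaddle_of_eigenvalues {g : Sph n → Sph n} {p : Sph n} {a b : ℝ} (hm : 1 ≤ m)
    (hp : g p = p)
    (he : eigenvalues (differentialAt g p) = (a : ℂ) ::ₘ Multiset.replicate m (b : ℂ))
    (ha : 1 < |a|) (hb : |b| < 1) : IsSaddle g p 1 := by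
  have ha' : 1 < ‖(a : ℂ)‖ := by simpa using ha
  have hb' : ‖(b : ℂ)‖ < 1 := by simpa using hb
  refine ⟨⟨hp, fun μ hμ => ?_⟩, ⟨b, ?_, hb'⟩, ⟨a, ?_, ha'⟩, ?_⟩
  · rw [he, Multiset.mem_cons] at hμ
    rcases hμ with rfl | hμ
    · exact ha'.ne'
    · rw [Multiset.eq_of_mem_replicate hμ]; exact hb'.ne
  · rw [he, Multiset.mem_cons, Multiset.mem_replicate]; exact Or.inr ⟨by omega, rfl⟩
  · rw [he]; exact Multiset.mem_cons_self _ _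
  · rw [he, Multiset.countP_cons_of_pos (p := fun μ : ℂ => 1 < ‖μ‖) _ ha', Multiset.countP_eq_zero.2]
    intro μ hμ
    rw [Multiset.eq_of_mem_replicate hμ]; exact hb'.le.not_gt

theorem isSink_southPole (h : IsPixtonConjugator A ζ) :
    IsSink (sphereMap ζ 1 2⁻¹) (southPole (m + 1)) :=
  isSink_of_eigenvalues (sphereMap_southPole h) (eigenvalues_southPole h isGluePair_one)
    (by norm_num [abs_of_pos]) (by norm_num [abs_of_pos])

theorem isSource_northPole (h : IsPixtonConjugator A ζ) :
    IsSource (sphereMap ζ 1 2⁻¹) (northPole (m + 1)) :=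
  isSource_of_eigenvalues sphereMap_northPole (eigenvalues_northPole h isGluePair_one)
    (by norm_num) (by norm_num)

theorem isSink_axisInSphere (h : IsPixtonConjugator A ζ) :
    IsSink (sphereMap ζ 1 2⁻¹) (axisInSphere ζ (-1)) :=
  isSink_of_eigenvalues (sphereMap_axisInSphere_fixed h.toIsConjugator (by norm_num))
    (eigenvalues_axisInSphere h (by norm_num)) (by simp) (by simp)

theorem isSaddle_axisInSphere (hm : 1 ≤ m) (h : IsPixtonConjugator A ζ) :
    IsSaddle (sphereMap ζ 1 2⁻¹) (axisInSphere ζ 1) 1 :=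
  isSaddle_of_eigenvalues hm (sphereMap_axisInSphere_fixed h.toIsConjugator (by norm_num))
    (eigenvalues_axisInSphere h (by norm_num)) (by simp) (by simp)

/-! ### Stable and unstable sets -/

theorem isOpen_stableSet_southPole (h : IsPixtonConjugator A ζ) :
    IsOpen (stableSet (sphereMap ζ 1 2⁻¹) (southPole (m + 1))) :=
  (isChartPair_stereo southPole_ne_northPole).isOpen_stableSet
    (continuous_sphereMap h isGluePair_one) (sphereMap_southPole h)
    (hasFDerivAt_gluedMap_southPole h isGluePair_one) (c := 2⁻¹) (by norm_num)
    (norm_axialMap_le (by norm_num [abs_of_pos]) (by norm_num [abs_of_pos])) (conj_southPole ζ 1 _)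

theorem stableSet_symm_southPole (h : IsPixtonConjugator A ζ) :
    stableSet (sphereMap ζ (-1) 2) (southPole (m + 1)) ⊆ {southPole (m + 1)} :=
  (isChartPair_stereo southPole_ne_northPole).stableSet_inverse
    (continuous_sphereMap h isGluePair_one) (sphereMap_southPole h)
    (hasFDerivAt_gluedMap_southPole h isGluePair_one) (c := 2⁻¹) (by norm_num)
    (norm_axialMap_le (by norm_num [abs_of_pos]) (by norm_num [abs_of_pos])) (conj_southPole ζ 1 _)
    (fun x => (pixtonDiffeo h).apply_symm_apply x) (sphereMap_southPole h)

theorem isOpen_stableSet_symm_northPole (h : IsPixtonConjugator A ζ) :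
    IsOpen (stableSet (sphereMap ζ (-1) 2) (northPole (m + 1))) :=
  (isChartPair_flip southPole_ne_northPole.symm).isOpen_stableSet
    (continuous_sphereMap h isGluePair_neg_one) sphereMap_northPole
    (hasFDerivAt_smul_axialMap _) (c := 2⁻¹) (by norm_num)
    (norm_axialMap_le (by norm_num [abs_of_pos]) (by norm_num [abs_of_pos]))
    (conj_northPole h isGluePair_neg_one)

theorem stableSet_northPole (h : IsPixtonConjugator A ζ) :
    stableSet (sphereMap ζ 1 2⁻¹) (northPole (m + 1)) ⊆ {northPole (m + 1)} :=
  (isChartPair_flip southPole_ne_northPole.symm).stableSet_inverse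
    (continuous_sphereMap h isGluePair_neg_one) sphereMap_northPole
    (hasFDerivAt_smul_axialMap _) (c := 2⁻¹) (by norm_num)
    (norm_axialMap_le (by norm_num [abs_of_pos]) (by norm_num [abs_of_pos]))
    (conj_northPole h isGluePair_neg_one)
    (fun x => (pixtonDiffeo h).symm_apply_apply x) sphereMap_northPole

/-- At the sink `ω` both multipliers are bounded by `exp (-1)`, which serves as contraction
constant. -/
theorem exp_sink_lt_one : Real.exp (4 / 3 * (-1)) ≤ Real.exp (-1) := by
  rw [Real.exp_le_exp]; norm_num

theorem isOpen_stableSet_axisInSphere (h : IsPixtonConjugator A ζ) :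
    IsOpen (stableSet (sphereMap ζ 1 2⁻¹) (axisInSphere ζ (-1))) :=
  (isChartPair_axis h.toIsConjugator (-1)).isOpen_stableSet
    (continuous_sphereMap h isGluePair_one)
    (sphereMap_axisInSphere_fixed h.toIsConjugator (by norm_num))
    (hasFDerivAt_modelFlow_axisInSphere h.toIsConjugator (by norm_num))
    (c := Real.exp (-1)) (by simp)
    (norm_axialMap_le (by simpa using exp_sink_lt_one) (by simp))
    (conj_axis h.toIsConjugator _)

theorem stableSet_symm_axisInSphere (h : IsPixtonConjugator A ζ) :
    stableSet (sphereMap ζ (-1) 2) (axisInSphere ζ (-1)) ⊆ {axisInSphere ζ (-1)} :=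
  (isChartPair_axis h.toIsConjugator (-1)).stableSet_inverse
    (continuous_sphereMap h isGluePair_one)
    (sphereMap_axisInSphere_fixed h.toIsConjugator (by norm_num))
    (hasFDerivAt_modelFlow_axisInSphere h.toIsConjugator (by norm_num))
    (c := Real.exp (-1)) (by simp)
    (norm_axialMap_le (by simpa using exp_sink_lt_one) (by simp))
    (conj_axis h.toIsConjugator _)
    (fun x => (pixtonDiffeo h).apply_symm_apply x)
    (sphereMap_axisInSphere_fixed h.toIsConjugator (by norm_num))

theorem mem_stableSet_axisInSphere (h : IsConjugator A ζ) {t : ℝ} (ht : t ^ 2 = 1)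
    {z : Euc (m + 1)} (hz : z ∈ cylinder m)
    (hlim : Tendsto (fun k : ℕ => modelFlow (s * k) z) atTop (𝓝 (axisPoint m t))) :
    cylinderInSphere ζ z ∈ stableSet (sphereMap ζ s lam) (axisInSphere ζ t) := by
  rw [mem_stableSet_iff (sphereMap_axisInSphere_fixed h ht)]
  have h1 := (contMDiffAt_cylinderInSphere h (y := axisPoint m t) (by simp)).continuousAt
  exact (h1.tendsto.comp hlim).congr fun k => (iterate_sphereMap_cylinderInSphere h hz k).symm

/-- Orbits that start outside the tube stay outside, whereas an orbit tending to a point of the axis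
eventually enters it. So the whole stable set can be read in the cylinder. -/
theorem exists_of_mem_stableSet (h : IsConjugator A ζ) (hs : IsGluePair s lam) {t : ℝ}
    (ht : t ^ 2 = 1) {x : Sph (m + 1)} (hx : x ∈ stableSet (sphereMap ζ s lam) (axisInSphere ζ t)) :
    ∃ z ∈ cylinder m, x = cylinderInSphere ζ z ∧
      Tendsto (fun k : ℕ => modelFlow (s * k) z) atTop (𝓝 (axisPoint m t)) := by
  have hfix := sphereMap_axisInSphere_fixed (s := s) (lam := lam) h ht
  have hxN : x ≠ northPole (m + 1) := by
    rintro rfl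
    exact axisInSphere_ne_northPole t (stableSet_fixed_eq sphereMap_northPole hfix hx).symm
  rw [mem_stableSet_iff hfix] at hx
  have hA : stereo x ∈ A := by
    by_contra hA
    obtain ⟨k, hk⟩ := (hx.eventually (eventually_mem h (y := axisPoint m t) (by simp))).exists
    have h1 := iterate_sphereMap_of_notMem h hs hA k
    rw [stereoInv_stereo hxN] at h1
    rw [h1.1, stereo_stereoInv] at hk
    exact h1.2 hk.2
  refine ⟨ζ (stereo x), h.mapsTo hA, eq_cylinderInSphere h hxN hA, ?_⟩
  have h1 := (isChartPair_axis h t).continuousAt.tendsto.comp hx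
  rw [apply_axisInSphere h] at h1
  refine h1.congr fun k => ?_
  rw [Function.comp_apply, eq_cylinderInSphere h hxN hA,
    iterate_sphereMap_cylinderInSphere h (h.mapsTo hA), Function.comp_apply,
    cylinderInSphere_apply h (modelFlow_mem_cylinder (h.mapsTo hA) _),
    cylinderInSphere_apply h (h.mapsTo hA)]

theorem tendsto_axisPoint_iff {c : ℕ → ℝ} {t : ℝ} :
    Tendsto (fun k => axisPoint m (c k)) atTop (𝓝 (axisPoint m t)) ↔ Tendsto c atTop (𝓝 t) := by
  refine ⟨fun h => ?_, fun h => (continuous_axisPoint.tendsto t).comp h⟩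
  have : Continuous fun x : Euc (m + 1) => x 0 := by fun_prop
  simpa [Function.comp_def] using (this.tendsto _).comp h

/-- Backward in time the distance to the axis does not decrease, so it can tend to 0 only if it
vanishes from the start. On the axis, points `≤ -1` never pass `-1`, and all others tend to the
saddle in backward time. -/
theorem unstableSet_saddle (h : IsConjugator A ζ) :
    stableSet (sphereMap ζ (-1) 2) (axisInSphere ζ 1) = axisInSphere ζ '' Ioi (-1) := by
  ext x
  constructor
  · intro hx
    obtain ⟨z, hz, rfl, hlim⟩ := exists_of_mem_stableSet h isGluePair_neg_one (by norm_num) hx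
    have hu : axisDistSq z = 0 := by
      refine le_antisymm ?_ (axisDistSq_nonneg z)
      have h1 := (continuous_axisDistSq.tendsto _).comp hlim
      rw [axisDistSq_axisPoint] at h1
      refine ge_of_tendsto' h1 fun k => ?_
      have := antitone_axisDistSq_modelFlow z (show (-1 : ℝ) * k ≤ 0 by
        have := Nat.cast_nonneg (α := ℝ) k; linarith)
      simpa using this
    have hz' := eq_axisPoint_of_axisDistSq_eq_zero hu
    refine ⟨z 0, ?_, by rw [axisInSphere_eq, ← hz']⟩
    by_contra hle
    rw [mem_Ioi, not_lt] at hle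
    rw [hz'] at hlim
    have hc : Continuous fun x : Euc (m + 1) => x 0 := by fun_prop
    have h1 := (hc.tendsto _).comp hlim
    rw [axisPoint_zero] at h1
    have := le_of_tendsto' h1 fun k => modelFlow_axisPoint_le hle (-1 * k)
    linarith
  · rintro ⟨t, ht, rfl⟩
    refine mem_stableSet_axisInSphere h (by norm_num) (axisPoint_mem_cylinder t) ?_
    have h1 := tendsto_axisPoint_iff (m := m).2 (tendsto_modelFlow_neg_axisPoint (m := m) ht)
    refine h1.congr fun k => ?_
    rw [← modelFlow_axisPoint_eq, neg_one_mul]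

theorem axisInSphere_mem_basin (h : IsConjugator A ζ) :
    axisInSphere ζ '' Ioo (-1) 1 ⊆ stableSet (sphereMap ζ 1 2⁻¹) (axisInSphere ζ (-1)) := by
  rintro _ ⟨t, ht, rfl⟩
  refine mem_stableSet_axisInSphere h (by norm_num) (axisPoint_mem_cylinder t) ?_
  have h1 := tendsto_axisPoint_iff (m := m).2 (tendsto_modelFlow_axisPoint (m := m) ht)
  refine h1.congr fun k => ?_
  rw [← modelFlow_axisPoint_eq, one_mul]

/-- A homoclinic point would lie on the axis. Below the saddle forward orbits tend to `-1`, above it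
they move further up. -/
theorem homoclinic_saddle (h : IsConjugator A ζ) {x : Sph (m + 1)}
    (hs : x ∈ stableSet (sphereMap ζ 1 2⁻¹) (axisInSphere ζ 1))
    (hu : x ∈ stableSet (sphereMap ζ (-1) 2) (axisInSphere ζ 1)) : x = axisInSphere ζ 1 := by
  rw [unstableSet_saddle h] at hu
  obtain ⟨t, ht, rfl⟩ := hu
  obtain ⟨z, hz, hzt, hlim⟩ := exists_of_mem_stableSet h isGluePair_one (by norm_num) hs
  have hz' := injOn_cylinderInSphere h (axisPoint_mem_cylinder t) hz hzt
  subst hz'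
  have hc : Continuous fun x : Euc (m + 1) => x 0 := by fun_prop
  have h1 : Tendsto (fun k : ℕ => modelFlow k (axisPoint m t) 0) atTop (𝓝 1) := by
    simpa [Function.comp_def] using (hc.tendsto _).comp hlim
  rcases lt_trichotomy t 1 with hlt | rfl | hgt
  · have := tendsto_nhds_unique h1 (tendsto_modelFlow_axisPoint ⟨ht, hlt⟩)
    norm_num at this
  · rfl
  · have := ge_of_tendsto' h1 fun k => (by
      simpa using monotone_modelFlow_axisPoint (m := m) hgt (Nat.cast_nonneg (α := ℝ) k) :
        t ≤ modelFlow (k : ℝ) (axisPoint m t) 0)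
    linarith

/-! ### Separatrices -/

/-- The coordinate `φ` maps a connected subset of the punctured curve onto an interval that avoids
1, so a component cannot reach the other side. Continuity of `φ` is needed only at points of the
curve. -/
theorem components_of_punctured_curve {X : Type*} [TopologicalSpace X] {c : ℝ → X} {φ : X → ℝ}
    (hc : Continuous c) (hφ : ∀ t, φ (c t) = t) (hφc : ∀ t, ContinuousAt φ (c t)) :
    {L | ∃ x ∈ c '' Ioi (-1) \ {c 1}, L = connectedComponentIn (c '' Ioi (-1) \ {c 1}) x} =
      {c '' Ioo (-1) 1, c '' Ioi 1} := by
  have hinj : Function.Injective c := Function.LeftInverse.injective hφ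
  set W := c '' Ioi (-1) \ {c 1} with hW
  have hWmem : ∀ t, -1 < t → t ≠ 1 → c t ∈ W := fun t ht h1 =>
    ⟨⟨t, ht, rfl⟩, fun h => h1 (hinj h)⟩
  have key : ∀ I : Set ℝ, IsPreconnected I → (∀ t ∈ I, -1 < t ∧ t ≠ 1) →
      (∀ s ∈ I, ∀ t, -1 < t → t ≠ 1 → t ∉ I → 1 ∈ uIcc s t) → ∀ s ∈ I,
      connectedComponentIn W (c s) = c '' I := by
    intro I hI hI1 hI2 s hs
    refine Subset.antisymm ?_ ?_
    · intro y hy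
      obtain ⟨⟨t, ht, rfl⟩, ht1⟩ := connectedComponentIn_subset _ _ hy
      by_contra hyI
      have htI : t ∉ I := fun h => hyI ⟨t, h, rfl⟩
      have h1 := hI2 s hs t ht (fun h => ht1 (by rw [h]; rfl)) htI
      have hcon : IsPreconnected (φ '' connectedComponentIn W (c s)) := by
        refine isPreconnected_connectedComponentIn.image _ fun z hz => ?_
        obtain ⟨⟨r, -, rfl⟩, -⟩ := connectedComponentIn_subset _ _ hz
        exact (hφc r).continuousWithinAt
      have hmem := hcon.ordConnected.uIcc_subset
        ⟨c s, mem_connectedComponentIn (hWmem s (hI1 s hs).1 (hI1 s hs).2), hφ s⟩ ⟨c t, hy, hφ t⟩ h1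
      obtain ⟨z, hz, hz1⟩ := hmem
      obtain ⟨⟨r, -, rfl⟩, hr⟩ := connectedComponentIn_subset _ _ hz
      rw [hφ] at hz1
      exact hr (by rw [hz1]; rfl)
    · refine (hI.image c hc.continuousOn).subset_connectedComponentIn ⟨s, hs, rfl⟩ ?_
      rintro _ ⟨t, ht, rfl⟩
      exact hWmem t (hI1 t ht).1 (hI1 t ht).2
  have k1 := key (Ioo (-1) 1) isPreconnected_Ioo (fun t ht => ⟨ht.1, ht.2.ne⟩)
    (fun s hs t ht h1 htI => by
      have : 1 ≤ t := not_lt.1 fun h => htI ⟨ht, h⟩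
      rw [uIcc_of_le (hs.2.le.trans this)]; exact ⟨hs.2.le, this⟩)
  have k2 := key (Ioi 1) isPreconnected_Ioi
    (fun t ht => ⟨by linarith [mem_Ioi.1 ht], (mem_Ioi.1 ht).ne'⟩)
    (fun s hs t ht h1 htI => by
      have : t ≤ 1 := not_lt.1 htI
      rw [uIcc_of_ge (this.trans (le_of_lt hs))]; exact ⟨this, le_of_lt hs⟩)
  ext L
  constructor
  · rintro ⟨x, ⟨⟨t, ht, rfl⟩, h1⟩, rfl⟩
    have h1' : t ≠ 1 := fun h => h1 (by rw [h]; rfl)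
    rcases lt_or_gt_of_ne h1' with hlt | hgt
    · exact Or.inl (k1 t ⟨ht, hlt⟩)
    · exact Or.inr (k2 t hgt)
  · rintro (rfl | rfl)
    · exact ⟨c 0, hWmem 0 (by norm_num) (by norm_num), (k1 0 (by norm_num)).symm⟩
    · exact ⟨c 2, hWmem 2 (by norm_num) (by norm_num), (k2 2 (by norm_num)).symm⟩

theorem unstableSeparatrices_pixtonDiffeo (h : IsPixtonConjugator A ζ) :
    unstableSeparatrices (pixtonDiffeo h) (axisInSphere ζ 1) =
      {axisInSphere ζ '' Ioo (-1) 1, axisInSphere ζ '' Ioi 1} := by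
  rw [unstableSeparatrices, coe_pixtonDiffeo_symm, unstableSet_saddle h.toIsConjugator]
  refine components_of_punctured_curve (φ := fun x => (ζ ∘ stereo) x 0)
    (continuous_axisInSphere h.toIsConjugator) (fun t => ?_) fun t => ?_
  · simp only [apply_axisInSphere h.toIsConjugator, axisPoint_zero]
  · have hc : Continuous fun x : Euc (m + 1) => x 0 := by fun_prop
    exact hc.continuousAt.comp (isChartPair_axis h.toIsConjugator t).continuousAt

/-! ### Transversality -/

theorem span_tangentVectors_of_mem_nhds_left {V W : Set (Sph n)} {x : Sph n} (hV : V ∈ 𝓝 x) :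
    Submodule.span ℝ (tangentVectors V x ∪ tangentVectors W x) = ⊤ := by
  rw [tangentVectors_eq_univ hV, univ_union, Submodule.span_univ]

theorem span_tangentVectors_of_mem_nhds_right {V W : Set (Sph n)} {x : Sph n} (hW : W ∈ 𝓝 x) :
    Submodule.span ℝ (tangentVectors V x ∪ tangentVectors W x) = ⊤ := by
  rw [tangentVectors_eq_univ hW, union_univ, Submodule.span_univ]

/-- The axis direction comes from the unstable manifold, each of the `m` orthogonal directions from
a curve of `exists_stable_curve`; the coefficients `2` undo its speed `2⁻¹`. -/
theorem span_tangentVectors_saddle (h : IsConjugator A ζ) :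
    Submodule.span ℝ
      (tangentVectors (stableSet (sphereMap ζ 1 2⁻¹) (axisInSphere ζ 1)) (axisInSphere ζ 1) ∪
        tangentVectors (stableSet (sphereMap ζ (-1) 2) (axisInSphere ζ 1)) (axisInSphere ζ 1)) =
      ⊤ := by
  have hch := isChartPair_axis h 1
  obtain ⟨e, -, he⟩ := hch.mfderiv_comp
  rw [eq_top_iff]
  rintro v -
  rw [← e.symm_apply_apply v]
  have hdec : e v = (e v 0) • axisPoint m 1 + ∑ i : Fin m, (2 * e v i.succ) •
      ((2 : ℝ)⁻¹ • EuclideanSpace.single i.succ (1 : ℝ)) := by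
    ext j
    refine Fin.cases ?_ (fun j => ?_) j
    · simp [Fin.succ_ne_zero, Finset.sum_apply]
    · simp [Finset.sum_apply, Pi.single_apply, Fin.succ_inj]
      ring
  rw [hdec, map_add, map_smul, map_sum]
  refine Submodule.add_mem _ (Submodule.smul_mem _ _ (Submodule.subset_span (Or.inr ?_)))
    (Submodule.sum_mem _ fun i _ => ?_)
  · rw [he]
    refine hch.mem_tangentVectors (c := fun t => axisPoint m (1 + Real.sin t)) ?_ ?_ ?_ ?_ ?_
    · have : ContDiff ℝ 1 (fun t => (1 + Real.sin t) • axisPoint m 1) :=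
        (contDiff_const.add Real.contDiff_sin).smul contDiff_const
      simpa only [← axisPoint_eq_smul] using this
    · rw [apply_axisInSphere h]; simp
    · have := ((Real.hasDerivAt_sin 0).const_add 1).smul_const (axisPoint m 1)
      rw [Real.cos_zero, one_smul] at this
      exact this.congr_of_eventuallyEq (Eventually.of_forall fun t => axisPoint_eq_smul _)
    · exact fun t => contMDiffAt_cylinderInSphere h (by simp)
    · intro t
      rw [unstableSet_saddle h]
      exact ⟨_, by rw [mem_Ioi]; linarith [Real.neg_one_le_sin t], rfl⟩
  · rw [map_smul]
    refine Submodule.smul_mem _ _ (Submodule.subset_span (Or.inl ?_))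
    obtain ⟨c, hc, hc0, hcd, hcs⟩ := exists_stable_curve i
    rw [he]
    refine hch.mem_tangentVectors hc (by rw [hc0, apply_axisInSphere h]) hcd ?_ ?_
    · exact fun t => contMDiffAt_cylinderInSphere h (hcs t).1
    · intro t
      refine mem_stableSet_axisInSphere h (by norm_num) (mem_cylinder.2 (hcs t).1.le) ?_
      simpa using (hcs t).2

/-- If `p` is a sink or `q` the source, one of the two manifolds is open. The stable manifold of the
source is a point, which forces `q` to be the source. What remains is `p` the saddle: against a sink
the intersection is empty, against itself it is the saddle only. -/
theorem isMorseSmale_pixtonDiffeo (hm : 1 ≤ m) (h : IsPixtonConjugator A ζ) :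
    IsMorseSmale (pixtonDiffeo h) := by
  have hσ := sphereMap_axisInSphere_fixed (s := 1) (lam := 2⁻¹) h.toIsConjugator
    (t := 1) (by norm_num)
  refine ⟨?_, ?_, ?_⟩
  · rw [nonWanderingSet_pixtonDiffeo h]
    exact Set.toFinite _
  · intro p hp
    refine ⟨1, one_pos, ?_⟩
    rw [Function.iterate_one, coe_pixtonDiffeo]
    rw [nonWanderingSet_pixtonDiffeo h] at hp
    rcases hp with rfl | rfl | rfl | rfl
    · exact (isSink_axisInSphere h).1
    · exact (isSink_southPole h).1
    · exact (isSaddle_axisInSphere hm h).1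
    · exact (isSource_northPole h).1
  · rw [nonWanderingSet_pixtonDiffeo h, coe_pixtonDiffeo, coe_pixtonDiffeo_symm]
    rintro p hp q hq x ⟨hxp, hxq⟩
    have hN : q = northPole (m + 1) → Submodule.span ℝ
        (tangentVectors (stableSet (sphereMap ζ 1 2⁻¹) p) x ∪
          tangentVectors (stableSet (sphereMap ζ (-1) 2) q) x) = ⊤ := by
      rintro rfl
      exact span_tangentVectors_of_mem_nhds_right
        ((isOpen_stableSet_symm_northPole h).mem_nhds hxq)
    have hqfix : sphereMap ζ (-1) 2 q = q := by
      rcases hq with rfl | rfl | rfl | rfl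
      · exact sphereMap_axisInSphere_fixed h.toIsConjugator (by norm_num)
      · exact sphereMap_southPole h
      · exact sphereMap_axisInSphere_fixed h.toIsConjugator (by norm_num)
      · exact sphereMap_northPole
    rcases hp with rfl | rfl | rfl | rfl
    · exact span_tangentVectors_of_mem_nhds_left
        ((isOpen_stableSet_axisInSphere h).mem_nhds hxp)
    · exact span_tangentVectors_of_mem_nhds_left ((isOpen_stableSet_southPole h).mem_nhds hxp)
    · rcases hq with rfl | rfl | rfl | rfl
      · obtain rfl := stableSet_symm_axisInSphere h hxq
        have := stableSet_fixed_eq (sphereMap_axisInSphere_fixed h.toIsConjugator (by norm_num))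
          hσ hxp
        have := injective_axisInSphere h.toIsConjugator this
        norm_num at this
      · obtain rfl := stableSet_symm_southPole h hxq
        exact absurd (stableSet_fixed_eq (sphereMap_southPole h) hσ hxp).symm
          (axisInSphere_ne_southPole h 1)
      · obtain rfl := homoclinic_saddle h.toIsConjugator hxp hxq
        exact span_tangentVectors_saddle h.toIsConjugator
      · exact hN rfl
    · obtain rfl := stableSet_northPole h hxp
      exact hN (stableSet_fixed_eq sphereMap_northPole hqfix hxq).symm

theorem hasPixtonDynamics (hm : 1 ≤ m) (h : IsPixtonConjugator A ζ) {γ : Set (Euc (m + 1))}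
    (hγ : γ ⊆ A) : HasPixtonDynamics γ ζ := by
  have hinj := injective_axisInSphere h.toIsConjugator
  refine ⟨pixtonDiffeo h, fun x => rfl, isMorseSmale_pixtonDiffeo hm h,
    nonWanderingSet_pixtonDiffeo h, ?_, isSink_axisInSphere h, isSink_southPole h,
    isSaddle_axisInSphere hm h, isSource_northPole h, unstableSeparatrices_pixtonDiffeo h,
    axisInSphere_mem_basin h.toIsConjugator, ?_⟩
  · rw [nonWanderingSet_pixtonDiffeo h]
    have h1 : axisInSphere ζ (-1) ≠ axisInSphere ζ 1 := fun hc => by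
      have := hinj hc
      norm_num at this
    rw [ncard_insert_of_notMem, ncard_insert_of_notMem, ncard_pair]
    · exact axisInSphere_ne_northPole 1
    · simp [(axisInSphere_ne_southPole h 1).symm, southPole_ne_northPole]
    · simp [axisInSphere_ne_southPole h (-1), h1, axisInSphere_ne_northPole]
  · intro hax L hL
    have hmem : ∀ t, axisInSphere ζ t ∈ stereoInv '' γ := fun t => by
      obtain ⟨y, hy, hyt⟩ : axisPoint m t ∈ ζ '' γ := hax ▸ mem_range_self t
      refine ⟨y, hy, ?_⟩
      rw [axisInSphere, ← hyt, h.left_inv (hγ hy)]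
    rw [unstableSeparatrices_pixtonDiffeo h] at hL
    rcases hL with rfl | rfl <;> rintro _ ⟨t, -, rfl⟩ <;> exact hmem t

end

end

/-! ### Coverings, degrees and straightening of tubular neighbourhoods. -/

section

variable {n m : ℕ}

/-! ### Local diffeomorphisms -/

section LocalDiffeo

variable {E F H G M N : Type*} [NormedAddCommGroup E] [NormedSpace ℝ E] [NormedAddCommGroup F]
  [NormedSpace ℝ F] [TopologicalSpace H] [TopologicalSpace G] {I : ModelWithCorners ℝ E H}
  {J : ModelWithCorners ℝ F G} [TopologicalSpace M] [ChartedSpace H M] [TopologicalSpace N]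
  [ChartedSpace G N] {k : WithTop ℕ∞}

theorem isLocalDiffeomorphAt_of_inverse {f : M → N} {g : N → M} {x : M}
    (hf : ∀ᶠ x' in 𝓝 x, ContMDiffAt I J k f x') (hg : ∀ᶠ y in 𝓝 (f x), ContMDiffAt J I k g y)
    (hl : ∀ᶠ x' in 𝓝 x, g (f x') = x') (hr : ∀ᶠ y in 𝓝 (f x), f (g y) = y) :
    IsLocalDiffeomorphAt I J k f x := by
  obtain ⟨U, hU, hUo, hxU⟩ := eventually_nhds_iff.1 (hf.and hl)
  obtain ⟨V, hV, hVo, hxV⟩ := eventually_nhds_iff.1 (hg.and hr)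
  have hfU : ContinuousOn f U := fun z hz => (hU z hz).1.continuousAt.continuousWithinAt
  have hgV : ContinuousOn g V := fun z hz => (hV z hz).1.continuousAt.continuousWithinAt
  refine ⟨{ toFun := f
            invFun := g
            source := U ∩ f ⁻¹' V
            target := V ∩ g ⁻¹' U
            map_source' := fun z hz => ⟨hz.2, by rw [mem_preimage, (hU z hz.1).2]; exact hz.1⟩
            map_target' := fun z hz => ⟨hz.2, by rw [mem_preimage, (hV z hz.1).2]; exact hz.1⟩
            left_inv' := fun z hz => (hU z hz.1).2
            right_inv' := fun z hz => (hV z hz.1).2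
            open_source := hfU.isOpen_inter_preimage hUo hVo
            open_target := hgV.isOpen_inter_preimage hVo hUo
            contMDiffOn_toFun := fun z hz => (hU z hz.1).1.contMDiffWithinAt
            contMDiffOn_invFun := fun z hz => (hV z hz.1).1.contMDiffWithinAt },
    ⟨hxU, hxV⟩, fun z _ => rfl⟩

theorem eventually_contMDiffAt_of_isLocalDiffeomorphAt {f : M → N} {x : M}
    (h : IsLocalDiffeomorphAt I J k f x) : ∀ᶠ x' in 𝓝 x, ContMDiffAt I J k f x' := by
  obtain ⟨Φ, hx, he⟩ := h
  filter_upwards [Φ.open_source.mem_nhds hx] with z hz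
  exact IsLocalDiffeomorphAt.contMDiffAt ⟨Φ, hz, he⟩

theorem isLocalDiffeomorphAt_congr {f f' : M → N} {x : M} (h : IsLocalDiffeomorphAt I J k f x)
    (he : f' =ᶠ[𝓝 x] f) : IsLocalDiffeomorphAt I J k f' x := by
  have hx : f' x = f x := he.self_of_nhds
  have hev := eventually_eventually_nhds.2 he
  have hinv := h.localInverse_contMDiffAt.continuousAt
  have hxx : h.localInverse (f x) = x := h.localInverse_left_inv h.localInverse_mem_target
  refine isLocalDiffeomorphAt_of_inverse (g := h.localInverse) ?_ ?_ ?_ ?_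
  · filter_upwards [hev, eventually_contMDiffAt_of_isLocalDiffeomorphAt h] with z h1 h2
    exact h2.congr_of_eventuallyEq h1
  · rw [hx]
    filter_upwards [h.localInverse_open_source.mem_nhds h.localInverse_mem_source] with y hy
    exact h.localInverse_contMDiffOn.contMDiffAt (h.localInverse_open_source.mem_nhds hy)
  · filter_upwards [he, h.localInverse_eventuallyEq_left] with z h1 h2
    rw [h1]; exact h2
  · rw [hx]
    have : ∀ᶠ y in 𝓝 (f x), f' (h.localInverse y) = f (h.localInverse y) :=
      hinv.eventually (by rw [hxx]; exact he)
    filter_upwards [this, h.localInverse_eventuallyEq_right] with y h1 h2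
    rw [h1]; exact h2

theorem exists_injOn_of_isLocalDiffeomorphAt {f : M → N} {x : M}
    (h : IsLocalDiffeomorphAt I J k f x) : ∃ u ∈ 𝓝 x, InjOn f u := by
  obtain ⟨Φ, hx, he⟩ := h
  exact ⟨Φ.source, Φ.open_source.mem_nhds hx, fun y hy z hz hyz =>
    Φ.injOn hy hz (by rw [he hy, he hz] at hyz; exact hyz)⟩

theorem eventually_isLocalDiffeomorphAt {f : M → N} {x : M}
    (h : IsLocalDiffeomorphAt I J k f x) : ∀ᶠ z in 𝓝 x, IsLocalDiffeomorphAt I J k f z := by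
  obtain ⟨Φ, hx, he⟩ := h
  filter_upwards [Φ.open_source.mem_nhds hx] with z hz using ⟨Φ, hz, he⟩

/-- A right inverse that is continuous at `f x` and takes it back to `x` must coincide nearby with
the local inverse. -/
theorem isLocalDiffeomorphAt_localInverse {f : M → N} {x : M}
    (h : IsLocalDiffeomorphAt I J k f x) {g : N → M} (hg : ContinuousAt g (f x)) (hx : g (f x) = x)
    (hr : ∀ᶠ y in 𝓝 (f x), f (g y) = y) : IsLocalDiffeomorphAt J I k g (f x) := by
  refine isLocalDiffeomorphAt_congr h.localInverse_isLocalDiffeomorphAt ?_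
  have := hg.eventually (by rw [hx]; exact h.localInverse_eventuallyEq_left)
  filter_upwards [this, hr] with y h1 h2
  simp only [Function.comp_apply, id_eq] at h1
  rw [← h1, h2]

end LocalDiffeo

/-- The inverse function theorem. Smoothness of the inverse is needed at all nearby points, and it
holds because invertibility of the derivative is an open condition. -/
theorem isLocalDiffeomorphAt_of_hasFDerivAt {E : Type*} [NormedAddCommGroup E] [NormedSpace ℝ E]
    [CompleteSpace E] {f : E → E} (hf : ContDiff ℝ ∞ f) {x : E} {f' : E ≃L[ℝ] E}
    (h : HasFDerivAt f (f' : E →L[ℝ] E) x) : IsLocalDiffeomorphAt 𝓘(ℝ, E) 𝓘(ℝ, E) ∞ f x := by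
  have hs : HasStrictFDerivAt f (f' : E →L[ℝ] E) x :=
    hf.contDiffAt.hasStrictFDerivAt' h (by simp)
  set Φ := hs.toOpenPartialHomeomorph f with hΦ
  have hcoe : ⇑Φ = f := hs.toOpenPartialHomeomorph_coe
  have hx : x ∈ Φ.source := hs.mem_toOpenPartialHomeomorph_source
  have hunit : ∀ᶠ z in 𝓝 x, z ∈ Φ.source ∧ ∃ e : E ≃L[ℝ] E, (e : E →L[ℝ] E) = fderiv ℝ f z := by
    refine Filter.Eventually.and (Φ.open_source.mem_nhds hx) ?_
    have hc : ContinuousAt (fderiv ℝ f) x := (hf.continuous_fderiv (by simp)).continuousAt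
    refine hc.eventually (p := fun L => ∃ e : E ≃L[ℝ] E, (e : E →L[ℝ] E) = L) ?_
    rw [h.fderiv]
    exact ContinuousLinearEquiv.nhds f'
  refine isLocalDiffeomorphAt_of_inverse (g := Φ.symm)
    (Eventually.of_forall fun z => hf.contDiffAt.contMDiffAt) ?_ ?_ ?_
  · have h1 : ContinuousAt Φ.symm (f x) := by
      rw [← hcoe]; exact Φ.symm.continuousAt (Φ.map_source hx)
    have h2 : Φ.symm (f x) = x := by rw [← hcoe]; exact Φ.left_inv hx
    have h3 : ∀ᶠ y in 𝓝 (f x), y ∈ Φ.target :=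
      Φ.open_target.mem_nhds (by rw [← hcoe]; exact Φ.map_source hx)
    filter_upwards [h3, h1.eventually (by rw [h2]; exact hunit)] with y hy1 hy2
    obtain ⟨-, e, he⟩ := hy2
    refine (Φ.contDiffAt_symm (f₀' := e) hy1 ?_ ?_).contMDiffAt
    · rw [hcoe, he]; exact (hf.differentiable (by simp) _).hasFDerivAt
    · rw [hcoe]; exact hf.contDiffAt
  · filter_upwards [Φ.open_source.mem_nhds hx] with z hz
    rw [← hcoe]; exact Φ.left_inv hz
  · have h3 : ∀ᶠ y in 𝓝 (f x), y ∈ Φ.target :=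
      Φ.open_target.mem_nhds (by rw [← hcoe]; exact Φ.map_source hx)
    filter_upwards [h3] with y hy
    have := Φ.right_inv hy
    rwa [hcoe] at this

/-! ### The circle -/

/-- The parametrization of the circle with period one. -/
def circ (t : ℝ) : Circle := Circle.exp (2 * Real.pi * t)

theorem circ_eq_iff {s t : ℝ} : circ s = circ t ↔ ∃ j : ℤ, s = t + j := by
  rw [circ, circ, Circle.exp_eq_exp]
  have hp := Real.pi_pos
  refine exists_congr fun j => ⟨fun h => ?_, fun h => ?_⟩
  · have : 2 * Real.pi * s = 2 * Real.pi * (t + j) := by rw [h]; ring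
    exact mul_left_cancel₀ (by positivity) this
  · rw [h]; ring

theorem circ_add_int (t : ℝ) (j : ℤ) : circ (t + j) = circ t := circ_eq_iff.2 ⟨j, rfl⟩

theorem circ_add (s t : ℝ) : circ (s + t) = circ s * circ t := by
  rw [circ, mul_add, Circle.exp_add]; rfl

theorem circ_neg (t : ℝ) : circ (-t) = (circ t)⁻¹ := by
  rw [circ, mul_neg, Circle.exp_neg]; rfl

theorem contMDiff_circ {k : WithTop ℕ∞} : ContMDiff 𝓘(ℝ, ℝ) (𝓡 1) k circ :=
  contMDiff_circleExp.comp (contDiff_const.mul contDiff_id : ContDiff ℝ k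
    fun t : ℝ => 2 * Real.pi * t).contMDiff

theorem continuous_circ : Continuous circ := (contMDiff_circ (k := 0)).continuous

/-- The inverse branch of `circ` centred at `t`. -/
def turn (t : ℝ) (z : Circle) : ℝ := t + Complex.arg (z * (circ t)⁻¹ : Circle) / (2 * Real.pi)

theorem circ_turn (t : ℝ) (z : Circle) : circ (turn t z) = z := by
  have hp := Real.pi_pos
  have h : ∀ w : Circle, circ (Complex.arg w / (2 * Real.pi)) = w := fun w => by
    rw [circ, mul_div_cancel₀ _ (by positivity), Circle.exp_arg]
  rw [turn, circ_add, h, mul_comm, mul_assoc, inv_mul_cancel, mul_one]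

theorem turn_circ {t s : ℝ} (h : |s - t| < 1 / 2) : turn t (circ s) = s := by
  have hp := Real.pi_pos
  rw [abs_lt] at h
  rw [turn, ← circ_neg, ← circ_add, circ, Circle.arg_exp]
  · field_simp; ring
  · nlinarith
  · nlinarith

theorem contMDiff_coe_circle {k : WithTop ℕ∞} :
    ContMDiff (𝓡 1) 𝓘(ℝ, ℂ) k (fun z : Circle => (z : ℂ)) :=
  have := finrank_real_complex_fact'
  contMDiff_coe_sphere (E := ℂ) (n := 1)

theorem contMDiffAt_turn {k : WithTop ℕ∞} {t : ℝ} {z : Circle}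
    (hz : ((z * (circ t)⁻¹ : Circle) : ℂ) ∈ Complex.slitPlane) :
    ContMDiffAt (𝓡 1) 𝓘(ℝ, ℝ) k (turn t) z := by
  have h1 : ContMDiff (𝓡 1) (𝓡 1) ω (fun z : Circle => z * (circ t)⁻¹) :=
    contMDiff_id.mul contMDiff_const
  have h2 : ContMDiffAt (𝓡 1) 𝓘(ℝ, ℂ) k (fun z : Circle => ((z * (circ t)⁻¹ : Circle) : ℂ)) z :=
    (contMDiff_coe_circle.comp (h1.of_le le_top)).contMDiffAt
  have h3 : ContDiffAt ℝ k (fun w : ℂ => t + Complex.arg w / (2 * Real.pi))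
      ((z * (circ t)⁻¹ : Circle) : ℂ) := by
    have h4 : ContDiffAt ℝ k (fun w : ℂ => (Complex.log w).im) ((z * (circ t)⁻¹ : Circle) : ℂ) :=
      Complex.imCLM.contDiff.contDiffAt.comp _ ((Complex.contDiffAt_log hz).restrict_scalars ℝ)
    simp only [Complex.log_im] at h4
    exact contDiffAt_const.add (h4.div_const _)
  exact ContMDiffAt.comp (g := fun w : ℂ => t + Complex.arg w / (2 * Real.pi)) z h3.contMDiffAt h2

theorem eventually_contMDiffAt_turn {k : WithTop ℕ∞} (t : ℝ) :
    ∀ᶠ z in 𝓝 (circ t), ContMDiffAt (𝓡 1) 𝓘(ℝ, ℝ) k (turn t) z := by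
  have hc : Continuous fun z : Circle => ((z * (circ t)⁻¹ : Circle) : ℂ) := by fun_prop
  filter_upwards [(Complex.isOpen_slitPlane.preimage hc).mem_nhds (by simp)] with z hz
  exact contMDiffAt_turn hz

theorem turn_self (t : ℝ) : turn t (circ t) = t := turn_circ (by simp)

theorem eventually_turn_circ (t : ℝ) : ∀ᶠ s in 𝓝 t, turn t (circ s) = s := by
  filter_upwards [Metric.ball_mem_nhds t (show (0 : ℝ) < 1 / 2 by norm_num)] with s hs
  exact turn_circ (by simpa [Real.dist_eq] using hs)

/-! ### The covering -/

open Classical in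
/-- The covering, extended by an arbitrary value at the origin. -/
def cov (x : Euc (m + 1)) : Sph m × Circle :=
  if hx : x ≠ 0 then covering ⟨x, hx⟩ else (northPole m, 1)

theorem cov_eq_covering {x : Euc (m + 1)} (hx : x ≠ 0) : cov x = covering ⟨x, hx⟩ := dif_pos hx

theorem coe_cov_fst {x : Euc (m + 1)} (hx : x ≠ 0) :
    ((cov x).1 : Euc (m + 1)) = ‖x‖⁻¹ • x := by rw [cov_eq_covering hx]; rfl

theorem cov_snd {x : Euc (m + 1)} (hx : x ≠ 0) : (cov x).2 = circ (Real.logb 2 ‖x‖) := by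
  rw [cov_eq_covering hx]; rfl

theorem mem_coveringPreimage {S : Set (Sph m × Circle)} {x : Euc (m + 1)} :
    x ∈ coveringPreimage S ↔ x ≠ 0 ∧ cov x ∈ S := by
  constructor
  · rintro ⟨hx, h⟩; exact ⟨hx, by rwa [cov_eq_covering hx]⟩
  · rintro ⟨hx, h⟩; exact ⟨hx, by rwa [cov_eq_covering hx] at h⟩

theorem coveringImage_eq {B : Set (Euc (m + 1))} (hB : (0 : Euc (m + 1)) ∉ B) :
    coveringImage B = cov '' B := by
  ext y
  constructor
  · rintro ⟨x, hx, rfl⟩; exact ⟨x, hx, cov_eq_covering x.2⟩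
  · rintro ⟨x, hx, rfl⟩
    have hx0 : x ≠ 0 := fun h => hB (h ▸ hx)
    exact ⟨⟨x, hx0⟩, hx, (cov_eq_covering hx0).symm⟩

/-- The point with given direction and binary logarithm of the norm. -/
def expand (u : Sph m) (r : ℝ) : Euc (m + 1) := (2 : ℝ) ^ r • (u : Euc (m + 1))

theorem norm_coe_sph (u : Sph m) : ‖(u : Euc (m + 1))‖ = 1 := by simp

theorem norm_expand (u : Sph m) (r : ℝ) : ‖expand u r‖ = 2 ^ r := by
  rw [expand, norm_smul, norm_coe_sph, mul_one, Real.norm_of_nonneg (by positivity)]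

theorem expand_ne_zero (u : Sph m) (r : ℝ) : expand u r ≠ 0 := by
  rw [← norm_ne_zero_iff, norm_expand]; positivity

theorem cov_expand (u : Sph m) (r : ℝ) : cov (expand u r) = (u, circ r) := by
  refine Prod.ext (Subtype.ext ?_) ?_
  · rw [coe_cov_fst (expand_ne_zero u r), norm_expand, expand, smul_smul,
      inv_mul_cancel₀ (by positivity), one_smul]
  · rw [cov_snd (expand_ne_zero u r), norm_expand, Real.logb_rpow (by norm_num) (by norm_num)]

theorem expand_cov {x : Euc (m + 1)} (hx : x ≠ 0) : expand (cov x).1 (Real.logb 2 ‖x‖) = x := by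
  have hn : 0 < ‖x‖ := norm_pos_iff.2 hx
  rw [expand, coe_cov_fst hx, Real.rpow_logb (by norm_num) (by norm_num) hn, smul_smul,
    mul_inv_cancel₀ hn.ne', one_smul]

theorem expand_add_int (u : Sph m) (r : ℝ) (j : ℤ) :
    expand u (r + j) = (2 : ℝ) ^ j • expand u r := by
  rw [expand, expand, Real.rpow_add (by norm_num), Real.rpow_intCast, smul_smul, mul_comm]

theorem cov_zpow_smul (x : Euc (m + 1)) (j : ℤ) : cov ((2 : ℝ) ^ j • x) = cov x := by
  by_cases hx : x = 0
  · rw [hx, smul_zero]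
  conv_lhs => rw [← expand_cov hx, ← expand_add_int, cov_expand, circ_add_int, ← cov_snd hx]

theorem cov_eq_iff {x y : Euc (m + 1)} (hx : x ≠ 0) (hy : y ≠ 0) :
    cov x = cov y ↔ ∃ j : ℤ, x = (2 : ℝ) ^ j • y := by
  constructor
  · intro h
    have h2 := congrArg Prod.snd h
    rw [cov_snd hx, cov_snd hy, circ_eq_iff] at h2
    obtain ⟨j, hj⟩ := h2
    refine ⟨j, ?_⟩
    rw [← expand_cov hx, h, hj, expand_add_int, expand_cov hy]
  · rintro ⟨j, rfl⟩
    exact cov_zpow_smul y j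

/-- The formula for stereographic projection is smooth in the ambient space near any point with last
coordinate different from 1, so it can be composed with the map into `ℝⁿ⁺¹`; the North Pole is
handled by flipping. -/
theorem contMDiffAt_of_coe_sph {k : WithTop ℕ∞} {F H M : Type*} [NormedAddCommGroup F]
    [NormedSpace ℝ F] [TopologicalSpace H] {I : ModelWithCorners ℝ F H} [TopologicalSpace M]
    [ChartedSpace H M] {f : M → Sph n} {x : M} (hc : ContinuousAt f x)
    (hf : ContMDiffAt I 𝓘(ℝ, Euc (n + 1)) k (fun x => (f x : Euc (n + 1))) x) :
    ContMDiffAt I (𝓡 n) k f x := by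
  have key : ∀ g : M → Sph n, ContinuousAt g x →
      ContMDiffAt I 𝓘(ℝ, Euc (n + 1)) k (fun x => (g x : Euc (n + 1))) x → g x ≠ northPole n →
      ContMDiffAt I (𝓡 n) k g x := by
    intro g hgc hg hgN
    have h2 : ContDiffAt ℝ k (fun y : Euc (n + 1) =>
        (WithLp.toLp 2 (fun i : Fin n => y i.castSucc / (1 - y (Fin.last n))) : Euc n))
        (g x : Euc (n + 1)) := by
      rw [contDiffAt_euclidean]
      intro i
      refine ContDiffAt.div (by fun_prop) (by fun_prop) ?_
      have := last_lt_one hgN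
      linarith
    have h3 := contMDiff_stereoInv.contMDiffAt.comp x (h2.contMDiffAt.comp x hg)
    refine h3.congr_of_eventuallyEq ?_
    filter_upwards [hgc.eventually (isOpen_ne.mem_nhds hgN)] with z hz
    exact (stereoInv_stereo hz).symm
  by_cases hN : f x = northPole n
  · have h1 := key (sphereFlip ∘ f)
      ((contMDiff_sphereFlip (k := 0)).continuous.continuousAt.comp hc) ?_ ?_
    · refine (contMDiff_sphereFlip.contMDiffAt.comp x h1).congr_of_eventuallyEq ?_
      exact Eventually.of_forall fun z => (sphereFlip_sphereFlip _).symm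
    · have h2 : ContDiff ℝ k (fun y : Euc (n + 1) => (WithLp.toLp 2 (Fin.snoc (α := fun _ => ℝ)
          (fun i : Fin n => y i.castSucc) (-y (Fin.last n))) : Euc (n + 1))) := by
        rw [contDiff_euclidean]
        intro i
        refine Fin.lastCases ?_ (fun i => ?_) i
        · simp only [Fin.snoc_last]; fun_prop
        · simp only [Fin.snoc_castSucc]; fun_prop
      exact h2.contMDiff.contMDiffAt.comp x hf
    · rw [Function.comp_apply, hN, sphereFlip_northPole]; exact southPole_ne_northPole
  · exact key f hc hf hN

theorem continuousAt_of_coe_sph {X : Type*} [TopologicalSpace X] {f : X → Sph n} {x : X}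
    (hf : ContinuousAt (fun x => (f x : Euc (n + 1))) x) : ContinuousAt f x :=
  Topology.IsInducing.subtypeVal.continuousAt_iff.2 hf

theorem contMDiffAt_cov {k : WithTop ℕ∞} {x : Euc (m + 1)} (hx : x ≠ 0) :
    ContMDiffAt 𝓘(ℝ, Euc (m + 1)) ((𝓡 m).prod (𝓡 1)) k cov x := by
  have hn : ContDiffAt ℝ k (fun y : Euc (m + 1) => ‖y‖) x := contDiffAt_norm ℝ hx
  have hne : ∀ᶠ y in 𝓝 x, y ≠ 0 := isOpen_ne.mem_nhds hx
  have h1 : ContDiffAt ℝ k (fun y : Euc (m + 1) => ((cov y).1 : Euc (m + 1))) x := by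
    refine ((hn.inv (norm_ne_zero_iff.2 hx)).smul contDiffAt_id).congr_of_eventuallyEq ?_
    filter_upwards [hne] with y hy using coe_cov_fst hy
  have h2 : ContMDiffAt 𝓘(ℝ, Euc (m + 1)) (𝓡 1) k (fun y : Euc (m + 1) => (cov y).2) x := by
    have h3 : ContDiffAt ℝ k (fun y : Euc (m + 1) => Real.logb 2 ‖y‖) x :=
      (hn.log (norm_ne_zero_iff.2 hx)).div_const _
    refine (contMDiff_circ.contMDiffAt.comp x h3.contMDiffAt).congr_of_eventuallyEq ?_
    filter_upwards [hne] with y hy using cov_snd hy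
  exact (contMDiffAt_of_coe_sph (continuousAt_of_coe_sph h1.continuousAt) h1.contMDiffAt).prodMk h2

theorem continuousAt_cov {x : Euc (m + 1)} (hx : x ≠ 0) : ContinuousAt cov x :=
  (contMDiffAt_cov (k := 0) hx).continuousAt

/-- The local section of the covering through `x`. -/
def covSection (x : Euc (m + 1)) (y : Sph m × Circle) : Euc (m + 1) :=
  expand y.1 (turn (Real.logb 2 ‖x‖) y.2)

theorem cov_covSection (x : Euc (m + 1)) (y : Sph m × Circle) : cov (covSection x y) = y := by
  rw [covSection, cov_expand, circ_turn]

theorem covSection_cov_self {x : Euc (m + 1)} (hx : x ≠ 0) : covSection x (cov x) = x := by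
  rw [covSection, cov_snd hx, turn_self, expand_cov hx]

theorem eventually_covSection_cov {x : Euc (m + 1)} (hx : x ≠ 0) :
    ∀ᶠ y in 𝓝 x, covSection x (cov y) = y := by
  have h1 : ContinuousAt (fun y : Euc (m + 1) => Real.logb 2 ‖y‖) x :=
    (continuousAt_id.norm.log (norm_ne_zero_iff.2 hx)).div_const _
  filter_upwards [h1.eventually (eventually_turn_circ _), isOpen_ne.mem_nhds hx] with y h2 hy
  rw [covSection, cov_snd hy, h2, expand_cov hy]

theorem isLocalDiffeomorphAt_cov {x : Euc (m + 1)} (hx : x ≠ 0) :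
    IsLocalDiffeomorphAt 𝓘(ℝ, Euc (m + 1)) ((𝓡 m).prod (𝓡 1)) ∞ cov x := by
  refine isLocalDiffeomorphAt_of_inverse (g := covSection x) ?_ ?_ (eventually_covSection_cov hx)
    (Eventually.of_forall (cov_covSection x))
  · filter_upwards [isOpen_ne.mem_nhds hx] with y hy using contMDiffAt_cov hy
  · have : ∀ᶠ y in 𝓝 (cov x), ContMDiffAt (𝓡 1) 𝓘(ℝ, ℝ) ∞ (turn (Real.logb 2 ‖x‖)) y.2 := by
      refine continuousAt_snd.eventually ?_
      rw [cov_snd hx]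
      exact eventually_contMDiffAt_turn _
    filter_upwards [this] with y hy
    have h1 : ContMDiffAt ((𝓡 m).prod (𝓡 1)) 𝓘(ℝ, ℝ) ∞
        (fun y : Sph m × Circle => turn (Real.logb 2 ‖x‖) y.2) y := hy.comp y contMDiffAt_snd
    have h2 : ContMDiffAt ((𝓡 m).prod (𝓡 1)) 𝓘(ℝ, ℝ) ∞
        (fun y : Sph m × Circle => (2 : ℝ) ^ turn (Real.logb 2 ‖x‖) y.2) y := by
      have h3 : ContDiff ℝ ∞ (fun r : ℝ => (2 : ℝ) ^ r) :=
        contDiff_iff_contDiffAt.2 fun r => contDiffAt_const.rpow contDiffAt_id (by norm_num)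
      exact h3.contMDiff.contMDiffAt.comp y h1
    have h3 : ContMDiffAt ((𝓡 m).prod (𝓡 1)) 𝓘(ℝ, Euc (m + 1)) ∞
        (fun y : Sph m × Circle => (y.1 : Euc (m + 1))) y :=
      contMDiff_coe_sph.contMDiffAt.comp y contMDiffAt_fst
    exact h2.smul h3

/-! ### Coordinates on the solid torus -/

/-- The inclusion of the fibre of the cylinder. -/
def tailInj (m : ℕ) : Euc m →L[ℝ] Euc (m + 1) :=
  LinearMap.toContinuousLinearMap
    { toFun := fun w => WithLp.toLp 2 (Fin.cons 0 fun i => w i)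
      map_add' := fun x y => by ext i; refine Fin.cases ?_ (fun i => ?_) i <;> simp
      map_smul' := fun c x => by ext i; refine Fin.cases ?_ (fun i => ?_) i <;> simp }

@[simp] theorem tailInj_zero (w : Euc m) : tailInj m w 0 = 0 := by simp [tailInj]

@[simp] theorem tailInj_succ (w : Euc m) (i : Fin m) : tailInj m w i.succ = w i := by
  simp [tailInj]

theorem axisPoint_add_tailInj (x : Euc (m + 1)) :
    axisPoint m (x 0) + tailInj m (axisTail m x) = x := by
  ext i; refine Fin.cases ?_ (fun i => ?_) i <;> simp [axisTail]

theorem axisTail_axisPoint_add (t : ℝ) (w : Euc m) :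
    axisTail m (axisPoint m t + tailInj m w) = w := by
  ext i; simp [axisTail]

/-- The covering of the solid torus by the cylinder. -/
def torusCov (x : Euc (m + 1)) : Euc m × Circle := (axisTail m x, circ (x 0))

theorem contMDiff_torusCov {k : WithTop ℕ∞} :
    ContMDiff 𝓘(ℝ, Euc (m + 1)) (𝓘(ℝ, Euc m).prod (𝓡 1)) k (torusCov (m := m)) := by
  have h1 : ContDiff ℝ k (fun x : Euc (m + 1) => x 0) := by fun_prop
  exact (axisTail m).contDiff.contMDiff.prodMk (contMDiff_circ.comp h1.contMDiff)

/-- The local inverse of `torusCov` centred at height `t`. -/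
def torusSection (t : ℝ) (y : Euc m × Circle) : Euc (m + 1) :=
  axisPoint m (turn t y.2) + tailInj m y.1

theorem torusCov_torusSection (t : ℝ) (y : Euc m × Circle) :
    torusCov (torusSection t y) = y := by
  rw [torusCov, torusSection, axisTail_axisPoint_add]
  simp [circ_turn]

theorem eventually_contMDiffAt_torusSection (x : Euc (m + 1)) : ∀ᶠ y in 𝓝 (torusCov x),
    ContMDiffAt (𝓘(ℝ, Euc m).prod (𝓡 1)) 𝓘(ℝ, Euc (m + 1)) ∞ (torusSection (x 0)) y := by
  have : ∀ᶠ y in 𝓝 (torusCov x), ContMDiffAt (𝓡 1) 𝓘(ℝ, ℝ) ∞ (turn (x 0)) y.2 :=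
    continuousAt_snd.eventually (eventually_contMDiffAt_turn (x 0))
  filter_upwards [this] with y hy
  have h1 : ContDiff ℝ ∞ (axisPoint m) := by
    have : ContDiff ℝ ∞ (fun t : ℝ => t • axisPoint m 1) := by fun_prop
    simpa only [← axisPoint_eq_smul] using this
  exact (h1.contMDiff.contMDiffAt.comp y (hy.comp y contMDiffAt_snd)).add
    ((tailInj m).contDiff.contMDiff.contMDiffAt.comp y contMDiffAt_fst)

theorem eventually_torusSection_torusCov (x : Euc (m + 1)) :
    ∀ᶠ z in 𝓝 x, torusSection (x 0) (torusCov z) = z := by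
  have h1 : Continuous (fun x : Euc (m + 1) => x 0) := by fun_prop
  filter_upwards [h1.continuousAt.eventually (eventually_turn_circ (x 0))] with z hz
  rw [torusSection, torusCov, hz, axisPoint_add_tailInj]

theorem isLocalDiffeomorphAt_torusCov (x : Euc (m + 1)) :
    IsLocalDiffeomorphAt 𝓘(ℝ, Euc (m + 1)) (𝓘(ℝ, Euc m).prod (𝓡 1)) ∞ (torusCov (m := m)) x :=
  isLocalDiffeomorphAt_of_inverse (g := torusSection (x 0))
    (Eventually.of_forall fun _ => contMDiff_torusCov.contMDiffAt)
    (eventually_contMDiffAt_torusSection x) (eventually_torusSection_torusCov x)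
    (Eventually.of_forall (torusCov_torusSection _))

theorem torusSection_torusCov_self (x : Euc (m + 1)) : torusSection (x 0) (torusCov x) = x :=
  (eventually_torusSection_torusCov x).self_of_nhds

theorem isLocalDiffeomorphAt_torusSection (x : Euc (m + 1)) :
    IsLocalDiffeomorphAt (𝓘(ℝ, Euc m).prod (𝓡 1)) 𝓘(ℝ, Euc (m + 1)) ∞
      (torusSection (m := m) (x 0)) (torusCov x) :=
  isLocalDiffeomorphAt_localInverse (isLocalDiffeomorphAt_torusCov x)
    (eventually_contMDiffAt_torusSection x).self_of_nhds.continuousAt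
    (torusSection_torusCov_self x) (Eventually.of_forall (torusCov_torusSection _))

/-! ### Lifts -/

theorem exists_circ_lift {X : Type*} [TopologicalSpace X] [SimplyConnectedSpace X]
    [LocallyPathConnectedSpace X] {f : X → Circle} (hf : Continuous f) :
    ∃ L : X → ℝ, Continuous L ∧ ∀ x, circ (L x) = f x := by
  have hp := Real.pi_pos
  obtain ⟨x₀⟩ : Nonempty X := inferInstance
  obtain ⟨F, ⟨-, hF⟩, -⟩ := Circle.isCoveringMap_exp.existsUnique_continuousMap_lifts
    ⟨f, hf⟩ x₀ (Complex.arg (f x₀)) (Circle.exp_arg _)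
  refine ⟨fun x => F x / (2 * Real.pi), F.continuous.div_const _, fun x => ?_⟩
  rw [circ, mul_div_cancel₀ _ (by positivity)]
  exact congrFun hF x

/-- The covering unwinds only the circle factor, so lifting the second component, the logarithm of
the norm, lifts the map. -/
theorem exists_cov_lift {X : Type*} [TopologicalSpace X] [SimplyConnectedSpace X]
    [LocallyPathConnectedSpace X] {f : X → Sph m × Circle} (hf : Continuous f) :
    ∃ L : X → ℝ, Continuous L ∧ (∀ x, circ (L x) = (f x).2) ∧
      Continuous (fun x => expand (f x).1 (L x)) ∧ ∀ x, cov (expand (f x).1 (L x)) = f x := by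
  obtain ⟨L, hL, hLf⟩ := exists_circ_lift (continuous_snd.comp hf)
  refine ⟨L, hL, hLf, ?_, fun x => by rw [cov_expand, hLf]; rfl⟩
  exact (continuous_const.rpow hL fun _ => Or.inl (by norm_num)).smul
    (continuous_subtype_val.comp (continuous_fst.comp hf))

/-- The difference is a continuous integer-valued function on a connected space. -/
theorem const_of_circ_eq {X : Type*} [TopologicalSpace X] [PreconnectedSpace X] {f g : X → ℝ}
    (hf : Continuous f) (hg : Continuous g) (h : ∀ x, circ (f x) = circ (g x)) :
    ∃ j : ℤ, ∀ x, f x = g x + j := by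
  choose j hj using fun x => circ_eq_iff.1 (h x)
  have hc : Continuous j := by
    have h1 : Continuous fun x => ((j x : ℤ) : ℝ) := by
      have : (fun x => ((j x : ℤ) : ℝ)) = fun x => f x - g x := by ext x; rw [hj x]; ring
      rw [this]; exact hf.sub hg
    exact Int.isClosedEmbedding_coe_real.isEmbedding.continuous_iff.2 h1
  cases isEmpty_or_nonempty X with
  | inl h => exact ⟨0, fun x => (h.false x).elim⟩
  | inr h =>
    obtain ⟨x₀⟩ := h
    exact ⟨j x₀, fun x => by rw [hj x, PreconnectedSpace.constant ‹_› hc (y := x₀)]⟩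

end

section

variable {n m : ℕ}

/-! ### Degrees of circle maps -/

/-- `f` has degree `d`. -/
def HasDegree (f : Circle → Circle) (d : ℤ) : Prop :=
  ∃ L : ℝ → ℝ, Continuous L ∧ (∀ t, circ (L t) = f (circ t)) ∧ ∀ t, L (t + 1) = L t + d

theorem circ_add_one (t : ℝ) : circ (t + 1) = circ t := by simpa using circ_add_int t 1

theorem lift_add_int {X : Type*} [AddCommGroup X] [Module ℝ X] {L : X → ℝ} {a : X} {d : ℤ}
    (h : ∀ t, L (t + a) = L t + d) (t : X) (j : ℤ) :
    L (t + (j : ℝ) • a) = L t + j * d := by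
  induction j using Int.induction_on with
  | zero => simp
  | succ i ih =>
    have := h (t + ((i : ℤ) : ℝ) • a)
    rw [ih] at this
    rw [show t + ((((i : ℤ) + 1 : ℤ) : ℝ)) • a = t + ((i : ℤ) : ℝ) • a + a by
      push_cast; module, this]
    push_cast; ring
  | pred i ih =>
    have := h (t + ((-(i : ℤ) - 1 : ℤ) : ℝ) • a)
    rw [show t + ((-(i : ℤ) - 1 : ℤ) : ℝ) • a + a = t + ((-(i : ℤ) : ℤ) : ℝ) • a by
      push_cast; module, ih] at this
    push_cast at this ⊢; linarith

theorem lift_real_add_int {L : ℝ → ℝ} {d : ℤ} (h : ∀ t, L (t + 1) = L t + d) (t : ℝ) (j : ℤ) :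
    L (t + j) = L t + j * d := by
  simpa using lift_add_int (a := (1 : ℝ)) h t j

theorem exists_hasDegree {f : Circle → Circle} (hf : Continuous f) : ∃ d, HasDegree f d := by
  obtain ⟨L, hL, hLf⟩ := exists_circ_lift (hf.comp continuous_circ)
  obtain ⟨d, hd⟩ := const_of_circ_eq (f := fun t => L (t + 1)) (g := L) (by fun_prop) hL
    fun t => by rw [hLf, hLf, Function.comp_apply, circ_add_one]; rfl
  exact ⟨d, L, hL, hLf, hd⟩

theorem HasDegree.of_lift {f : Circle → Circle} {d : ℤ} (h : HasDegree f d) {L : ℝ → ℝ}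
    (hL : Continuous L) (hLf : ∀ t, circ (L t) = f (circ t)) (t : ℝ) : L (t + 1) = L t + d := by
  obtain ⟨L', hL', hLf', hd⟩ := h
  obtain ⟨j, hj⟩ := const_of_circ_eq hL hL' fun t => (hLf t).trans (hLf' t).symm
  rw [hj, hj, hd]; ring

theorem HasDegree.unique {f : Circle → Circle} {d e : ℤ} (h : HasDegree f d)
    (h' : HasDegree f e) : d = e := by
  obtain ⟨L, hL, hLf, hd⟩ := h'
  have := h.of_lift hL hLf 0
  rw [hd] at this
  exact_mod_cast (add_left_cancel this).symm

theorem HasDegree.comp {f g : Circle → Circle} {d e : ℤ} (hg : HasDegree g e)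
    (hf : HasDegree f d) : HasDegree (g ∘ f) (d * e) := by
  obtain ⟨L, hL, hLf, hd⟩ := hf
  obtain ⟨P, hP, hPg, he⟩ := hg
  refine ⟨P ∘ L, hP.comp hL, fun t => by simp [hPg, hLf], fun t => ?_⟩
  rw [Function.comp_apply, hd, lift_real_add_int he]
  push_cast; rfl

theorem hasDegree_id : HasDegree id 1 := ⟨id, continuous_id, fun _ => rfl, fun t => by simp⟩

theorem hasDegree_inv : HasDegree (fun z => z⁻¹) (-1) :=
  ⟨fun t => -t, continuous_neg, fun t => circ_neg t, fun t => by push_cast; ring⟩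

/-- Lift the homotopy, extended constantly beyond its ends, to the plane. The shift of the lift
under a full turn is one integer for the whole plane, hence the same at both ends. -/
theorem HasDegree.of_homotopic {f g : C(Circle, Circle)} (h : f.Homotopic g) {d : ℤ}
    (hg : HasDegree g d) : HasDegree f d := by
  obtain ⟨H⟩ := h
  have hc : Continuous fun x : ℝ × ℝ => H (projIcc 0 1 zero_le_one x.1, circ x.2) :=
    H.continuous.comp ((continuous_projIcc.comp continuous_fst).prodMk
      (continuous_circ.comp continuous_snd))
  have : SimplyConnectedSpace (ℝ × ℝ) := SimplyConnectedSpace.ofContractible _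
  obtain ⟨L, hL, hLf⟩ := exists_circ_lift hc
  obtain ⟨e, he⟩ := const_of_circ_eq (f := fun x : ℝ × ℝ => L (x.1, x.2 + 1)) (g := L)
    (by fun_prop) hL fun x => by rw [hLf, hLf, circ_add_one]
  have h0 : HasDegree f e := ⟨fun t => L (0, t), by fun_prop, fun t => by
    rw [hLf]; simp, fun t => he (0, t)⟩
  have h1 : HasDegree g e := ⟨fun t => L (1, t), by fun_prop, fun t => by
    rw [hLf]; simp, fun t => he (1, t)⟩
  rwa [hg.unique h1]

/-- Degrees multiply under composition, and the identity has degree 1. -/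
theorem isUnit_degree_of_leftInverse {f g : Circle → Circle}
    (hg : Continuous g) (h : ∀ z, g (f z) = z) {d : ℤ} (hd : HasDegree f d) : IsUnit d := by
  obtain ⟨e, he⟩ := exists_hasDegree hg
  have h1 := he.comp hd
  rw [show g ∘ f = id from funext h] at h1
  exact IsUnit.of_mul_eq_one e (h1.unique hasDegree_id)

theorem exists_reparametrization {X : Type*} [TopologicalSpace X] [T2Space X] {κ e : Circle → X}
    (hκ : Continuous κ) (hκi : Function.Injective κ) (he : Continuous e)
    (hei : Function.Injective e) (h : range e = range κ) :
    ∃ φ : Circle → Circle, Continuous φ ∧ (∀ z, κ (φ z) = e z) ∧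
      ∀ d, HasDegree φ d → IsUnit d := by
  have hκe := (hκ.isClosedEmbedding hκi).isEmbedding
  have hee := (he.isClosedEmbedding hei).isEmbedding
  choose φ hφ using fun z => (show e z ∈ range κ from h ▸ mem_range_self z)
  choose ψ hψ using fun z => (show κ z ∈ range e from h ▸ mem_range_self z)
  have hφc : Continuous φ := hκe.continuous_iff.2 (by
    rw [show κ ∘ φ = e from funext hφ]; exact he)
  have hψc : Continuous ψ := hee.continuous_iff.2 (by
    rw [show e ∘ ψ = κ from funext hψ]; exact hκ)
  exact ⟨φ, hφc, hφ, fun d hd => isUnit_degree_of_leftInverse hψc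
    (fun z => hei (by rw [hψ, hφ])) hd⟩

/-! ### Lifting the tubular neighbourhood -/

/-- The core of a tubular neighbourhood parametrizes the same curve as the knot, so the two differ
by a homeomorphism of the circle, of degree `±1`. -/
theorem isUnit_degree_tubular {K : Set (Sph m × Circle)} (hK : IsEssentialKnot K)
    {e : Circle → Sph m × Circle} (he : Continuous e) (hei : Function.Injective e)
    (heK : range e = K) : ∃ d : ℤ, IsUnit d ∧ HasDegree (fun z => (e z).2) d := by
  obtain ⟨κ, -, hκi, -, hκK, hdeg⟩ := hK
  obtain ⟨φ, hφc, hφ, hφd⟩ := exists_reparametrization κ.continuous hκi he hei (by rw [heK, hκK])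
  obtain ⟨d, hd⟩ := exists_hasDegree hφc
  have hκd : ∃ c : ℤ, IsUnit c ∧ HasDegree (ContinuousMap.snd.comp κ) c := by
    rcases hdeg with h | h
    · exact ⟨1, isUnit_one, HasDegree.of_homotopic h hasDegree_id⟩
    · exact ⟨-1, isUnit_one.neg, HasDegree.of_homotopic h hasDegree_inv⟩
  obtain ⟨c, hc, hcd⟩ := hκd
  refine ⟨d * c, (hφd d hd).mul hc, ?_⟩
  have := hcd.comp hd
  rwa [show (ContinuousMap.snd.comp κ) ∘ φ = fun z => (e z).2 from funext fun z => by
    simp [hφ]] at this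

instance : SimplyConnectedSpace (Euc n) := SimplyConnectedSpace.ofContractible _

theorem torusCov_eq_iff {x y : Euc (m + 1)} :
    torusCov x = torusCov y ↔ ∃ j : ℤ, x = y + (j : ℝ) • axisPoint m 1 := by
  rw [torusCov, torusCov, Prod.mk.injEq, circ_eq_iff]
  constructor
  · rintro ⟨h1, j, hj⟩
    refine ⟨j, ?_⟩
    rw [← axisPoint_add_tailInj x, h1, hj, axisPoint_add, axisPoint_eq_smul (j : ℝ)]
    conv_rhs => rw [← axisPoint_add_tailInj y]
    abel
  · rintro ⟨j, rfl⟩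
    refine ⟨?_, j, by simp⟩
    ext i; simp [axisTail]

theorem torusCov_surjective : Function.Surjective (torusCov (m := m)) :=
  fun y => ⟨_, torusCov_torusSection 0 y⟩

theorem isLocalDiffeomorphAt_covSection {x : Euc (m + 1)} (hx : x ≠ 0) :
    IsLocalDiffeomorphAt ((𝓡 m).prod (𝓡 1)) 𝓘(ℝ, Euc (m + 1)) ∞ (covSection x) (cov x) := by
  refine isLocalDiffeomorphAt_localInverse (isLocalDiffeomorphAt_cov hx) ?_
    (covSection_cov_self hx) (Eventually.of_forall (cov_covSection x))
  have h3 : ContinuousAt (turn (Real.logb 2 ‖x‖)) (cov x).2 := by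
    rw [cov_snd hx]
    exact (eventually_contMDiffAt_turn (k := 0) _).self_of_nhds.continuousAt
  exact (continuousAt_const.rpow (h3.comp continuousAt_snd) (Or.inl (by norm_num))).smul
    (continuous_subtype_val.continuousAt.comp continuousAt_fst)

/-- The lift of an embedding of the solid torus to the punctured space. -/
theorem exists_torus_lift {e : Euc m × Circle → Sph m × Circle}
    (he : IsLocalDiffeomorph (𝓘(ℝ, Euc m).prod (𝓡 1)) ((𝓡 m).prod (𝓡 1)) ∞ e) {d : ℤ}
    (hd : HasDegree (fun z => (e (0, z)).2) d) :
    ∃ E : Euc (m + 1) → Euc (m + 1), (∀ x, E x ≠ 0) ∧ (∀ x, cov (E x) = e (torusCov x)) ∧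
      (∀ x (j : ℤ), E (x + (j : ℝ) • axisPoint m 1) = (2 : ℝ) ^ (j * d) • E x) ∧
      ∀ x, IsLocalDiffeomorphAt 𝓘(ℝ, Euc (m + 1)) 𝓘(ℝ, Euc (m + 1)) ∞ E x := by
  have hec : Continuous e := he.contMDiff.continuous
  have htc : Continuous (torusCov (m := m)) := (contMDiff_torusCov (k := 0)).continuous
  obtain ⟨L, hL, hLe, hEc, hE⟩ := exists_cov_lift (hec.comp htc)
  have hper : ∀ x : Euc (m + 1), torusCov (x + axisPoint m 1) = torusCov x := fun x =>
    torusCov_eq_iff.2 ⟨1, by simp⟩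
  -- The shift of the lift under one turn is a constant integer, and it is read off on the axis,
  -- where it is the degree of the core.
  have hLper : ∀ x, L (x + axisPoint m 1) = L x + d := by
    obtain ⟨c, hc⟩ := const_of_circ_eq (f := fun x => L (x + axisPoint m 1)) (g := L)
      (by fun_prop) hL fun x => by
        rw [hLe, hLe, Function.comp_apply, Function.comp_apply, hper]
    have h1 := hd.of_lift (L := fun t => L (axisPoint m t)) (hL.comp continuous_axisPoint)
      (fun t => by
        rw [hLe, Function.comp_apply, torusCov, axisPoint_zero]
        congr 3) 0
    rw [axisPoint_add, hc] at h1
    have : (c : ℝ) = d := by linarith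
    intro x
    rw [hc, this]
  refine ⟨_, fun x => expand_ne_zero _ _, hE, fun x j => ?_, fun x => ?_⟩
  · have h2 : torusCov (x + (j : ℝ) • axisPoint m 1) = torusCov x :=
      torusCov_eq_iff.2 ⟨j, rfl⟩
    rw [Function.comp_apply, Function.comp_apply, h2, lift_add_int hLper,
      ← expand_add_int]
    push_cast; rfl
  · set x₀ := expand ((e ∘ torusCov) x).1 (L x) with hx₀
    have hx₀0 : x₀ ≠ 0 := expand_ne_zero _ _
    have hcx₀ : cov x₀ = e (torusCov x) := hE x
    have h1 := isLocalDiffeomorphAt_covSection hx₀0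
    rw [hcx₀] at h1
    have h2 := ((isLocalDiffeomorphAt_torusCov x).comp _ _ (he (torusCov x))).comp _ _ h1
    refine isLocalDiffeomorphAt_congr h2 ?_
    filter_upwards [hEc.continuousAt.eventually (eventually_covSection_cov hx₀0)] with y hy
    rw [hE] at hy
    exact hy.symm

theorem contDiffAt_invFun_of_isLocalDiffeomorphAt {E : Type*} [NormedAddCommGroup E]
    [NormedSpace ℝ E] {f : E → E} (hf : Function.Injective f) {x : E}
    (h : IsLocalDiffeomorphAt 𝓘(ℝ, E) 𝓘(ℝ, E) ∞ f x) :
    ContDiffAt ℝ ∞ (Function.invFun f) (f x) := by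
  refine h.localInverse_contMDiffAt.contDiffAt.congr_of_eventuallyEq ?_
  filter_upwards [h.localInverse_eventuallyEq_right] with y hy
  simp only [Function.comp_apply, id_eq] at hy
  conv_lhs => rw [← hy]
  exact Function.leftInverse_invFun hf _

theorem axialMap_axialMap (a b a' b' : ℝ) (x : Euc (m + 1)) :
    axialMap m a b (axialMap m a' b' x) = axialMap m (a * a') (b * b') x := by
  ext i; refine Fin.cases ?_ (fun i => ?_) i <;> simp [mul_assoc]

theorem axialMap_one_one (x : Euc (m + 1)) : axialMap m 1 1 x = x := by
  rw [axialMap_self]; simp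

theorem axisTail_axialMap (a b : ℝ) (x : Euc (m + 1)) :
    axisTail m (axialMap m a b x) = b • axisTail m x := by
  ext i; simp [axisTail]

theorem axialMap_axisPoint (a b t : ℝ) : axialMap m a b (axisPoint m t) = axisPoint m (a * t) := by
  ext i; refine Fin.cases ?_ (fun i => ?_) i <;> simp

theorem isUnit_mul_self {d : ℤ} (hd : IsUnit d) : (d : ℝ) * d = 1 := by
  exact_mod_cast Int.isUnit_mul_self hd

/-- A tubular neighbourhood has a conjugator that straightens the knot. -/
theorem exists_isConjugator {K T : Set (Sph m × Circle)} (hK : IsEssentialKnot K)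
    (hT : IsTubularNeighborhood K T) :
    ∃ ζ, IsConjugator (coveringPreimage T) ζ ∧
      ζ '' coveringPreimage K = range (axisPoint m) := by
  obtain ⟨e, he, hei, heT, heK⟩ := hT
  have hec : Continuous e := he.contMDiff.continuous
  obtain ⟨d, hdu, hd⟩ := isUnit_degree_tubular hK (e := fun z => e (0, z)) (by fun_prop)
    (fun z w h => (Prod.ext_iff.1 (hei h)).2) (by rw [← heK]; ext y; simp)
  have hdd := isUnit_mul_self hdu
  obtain ⟨E, hE0, hEe, hEper, hEd⟩ := exists_torus_lift he hd
  -- Points with equal image cover the same point of the solid torus, so they differ by `j` turns;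
  -- then `2 ^ (j * d) = 1` forces `j = 0`, as `d ≠ 0`.
  have hEinj : Function.Injective E := fun x y hxy => by
    have h1 : torusCov x = torusCov y := hei (by rw [← hEe, ← hEe, hxy])
    obtain ⟨j, rfl⟩ := torusCov_eq_iff.1 h1
    rw [hEper] at hxy
    have h2 : ((2 : ℝ) ^ (j * d) - 1) • E y = 0 := by rw [sub_smul, one_smul, hxy, sub_self]
    have h3 := (smul_eq_zero.1 h2).resolve_right (hE0 y)
    have h4 : (2 : ℝ) ^ (j * d) = 2 ^ (0 : ℤ) := by rw [zpow_zero]; linarith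
    have h5 := zpow_right_injective₀ (by norm_num : (0 : ℝ) < 2) (by norm_num) h4
    have h6 : j = 0 := (mul_eq_zero.1 h5).resolve_right hdu.ne_zero
    simp [h6]
  have hEsmooth : ContDiff ℝ ∞ E := contMDiff_iff_contDiff.1 fun x => (hEd x).contMDiffAt
  have himage : ∀ S : Set (Euc m), coveringPreimage (e '' (S ×ˢ univ)) =
      E '' {x | axisTail m x ∈ S} := by
    intro S
    ext x
    rw [mem_coveringPreimage]
    constructor
    · rintro ⟨hx0, ⟨⟨w, z⟩, ⟨hw, -⟩, hwz⟩⟩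
      obtain ⟨y, hy⟩ := torusCov_surjective (w, z)
      rw [← hy, ← hEe] at hwz
      obtain ⟨j, hj⟩ := (cov_eq_iff hx0 (hE0 y)).1 hwz.symm
      -- The lift reaches every sheet: `j * d` turns multiply by `2 ^ (j * d * d) = 2 ^ j`. Here
      -- degree `±1`, not merely nonzero, is essential.
      refine ⟨y + ((j * d : ℤ) : ℝ) • axisPoint m 1, ?_, ?_⟩
      · have h1 : torusCov (y + ((j * d : ℤ) : ℝ) • axisPoint m 1) = (w, z) := by
          rw [← hy]; exact torusCov_eq_iff.2 ⟨_, rfl⟩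
        have h2 := congrArg Prod.fst h1
        change axisTail m _ = w at h2
        rw [mem_ofPred_eq, h2]; exact hw
      · rw [hEper, hj, mul_assoc, Int.isUnit_mul_self hdu, mul_one]
    · rintro ⟨y, hy, rfl⟩
      exact ⟨hE0 y, torusCov y, ⟨hy, mem_univ _⟩, (hEe y).symm⟩
  have hinv : ∀ x, Function.invFun E (E x) = x := Function.leftInverse_invFun hEinj
  have hT' := himage (Metric.closedBall 0 1)
  rw [heT] at hT'
  have hS : ∀ x : Euc (m + 1), axialMap m (-d) 2⁻¹ (axialMap m (-d) 2 x) = x := fun x => by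
    rw [axialMap_axialMap, neg_mul_neg, hdd, inv_mul_cancel₀ (by norm_num), axialMap_one_one]
  have hS' : ∀ x : Euc (m + 1), axialMap m (-d) 2 (axialMap m (-d) 2⁻¹ x) = x := fun x => by
    rw [axialMap_axialMap, neg_mul_neg, hdd, mul_inv_cancel₀ (by norm_num), axialMap_one_one]
  -- The inverse of `E` followed by a diagonal map: the factor 2 takes the unit ball bundle to the
  -- cylinder of radius 2, and `-d` turns the shift by `-d`, which corresponds to the homothety,
  -- into the shift by `+1`.
  let ζ : PartialEquiv (Euc (m + 1)) (Euc (m + 1)) :=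
    { toFun := fun x => axialMap m (-d) 2 (Function.invFun E x)
      invFun := fun y => E (axialMap m (-d) 2⁻¹ y)
      source := coveringPreimage T
      target := cylinder m
      map_source' := fun x hx => by
        rw [hT'] at hx
        obtain ⟨y, hy, rfl⟩ := hx
        rw [hinv, cylinder_eq_preimage, mem_preimage, axisTail_axialMap, mem_closedBall_zero_iff,
          norm_smul, Real.norm_ofNat]
        have := mem_closedBall_zero_iff.1 hy
        linarith
      map_target' := fun y hy => by
        rw [hT']
        refine ⟨_, ?_, rfl⟩
        rw [cylinder_eq_preimage, mem_preimage, mem_closedBall_zero_iff] at hy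
        rw [mem_ofPred_eq, axisTail_axialMap, mem_closedBall_zero_iff, norm_smul, norm_inv,
          Real.norm_ofNat]
        linarith
      left_inv' := fun x hx => by
        rw [hT'] at hx
        obtain ⟨y, hy, rfl⟩ := hx
        rw [hinv, hS]
      right_inv' := fun y hy => by rw [hinv, hS'] }
  have hhom : ∀ y, homothety (E y) = E (y + ((-d : ℤ) : ℝ) • axisPoint m 1) := fun y => by
    rw [hEper, neg_mul, Int.isUnit_mul_self hdu, zpow_neg_one]; rfl
  have hmem : ∀ (y : Euc (m + 1)) (c : ℝ),
      axisTail m (y + c • axisPoint m 1) = axisTail m y := fun y c => by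
    ext i; simp [axisTail]
  refine ⟨ζ, ⟨rfl, rfl, ?_, ?_, ?_, ?_⟩, ?_⟩
  · intro x hx
    rw [hT'] at hx
    obtain ⟨y, hy, rfl⟩ := hx
    exact ((axialMap m (-d) 2).contDiff.contDiffAt.comp _
      (contDiffAt_invFun_of_isLocalDiffeomorphAt hEinj (hEd y))).contDiffWithinAt
  · exact (hEsmooth.comp (axialMap m (-d) 2⁻¹).contDiff).contDiffOn
  · intro x
    rw [mem_coveringPreimage, mem_coveringPreimage]
    have h0 : homothety x ≠ 0 ↔ x ≠ 0 := by simp [homothety]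
    rw [h0]
    refine and_congr_right fun _ => ?_
    have := cov_zpow_smul x (-1)
    rw [zpow_neg_one] at this
    rw [homothety, this]
  · intro x hx
    rw [hT'] at hx
    obtain ⟨y, hy, rfl⟩ := hx
    change axialMap m (-d) 2 (Function.invFun E (homothety (E y))) =
      axialMap m (-d) 2 (Function.invFun E (E y)) + axisPoint m 1
    rw [hhom, hinv, hinv, map_add, map_smul, axialMap_axisPoint, axisPoint_eq_smul (_ * _),
      smul_smul]
    congr 1
    push_cast
    rw [mul_one, neg_mul_neg, hdd, one_smul]
  · rw [← heK, himage]
    ext y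
    constructor
    · rintro ⟨_, ⟨x, hx, rfl⟩, rfl⟩
      change axialMap m (-d) 2 (Function.invFun E (E x)) ∈ _
      have hx' : axisTail m x = 0 := hx
      rw [hinv, ← axisPoint_add_tailInj x, hx', map_zero, add_zero, axialMap_axisPoint]
      exact mem_range_self _
    · rintro ⟨t, rfl⟩
      refine ⟨E (axisPoint m (-d * t)), ⟨_, ?_, rfl⟩, ?_⟩
      · change axisTail m _ = 0
        ext i; simp [axisTail]
      · change axialMap m (-d) 2 (Function.invFun E (E _)) = _
        rw [hinv, axialMap_axisPoint, ← mul_assoc, neg_mul_neg, hdd, one_mul]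

/-! ### The preimage of a tubular neighbourhood -/

theorem IsTubularNeighborhood.isClosed {K T : Set (Sph m × Circle)}
    (hT : IsTubularNeighborhood K T) : IsClosed T := by
  obtain ⟨e, he, -, heT, -⟩ := hT
  rw [← heT]
  exact (((isCompact_closedBall _ _).prod isCompact_univ).image
    he.contMDiff.continuous).isClosed

theorem IsTubularNeighborhood.subset {K T : Set (Sph m × Circle)}
    (hT : IsTubularNeighborhood K T) : K ⊆ T := by
  obtain ⟨e, he, -, rfl, rfl⟩ := hT
  exact image_mono (prod_mono (by simp) subset_rfl)

theorem isClosed_insert_coveringPreimage {T : Set (Sph m × Circle)} (hT : IsClosed T) :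
    IsClosed (insert 0 (coveringPreimage T)) := by
  rw [← isOpen_compl_iff, isOpen_iff_mem_nhds]
  intro x hx
  rw [mem_compl_iff, mem_insert_iff, not_or, mem_coveringPreimage, not_and] at hx
  filter_upwards [isOpen_ne.mem_nhds hx.1,
    (continuousAt_cov hx.1).eventually (hT.isOpen_compl.mem_nhds (hx.2 hx.1))] with y h1 h2
  rw [mem_compl_iff, mem_insert_iff, not_or, mem_coveringPreimage, not_and]
  exact ⟨h1, fun _ => h2⟩

theorem hasPixtonDynamics_of_isTubularNeighborhood (hm : 1 ≤ m) {K T : Set (Sph m × Circle)}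
    (hT : IsTubularNeighborhood K T) {ζ : PartialEquiv (Euc (m + 1)) (Euc (m + 1))}
    (hζ : IsConjugator (coveringPreimage T) ζ) : HasPixtonDynamics (coveringPreimage K) ζ := by
  refine hasPixtonDynamics hm (A := coveringPreimage T)
    ⟨hζ, fun h => (mem_coveringPreimage.1 h).1 rfl, isClosed_insert_coveringPreimage hT.isClosed⟩ ?_
  intro x hx
  rw [mem_coveringPreimage] at hx ⊢
  exact ⟨hx.1, hT.subset hx.2⟩

end

/-! ### Existence of tubular neighbourhoods. -/

section

variable {n m : ℕ}

/-! ### Lifting a knot -/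

/-- The lift of the parametrized knot to the punctured space, closing up to a power of 2. It is
smooth because it is locally a section of the covering composed with the knot. -/
theorem IsEssentialKnot.exists_lift {K : Set (Sph m × Circle)} (hK : IsEssentialKnot K) :
    ∃ (κ : Circle → Sph m × Circle) (γ : ℝ → Euc (m + 1)) (d : ℤ), Function.Injective κ ∧
      range κ = K ∧ (∀ t, γ t ≠ 0) ∧ (∀ t, cov (γ t) = κ (circ t)) ∧
      (∀ t, γ (t + 1) = (2 : ℝ) ^ d • γ t) ∧ ContDiff ℝ ∞ γ ∧ ∀ t, deriv γ t ≠ 0 := by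
  obtain ⟨κ, hκ, hκi, hκd, hκK, hdeg⟩ := hK
  obtain ⟨L, hL, hLκ, hγc, hγ⟩ := exists_cov_lift (κ.continuous.comp continuous_circ)
  obtain ⟨d, hd⟩ := exists_hasDegree (f := fun z => (κ z).2) (by fun_prop)
  set γ : ℝ → Euc (m + 1) := fun t => expand ((κ ∘ circ) t).1 (L t) with hγdef
  have hγ0 : ∀ t, γ t ≠ 0 := fun t => expand_ne_zero _ _
  have hsmooth : ContDiff ℝ ∞ γ := by
    refine contMDiff_iff_contDiff.1 fun t => ?_
    have h1 := (isLocalDiffeomorphAt_covSection (hγ0 t)).contMDiffAt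
    rw [hγ t] at h1
    have h2 := h1.comp t (hκ.comp contMDiff_circ).contMDiffAt
    refine h2.congr_of_eventuallyEq ?_
    filter_upwards [hγc.continuousAt.eventually (eventually_covSection_cov (hγ0 t))] with s hs
    rw [hγ] at hs
    exact hs.symm
  refine ⟨κ, γ, d, hκi, hκK, hγ0, hγ, fun t => ?_, hsmooth, fun t ht => ?_⟩
  · rw [hγdef]
    simp only [Function.comp_apply]
    rw [hd.of_lift hL hLκ, circ_add_one, expand_add_int]
  -- Since `κ = cov ∘ γ ∘ turn t`, a zero of `γ'` would make the differential of `κ` vanish,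
  -- contrary to its injectivity.
  · have h1 : HasMFDerivAt 𝓘(ℝ, ℝ) 𝓘(ℝ, Euc (m + 1)) γ t (0 : ℝ →L[ℝ] Euc (m + 1)) := by
      have := (hsmooth.differentiable (by simp) t).hasDerivAt
      rw [ht] at this
      have h2 := this.hasFDerivAt.hasMFDerivAt
      simpa using h2
    have h2 := ((eventually_contMDiffAt_turn (k := 1) t).self_of_nhds.mdifferentiableAt
      one_ne_zero).hasMFDerivAt
    have h1' : HasMFDerivAt 𝓘(ℝ, ℝ) 𝓘(ℝ, Euc (m + 1)) γ (turn t (circ t))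
      (0 : ℝ →L[ℝ] Euc (m + 1)) := by rwa [turn_self]
    have h3 := h1'.comp (circ t) h2
    have h4 := ((contMDiffAt_cov (k := 1) (hγ0 (turn t (circ t)))).mdifferentiableAt
      one_ne_zero).hasMFDerivAt
    have h5 := h4.comp (circ t) h3
    have h6 : cov ∘ (γ ∘ turn t) = κ := by
      ext1 z
      rw [Function.comp_apply, Function.comp_apply, hγ, Function.comp_apply, circ_turn]
    rw [h6] at h5
    have h7 := hκd (circ t)
    rw [h5.mfderiv] at h7
    have h8 : (EuclideanSpace.single 0 1 : EuclideanSpace ℝ (Fin 1)) = 0 := by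
      refine h7 ?_
      exact (show mfderiv 𝓘(ℝ, Euc (m + 1)) ((𝓡 m).prod (𝓡 1)) cov (γ (turn t (circ t)))
          (0 : Euc (m + 1)) =
        mfderiv 𝓘(ℝ, Euc (m + 1)) ((𝓡 m).prod (𝓡 1)) cov (γ (turn t (circ t)))
          (0 : Euc (m + 1)) from rfl)
    simpa using congrArg (fun v : EuclideanSpace ℝ (Fin 1) => v 0) h8

/-! ### Moving frames -/

/-- In the plane the tangent vector and its rotation by a right angle form a frame. -/
theorem exists_frame_plane {T : ℝ → Euc 2} (hT : ContDiff ℝ ∞ T) (hT0 : ∀ t, T t ≠ 0) {c : ℝ}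
    (hper : ∀ t, T (t + 1) = c • T t) :
    ∃ M : ℝ → Euc 2 →L[ℝ] Euc 2, ContDiff ℝ ∞ M ∧ (∀ t, M (t + 1) = c • M t) ∧
      (∀ t, Function.Injective (M t)) ∧ ∀ t, M t (axisPoint 1 1) = T t := by
  let M : ℝ → Euc 2 →L[ℝ] Euc 2 := fun t =>
    (EuclideanSpace.proj (𝕜 := ℝ) (0 : Fin 2)).smulRight (T t) +
      (EuclideanSpace.proj (𝕜 := ℝ) (1 : Fin 2)).smulRight !₂[-T t 1, T t 0]
  have hM : ∀ t y, M t y = y 0 • T t + y 1 • !₂[-T t 1, T t 0] := fun t y => by simp [M]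
  refine ⟨M, ?_, fun t => ?_, fun t => ?_, fun t => ?_⟩
  · rw [contDiff_clm_apply_iff]
    intro y
    simp only [hM]
    have h1 : ContDiff ℝ ∞ (fun t => !₂[-T t 1, T t 0]) := by
      rw [contDiff_euclidean] at hT ⊢
      intro i
      fin_cases i
      · exact (hT 1).neg
      · exact hT 0
    exact (ContDiff.fun_smul contDiff_const hT).add (ContDiff.fun_smul contDiff_const h1)
  · ext y i
    have : M (t + 1) y = c • M t y := by
      rw [hM, hM, hper]
      ext i
      fin_cases i <;> simp <;> ring
    exact congrArg (fun v : Euc 2 => v i) this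
  · rw [injective_iff_map_eq_zero]
    intro y hy
    rw [hM] at hy
    have e0 := congrArg (fun v : Euc 2 => v 0) hy
    have e1 := congrArg (fun v : Euc 2 => v 1) hy
    simp at e0 e1
    have hpos : 0 < T t 0 ^ 2 + T t 1 ^ 2 := by
      have h1 : 0 < ‖T t‖ ^ 2 := by have := norm_pos_iff.2 (hT0 t); positivity
      rw [EuclideanSpace.norm_sq_eq] at h1
      simpa using h1
    have h0 : y 0 * (T t 0 ^ 2 + T t 1 ^ 2) = 0 := by linear_combination T t 0 * e0 + T t 1 * e1
    have h1 : y 1 * (T t 0 ^ 2 + T t 1 ^ 2) = 0 := by linear_combination T t 0 * e1 - T t 1 * e0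
    ext i
    fin_cases i
    · exact (mul_eq_zero.1 h0).resolve_right hpos.ne'
    · exact (mul_eq_zero.1 h1).resolve_right hpos.ne'
  · rw [hM]; simp [axisPoint]

/-- In dimension at least 3 the cone over the curve `T` is the image of a surface and misses some
vector `q`. The reflection that exchanges the unit vectors `q₁` and `S t` is smooth in `t`, as they
never coincide, and periodic like `S`. So no monodromy has to be corrected. -/
theorem exists_frame_space (hm : 2 ≤ m) {T : ℝ → Euc (m + 1)} (hT : ContDiff ℝ ∞ T)
    (hT0 : ∀ t, T t ≠ 0) {c : ℝ} (hc : 0 < c) (hper : ∀ t, T (t + 1) = c • T t) :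
    ∃ M : ℝ → Euc (m + 1) →L[ℝ] Euc (m + 1), ContDiff ℝ ∞ M ∧ (∀ t, M (t + 1) = c • M t) ∧
      (∀ t, Function.Injective (M t)) ∧ ∀ t, M t (axisPoint m 1) = T t := by
  obtain ⟨q, hq⟩ : ∃ q, q ∉ range (fun x : ℝ × ℝ => x.1 • T x.2) := by
    have h1 : ContDiff ℝ 1 (fun x : ℝ × ℝ => x.1 • T x.2) :=
      contDiff_fst.smul ((hT.of_le (by simp)).comp contDiff_snd)
    exact (h1.dense_compl_range_of_finrank_lt_finrank (by simp; omega)).nonempty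
  have hq0 : q ≠ 0 := by rintro rfl; exact hq ⟨(0, 0), by simp⟩
  set q₁ : Euc (m + 1) := ‖q‖⁻¹ • q with hq₁
  set S : ℝ → Euc (m + 1) := fun t => ‖T t‖⁻¹ • T t with hS
  have hq₁n : ‖q₁‖ = 1 := by
    rw [hq₁, norm_smul, norm_inv, norm_norm, inv_mul_cancel₀ (norm_ne_zero_iff.2 hq0)]
  have hSn : ∀ t, ‖S t‖ = 1 := fun t => by
    rw [hS]
    simp only [norm_smul, norm_inv, norm_norm]
    rw [inv_mul_cancel₀ (norm_ne_zero_iff.2 (hT0 t))]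
  have hne : ∀ t, q₁ - S t ≠ 0 := fun t h => by
    rw [sub_eq_zero] at h
    refine hq ⟨(‖q‖ * ‖T t‖⁻¹, t), ?_⟩
    simp only
    rw [mul_smul, show ‖T t‖⁻¹ • T t = q₁ from h.symm, hq₁, smul_smul,
      mul_inv_cancel₀ (norm_ne_zero_iff.2 hq0), one_smul]
  have hSs : ContDiff ℝ ∞ S := (ContDiff.inv (hT.norm ℝ hT0)
    fun t => norm_ne_zero_iff.2 (hT0 t)).smul hT
  have hSper : ∀ t, S (t + 1) = S t := fun t => by
    simp only [hS]
    rw [hper, norm_smul, Real.norm_of_nonneg hc.le, smul_smul, mul_inv, mul_right_comm,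
      inv_mul_cancel₀ hc.ne', one_mul]
  set O : Euc (m + 1) ≃ₗᵢ[ℝ] Euc (m + 1) :=
    Submodule.reflection (Submodule.span ℝ {axisPoint m 1 - q₁})ᗮ with hO
  have hO1 : O (axisPoint m 1) = q₁ := Submodule.reflection_sub (by rw [hq₁n]; simp [axisPoint])
  set R : ℝ → Euc (m + 1) ≃ₗᵢ[ℝ] Euc (m + 1) := fun t =>
    Submodule.reflection (Submodule.span ℝ {q₁ - S t})ᗮ with hR
  have hR1 : ∀ t, R t q₁ = S t := fun t => Submodule.reflection_sub (by rw [hq₁n, hSn])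
  have hRf : ∀ t x, R t x =
      x - (2 * (inner ℝ (q₁ - S t) x / ‖q₁ - S t‖ ^ 2)) • (q₁ - S t) := fun t x => by
    simp only [hR]
    rw [Submodule.reflection_orthogonal_apply, Submodule.reflection_singleton_apply]
    simp only [RCLike.ofReal_real_eq_id, id_eq]
    rw [neg_sub, mul_smul, two_smul, two_smul]
  let M : ℝ → Euc (m + 1) →L[ℝ] Euc (m + 1) := fun t =>
    ‖T t‖ • ((R t).toContinuousLinearEquiv : Euc (m + 1) →L[ℝ] Euc (m + 1)).comp
      (O.toContinuousLinearEquiv : Euc (m + 1) →L[ℝ] Euc (m + 1))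
  have hM : ∀ t y, M t y = ‖T t‖ • R t (O y) := fun t y => rfl
  refine ⟨M, ?_, fun t => ?_, fun t => ?_, fun t => ?_⟩
  · rw [contDiff_clm_apply_iff]
    intro y
    simp only [hM, hRf]
    have hu : ContDiff ℝ ∞ fun t => q₁ - S t := contDiff_const.sub hSs
    refine (hT.norm ℝ hT0).fun_smul (contDiff_const.sub (ContDiff.fun_smul (contDiff_const.mul ?_) hu))
    refine (hu.inner ℝ contDiff_const).div (hu.norm_sq ℝ) fun t => ?_
    exact pow_ne_zero 2 (norm_ne_zero_iff.2 (hne t))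
  · ext1 y
    have : M (t + 1) y = c • M t y := by
      rw [hM, hM, hper, norm_smul, Real.norm_of_nonneg hc.le, mul_smul, hRf, hRf, hSper]
    exact this
  · rw [injective_iff_map_eq_zero]
    intro y hy
    rw [hM, smul_eq_zero, or_iff_right (norm_ne_zero_iff.2 (hT0 t))] at hy
    simpa using hy
  · rw [hM, hO1, hR1, hS, smul_smul, mul_inv_cancel₀ (norm_ne_zero_iff.2 (hT0 t)), one_smul]

theorem exists_frame (hm : 1 ≤ m) {T : ℝ → Euc (m + 1)} (hT : ContDiff ℝ ∞ T)
    (hT0 : ∀ t, T t ≠ 0) {c : ℝ} (hc : 0 < c) (hper : ∀ t, T (t + 1) = c • T t) :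
    ∃ M : ℝ → Euc (m + 1) →L[ℝ] Euc (m + 1), ContDiff ℝ ∞ M ∧ (∀ t, M (t + 1) = c • M t) ∧
      (∀ t, Function.Injective (M t)) ∧ ∀ t, M t (axisPoint m 1) = T t := by
  rcases eq_or_lt_of_le hm with rfl | hm
  · exact exists_frame_plane hT hT0 hper
  · exact exists_frame_space hm hT hT0 hc hper

/-! ### Existence of tubular neighbourhoods -/

/-- The map adds to the curve the frame applied to the orthogonal coordinates. On the axis its
derivative is the frame itself, hence invertible, because the first frame vector is the tangent. -/
theorem exists_normal_map (hm : 1 ≤ m) {γ : ℝ → Euc (m + 1)} (hγ : ContDiff ℝ ∞ γ)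
    (hγ' : ∀ t, deriv γ t ≠ 0) {c : ℝ} (hc : 0 < c) (hper : ∀ t, γ (t + 1) = c • γ t) :
    ∃ E : Euc (m + 1) → Euc (m + 1), (∀ t, E (axisPoint m t) = γ t) ∧
      (∀ x, E (x + axisPoint m 1) = c • E x) ∧
      ∀ t, IsLocalDiffeomorphAt 𝓘(ℝ, Euc (m + 1)) 𝓘(ℝ, Euc (m + 1)) ∞ E (axisPoint m t) := by
  have hγs : ContDiff ℝ ∞ (deriv γ) := (contDiff_infty_iff_deriv.1 hγ).2
  have hper' : ∀ t, deriv γ (t + 1) = c • deriv γ t := fun t => by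
    rw [← deriv_comp_add_const, funext hper, deriv_fun_const_smul]
    exact hγ.differentiable (by simp) t
  obtain ⟨M, hM, hMper, hMinj, hMT⟩ := exists_frame hm hγs hγ' hc hper'
  set P : Euc (m + 1) →L[ℝ] Euc (m + 1) := (tailInj m).comp (axisTail m) with hP
  have hPa : ∀ t, P (axisPoint m t) = 0 := fun t => by
    ext i; refine Fin.cases ?_ (fun i => ?_) i <;> simp [hP, axisTail]
  have hx0 : ContDiff ℝ ∞ (fun x : Euc (m + 1) => x 0) := by fun_prop
  set E : Euc (m + 1) → Euc (m + 1) := fun x => γ (x 0) + M (x 0) (P x) with hE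
  have hEs : ContDiff ℝ ∞ E :=
    (hγ.comp hx0).add ((hM.comp hx0).clm_apply P.contDiff)
  refine ⟨E, fun t => by simp [hE, hPa], fun x => ?_, fun t => ?_⟩
  · simp only [hE]
    rw [map_add, hPa, add_zero]
    have : (x + axisPoint m 1) 0 = x 0 + 1 := by simp
    rw [this, hper, hMper, smul_add]; rfl
  · set p0 : Euc (m + 1) →L[ℝ] ℝ := EuclideanSpace.proj (𝕜 := ℝ) (0 : Fin (m + 1)) with hp0
    have hd0 : HasFDerivAt (fun x : Euc (m + 1) => x 0) p0 (axisPoint m t) := p0.hasFDerivAt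
    have h0 : axisPoint m t 0 = t := axisPoint_zero t
    have h1 : HasFDerivAt (fun x : Euc (m + 1) => γ (x 0)) (p0.smulRight (deriv γ t))
        (axisPoint m t) := by
      have h2 : HasDerivAt γ (deriv γ t) (axisPoint m t 0) := by
        rw [h0]; exact (hγ.differentiable (by simp) t).hasDerivAt
      refine (HasFDerivAt.comp (g := γ) (f := fun x : Euc (m + 1) => x 0) (axisPoint m t)
        h2.hasFDerivAt hd0).congr_fderiv ?_
      ext1 v; simp
    have h2 : HasFDerivAt (fun x : Euc (m + 1) => M (x 0))
        (fderiv ℝ (fun x : Euc (m + 1) => M (x 0)) (axisPoint m t)) (axisPoint m t) :=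
      ((hM.comp hx0).differentiable (by simp) _).hasFDerivAt
    have h3 := h1.add (h2.clm_apply P.hasFDerivAt)
    have hinj := hMinj t
    set e : Euc (m + 1) ≃L[ℝ] Euc (m + 1) :=
      (LinearEquiv.ofInjectiveEndo (M t : Euc (m + 1) →ₗ[ℝ] Euc (m + 1))
        hinj).toContinuousLinearEquiv with he
    refine isLocalDiffeomorphAt_of_hasFDerivAt hEs (f' := e) (h3.congr_fderiv ?_)
    ext1 v
    have hev : (e : Euc (m + 1) →L[ℝ] Euc (m + 1)) v = M t v := rfl
    rw [hev, hPa]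
    have hdec : M t v = v 0 • deriv γ t + M t (P v) := by
      conv_lhs => rw [← axisPoint_add_tailInj v, map_add, axisPoint_eq_smul, map_smul, hMT]
      rfl
    rw [hdec]
    simp [hp0]

/-- The normal map along the lifted knot descends to `Euc m × Circle`, where it is a local
diffeomorphism along the core and injective on it. By compactness both properties extend to a thin
tube, onto which all of `Euc m × Circle` is then squeezed. -/
theorem exists_isTubularNeighborhood (hm : 1 ≤ m) {K : Set (Sph m × Circle)}
    (hK : IsEssentialKnot K) : ∃ T, IsTubularNeighborhood K T := by
  obtain ⟨κ, γ, d, hκi, rfl, hγ0, hγ, hγper, hγs, hγ'⟩ := hK.exists_lift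
  obtain ⟨E, hEγ, hEper, hEd⟩ := exists_normal_map hm hγs hγ' (c := (2 : ℝ) ^ d) (by positivity)
    hγper
  have hcper : ∀ x, cov (E (x + axisPoint m 1)) = cov (E x) := fun x => by
    rw [hEper, cov_zpow_smul]
  have hcint : ∀ x (j : ℤ), cov (E (x + (j : ℝ) • axisPoint m 1)) = cov (E x) := by
    intro x j
    induction j using Int.induction_on with
    | zero => simp
    | succ i ih =>
      rw [← ih, ← hcper (x + ((i : ℤ) : ℝ) • axisPoint m 1)]
      congr 2; push_cast; module
    | pred i ih =>
      rw [← ih, ← hcper (x + ((-(i : ℤ) - 1 : ℤ) : ℝ) • axisPoint m 1)]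
      congr 2; push_cast; module
  set e₀ : Euc m × Circle → Sph m × Circle := fun y => cov (E (torusSection 0 y)) with he₀
  -- The branch of the angle does not matter: branches differ by full turns, which multiply `E` by
  -- powers of 2 invisible to the covering. So each point can be treated with a branch that is
  -- smooth there.
  have he₀t : ∀ t y, e₀ y = cov (E (torusSection t y)) := fun t y => by
    have h1 : torusCov (torusSection 0 y) = torusCov (torusSection t y) := by
      rw [torusCov_torusSection, torusCov_torusSection]
    obtain ⟨j, hj⟩ := torusCov_eq_iff.1 h1
    rw [he₀]
    simp only
    rw [hj, hcint]
  have hax : ∀ t, torusCov (axisPoint m t) = ((0 : Euc m), circ t) := fun t => by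
    rw [torusCov, axisPoint_zero]; congr 1
  have hloc : ∀ z, IsLocalDiffeomorphAt (𝓘(ℝ, Euc m).prod (𝓡 1)) ((𝓡 m).prod (𝓡 1)) ∞ e₀
      ((0 : Euc m), z) := by
    intro z
    set t := turn 0 z with ht
    have hz : circ t = z := circ_turn 0 z
    have hs : torusSection t ((0 : Euc m), z) = axisPoint m t := by
      rw [← hz, ← hax]
      simpa using torusSection_torusCov_self (axisPoint m t)
    have h1 := isLocalDiffeomorphAt_torusSection (axisPoint m t)
    rw [axisPoint_zero, hax, hz] at h1
    have h2 := hEd t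
    rw [← hs] at h2
    have h3 := isLocalDiffeomorphAt_cov (hγ0 t)
    rw [← hEγ t, ← hs] at h3
    exact isLocalDiffeomorphAt_congr ((h1.comp _ _ h2).comp _ _ h3)
      (Eventually.of_forall fun y => he₀t t y)
  have he₀κ : ∀ z, e₀ (0, z) = κ z := fun z => by
    have h1 : torusSection 0 ((0 : Euc m), z) = axisPoint m (turn 0 z) := by simp [torusSection]
    rw [he₀]
    simp only
    rw [h1, hEγ, hγ, circ_turn]
  have hcomp : IsCompact (({0} : Set (Euc m)) ×ˢ (univ : Set Circle)) :=
    isCompact_singleton.prod isCompact_univ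
  obtain ⟨U, hU, hUinj⟩ := InjOn.exists_mem_nhdsSet (f := e₀) (s := {0} ×ˢ univ)
    (by
      rintro ⟨w, z⟩ ⟨hw, -⟩ ⟨w', z'⟩ ⟨hw', -⟩ h
      obtain rfl : w = 0 := hw
      obtain rfl : w' = 0 := hw'
      rw [he₀κ, he₀κ] at h
      rw [hκi h]) hcomp
    (by
      rintro ⟨w, z⟩ ⟨hw, -⟩
      obtain rfl : w = 0 := hw
      exact (hloc z).contMDiffAt.continuousAt)
    (by
      rintro ⟨w, z⟩ ⟨hw, -⟩
      obtain rfl : w = 0 := hw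
      exact exists_injOn_of_isLocalDiffeomorphAt (hloc z))
  have hV : ∀ᶠ y in 𝓝ˢ (({0} : Set (Euc m)) ×ˢ (univ : Set Circle)),
      IsLocalDiffeomorphAt (𝓘(ℝ, Euc m).prod (𝓡 1)) ((𝓡 m).prod (𝓡 1)) ∞ e₀ y := by
    rw [eventually_nhdsSet_iff_forall]
    rintro ⟨w, z⟩ ⟨hw, -⟩
    obtain rfl : w = 0 := hw
    exact eventually_isLocalDiffeomorphAt (hloc z)
  have hUV := hV.and hU
  rw [isCompact_singleton.nhdsSet_prod_eq isCompact_univ, nhdsSet_singleton, nhdsSet_univ] at hUV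
  obtain ⟨W, hW, Z, hZ, hWZ⟩ := Filter.mem_prod_iff.1 hUV
  obtain ⟨r, hr, hrW⟩ := Metric.mem_nhds_iff.1 hW
  have hball : ∀ w ∈ Metric.ball (0 : Euc m) r, ∀ z : Circle,
      IsLocalDiffeomorphAt (𝓘(ℝ, Euc m).prod (𝓡 1)) ((𝓡 m).prod (𝓡 1)) ∞ e₀ (w, z) ∧
        (w, z) ∈ U := fun w hw z => hWZ ⟨hrW hw, by rw [Filter.mem_top.1 hZ]; exact mem_univ z⟩
  -- A diffeomorphism of `Euc m` onto the ball of radius `r` that fixes the centre.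
  set η := OpenPartialHomeomorph.univBall (0 : Euc m) r with hη
  have hηmem : ∀ w, η w ∈ Metric.ball (0 : Euc m) r := fun w => by
    rw [← OpenPartialHomeomorph.univBall_target (0 : Euc m) hr]
    exact η.map_source (by simp [hη])
  have hηinj : ∀ w, η.symm (η w) = w := fun w => η.left_inv (by simp [hη])
  have hηd : ∀ y : Euc m × Circle, IsLocalDiffeomorphAt (𝓘(ℝ, Euc m).prod (𝓡 1))
      (𝓘(ℝ, Euc m).prod (𝓡 1)) ∞ (Prod.map η id) y := by
    rintro ⟨w, z⟩
    refine isLocalDiffeomorphAt_of_inverse (g := Prod.map η.symm id) ?_ ?_ ?_ ?_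
    · exact Eventually.of_forall fun y =>
        (OpenPartialHomeomorph.contDiff_univBall.contMDiff.prodMap contMDiff_id).contMDiffAt
    · have : ∀ᶠ y : Euc m × Circle in 𝓝 (η w, z), y.1 ∈ Metric.ball (0 : Euc m) r :=
        continuousAt_fst.eventually (Metric.isOpen_ball.mem_nhds (hηmem w))
      filter_upwards [this] with y hy
      refine ContMDiffAt.prodMap' ?_ contMDiffAt_id
      exact (OpenPartialHomeomorph.contDiffOn_univBall_symm.contDiffAt
        (Metric.isOpen_ball.mem_nhds hy)).contMDiffAt
    · exact Eventually.of_forall fun y => Prod.ext (hηinj y.1) rfl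
    · have : ∀ᶠ y : Euc m × Circle in 𝓝 (η w, z), y.1 ∈ Metric.ball (0 : Euc m) r :=
        continuousAt_fst.eventually (Metric.isOpen_ball.mem_nhds (hηmem w))
      filter_upwards [this] with y hy
      refine Prod.ext (η.right_inv ?_) rfl
      rwa [hη, OpenPartialHomeomorph.univBall_target (0 : Euc m) hr]
  refine ⟨_, e₀ ∘ Prod.map η id, fun y => (hηd y).comp _ _ (hball _ (hηmem y.1) y.2).1, ?_, rfl, ?_⟩
  · rintro ⟨w, z⟩ ⟨w', z'⟩ h
    have h1 := hUinj (hball _ (hηmem w) z).2 (hball _ (hηmem w') z').2 h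
    rw [Prod.mk.injEq] at h1
    rw [← hηinj w, h1.1, hηinj]
    exact congrArg _ h1.2
  · ext y
    constructor
    · rintro ⟨⟨w, z⟩, ⟨hw, -⟩, rfl⟩
      obtain rfl : w = 0 := hw
      refine ⟨z, ?_⟩
      rw [← he₀κ]; simp [hη]
    · rintro ⟨z, rfl⟩
      refine ⟨(0, z), ⟨rfl, mem_univ z⟩, ?_⟩
      rw [← he₀κ]; simp [hη]

theorem constructionWorks (hm : 1 ≤ m) {K : Set (Sph m × Circle)} (hK : IsEssentialKnot K) :
    ConstructionWorks K :=
  ⟨exists_isTubularNeighborhood hm hK, fun _ hT => ⟨exists_isConjugator hK hT,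
    fun _ hζ => hasPixtonDynamics_of_isTubularNeighborhood hm hT hζ⟩⟩

end

/-! ### From arcs to curves equivariant under the homothety. -/

section

variable {n m : ℕ}

/-! ### Transition functions between arcs -/

section Transition

variable {X : Type*} [TopologicalSpace X] [T2Space X] {σ τ : ℝ → X} {p q r s : ℝ}

/-- An injective continuous map on a compact interval is an embedding, so `σ⁻¹ ∘ τ` is continuous;
it is extended by constants beyond the interval. -/
theorem exists_transition (hrs : r ≤ s) (hσ : ContinuousOn σ (Icc p q))
    (hσi : InjOn σ (Icc p q)) (hτ : ContinuousOn τ (Icc r s))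
    (hsub : τ '' Icc r s ⊆ σ '' Icc p q) :
    ∃ θ : ℝ → ℝ, Continuous θ ∧ ∀ t ∈ Icc r s, θ t ∈ Icc p q ∧ σ (θ t) = τ t := by
  have hemb := ((continuousOn_iff_continuous_domRestrict.1 hσ).isClosedEmbedding
    (injOn_iff_injective.1 hσi)).isEmbedding
  choose f hf using fun t : Icc r s => hsub (mem_image_of_mem τ t.2)
  let θ : Icc r s → Icc p q := fun t => ⟨f t, (hf t).1⟩
  have hθ : Continuous θ := hemb.continuous_iff.2 (by
    have : (Icc p q).domRestrict σ ∘ θ = (Icc r s).domRestrict τ := funext fun t => (hf t).2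
    rw [this]
    exact continuousOn_iff_continuous_domRestrict.1 hτ)
  refine ⟨IccExtend hrs fun t => (θ t : ℝ), (continuous_subtype_val.comp hθ).Icc_extend', ?_⟩
  intro t ht
  rw [IccExtend_of_mem hrs _ ht]
  exact hf ⟨t, ht⟩

theorem exists_subarc (hrs : r < s) (hσ : ContinuousOn σ (Icc p q))
    (hσi : InjOn σ (Icc p q)) (hτ : ContinuousOn τ (Icc r s)) (hτi : InjOn τ (Icc r s))
    (hsub : τ '' Icc r s ⊆ σ '' Icc p q) :
    ∃ x ∈ Icc p q, ∃ y ∈ Icc p q, x ≠ y ∧ σ x = τ r ∧ σ y = τ s ∧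
      σ '' uIcc x y = τ '' Icc r s := by
  obtain ⟨θ, hθ, hθσ⟩ := exists_transition hrs.le hσ hσi hτ hsub
  have hr : r ∈ Icc r s := left_mem_Icc.2 hrs.le
  have hs : s ∈ Icc r s := right_mem_Icc.2 hrs.le
  have hθi : InjOn θ (Icc r s) := fun a ha b hb hab => hτi ha hb (by
    rw [← (hθσ a ha).2, ← (hθσ b hb).2, hab])
  refine ⟨θ r, (hθσ r hr).1, θ s, (hθσ s hs).1, fun h => hrs.ne (hθi hr hs h), (hθσ r hr).2,
    (hθσ s hs).2, ?_⟩
  have himg : θ '' Icc r s = uIcc (θ r) (θ s) := by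
    rcases le_total (θ r) (θ s) with h | h
    · have hm := hθ.continuousOn.strictMonoOn_of_injOn_Icc hrs.le h hθi
      rw [uIcc_of_le h]
      refine Subset.antisymm ?_ (intermediate_value_Icc hrs.le hθ.continuousOn)
      rintro _ ⟨t, ht, rfl⟩
      exact ⟨hm.monotoneOn hr ht ht.1, hm.monotoneOn ht hs ht.2⟩
    · have hm := hθ.continuousOn.strictAntiOn_of_injOn_Icc hrs.le h hθi
      rw [uIcc_of_ge h]
      refine Subset.antisymm ?_ (intermediate_value_Icc' hrs.le hθ.continuousOn)
      rintro _ ⟨t, ht, rfl⟩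
      exact ⟨hm.antitoneOn ht hs ht.2, hm.antitoneOn hr ht ht.1⟩
  rw [← himg, image_image]
  exact image_congr fun t ht => (hθσ t ht).2

end Transition

/-- Project onto the velocity `v` of `σ`: the scalar function `⟨v, σ⟩` is locally invertible, which
expresses `θ` through `τ`. -/
theorem differentiableAt_transition {σ τ : ℝ → Euc n} {θ : ℝ → ℝ} {t : ℝ}
    (hσ : ContDiff ℝ 1 σ) (hτ : DifferentiableAt ℝ τ t) (hθ : ContinuousAt θ t)
    (h : ∀ᶠ x in 𝓝 t, σ (θ x) = τ x) (hd : deriv σ (θ t) ≠ 0) : DifferentiableAt ℝ θ t := by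
  set v := deriv σ (θ t) with hv
  set f : ℝ → ℝ := fun x => inner ℝ v (σ x) with hf
  have hfc : ContDiff ℝ 1 f := contDiff_const.inner ℝ hσ
  have hσd : HasDerivAt σ v (θ t) := (hσ.differentiable one_ne_zero _).hasDerivAt
  have hfd : HasDerivAt f (inner ℝ v v) (θ t) := by
    have := (hasDerivAt_const (θ t) v).inner ℝ hσd
    simpa using this
  have hne : (inner ℝ v v : ℝ) ≠ 0 := inner_self_ne_zero.2 hd
  have hstrict : HasStrictDerivAt f (inner ℝ v v) (θ t) :=
    hfc.contDiffAt.hasStrictDerivAt' hfd one_ne_zero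
  set F := hstrict.localInverse f _ _ hne with hF
  have hFd : HasStrictDerivAt F (inner ℝ v v : ℝ)⁻¹ (f (θ t)) := hstrict.to_localInverse hne
  have hFl : ∀ᶠ x in 𝓝 (θ t), F (f x) = x :=
    (hstrict.hasStrictFDerivAt_equiv hne).eventually_left_inverse
  have hg : ∀ᶠ x in 𝓝 t, θ x = F (inner ℝ v (τ x)) := by
    filter_upwards [hθ.eventually hFl, h] with x h1 h2
    rw [← h2]; exact h1.symm
  have hval : f (θ t) = inner ℝ v (τ t) := by rw [hf, ← h.self_of_nhds]
  rw [hval] at hFd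
  have h3 : DifferentiableAt ℝ (fun x => (inner ℝ v (τ x) : ℝ)) t :=
    (differentiableAt_const v).inner ℝ hτ
  exact (DifferentiableAt.comp (g := F) t hFd.hasDerivAt.differentiableAt h3).congr_of_eventuallyEq hg

/-! ### Periodic extension of curves -/

/-- The curve is given on slightly more than one period and is already equivariant on the overlap.
Hence every real number has an integer translate in the open interval `(0, 1 + c)`, and the
extension shows no seam. -/
theorem exists_periodic_extension {E : Type*} [NormedAddCommGroup E] [NormedSpace ℝ E]
    {ν : ℝ → E} {c : ℝ} (hc0 : 0 < c) (hc1 : c < 1)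
    (hper : ∀ t ∈ Icc 0 c, ν (t + 1) = (2 : ℝ)⁻¹ • ν t)
    (hν : ∀ t ∈ Ioo 0 (1 + c), ContDiffAt ℝ ∞ ν t ∧ deriv ν t ≠ 0) :
    ∃ μ : ℝ → E, ContDiff ℝ ∞ μ ∧ (∀ t, deriv μ t ≠ 0) ∧ (∀ t, μ (t + 1) = (2 : ℝ)⁻¹ • μ t) ∧
      ∀ t ∈ Ico (0 : ℝ) 1, μ t = ν t := by
  set μ : ℝ → E := fun t => (2 : ℝ)⁻¹ ^ ⌊t⌋ • ν (Int.fract t) with hμ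
  have hrep : ∀ (k : ℤ) (t : ℝ), t - k ∈ Ico 0 (1 + c) → μ t = (2 : ℝ)⁻¹ ^ k • ν (t - k) := by
    intro k t ht
    rcases lt_or_ge (t - k) 1 with h1 | h1
    · have hfl : ⌊t⌋ = k := Int.floor_eq_iff.2 ⟨by linarith [ht.1], by linarith⟩
      simp only [hμ, Int.fract, hfl]
    · have hfl : ⌊t⌋ = k + 1 := Int.floor_eq_iff.2
        ⟨by push_cast; linarith, by push_cast; linarith [ht.2]⟩
      simp only [hμ, Int.fract, hfl]
      have h2 := hper (t - k - 1) ⟨by linarith, by linarith [ht.2]⟩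
      rw [sub_add_cancel] at h2
      rw [h2, smul_smul, zpow_add_one₀ (by norm_num)]
      push_cast
      rw [sub_sub]
  have hk : ∀ t : ℝ, ∃ k : ℤ, t - k ∈ Ioo 0 (1 + c) := fun t => by
    rcases (Int.fract_nonneg t).eq_or_lt with h | h
    -- An integer is translated to 1, inside the overlap, rather than to the end 0.
    · refine ⟨⌊t⌋ - 1, ?_⟩
      have : t - ⌊t⌋ = 0 := h.symm
      push_cast
      constructor <;> linarith
    · exact ⟨⌊t⌋, h, (Int.fract_lt_one t).trans (by linarith)⟩
  have hloc : ∀ t : ℝ, ∃ k : ℤ, t - k ∈ Ioo 0 (1 + c) ∧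
      μ =ᶠ[𝓝 t] fun x => (2 : ℝ)⁻¹ ^ k • ν (x - k) := fun t => by
    obtain ⟨k, hk⟩ := hk t
    refine ⟨k, hk, ?_⟩
    have : ContinuousAt (fun x : ℝ => x - k) t := by fun_prop
    filter_upwards [this.eventually (isOpen_Ioo.mem_nhds hk)] with x hx
    exact hrep k x ⟨hx.1.le, hx.2⟩
  refine ⟨μ, contDiff_iff_contDiffAt.2 fun t => ?_, fun t => ?_, fun t => ?_, fun t ht => ?_⟩
  · obtain ⟨k, hk, he⟩ := hloc t
    refine ContDiffAt.congr_of_eventuallyEq ?_ he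
    have h1 : ContDiffAt ℝ ∞ (fun x : ℝ => ν (x - k)) t :=
      ContDiffAt.comp (g := ν) t (hν _ hk).1 (by fun_prop)
    exact contDiffAt_const.fun_smul h1
  · obtain ⟨k, hk, he⟩ := hloc t
    have h1 : HasDerivAt (fun x : ℝ => ν (x - k)) (deriv ν (t - k)) t :=
      ((hν _ hk).1.differentiableAt (by simp)).hasDerivAt.comp_sub_const t (k : ℝ)
    have h2 := h1.fun_const_smul ((2 : ℝ)⁻¹ ^ k)
    rw [he.deriv_eq, h2.deriv]
    exact smul_ne_zero (zpow_ne_zero _ (by norm_num)) (hν _ hk).2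
  · simp only [hμ, Int.floor_add_one, Int.fract_add_one]
    rw [zpow_add_one₀ (by norm_num), mul_comm, smul_smul]
  · have := hrep 0 t ⟨by simpa using ht.1, by simp; linarith [ht.2]⟩
    simpa using this

/-! ### Parametrization by invariant length -/

/-- The primitive minus `c t` is monotone, so the primitive is unbounded in both directions. -/
theorem exists_primitive_homeomorph {w : ℝ → ℝ} (hw : Continuous w) {c : ℝ} (hc : 0 < c)
    (hwc : ∀ t, c ≤ w t) (a : ℝ) :
    ∃ S : ℝ ≃ₜ ℝ, StrictMono S ∧ S a = 0 ∧ ∀ t, HasDerivAt S (w t) t := by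
  set s : ℝ → ℝ := fun t => ∫ x in a..t, w x with hs
  have hd : ∀ t, HasDerivAt s (w t) t := fun t =>
    intervalIntegral.integral_hasDerivAt_right (hw.intervalIntegrable _ _)
      (hw.stronglyMeasurableAtFilter _ _) hw.continuousAt
  have hmono : StrictMono s := strictMono_of_deriv_pos fun t => by
    rw [(hd t).deriv]; exact hc.trans_le (hwc t)
  have hm : Monotone fun t => s t - c * t := by
    have hd' : ∀ t, HasDerivAt (fun t => s t - c * t) (w t - c) t := fun t =>
      (hd t).sub (by simpa using (hasDerivAt_id t).const_mul c)
    refine monotone_of_deriv_nonneg (fun t => (hd' t).differentiableAt) fun t => ?_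
    rw [(hd' t).deriv]; linarith [hwc t]
  have hsurj : Function.Surjective s := by
    refine Continuous.surjective (continuous_iff_continuousAt.2 fun t => (hd t).continuousAt) ?_ ?_
    · refine tendsto_atTop_mono' _ ?_
        (tendsto_atTop_add_const_right atTop (s 0) (tendsto_id.const_mul_atTop hc))
      filter_upwards [eventually_ge_atTop 0] with t ht
      have := hm ht
      simp only [mul_zero, sub_zero] at this
      simp only [id_eq]; linarith
    · refine tendsto_atBot_mono' _ ?_
        (tendsto_atBot_add_const_right atBot (s 0) (tendsto_id.const_mul_atBot hc))
      filter_upwards [eventually_le_atBot 0] with t ht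
      have := hm ht
      simp only [mul_zero, sub_zero] at this
      simp only [id_eq]; linarith
  exact ⟨(hmono.orderIsoOfSurjective s hsurj).toHomeomorph, hmono, by
    change s a = 0; simp [hs], hd⟩

theorem contDiffAt_homeomorph_symm {S : ℝ ≃ₜ ℝ} {w : ℝ → ℝ} (hd : ∀ t, HasDerivAt S (w t) t)
    {p q : ℝ} (hw : ContDiffOn ℝ ∞ w (Ioo p q)) {t : ℝ} (ht : t ∈ Ioo p q) (hne : w t ≠ 0) :
    ContDiffAt ℝ ∞ S.symm (S t) := by
  have hS : ContDiffOn ℝ ∞ S (Ioo p q) := by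
    rw [contDiffOn_infty_iff_deriv_of_isOpen isOpen_Ioo]
    refine ⟨fun x _ => (hd x).differentiableAt.differentiableWithinAt, ?_⟩
    rw [show deriv S = w from funext fun x => (hd x).deriv]
    exact hw
  have hval : S.toOpenPartialHomeomorph.symm (S t) = t := S.symm_apply_apply t
  refine S.toOpenPartialHomeomorph.contDiffAt_symm_deriv (a := S t) hne (mem_univ _) ?_ ?_
  · rw [hval]; exact hd t
  · rw [hval]; exact hS.contDiffAt (isOpen_Ioo.mem_nhds ht)

/-- The length density of a curve that is invariant under homotheties. -/
def lengthDensity (σ : ℝ → Euc n) (t : ℝ) : ℝ := ‖deriv σ t‖ / ‖σ t‖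

theorem lengthDensity_pos {σ : ℝ → Euc n} {t : ℝ} (h0 : σ t ≠ 0) (hd : deriv σ t ≠ 0) :
    0 < lengthDensity σ t := div_pos (norm_pos_iff.2 hd) (norm_pos_iff.2 h0)

theorem contDiffAt_lengthDensity {σ : ℝ → Euc n} (hσ : ContDiff ℝ ∞ σ) {t : ℝ} (h0 : σ t ≠ 0)
    (hd : deriv σ t ≠ 0) : ContDiffAt ℝ ∞ (lengthDensity σ) t :=
  (((contDiff_infty_iff_deriv.1 hσ).2.contDiffAt).norm ℝ hd).div (hσ.contDiffAt.norm ℝ h0)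
    (norm_ne_zero_iff.2 h0)

/-- The form `|dx| / |x|` is invariant under homotheties, so the transition function of the
homothety preserves the length that it measures. -/
theorem hasDerivAt_eq_of_homothetic {σ : ℝ → Euc n} (hσ : ContDiff ℝ ∞ σ) {θ : ℝ → ℝ} {t : ℝ}
    (hθ : ContinuousAt θ t) (h : ∀ᶠ x in 𝓝 t, σ (θ x) = (2 : ℝ)⁻¹ • σ x)
    (hd : deriv σ (θ t) ≠ 0) :
    ∃ θ', HasDerivAt θ θ' t ∧ lengthDensity σ (θ t) * |θ'| = lengthDensity σ t := by
  have hσd : ∀ x, HasDerivAt σ (deriv σ x) x := fun x =>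
    (hσ.differentiable (by simp) x).hasDerivAt
  have hτ : HasDerivAt (fun x => (2 : ℝ)⁻¹ • σ x) ((2 : ℝ)⁻¹ • deriv σ t) t :=
    (hσd t).fun_const_smul _
  have h1 := (differentiableAt_transition (hσ.of_le (by simp)) hτ.differentiableAt hθ h
    hd).hasDerivAt
  refine ⟨_, h1, ?_⟩
  have h2 := (hσd (θ t)).scomp t h1
  have h3 := h2.unique (hτ.congr_of_eventuallyEq h)
  have h4 := congrArg norm h3
  rw [norm_smul, norm_smul, Real.norm_eq_abs] at h4
  have h5 : ‖σ (θ t)‖ = 2⁻¹ * ‖σ t‖ := by rw [h.self_of_nhds, norm_smul]; norm_num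
  have h6 : ‖(2 : ℝ)⁻¹‖ = 2⁻¹ := by norm_num
  rw [h6] at h4
  rw [lengthDensity, lengthDensity, h5, div_mul_eq_mul_div, mul_comm _ |_|, h4]
  exact mul_div_mul_left _ _ (by norm_num)

/-- A regular arc whose final piece is the image of the initial one under the homothety extends
to a curve that is equivariant under the homothety. -/
theorem exists_equivariant_curve {σ : ℝ → Euc n} (hσ : ContDiff ℝ ∞ σ) {x₀ x₁ x₃ x₄ : ℝ}
    (h01 : x₀ < x₁) (h13 : x₁ < x₃) (h34 : x₃ < x₄) (hinj : InjOn σ (Icc x₀ x₄))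
    (hd : ∀ t ∈ Icc x₀ x₄, deriv σ t ≠ 0) (h0 : ∀ t ∈ Icc x₀ x₄, σ t ≠ 0)
    (himg : σ '' Icc x₃ x₄ = homothety '' (σ '' Icc x₀ x₁)) (h3 : σ x₃ = homothety (σ x₀))
    (h4 : σ x₄ = homothety (σ x₁)) :
    ∃ μ : ℝ → Euc n, ContDiff ℝ ∞ μ ∧ (∀ t, deriv μ t ≠ 0) ∧
      (∀ t, μ (t + 1) = (2 : ℝ)⁻¹ • μ t) ∧ μ '' Ico 0 1 = σ '' Ico x₀ x₃ ∧
      InjOn μ (Ico 0 1) := by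
  have h04 : x₀ ≤ x₄ := by linarith
  have hsub1 : Icc x₀ x₁ ⊆ Icc x₀ x₄ := Icc_subset_Icc le_rfl (by linarith)
  have hsub3 : Icc x₃ x₄ ⊆ Icc x₀ x₄ := Icc_subset_Icc (by linarith) le_rfl
  have hwc : ContinuousOn (lengthDensity σ) (Icc x₀ x₄) := fun t ht =>
    (contDiffAt_lengthDensity hσ (h0 t ht) (hd t ht)).continuousAt.continuousWithinAt
  obtain ⟨t₀, ht₀, hmin⟩ := isCompact_Icc.exists_isMinOn (nonempty_Icc.2 h04) hwc
  set w : ℝ → ℝ := IccExtend h04 ((Icc x₀ x₄).domRestrict (lengthDensity σ)) with hw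
  have hww : ∀ t ∈ Icc x₀ x₄, w t = lengthDensity σ t := fun t ht => IccExtend_of_mem h04 _ ht
  have hwcont : Continuous w := (continuousOn_iff_continuous_domRestrict.1 hwc).Icc_extend'
  have hpos : 0 < lengthDensity σ t₀ := lengthDensity_pos (h0 _ ht₀) (hd _ ht₀)
  have hwmin : ∀ t, lengthDensity σ t₀ ≤ w t := fun t => hmin (projIcc x₀ x₄ h04 t).2
  obtain ⟨S, hSm, hS0, hSd⟩ := exists_primitive_homeomorph hwcont hpos hwmin x₀
  -- the transition function of the homothety
  obtain ⟨θ, hθ, hθσ⟩ := exists_transition (σ := σ) (τ := fun t => (2 : ℝ)⁻¹ • σ t) h01.le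
    hσ.continuous.continuousOn (hinj.mono hsub3)
    (hσ.continuous.fun_const_smul (2 : ℝ)⁻¹).continuousOn (by
      rw [himg, image_image]; exact Subset.rfl)
  have hl : x₀ ∈ Icc x₀ x₁ := left_mem_Icc.2 h01.le
  have hr : x₁ ∈ Icc x₀ x₁ := right_mem_Icc.2 h01.le
  have hθ0 : θ x₀ = x₃ := hinj (hsub3 (hθσ _ hl).1) (hsub3 (left_mem_Icc.2 h34.le))
    ((hθσ _ hl).2.trans h3.symm)
  have hθ1 : θ x₁ = x₄ := hinj (hsub3 (hθσ _ hr).1) (hsub3 (right_mem_Icc.2 h34.le))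
    ((hθσ _ hr).2.trans h4.symm)
  have hθi : InjOn θ (Icc x₀ x₁) := fun a ha b hb hab => by
    have h1 : (2 : ℝ)⁻¹ • σ a = (2 : ℝ)⁻¹ • σ b := by
      rw [← (hθσ a ha).2, ← (hθσ b hb).2, hab]
    exact hinj (hsub1 ha) (hsub1 hb) (smul_right_injective _ (by norm_num : (2 : ℝ)⁻¹ ≠ 0) h1)
  have hθm : StrictMonoOn θ (Icc x₀ x₁) := hθ.continuousOn.strictMonoOn_of_injOn_Icc h01.le
    (by rw [hθ0, hθ1]; exact h34.le) hθi
  -- In the invariant length parameter the transition function becomes a translation: `S ∘ θ - S`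
  -- has zero derivative. This is what allows a smooth equivariant extension.
  have hshift : ∀ t ∈ Icc x₀ x₁, S (θ t) = S t + S x₃ := by
    have hder : ∀ t ∈ Ioo x₀ x₁, HasDerivAt (fun t => S (θ t) - S t) 0 t := fun t ht => by
      have hev : ∀ᶠ x in 𝓝 t, σ (θ x) = (2 : ℝ)⁻¹ • σ x := by
        filter_upwards [Icc_mem_nhds ht.1 ht.2] with x hx using (hθσ x hx).2
      have ht' := Ioo_subset_Icc_self ht
      have hθt := hsub3 (hθσ t ht').1
      obtain ⟨θ', hθ', hlen⟩ := hasDerivAt_eq_of_homothetic hσ hθ.continuousAt hev (hd _ hθt)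
      have hnn : 0 ≤ θ' := by
        have := hθm.monotoneOn.derivWithin_nonneg (x := t)
        rwa [derivWithin_of_mem_nhds (Icc_mem_nhds ht.1 ht.2), hθ'.deriv] at this
      rw [abs_of_nonneg hnn, ← hww _ hθt, ← hww t (hsub1 ht')] at hlen
      have hS := ((hSd (θ t)).comp t hθ').sub (hSd t)
      rw [hlen, sub_self] at hS
      exact hS
    intro t ht
    rcases eq_or_lt_of_le ht.1 with rfl | h
    · rw [hθ0, hS0, zero_add]
    · obtain ⟨u, -, hu⟩ := exists_hasDerivAt_eq_slope (fun t => S (θ t) - S t) (fun _ => 0) h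
        ((S.continuous.comp hθ).sub S.continuous).continuousOn
        fun u hu => hder u ⟨hu.1, hu.2.trans_le ht.2⟩
      have h1 := (div_eq_zero_iff.1 hu.symm).resolve_right (sub_ne_zero.2 h.ne')
      simp only [hθ0, hS0] at h1
      linarith
  have hP : 0 < S x₃ := hS0 ▸ hSm (h01.trans h13)
  have hs0 : 0 < S x₁ := hS0 ▸ hSm h01
  have hs4 : S x₄ = S x₁ + S x₃ := hθ1 ▸ hshift x₁ hr
  set P := S x₃ with hPdef
  set c := S x₁ / P with hcdef
  have hPc : P * c = S x₁ := mul_div_cancel₀ _ hP.ne'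
  have hc0 : 0 < c := div_pos hs0 hP
  have hc1 : c < 1 := (div_lt_one hP).2 (hSm h13)
  have hST : ∀ t, S (S.symm t) = t := S.apply_symm_apply
  -- Rescaling by the length `P` of a fundamental piece gives period 1; `c` is the relative length
  -- of the overlap.
  obtain ⟨μ, hμ, hμd, hμp, hμν⟩ := exists_periodic_extension (ν := fun t => σ (S.symm (P * t)))
    hc0 hc1 (fun t ht => by
      have hu : S.symm (P * t) ∈ Icc x₀ x₁ := by
        constructor <;> rw [← hSm.le_iff_le, hST]
        · rw [hS0]; exact mul_nonneg hP.le ht.1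
        · rw [← hPc]; exact mul_le_mul_of_nonneg_left ht.2 hP.le
      have h1 := hshift _ hu
      rw [hST, show P * t + P = P * (t + 1) by ring] at h1
      change σ (S.symm (P * (t + 1))) = _
      rw [← h1, S.symm_apply_apply]
      exact (hθσ _ hu).2) (fun t ht => by
      have hu : S.symm (P * t) ∈ Ioo x₀ x₄ := by
        constructor <;> rw [← hSm.lt_iff_lt, hST]
        · rw [hS0]; exact mul_pos hP ht.1
        · rw [hs4, ← hPc, show P * c + P = P * (1 + c) by ring]
          exact mul_lt_mul_of_pos_left ht.2 hP
      have hu' := Ioo_subset_Icc_self hu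
      have hwu : w (S.symm (P * t)) ≠ 0 := (hpos.trans_le (hwmin _)).ne'
      have hwd : ContDiffOn ℝ ∞ w (Ioo x₀ x₄) := fun x hx =>
        ((contDiffAt_lengthDensity hσ (h0 x (Ioo_subset_Icc_self hx))
          (hd x (Ioo_subset_Icc_self hx))).congr_of_eventuallyEq (by
            filter_upwards [Icc_mem_nhds hx.1 hx.2] with y hy using hww y hy)).contDiffWithinAt
      have h1 := contDiffAt_homeomorph_symm hSd hwd hu hwu
      rw [hST] at h1
      have h2 : ContDiffAt ℝ ∞ (fun t => S.symm (P * t)) t :=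
        ContDiffAt.comp (g := S.symm) t h1 (contDiffAt_const.mul contDiffAt_id)
      refine ⟨ContDiffAt.comp (g := σ) t hσ.contDiffAt h2, ?_⟩
      have h3 := (h2.differentiableAt (by simp)).hasDerivAt
      have h4 := ((hSd _).comp t h3).unique
        (((hasDerivAt_id t).const_mul P).congr_of_eventuallyEq
          (Eventually.of_forall fun x => hST (P * x)))
      have h5 := ((hσ.differentiable (by simp) (S.symm (P * t))).hasDerivAt).scomp t h3
      have h6 : deriv (fun t => S.symm (P * t)) t ≠ 0 := fun h => by
        rw [h, mul_zero, mul_one] at h4; exact hP.ne h4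
      have h7 : deriv (fun t => σ (S.symm (P * t))) t = _ := h5.deriv
      rw [h7]
      exact smul_ne_zero h6 (hd _ hu'))
  have hrange : (fun t => S.symm (P * t)) '' Ico 0 1 = Ico x₀ x₃ := by
    ext x
    constructor
    · rintro ⟨t, ht, rfl⟩
      constructor
      · rw [← hSm.le_iff_le, hST, hS0]; exact mul_nonneg hP.le ht.1
      · rw [← hSm.lt_iff_lt, hST]; exact mul_lt_of_lt_one_right hP ht.2
    · intro hx
      refine ⟨S x / P, ⟨div_nonneg (hS0 ▸ hSm.monotone hx.1) hP.le,
        (div_lt_one hP).2 (hSm hx.2)⟩, ?_⟩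
      change S.symm (P * (S x / P)) = x
      rw [mul_div_cancel₀ _ hP.ne', S.symm_apply_apply]
  refine ⟨μ, hμ, hμd, hμp, ?_, fun s hs t ht hst => ?_⟩
  · rw [image_congr hμν, ← hrange, image_image]
  · rw [hμν s hs, hμν t ht] at hst
    have hsub : ∀ t ∈ Ico (0 : ℝ) 1, S.symm (P * t) ∈ Icc x₀ x₄ := fun t ht => by
      have : S.symm (P * t) ∈ Ico x₀ x₃ := hrange ▸ mem_image_of_mem _ ht
      exact ⟨this.1, this.2.le.trans h34.le⟩
    exact mul_left_cancel₀ hP.ne' (S.symm.injective (hinj (hsub s hs) (hsub t ht) hst))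

end

/-! ### Knots covered by equivariant curves. -/

section

variable {n m : ℕ}

/-! ### Knots covered by equivariant curves -/

section EquivariantCurve

variable {μ : ℝ → Euc (m + 1)}

theorem equivariant_add_int (hper : ∀ t, μ (t + 1) = (2 : ℝ)⁻¹ • μ t) (t : ℝ) (j : ℤ) :
    μ (t + j) = (2 : ℝ)⁻¹ ^ j • μ t := by
  induction j using Int.induction_on with
  | zero => simp
  | succ k ih =>
    push_cast at ih ⊢
    rw [← add_assoc, hper, ih, smul_smul, zpow_add_one₀ (by norm_num), mul_comm]
  | pred k ih =>
    have := hper (t + (-k - 1 : ℝ))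
    rw [show t + (-k - 1 : ℝ) + 1 = t + -k by ring] at this
    push_cast at ih ⊢
    rw [this] at ih
    rw [zpow_sub_one₀ (by norm_num), mul_comm, mul_smul, ← ih, smul_smul]
    norm_num

theorem equivariant_ne_zero (hper : ∀ t, μ (t + 1) = (2 : ℝ)⁻¹ • μ t)
    (hinj : Function.Injective μ) (t : ℝ) : μ t ≠ 0 := fun h => by
  have : t + 1 = t := hinj (by rw [hper, h, smul_zero])
  linarith

theorem cov_equivariant_eq_iff (hper : ∀ t, μ (t + 1) = (2 : ℝ)⁻¹ • μ t)
    (hinj : Function.Injective μ) {s t : ℝ} : cov (μ s) = cov (μ t) ↔ circ s = circ t := by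
  constructor
  · intro h
    obtain ⟨j, hj⟩ := (cov_eq_iff (equivariant_ne_zero hper hinj s)
      (equivariant_ne_zero hper hinj t)).1 h
    refine circ_eq_iff.2 ⟨-j, hinj ?_⟩
    rw [hj, equivariant_add_int hper, inv_zpow', neg_neg]
  · intro h
    obtain ⟨j, rfl⟩ := circ_eq_iff.1 h
    rw [equivariant_add_int hper, inv_zpow', cov_zpow_smul]

/-- Equivariance lets the curve descend to the circle. The norm is halved at each turn, so the
degree is `-1`, and the homotopy to `z⁻¹` interpolates linearly between `log₂ |μ t|` and `-t`. -/
theorem isEssentialKnot_cov_range (hμ : ContDiff ℝ ∞ μ) (hd : ∀ t, deriv μ t ≠ 0)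
    (hper : ∀ t, μ (t + 1) = (2 : ℝ)⁻¹ • μ t) (hinj : Function.Injective μ) :
    IsEssentialKnot (cov '' range μ) := by
  have h0 := equivariant_ne_zero hper hinj
  set κ : Circle → Sph m × Circle := fun z => cov (μ (turn 0 z)) with hκ
  have hcirc : ∀ t, κ (circ t) = cov (μ t) := fun t =>
    (cov_equivariant_eq_iff hper hinj).2 (circ_turn 0 _)
  -- `turn 0` is discontinuous at one point of the circle; the same map is rewritten with a branch
  -- centred at the point under study.
  have hloc : ∀ t, κ = cov ∘ (μ ∘ turn t) := fun t => funext fun z => by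
    conv_lhs => rw [← circ_turn t z, hcirc]
    rfl
  have hsm : ContMDiff (𝓡 1) ((𝓡 m).prod (𝓡 1)) ∞ κ := fun z => by
    rw [← circ_turn 0 z]
    set t := turn 0 z
    rw [hloc t]
    have h1 := (eventually_contMDiffAt_turn (k := ∞) t).self_of_nhds
    have h2 : ContMDiffAt 𝓘(ℝ, ℝ) 𝓘(ℝ, Euc (m + 1)) ∞ μ (turn t (circ t)) :=
      hμ.contMDiff.contMDiffAt
    exact (contMDiffAt_cov (h0 _)).comp (circ t) (h2.comp (circ t) h1)
  refine ⟨⟨κ, hsm.continuous⟩, hsm, fun z w h => ?_, fun z => ?_, ?_, Or.inr ⟨?_⟩⟩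
  · have := (cov_equivariant_eq_iff hper hinj).1 h
    rwa [circ_turn, circ_turn] at this
  · change Function.Injective (mfderiv (𝓡 1) ((𝓡 m).prod (𝓡 1)) κ z)
    rw [← circ_turn 0 z]
    set t := turn 0 z
    have h1 := (((eventually_contMDiffAt_turn (k := 1) t).self_of_nhds).mdifferentiableAt
      one_ne_zero).hasMFDerivAt
    have h2 : HasMFDerivAt 𝓘(ℝ, ℝ) 𝓘(ℝ, Euc (m + 1)) μ (turn t (circ t))
        (ContinuousLinearMap.toSpanSingleton ℝ (deriv μ (turn t (circ t)))) :=
      (hμ.differentiable (by simp) _).hasDerivAt.hasFDerivAt.hasMFDerivAt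
    have h3 := ((contMDiffAt_cov (k := 1) (h0 (turn t (circ t)))).mdifferentiableAt
      one_ne_zero).hasMFDerivAt
    have h4 := h3.comp (circ t) (h2.comp (circ t) h1)
    rw [← hloc t] at h4
    rw [h4.mfderiv]
    have i1 : Function.Injective (mfderiv (𝓡 1) 𝓘(ℝ, ℝ) (turn t) (circ t)) := by
      have h5 := ((contMDiff_circ (k := 1)).contMDiffAt.mdifferentiableAt
        one_ne_zero).hasMFDerivAt.comp (circ t) h1
      have h6 : circ ∘ turn t = id := funext fun z => circ_turn t z
      rw [h6] at h5
      have h7 := h5.mfderiv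
      rw [mfderiv_id] at h7
      intro v w hvw
      have h8 := fun v => congrArg (fun A => A v) h7
      have h9 := (h8 v).trans ((congrArg _ hvw).trans (h8 w).symm)
      exact h9
    have i2 : Function.Injective
        (ContinuousLinearMap.toSpanSingleton ℝ (deriv μ (turn t (circ t)))) :=
      fun a b hab => smul_left_injective ℝ (hd _) (by simpa using hab)
    have i3 : Function.Injective
        (mfderiv 𝓘(ℝ, Euc (m + 1)) ((𝓡 m).prod (𝓡 1)) cov (μ (turn t (circ t)))) :=
      ((isLocalDiffeomorphAt_cov (h0 _)).mfderivToContinuousLinearEquiv (by simp)).injective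
    exact i3.comp (i2.comp i1)
  · ext y
    constructor
    · rintro ⟨z, rfl⟩; exact ⟨_, ⟨_, rfl⟩, rfl⟩
    · rintro ⟨_, ⟨t, rfl⟩, rfl⟩; exact ⟨circ t, hcirc t⟩
  · set G : ℝ → ℝ → ℝ := fun τ t => (1 - τ) * Real.logb 2 ‖μ t‖ - τ * t with hG
    -- Both ends of the interpolation drop by 1 per turn, so every intermediate map descends to the
    -- circle too.
    have hGper : ∀ τ s t, circ s = circ t → circ (G τ s) = circ (G τ t) := by
      intro τ s t h
      obtain ⟨j, rfl⟩ := circ_eq_iff.1 h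
      refine circ_eq_iff.2 ⟨-j, ?_⟩
      simp only [hG]
      rw [equivariant_add_int hper, norm_smul, norm_zpow, norm_inv, Real.norm_two,
        Real.logb_mul (by positivity) (norm_ne_zero_iff.2 (h0 t)), inv_zpow',
        ← Real.rpow_intCast, Real.logb_rpow (by norm_num) (by norm_num)]
      push_cast
      ring
    refine ⟨⟨fun x => circ (G x.1 (turn 0 x.2)), ?_⟩, fun z => ?_, fun z => ?_⟩
    · rw [continuous_iff_continuousAt]
      rintro ⟨τ, z⟩
      rw [← circ_turn 0 z]
      set t := turn 0 z
      have heq : (fun x : unitInterval × Circle => circ (G x.1 (turn 0 x.2))) =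
          fun x => circ (G x.1 (turn t x.2)) :=
        funext fun x => hGper _ _ _ (by rw [circ_turn, circ_turn])
      rw [heq]
      have h1 : ContinuousAt (turn t) (circ t) :=
        (eventually_contMDiffAt_turn (k := 0) t).self_of_nhds.continuousAt
      have h2 : ContinuousAt (fun x : unitInterval × Circle => turn t x.2) (τ, circ t) :=
        ContinuousAt.comp (g := turn t) h1 continuousAt_snd
      have h3 : Continuous fun t => Real.logb 2 ‖μ t‖ :=
        (hμ.continuous.norm.log fun t => norm_ne_zero_iff.2 (h0 t)).div_const _
      have h4 : ContinuousAt (fun x : unitInterval × Circle => (x.1 : ℝ)) (τ, circ t) := by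
        fun_prop
      have h5 : ContinuousAt (fun x : unitInterval × Circle => Real.logb 2 ‖μ (turn t x.2)‖)
          (τ, circ t) :=
        ContinuousAt.comp (g := fun t => Real.logb 2 ‖μ t‖) h3.continuousAt h2
      exact ContinuousAt.comp (g := circ) continuous_circ.continuousAt
        (((continuousAt_const.sub h4).mul h5).sub (h4.mul h2))
    · change circ (G 0 (turn 0 z)) = (κ z).2
      rw [hκ]
      simp only [hG, cov_snd (h0 _)]
      simp
    · change circ (G 1 (turn 0 z)) = z⁻¹
      simp only [hG]
      rw [sub_self, zero_mul, one_mul, zero_sub, circ_neg, circ_turn]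

end EquivariantCurve

end

/-! ### The Fox–Artin arc as an equivariant curve. -/

section

variable {n m : ℕ}

/-! ### Smooth arcs -/

theorem norm_homothety (x : Euc n) : ‖homothety x‖ = ‖x‖ / 2 := by
  rw [homothety, norm_smul, norm_inv, Real.norm_two]; ring

theorem homothety_injective : Function.Injective (homothety (n := n)) :=
  smul_right_injective _ (by norm_num : (2 : ℝ)⁻¹ ≠ 0)

theorem IsSmoothArc.image_homothety {A : Set (Euc n)} {u v : Euc n} (h : IsSmoothArc A u v) :
    IsSmoothArc (homothety '' A) (homothety u) (homothety v) := by
  obtain ⟨σ, hσ, hi, hd, rfl, rfl, rfl⟩ := h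
  refine ⟨fun t => homothety (σ t), ContDiff.fun_smul contDiff_const hσ,
    fun s hs t ht hst => hi hs ht (homothety_injective hst), fun t ht => ?_, ?_, rfl, rfl⟩
  · have h1 : HasDerivAt (fun t => homothety (σ t)) ((2 : ℝ)⁻¹ • deriv σ t) t :=
      (hσ.differentiable (by simp) t).hasDerivAt.fun_const_smul _
    rw [h1.deriv]
    exact smul_ne_zero (by norm_num) (hd t ht)
  · rw [image_image]

theorem IsSmoothArc.left_mem {A : Set (Euc n)} {u v : Euc n} (h : IsSmoothArc A u v) : u ∈ A := by
  obtain ⟨σ, -, -, -, rfl, rfl, -⟩ := h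
  exact mem_image_of_mem _ (by simp)

theorem IsSmoothArc.right_mem {A : Set (Euc n)} {u v : Euc n} (h : IsSmoothArc A u v) :
    v ∈ A := by
  obtain ⟨σ, -, -, -, rfl, -, rfl⟩ := h
  exact mem_image_of_mem _ (by simp)

theorem IsSmoothArc.isPreconnected {A : Set (Euc n)} {u v : Euc n} (h : IsSmoothArc A u v) :
    IsPreconnected A := by
  obtain ⟨σ, hσ, -, -, rfl, -, -⟩ := h
  exact isPreconnected_Icc.image _ hσ.continuous.continuousOn

theorem IsSmoothArc.exists_subarc {A : Set (Euc n)} {u v : Euc n} (h : IsSmoothArc A u v)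
    {σ : ℝ → Euc n} (hσ : Continuous σ) (hi : InjOn σ (Icc 0 1)) (hA : A ⊆ σ '' Icc 0 1) :
    ∃ x ∈ Icc (0 : ℝ) 1, ∃ y ∈ Icc (0 : ℝ) 1, x ≠ y ∧ σ x = u ∧ σ y = v ∧
      σ '' uIcc x y = A := by
  obtain ⟨τ, hτ, hτi, -, rfl, rfl, rfl⟩ := h
  exact Pixton.exists_subarc one_pos hσ.continuousOn hi hτ.continuous.continuousOn hτi hA

/-- An arc that contains another one can be parametrized along the latter. -/
theorem IsSmoothArc.exists_oriented {A Y : Set (Euc n)} {p q u v : Euc n} (hA : IsSmoothArc A p q)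
    (hY : IsSmoothArc Y u v) (hAY : A ⊆ Y) :
    ∃ σ : ℝ → Euc n, ContDiff ℝ ∞ σ ∧ InjOn σ (Icc 0 1) ∧ (∀ t ∈ Icc (0 : ℝ) 1, deriv σ t ≠ 0) ∧
      σ '' Icc 0 1 = Y ∧ ∃ x ∈ Icc (0 : ℝ) 1, ∃ y ∈ Icc (0 : ℝ) 1, x < y ∧ σ x = p ∧ σ y = q ∧
        σ '' Icc x y = A := by
  obtain ⟨σ, hσ, hi, hd, rfl, -, -⟩ := hY
  obtain ⟨x, hx, y, hy, hxy, hσx, hσy, himg⟩ := hA.exists_subarc hσ.continuous hi hAY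
  rcases lt_or_gt_of_ne hxy with h | h
  · exact ⟨σ, hσ, hi, hd, rfl, x, hx, y, hy, h, hσx, hσy, by rwa [uIcc_of_le h.le] at himg⟩
  · have hmem : ∀ t ∈ Icc (0 : ℝ) 1, 1 - t ∈ Icc (0 : ℝ) 1 := fun t ht =>
      ⟨by linarith [ht.2], by linarith [ht.1]⟩
    refine ⟨fun t => σ (1 - t), hσ.comp (contDiff_const.sub contDiff_id),
      fun s hs t ht hst => ?_, fun t ht => ?_, ?_, 1 - x, hmem x hx, 1 - y, hmem y hy,
      by linarith, by simpa using hσx, by simpa using hσy, ?_⟩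
    · have := hi (hmem s hs) (hmem t ht) hst
      linarith
    · rw [deriv_comp_const_sub]
      exact neg_ne_zero.2 (hd _ (hmem t ht))
    · rw [← image_image σ (fun t => 1 - t), image_const_sub_Icc]
      simp
    · rw [← image_image σ (fun t => 1 - t), image_const_sub_Icc, ← himg, uIcc_of_ge h.le]
      simp

/-- The next arc starts at `σ y` and meets the previous piece only there, so inside the big arc it
must lie on the far side. -/
theorem IsSmoothArc.exists_next {B : Set (Euc n)} {q : Euc n} {σ : ℝ → Euc n} {x y : ℝ}
    (hσ : Continuous σ) (hi : InjOn σ (Icc 0 1)) (hx : x ∈ Icc (0 : ℝ) 1)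
    (hy : y ∈ Icc (0 : ℝ) 1) (hxy : x < y) (hB : IsSmoothArc B (σ y) q) (hBY : B ⊆ σ '' Icc 0 1)
    (hAB : ∀ z ∈ σ '' Icc x y, z ∈ B → z = σ y) :
    ∃ z ∈ Icc (0 : ℝ) 1, y < z ∧ σ z = q ∧ σ '' Icc y z = B := by
  obtain ⟨y', hy', z, hz, hne, h1, h2, himg⟩ := hB.exists_subarc hσ hi hBY
  obtain rfl : y' = y := hi hy' hy h1
  rcases lt_or_gt_of_ne hne with h | h
  · exact ⟨z, hz, h, h2, by rwa [uIcc_of_le h.le] at himg⟩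
  · rw [uIcc_of_ge h.le] at himg
    have hmax : max x z < y' := max_lt hxy h
    have h3 := hAB (σ (max x z)) (mem_image_of_mem _ ⟨le_max_left _ _, hmax.le⟩)
      (himg ▸ mem_image_of_mem _ ⟨le_max_right _ _, hmax.le⟩)
    exact absurd (hi ⟨hx.1.trans (le_max_left _ _), hmax.le.trans hy.2⟩ hy h3) hmax.ne

/-! ### Fundamental domains of equivariant curves -/

section FundamentalDomain

variable {μ : ℝ → Euc (m + 1)}

theorem equivariant_floor (hper : ∀ t, μ (t + 1) = (2 : ℝ)⁻¹ • μ t) (t : ℝ) :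
    μ t = (2 : ℝ)⁻¹ ^ ⌊t⌋ • μ (Int.fract t) := by
  rw [← equivariant_add_int hper, Int.fract_add_floor]

theorem fract_mem_Ico (t : ℝ) : Int.fract t ∈ Ico (0 : ℝ) 1 :=
  ⟨Int.fract_nonneg t, Int.fract_lt_one t⟩

/-- Two parameters whose integer parts differ give points of a fundamental piece related by a proper
power of the homothety; those with equal integer parts reduce to `Ico 0 1`. -/
theorem equivariant_injective (hper : ∀ t, μ (t + 1) = (2 : ℝ)⁻¹ • μ t)
    (hinj : InjOn μ (Ico 0 1))
    (hdisj : ∀ x ∈ μ '' Ico 0 1, ∀ y ∈ μ '' Ico 0 1, ∀ k : ℕ, x ≠ (2 : ℝ)⁻¹ ^ (k + 1) • y) :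
    Function.Injective μ := by
  have key : ∀ s t, ⌊s⌋ ≤ ⌊t⌋ → μ s = μ t → s = t := by
    intro s t hle h
    rw [equivariant_floor hper s, equivariant_floor hper t] at h
    have h2 : (2 : ℝ)⁻¹ ^ ⌊s⌋ ≠ 0 := zpow_ne_zero _ (by norm_num)
    obtain ⟨k, hk⟩ := Int.eq_ofNat_of_zero_le (sub_nonneg.2 hle)
    rw [show ⌊t⌋ = ⌊s⌋ + k by omega, zpow_add₀ (by norm_num), mul_smul, zpow_natCast] at h
    have h3 := smul_right_injective _ h2 h
    rcases k with _ | k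
    · rw [pow_zero, one_smul] at h3
      have h4 := hinj (fract_mem_Ico s) (fract_mem_Ico t) h3
      have h5 : ⌊s⌋ = ⌊t⌋ := by simpa using (show ⌊t⌋ = ⌊s⌋ by simp at hk; omega).symm
      rw [← Int.fract_add_floor s, ← Int.fract_add_floor t, h4, h5]
    · exact absurd h3 (hdisj _ (mem_image_of_mem _ (fract_mem_Ico s)) _
        (mem_image_of_mem _ (fract_mem_Ico t)) k)
  intro s t h
  rcases le_total ⌊s⌋ ⌊t⌋ with hle | hle
  · exact key s t hle h
  · exact (key t s hle h.symm).symm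

theorem range_equivariant (hper : ∀ t, μ (t + 1) = (2 : ℝ)⁻¹ • μ t) :
    range μ = ⋃ k : ℤ, (fun x => ((2 : ℝ)⁻¹ ^ k) • x) '' (μ '' Ico 0 1) := by
  ext x
  simp only [mem_iUnion]
  constructor
  · rintro ⟨t, rfl⟩
    exact ⟨⌊t⌋, _, mem_image_of_mem _ (fract_mem_Ico t), (equivariant_floor hper t).symm⟩
  · rintro ⟨k, _, ⟨t, -, rfl⟩, rfl⟩
    exact ⟨t + k, equivariant_add_int hper t k⟩

end FundamentalDomain

/-! ### The Fox–Artin arc -/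

/-- Consecutive pieces share the ends `h(α)`, `h(β)`, `h(γ)`, so `c`, `h(a)`, `b`, `h(c)` lie on one
component, which is a smooth arc by hypothesis, and follow each other along it. The piece `c ∪ h(a)
∪ b` is a fundamental domain, and `h(c)`, the image of its beginning, is the overlap for the
equivariant extension. Injectivity comes from comparing norms and from the disjointness of the arcs.
-/
theorem IsFoxArtinArc.exists_equivariant_curve {l : Set (Euc 3)} (hl : IsFoxArtinArc l) :
    ∃ μ : ℝ → Euc 3, ContDiff ℝ ∞ μ ∧ (∀ t, deriv μ t ≠ 0) ∧
      (∀ t, μ (t + 1) = (2 : ℝ)⁻¹ • μ t) ∧ Function.Injective μ ∧ range μ = l := by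
  obtain ⟨α, β, γ, a, b, c, d, δ, hα, hβ, hγ, -, -, hαγ, -, -, -, ha, hb, hc, haV, hbV, hcV, hab,
    hbc, hac, haV2, hcV2, hends, -, -, -, -, -, -, -, hcomp, rfl⟩ := hl
  have hV3 : ∀ x ∈ V3, 1 / 2 ≤ ‖x‖ ∧ ‖x‖ ≤ 1 := fun x hx => by
    have h0 := norm_nonneg x
    have h1 := hx.1
    have h2 := hx.2
    constructor <;> nlinarith
  have hF3 : ∀ x ∈ F2, ‖x‖ = 1 := fun x hx => by
    have h0 := norm_nonneg x
    have h1 : ‖x‖ ^ 2 = 1 := hx.1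
    nlinarith
  have hF2 : ∀ x ∈ V2, ‖x‖ = 1 → x ∈ F2 := fun x hx h => ⟨by simp [F3, h], hx.2⟩
  have hHF2 : ∀ x ∈ V2, ‖x‖ = 1 / 2 → x ∈ homothety '' F2 := fun x hx h => by
    refine ⟨(2 : ℝ) • x, ⟨?_, ?_⟩, ?_⟩
    · simp [F3, norm_smul, h]
    · simp [hx.2]
    · simp [homothety, smul_smul]
  have hends' : ∀ x, x ∈ a \ {α, β} ∪ c \ {γ, homothety α} → x ∉ F2 ∪ homothety '' F2 :=
    fun x hx h => disjoint_left.1 hends hx h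
  have na1 : ∀ x ∈ a, ‖x‖ = 1 → x = α ∨ x = β := fun x hx h => by
    by_contra hne
    exact hends' x (Or.inl ⟨hx, hne⟩) (Or.inl (hF2 x (haV2 hx) h))
  -- Both ends of `a` lie on the outer circle, so `a` misses the inner one; the strict inequality is
  -- needed for the norm estimate on the fundamental domain.
  have na2 : ∀ x ∈ a, 1 / 2 < ‖x‖ := fun x hx => by
    refine lt_of_le_of_ne (hV3 x (haV hx)).1 fun h => ?_
    by_cases hne : x ∈ ({α, β} : Set (Euc 3))
    · rcases hne with rfl | rfl
      · rw [hF3 _ hα] at h; norm_num at h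
      · rw [hF3 _ hβ] at h; norm_num at h
    · exact hends' x (Or.inl ⟨hx, hne⟩) (Or.inr (hHF2 x (haV2 hx) h.symm))
  have nc1 : ∀ x ∈ c, ‖x‖ = 1 → x = γ := fun x hx h => by
    by_contra hne
    by_cases hne' : x = homothety α
    · rw [hne', norm_homothety, hF3 _ hα] at h; norm_num at h
    · exact hends' x (Or.inr ⟨hx, by simp [hne, hne']⟩) (Or.inl (hF2 x (hcV2 hx) h))
  have nc2 : ∀ x ∈ c, ‖x‖ = 1 / 2 → x = homothety α := fun x hx h => by
    by_contra hne
    by_cases hne' : x = γ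
    · rw [hne', hF3 _ hγ] at h; norm_num at h
    · exact hends' x (Or.inr ⟨hx, by simp [hne, hne']⟩) (Or.inr (hHF2 x (hcV2 hx) h))
  -- a point of `V₃` and of its image lies on the common sphere
  have hsphere : ∀ y ∈ V3, homothety y ∈ V3 → ‖y‖ = 1 := fun y hy hy' => by
    have h1 := (hV3 _ hy').1
    rw [norm_homothety] at h1
    linarith [(hV3 y hy).2]
  have hhalf : ∀ y : Euc 3, ‖y‖ = 1 → ‖homothety y‖ = 1 / 2 := fun y hy => by
    rw [norm_homothety, hy]
  have ica : ∀ y ∈ a, homothety y ∈ c → y = α := fun y hy hy' =>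
    homothety_injective (nc2 _ hy' (hhalf y (hsphere y (haV hy) (hcV hy'))))
  have iba : ∀ y ∈ a, homothety y ∈ b → y = β := fun y hy hy' => by
    rcases na1 y hy (hsphere y (haV hy) (hbV hy')) with rfl | h
    · exact absurd hc.right_mem (disjoint_left.1 hbc hy')
    · exact h
  have ibc : ∀ y ∈ c, homothety y ∈ b → y = γ := fun y hy hy' =>
    nc1 y hy (hsphere y (hcV hy) (hbV hy'))
  have icc : ∀ y ∈ c, homothety y ∉ c := fun y hy hy' => by
    have h1 := hsphere y (hcV hy) (hcV hy')
    have h2 := homothety_injective (nc2 _ hy' (hhalf y h1))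
    exact hαγ (h2.symm.trans (nc1 y hy h1))
  have icb : ∀ y ∈ b, homothety y ∉ c := fun y hy hy' => by
    have h1 := hsphere y (hbV hy) (hcV hy')
    have h2 := homothety_injective (nc2 _ hy' (hhalf y h1))
    exact disjoint_left.1 hab ha.left_mem (h2 ▸ hy)
  set X := (a ∪ b ∪ c) ∪ homothety '' (a ∪ b ∪ c) with hX
  have hHa := ha.image_homothety
  have hHb := hb.image_homothety
  have hHc := hc.image_homothety
  have hbX : b ⊆ X := fun x hx => Or.inl (Or.inl (Or.inr hx))
  have hcX : c ⊆ X := fun x hx => Or.inl (Or.inr hx)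
  have hHaX : homothety '' a ⊆ X := fun x hx =>
    Or.inr (image_mono (fun y hy => Or.inl (Or.inl hy)) hx)
  have hHbX : homothety '' b ⊆ X := fun x hx =>
    Or.inr (image_mono (fun y hy => Or.inl (Or.inr hy)) hx)
  have hHcX : homothety '' c ⊆ X := fun x hx => Or.inr (image_mono (fun y hy => Or.inr hy) hx)
  obtain ⟨u, v, hY⟩ := hcomp _ (hbX hb.left_mem)
  set Y := connectedComponentIn X (homothety β) with hYdef
  have hbY : b ⊆ Y := hb.isPreconnected.subset_connectedComponentIn hb.left_mem hbX
  have hHaY : homothety '' a ⊆ Y :=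
    hHa.isPreconnected.subset_connectedComponentIn hHa.right_mem hHaX
  have hextend : ∀ A : Set (Euc 3), IsPreconnected A → A ⊆ X → ∀ x ∈ A, x ∈ Y → A ⊆ Y := by
    intro A hA hAX x hxA hxY
    rw [hYdef, connectedComponentIn_eq hxY]
    exact hA.subset_connectedComponentIn hxA hAX
  have hcY : c ⊆ Y := hextend c hc.isPreconnected hcX _ hc.right_mem (hHaY hHa.left_mem)
  have hHcY : homothety '' c ⊆ Y :=
    hextend _ hHc.isPreconnected hHcX _ hHc.left_mem (hbY hb.right_mem)
  obtain ⟨σ, hσ, hσi, hσd, hσY, x₀, hx₀, x₁, hx₁, h01, hσ0, hσ1, hσc⟩ := hc.exists_oriented hY hcY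
  rw [← hσY] at hbY hHaY hHcY
  obtain ⟨x₂, hx₂, h12, hσ2, hσa⟩ := IsSmoothArc.exists_next hσ.continuous hσi hx₀ hx₁ h01
    (hσ1.symm ▸ hHa) hHaY (by
      rw [hσc, hσ1]
      rintro _ hz ⟨y, hy, rfl⟩
      rw [ica y hy hz])
  obtain ⟨x₃, hx₃, h23, hσ3, hσb⟩ := IsSmoothArc.exists_next hσ.continuous hσi hx₁ hx₂ h12
    (hσ2.symm ▸ hb) hbY (by
      rw [hσa, hσ2]
      rintro _ ⟨y, hy, rfl⟩ hz
      rw [iba y hy hz])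
  obtain ⟨x₄, hx₄, h34, hσ4, hσc'⟩ := IsSmoothArc.exists_next hσ.continuous hσi hx₂ hx₃ h23
    (hσ3.symm ▸ hHc) hHcY (by
      rw [hσb, hσ3]
      rintro _ hz ⟨y, hy, rfl⟩
      rw [ibc y hy hz])
  -- No condition keeps the interior of `b` off the boundary spheres, so norms alone do not exclude
  -- a meeting of `b` and `h(b)`. If they met, `h(b)` would lie on the big arc and avoid both ends
  -- of `b`, hence would be contained in `b`; then `h(β)` would have norm 1 instead of 1/2.
  have ibb : ∀ y ∈ b, homothety y ∉ b := by
    intro y hy hy'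
    have hHbY : homothety '' b ⊆ σ '' Icc 0 1 := by
      rw [hσY]
      exact hextend _ hHb.isPreconnected hHbX _ (mem_image_of_mem _ hy) (hσY ▸ hbY hy')
    obtain ⟨p, hp, q, hq, -, -, -, hpq⟩ := hHb.exists_subarc hσ.continuous hσi hHbY
    have hsub : uIcc p q ⊆ Icc 0 1 := ordConnected_Icc.uIcc_subset hp hq
    have havoid : ∀ z ∈ b, ∀ w, w ∈ a ∪ c → homothety w ≠ homothety z := fun z hz w hw h => by
      rw [homothety_injective h] at hw
      rcases hw with hw | hw
      · exact disjoint_left.1 hab hw hz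
      · exact disjoint_left.1 hbc hz hw
    have hno2 : x₂ ∉ uIcc p q := fun h => by
      obtain ⟨z, hz, hzx⟩ := hpq ▸ mem_image_of_mem σ h
      exact havoid z hz β (Or.inl ha.right_mem) (hσ2 ▸ hzx.symm)
    have hno3 : x₃ ∉ uIcc p q := fun h => by
      obtain ⟨z, hz, hzx⟩ := hpq ▸ mem_image_of_mem σ h
      exact havoid z hz γ (Or.inr hc.left_mem) (hσ3 ▸ hzx.symm)
    obtain ⟨t, ht, htσ⟩ := hσb ▸ hy'
    obtain ⟨s, hs, hsσ⟩ := hpq ▸ mem_image_of_mem homothety hy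
    obtain rfl : s = t := hσi (hsub hs) ⟨hx₂.1.trans ht.1, ht.2.trans hx₃.2⟩ (hsσ.trans htσ.symm)
    have hin : uIcc p q ⊆ Icc x₂ x₃ := fun r hr => by
      refine ⟨?_, ?_⟩
      · by_contra! h
        exact hno2 (ordConnected_uIcc.out hr hs ⟨h.le, ht.1⟩)
      · by_contra! h
        exact hno3 (ordConnected_uIcc.out hs hr ⟨ht.2, h.le⟩)
    have hbb : homothety '' b ⊆ b := by
      rw [← hpq, ← hσb]; exact image_mono hin
    have h1 := hsphere _ (hbV hb.left_mem) (hbV (hbb (mem_image_of_mem _ hb.left_mem)))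
    rw [norm_homothety, hF3 _ hβ] at h1
    norm_num at h1
  set F := c ∪ homothety '' a ∪ b with hF
  have hFσ : σ '' Icc x₀ x₃ = F := by
    rw [hF, ← hσc, ← hσa, ← hσb, ← image_union, ← image_union,
      Icc_union_Icc_eq_Icc h01.le h12.le, Icc_union_Icc_eq_Icc (h01.trans h12).le h23.le]
  have nHa : ∀ x ∈ homothety '' a, 1 / 4 < ‖x‖ ∧ ‖x‖ ≤ 1 / 2 := by
    rintro _ ⟨y, hy, rfl⟩
    rw [norm_homothety]
    constructor <;> linarith [na2 y hy, (hV3 y (haV hy)).2]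
  have nF : ∀ x ∈ F, 1 / 4 < ‖x‖ ∧ ‖x‖ ≤ 1 := by
    rintro x ((hx | hx) | hx)
    · have := hV3 x (hcV hx); constructor <;> linarith
    · have := nHa x hx; constructor <;> linarith
    · have := hV3 x (hbV hx); constructor <;> linarith
  -- The fundamental domain meets its image only at `h(γ)`, its far end, which the half-open
  -- parametrization omits.
  have hFF : ∀ y ∈ F, homothety y ∈ F → y = γ := by
    rintro y ((hy | hy) | hy) ((h | h) | h)
    · exact absurd h (icc y hy)
    · obtain ⟨z, hz, hzy⟩ := h
      exact absurd hy (disjoint_left.1 hac (homothety_injective hzy ▸ hz))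
    · exact ibc y hy h
    · have := (hV3 _ (hcV h)).1; rw [norm_homothety] at this
      linarith [nHa y hy]
    · have := (nHa _ h).1; rw [norm_homothety] at this
      linarith [nHa y hy]
    · have := (hV3 _ (hbV h)).1; rw [norm_homothety] at this
      linarith [nHa y hy]
    · exact absurd h (icb y hy)
    · obtain ⟨z, hz, hzy⟩ := h
      exact absurd hy (disjoint_left.1 hab (homothety_injective hzy ▸ hz))
    · exact absurd h (ibb y hy)
  have h04 : Icc x₀ x₄ ⊆ Icc 0 1 := Icc_subset_Icc hx₀.1 hx₄.2
  have hσne : ∀ t ∈ Icc x₀ x₄, σ t ≠ 0 := fun t ht h => by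
    rcases le_total t x₃ with h3 | h3
    · have := (nF (σ t) (hFσ ▸ mem_image_of_mem _ ⟨ht.1, h3⟩)).1
      rw [h, norm_zero] at this; norm_num at this
    · obtain ⟨y, hy, hyt⟩ := hσc' ▸ mem_image_of_mem σ (⟨h3, ht.2⟩ : t ∈ Icc x₃ x₄)
      have := (hV3 y (hcV hy)).1
      rw [h] at hyt
      have h2 := norm_homothety y
      rw [hyt, norm_zero] at h2
      linarith
  obtain ⟨μ, hμ, hμd, hper, hμσ, hμi⟩ := Pixton.exists_equivariant_curve hσ h01 (h12.trans h23) h34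
    (hσi.mono h04) (fun t ht => hσd t (h04 ht)) hσne (by rw [hσc, hσc']) (by rw [hσ3, hσ0])
    (by rw [hσ4, hσ1])
  have hDF : μ '' Ico 0 1 ⊆ F := by
    rw [hμσ, ← hFσ]; exact image_mono Ico_subset_Icc_self
  have hDγ : ∀ x ∈ μ '' Ico 0 1, x ≠ homothety γ := by
    rw [hμσ]
    rintro _ ⟨t, ht, rfl⟩ h
    exact ht.2.ne (hσi ⟨hx₀.1.trans ht.1, ht.2.le.trans hx₃.2⟩ hx₃ (h.trans hσ3.symm))
  have hμinj : Function.Injective μ := by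
    refine equivariant_injective hper hμi fun x hx y hy k h => ?_
    rcases k with _ | k
    · rw [zero_add, pow_one] at h
      have h1 := hFF y (hDF hy) (show (2 : ℝ)⁻¹ • y ∈ F from h ▸ hDF hx)
      exact hDγ x hx (h.trans (by rw [h1]; rfl))
    -- For the second and higher powers norms suffice: on the fundamental domain `1/4 < |x| ≤ 1`,
    -- while the image has norm at most `1/4`.
    · have h1 := congrArg norm h
      rw [norm_smul, norm_pow, norm_inv, Real.norm_two] at h1
      have h2 := nF x (hDF hx)
      have h3 := nF y (hDF hy)
      have h4 : (2 : ℝ)⁻¹ ^ (k + 1 + 1) ≤ 2⁻¹ ^ 2 :=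
        pow_le_pow_of_le_one (by norm_num) (by norm_num) (by omega)
      have h5 : (2 : ℝ)⁻¹ ^ (k + 1 + 1) * ‖y‖ ≤ 2⁻¹ ^ 2 * 1 :=
        mul_le_mul h4 h3.2 (norm_nonneg _) (by norm_num)
      norm_num at h5
      norm_num at h1
      linarith [h2.1]
  refine ⟨μ, hμ, hμd, hper, hμinj, ?_⟩
  have hFr : F ⊆ range μ := by
    rw [← hFσ]
    rintro _ ⟨t, ht, rfl⟩
    have hsub : σ '' Ico x₀ x₃ ⊆ range μ := hμσ ▸ image_subset_range _ _
    rcases ht.2.lt_or_eq with h | rfl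
    · exact hsub (mem_image_of_mem _ ⟨ht.1, h⟩)
    -- The far end is the image of the near end under the homothety, so it is reached one period
    -- later.
    · obtain ⟨s, hs⟩ := hsub (mem_image_of_mem σ (left_mem_Ico.2 (h01.trans (h12.trans h23))))
      refine ⟨s + 1, ?_⟩
      rw [hper, hs, hσ0, hσ3]; rfl
  refine Subset.antisymm ?_ ?_
  · rw [range_equivariant hper]
    refine iUnion_subset fun k => ?_
    rintro _ ⟨x, hx, rfl⟩
    rw [mem_iUnion]
    rcases hDF hx with (h | ⟨y, hy, rfl⟩) | h
    · exact ⟨k, x, Or.inr h, rfl⟩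
    · refine ⟨k + 1, y, Or.inl (Or.inl hy), ?_⟩
      simp only [homothety, smul_smul]
      rw [zpow_add_one₀ (by norm_num)]
    · exact ⟨k, x, Or.inl (Or.inr h), rfl⟩
  · refine iUnion_subset fun k => ?_
    rintro _ ⟨x, hx, rfl⟩
    have hxr : x ∈ range μ := by
      rcases hx with (hx | hx) | hx
      · obtain ⟨t, ht⟩ := hFr (Or.inl (Or.inr (mem_image_of_mem homothety hx)))
        refine ⟨t - 1, homothety_injective ?_⟩
        rw [← ht]
        have := hper (t - 1)
        rw [sub_add_cancel] at this
        exact this.symm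
      · exact hFr (Or.inr hx)
      · exact hFr (Or.inl (Or.inl hx))
    obtain ⟨t, rfl⟩ := hxr
    exact ⟨t + k, equivariant_add_int hper t k⟩

theorem isEssentialKnot_coveringImage {l : Set (Euc 3)} (hl : IsFoxArtinArc l) :
    IsEssentialKnot (coveringImage (m := 2) l) := by
  obtain ⟨μ, hμ, hd, hper, hinj, rfl⟩ := hl.exists_equivariant_curve
  rw [coveringImage_eq (by rintro ⟨t, ht⟩; exact equivariant_ne_zero hper hinj t ht)]
  exact isEssentialKnot_cov_range hμ hd hper hinj

theorem coveringPreimage_coveringImage {l : Set (Euc 3)} (hl : IsFoxArtinArc l) :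
    coveringPreimage (coveringImage (m := 2) l) = l := by
  obtain ⟨μ, -, -, hper, hinj, rfl⟩ := hl.exists_equivariant_curve
  have h0 := equivariant_ne_zero (m := 2) hper hinj
  rw [coveringImage_eq (by rintro ⟨t, ht⟩; exact h0 t ht)]
  ext x
  rw [mem_coveringPreimage]
  constructor
  · rintro ⟨hx, _, ⟨t, rfl⟩, h⟩
    obtain ⟨j, rfl⟩ := (cov_eq_iff hx (h0 t)).1 h.symm
    refine ⟨t + (-j : ℤ), ?_⟩
    rw [equivariant_add_int (m := 2) hper, inv_zpow', neg_neg]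
  · rintro ⟨t, rfl⟩
    exact ⟨h0 t, _, ⟨t, rfl⟩, rfl⟩

end

end Pixton

end

theorem mainTheorem3 :
    -- the flow `φᵗ` is well defined on the cylinder
    (∀ (m : ℕ), 1 ≤ m → ∀ x ∈ Pixton.cylinder m,
      Pixton.IsModelTrajectory x (fun t => Pixton.modelFlow t x) ∧
      ∀ t, Pixton.modelFlow t x ∈ Pixton.cylinder m) ∧
    -- the construction on `Sⁿ`, `n = m + 1 ≥ 2`, for a knot in `Sᵐ × S¹`
    (∀ (m : ℕ), 1 ≤ m → ∀ K : Set (Pixton.Sph m × Circle), Pixton.IsEssentialKnot K →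
      Pixton.ConstructionWorks K) ∧
    -- a Fox–Artin arc in `ℝ³` is the lift of such a knot, so that `φ_{l,3}` is defined
    (∀ l : Set (Pixton.Euc 3), Pixton.IsFoxArtinArc l →
      Pixton.IsEssentialKnot (Pixton.coveringImage (m := 2) l) ∧
      Pixton.coveringPreimage (Pixton.coveringImage (m := 2) l) = l ∧
      Pixton.ConstructionWorks (Pixton.coveringImage (m := 2) l)) := by
  refine ⟨fun m _ x hx => ⟨Pixton.isTrajectory_modelFlow x, Pixton.modelFlow_mem_cylinder hx⟩,
    fun m hm K hK => Pixton.constructionWorks hm hK, fun l hl => ?_⟩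
  have hK := Pixton.isEssentialKnot_coveringImage hl
  exact ⟨hK, Pixton.coveringPreimage_coveringImage hl, Pixton.constructionWorks one_le_two hK⟩
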